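/- **Notation.** On $\mathbb R^{3+1}$ with coordinates $(t,x)$ let $r=|x|$, $\Box=-\partial_t^2+\Delta$, $\partial=(\partial_t,\partial_1,\partial_2,\partial_3)$, $\partial_r=\frac{x}{|x|}\cdot\nabla$, $\partial_v=\partial_t+\partial_r$, let $\nabla\!\!\!\!/$ be the gradient along the sphere of radius $r$, $\Omega_{ij}=x_i\partial_j-x_j\partial_i$, $s_+=\max\{s,0\}$. A function $\Phi\in C^\infty(\mathbb R^{3+1})$ is a $(\delta,\alpha,t_0,R_1,C_0)$-*weak wave* if $\delta,\alpha,t_0,R_1,C_0>0$, $\alpha\le\frac14$, $R_1\le t_0$ and (i) $|\partial\Phi|\le C_0$ for $t\le t_0$; (ii) $|\partial\Phi|\le C_0(1+r)^{-1/2}(1+(t-r)_+)^{-1/2-4\alpha}$ for $r\ge R_1$, $t\ge t_0$; (iii) $|\partial_v\Phi|\le C_0(1+r)^{-1-3\alpha}$ for $r\ge R_1$, $t\ge t_0$; (iv) $|\partial\Phi|\le\delta\alpha(1+r)^{-1-\alpha}$ for $r\le R_1$, $t\ge t_0$. For $R>0$ let $S_\tau=\{t-r=\tau-R,\ r\ge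 R\}$ and $\Sigma_\tau=\{t=\tau,\ r\le R\}\cup S_\tau$. With $v=\frac{t+r}2$ and $\psi=r\phi$ put $$E[\phi](\tau)=\int_{\{t=\tau,\,r\le R\}}|\partial\phi|^2dx+\int_{S_\tau}\big(|\partial_v\phi|^2+|\nabla\!\!\!\!/\,\phi|^2\big)r^2\,dv\,d\omega,\qquad g(p,\tau)=\int_{S_\tau}r^p|\partial_v\psi|^2\,dv\,d\omega,$$ $$\bar G[0,p]_{\tau_1}^{\tau_2}=\int_{\tau_1}^{\tau_2}\!\int_{S_\tau}r^p\big(|\partial_v\psi|^2+|\nabla\!\!\!\!/\,\psi|^2\big)dv\,d\omega\,d\tau,\qquad D^\beta[F]_{\tau_1}^{\tau_2}=\int_{\tau_1}^{\tau_2}\!\int_{\Sigma_\tau}|F|^2(1+r)^{\beta+1}\,dx\,d\tau,$$ and $|\bar\partial\phi|^2=|\partial\phi|^2+\frac{\phi^2}{(1+r)^2}$. All these integrals take values in $[0,\infty]$. **Proposition 3.1.** Let $B=(B^{\mu\nu})$ be a real constant $4\times4$ matrix satisfying the null condition: $B^{\mu\nu}\xi_\mu\xi_\nu=0$ whenever $\xi_0^2=\xi_1^2+\xi_2^2+\xi_3^2$.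 There is $\delta_0>0$ depending only on $B$ such that for all $\alpha,t_0,R_1,C_0$ and all $R_0>0$ there is a constant $C$, depending only on $B,\alpha,t_0,R_1,C_0,R_0$, with the following property. Let $\delta<\delta_0$ with $(1+t_0)^\alpha\delta\alpha\ge C_0$. Let $\Phi$ be a $(\delta,\alpha,t_0,R_1,C_0)$-weak wave; if $B$ is not symmetric, suppose moreover that the functions $\Omega_{ij}\Phi$ are $(\delta,\alpha,t_0,R_1,C_0)$-weak waves. Let $L^\mu$ be measurable functions with $|L^\mu|\le C_0$ for $t\le t_0$ which satisfy one of the two conditions $$|L^\mu|\le\delta\alpha(1+r)^{-1-3\alpha}\quad(t\ge t_0),\qquad\text{or}\qquad|L^\mu|\le C_0(1+r)^{-1-3\alpha}(1+(t-r)_+)^{-\alpha}\quad(t\ge t_0).$$ Let $\phi\in C^\infty(\mathbb R^{3+1})$ solve $$\Box\phi+B^{\mu\nu}\partial_\mu\Phi\,\partial_\nu\phi+L^\mu\partial_\mu\phi=F\qquad\text{for }t\ge0,$$ with $\phi(0,\cdot)$ and $\partial_t\phi(0,\cdot)$ vanishing for $|x|>R_0$, and let $R=t_0+R_0$. Then for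 all $0\le\tau_1\le\tau_2$: (1) (integrated local energy estimate) $$\int_{\tau_1}^{\tau_2}\!\int_{\Sigma_\tau}\frac{|\bar\partial\phi|^2}{(1+r)^{1+\alpha}}\,dx\,d\tau\le C\Big(E[\phi](\tau_1)+D^\alpha[F]_{\tau_1}^{\tau_2}+(1+\tau_1)^{-\alpha}D^{2\alpha}[F]_{\tau_1}^{\tau_2}+(1+\tau_1)^{-1-2\alpha}\Big(g(1+2\alpha,\tau_1)+\int_{\tau_1}^{\tau_2}\tau^{\frac\alpha2}D^{2\alpha}[F]_\tau^{\tau_2}d\tau\Big)\Big);$$ (2) (energy bound) $$E[\phi](\tau_2)\le C\Big(E[\phi](\tau_1)+D^\alpha[F]_{\tau_1}^{\tau_2}+(1+\tau_1)^{-\alpha}D^{2\alpha}[F]_{\tau_1}^{\tau_2}+(1+\tau_1)^{-1-2\alpha}\Big(g(1+2\alpha,\tau_1)+\int_{\tau_1}^{\tau_2}\tau^{\frac\alpha2}D^{2\alpha}[F]_\tau^{\tau_2}d\tau\Big)\Big);$$ (3) ($p$-weighted energy inequalities, $p=1$ and $p=1+2\alpha$) $$g(1,\tau_2)+\int_{\tau_1}^{\tau_2}E[\phi](\tau)d\tau\le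 C\Big(g(1,\tau_1)+(1+\tau_1)^{1-\alpha}D^{2\alpha}[F]_{\tau_1}^{\tau_2}+(1+\tau_1)^{1-\alpha}E[\phi](\tau_1)+\int_{\tau_1}^{\tau_2}(1+\tau)^{-\alpha}D^{2\alpha}[F]_\tau^{\tau_2}d\tau+(1+\tau_1)^{-2\alpha}\int_{\tau_1}^{\tau_2}\tau^{\frac\alpha2}D^{2\alpha}[F]_\tau^{\tau_2}d\tau+(1+\tau_1)^{-2\alpha}g(1+2\alpha,\tau_1)\Big),$$ $$g(1+2\alpha,\tau_2)+\bar G[0,2\alpha]_{\tau_1}^{\tau_2}\le C\Big(g(1+2\alpha,\tau_1)+(1+\tau_1)^{1-\alpha}E[\phi](\tau_1)+\int_{\tau_1}^{\tau_2}\tau^{\frac\alpha2}D^{2\alpha}[F]_\tau^{\tau_2}d\tau+(1+\tau_1)^{1+\frac\alpha2}D^{2\alpha}[F]_{\tau_1}^{\tau_2}\Big).$$ -/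

import Mathlib

open MeasureTheory Set
open scoped ENNReal NNReal ContDiff

namespace MinkowskiWave

noncomputable section

/-- Physical space `ℝ³` with its Euclidean norm; `r = |x| = ‖x‖`. -/
abbrev Space : Type := EuclideanSpace ℝ (Fin 3)

/-- Minkowski spacetime `ℝ^{3+1}`; a point is `p = (t, x)`. -/
abbrev Spacetime : Type := ℝ × Space

/-- The coordinate vectors of `ℝ^{3+1}`: index `0` is time, index `i + 1` is the direction `x_i`. -/
def basisVec : Fin 4 → Spacetime :=
  Fin.cons ((1 : ℝ), (0 : Space)) (fun i : Fin 3 => ((0 : ℝ), EuclideanSpace.single i (1 : ℝ)))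

/-- The partial derivative `∂_μ f` (Greek index, `∂_0 = ∂_t`). -/
def pd (μ : Fin 4) (f : Spacetime → ℝ) (p : Spacetime) : ℝ :=
  fderiv ℝ f p (basisVec μ)

/-- The wave operator `□ = -∂_t² + Δ`. -/
def box (f : Spacetime → ℝ) (p : Spacetime) : ℝ :=
  -pd 0 (pd 0 f) p + ∑ i : Fin 3, pd i.succ (pd i.succ f) p

/-- `|∂f|² = (∂_t f)² + ∑ (∂_i f)²`. -/
def gradSq (f : Spacetime → ℝ) (p : Spacetime) : ℝ :=
  ∑ μ : Fin 4, (pd μ f p) ^ 2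

/-- The unit radial vector `ω = x / |x|` (used for `x ≠ 0`). -/
def radial (x : Space) : Space := ‖x‖⁻¹ • x

/-- The radial derivative `∂_r`. -/
def dr (f : Spacetime → ℝ) (p : Spacetime) : ℝ :=
  fderiv ℝ f p ((0 : ℝ), radial p.2)

/-- The outgoing null derivative `∂_v = ∂_t + ∂_r`. -/
def dv (f : Spacetime → ℝ) (p : Spacetime) : ℝ :=
  pd 0 f p + dr f p

/-- The squared length of the angular gradient, that is, of the gradient along the sphere of
radius `r` through `p`: the spatial gradient minus its radial part. -/
def angSq (f : Spacetime → ℝ) (p : Spacetime) : ℝ :=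
  ∑ i : Fin 3, (pd i.succ f p - radial p.2 i * dr f p) ^ 2

/-- The rotation vector fields `Ω_{ij} = x_i ∂_j - x_j ∂_i`. -/
def rot (i j : Fin 3) (f : Spacetime → ℝ) (p : Spacetime) : ℝ :=
  p.2 i * pd j.succ f p - p.2 j * pd i.succ f p

/-- `(δ, α, t₀, R₁, C₀)`-weak waves. -/
structure IsWeakWave (δ α t₀ R₁ C₀ : ℝ) (Φ : Spacetime → ℝ) : Prop where
  smooth : ContDiff ℝ ∞ Φ
  δ_pos : 0 < δ
  α_pos : 0 < α
  t₀_pos : 0 < t₀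
  R₁_pos : 0 < R₁
  C₀_pos : 0 < C₀
  α_le : α ≤ 1 / 4
  R₁_le : R₁ ≤ t₀
  early : ∀ t x, t ≤ t₀ → √(gradSq Φ (t, x)) ≤ C₀
  exterior : ∀ t x, t₀ ≤ t → R₁ ≤ ‖x‖ →
    √(gradSq Φ (t, x)) ≤
      C₀ * (1 + ‖x‖) ^ (-(1 / 2) : ℝ) * (1 + max (t - ‖x‖) 0) ^ (-(1 / 2) - 4 * α)
  outgoing : ∀ t x, t₀ ≤ t → R₁ ≤ ‖x‖ →
    |dv Φ (t, x)| ≤ C₀ * (1 + ‖x‖) ^ (-1 - 3 * α)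
  interior : ∀ t x, t₀ ≤ t → ‖x‖ ≤ R₁ →
    √(gradSq Φ (t, x)) ≤ δ * α * (1 + ‖x‖) ^ (-1 - α)

/-- The null condition: `B^{μν} ξ_μ ξ_ν = 0` whenever `ξ_0² = ξ_1² + ξ_2² + ξ_3²`. -/
def NullCondition (B : Matrix (Fin 4) (Fin 4) ℝ) : Prop :=
  ∀ ξ : Fin 4 → ℝ, ξ 0 ^ 2 = ξ 1 ^ 2 + ξ 2 ^ 2 + ξ 3 ^ 2 →
    ∑ μ, ∑ ν, B μ ν * ξ μ * ξ ν = 0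

/-- `N(Φ, φ) = B^{μν} ∂_μ Φ ∂_ν φ`. -/
def nullForm (B : Matrix (Fin 4) (Fin 4) ℝ) (Φ φ : Spacetime → ℝ) (p : Spacetime) : ℝ :=
  ∑ μ, ∑ ν, B μ ν * pd μ Φ p * pd ν φ p

/-- `L(∂φ) = L^μ ∂_μ φ`. -/
def linTerm (L : Fin 4 → Spacetime → ℝ) (φ : Spacetime → ℝ) (p : Spacetime) : ℝ :=
  ∑ μ, L μ p * pd μ φ p

/-- One of the two decay conditions on the functions `L^μ` for `t ≥ t₀`. -/
def LDecay (δ α t₀ C₀ : ℝ) (L : Fin 4 → Spacetime → ℝ) : Prop :=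
  (∀ μ t x, t₀ ≤ t → |L μ (t, x)| ≤ δ * α * (1 + ‖x‖) ^ (-1 - 3 * α)) ∨
  (∀ μ t x, t₀ ≤ t →
    |L μ (t, x)| ≤ C₀ * (1 + ‖x‖) ^ (-1 - 3 * α) * (1 + max (t - ‖x‖) 0) ^ (-α))

/-- `∫_{S_τ} h r² dv dω` for `h ≥ 0`, where `S_τ = {t - r = τ - R, r ≥ R}`. On `S_τ` one has
`v = (t + r) / 2 = r + (τ - R) / 2`, hence `dv = dr` and `r² dv dω = dx`. -/
def coneInt (R τ : ℝ) (h : Spacetime → ℝ) : ℝ≥0∞ :=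
  ∫⁻ x in {x : Space | R ≤ ‖x‖}, ENNReal.ofReal (h (τ - R + ‖x‖, x))

/-- The energy flux through `Σ_τ = {t = τ, r ≤ R} ∪ S_τ`:
`E[φ](τ) = ∫_{r ≤ R} |∂φ|² dx + ∫_{S_τ} (|∂_v φ|² + |angular gradient of φ|²) r² dv dω`. -/
def energy (R : ℝ) (φ : Spacetime → ℝ) (τ : ℝ) : ℝ≥0∞ :=
  (∫⁻ x in {x : Space | ‖x‖ ≤ R}, ENNReal.ofReal (gradSq φ (τ, x))) +
    coneInt R τ (fun p => dv φ p ^ 2 + angSq φ p)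

/-- `ψ = r φ`. -/
def psi (φ : Spacetime → ℝ) (p : Spacetime) : ℝ := ‖p.2‖ * φ p

/-- `g(p, τ) = ∫_{S_τ} r^p |∂_v ψ|² dv dω`. -/
def gFlux (R : ℝ) (φ : Spacetime → ℝ) (p τ : ℝ) : ℝ≥0∞ :=
  coneInt R τ (fun q => ‖q.2‖ ^ (p - 2) * dv (psi φ) q ^ 2)

/-- `ḡ(p, τ) = ∫_{S_τ} r^p (|∂_v ψ|² + |angular gradient of ψ|²) dv dω`. -/
def gBarFlux (R : ℝ) (φ : Spacetime → ℝ) (p τ : ℝ) : ℝ≥0∞ :=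
  coneInt R τ (fun q => ‖q.2‖ ^ (p - 2) * (dv (psi φ) q ^ 2 + angSq (psi φ) q))

/-- `Ḡ[β, p]_{τ₁}^{τ₂} = ∫_{τ₁}^{τ₂} (1 + τ)^{-β} ḡ(p, τ) dτ`. -/
def GBar (R : ℝ) (φ : Spacetime → ℝ) (β p τ₁ τ₂ : ℝ) : ℝ≥0∞ :=
  ∫⁻ τ in Icc τ₁ τ₂, ENNReal.ofReal ((1 + τ) ^ (-β)) * gBarFlux R φ p τ

/-- `∫_{τ₁}^{τ₂} ∫_{Σ_τ} h dvol` for `h ≥ 0`. The leaf `Σ_τ` is the graph `t = τ + (|x| - R)_+`,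
so that `dvol = dt dx = dx dτ`. -/
def bulkInt (R τ₁ τ₂ : ℝ) (h : Spacetime → ℝ) : ℝ≥0∞ :=
  ∫⁻ τ in Icc τ₁ τ₂, ∫⁻ x : Space, ENNReal.ofReal (h (τ + max (‖x‖ - R) 0, x))

/-- `D^β[F]_{τ₁}^{τ₂} = ∫_{τ₁}^{τ₂} ∫_{Σ_τ} |F|² (1 + r)^{β + 1} dvol`. -/
def DNorm (R β : ℝ) (F : Spacetime → ℝ) (τ₁ τ₂ : ℝ) : ℝ≥0∞ :=
  bulkInt R τ₁ τ₂ (fun p => F p ^ 2 * (1 + ‖p.2‖) ^ (β + 1))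

/-- `∫_{τ₁}^{τ₂} ∫_{Σ_τ} (|∂φ|² + φ² / (1 + r)²) / (1 + r)^{1 + α} dvol`. -/
def localEnergy (R α : ℝ) (φ : Spacetime → ℝ) (τ₁ τ₂ : ℝ) : ℝ≥0∞ :=
  bulkInt R τ₁ τ₂
    (fun p => (gradSq φ p + (φ p / (1 + ‖p.2‖)) ^ 2) / (1 + ‖p.2‖) ^ (1 + α))

/-- `∫_{τ₁}^{τ₂} τ^{α/2} D^{2α}[F]_τ^{τ₂} dτ`. -/
def DIter (R α : ℝ) (F : Spacetime → ℝ) (τ₁ τ₂ : ℝ) : ℝ≥0∞ :=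
  ∫⁻ τ in Icc τ₁ τ₂, ENNReal.ofReal (τ ^ (α / 2)) * DNorm R (2 * α) F τ τ₂

/-- `φ` is a smooth solution, for `t ≥ 0`, of `□φ + B^{μν} ∂_μΦ ∂_νφ + L^μ ∂_μφ = F` whose Cauchy
data at `t = 0` are supported in `{|x| ≤ R₀}`. -/
structure IsSolution (B : Matrix (Fin 4) (Fin 4) ℝ) (Φ : Spacetime → ℝ)
    (L : Fin 4 → Spacetime → ℝ) (F : Spacetime → ℝ) (R₀ : ℝ) (φ : Spacetime → ℝ) : Prop where
  smooth : ContDiff ℝ ∞ φ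
  eqn : ∀ t x, 0 ≤ t →
    box φ (t, x) + nullForm B Φ φ (t, x) + linTerm L φ (t, x) = F (t, x)
  data : ∀ x : Space, R₀ < ‖x‖ → φ (0, x) = 0 ∧ pd 0 φ (0, x) = 0

end

end MinkowskiWave

open MinkowskiWave

open ENNReal (ofReal ofReal_le_ofReal ofReal_mul ofReal_ne_top ofReal_add ofReal_one ofReal_of_nonpos ofReal_lt_top ofReal_add_le ofReal_coe_nnreal)
open Real (rpow_add rpow_natCast rpow_neg rpow_le_rpow_of_nonpos rpow_le_rpow_of_exponent_le rpow_le_rpow rpow_add_one rpow_sub_one rpow_zero one_le_rpow exp exp_pos smoothTransition)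

namespace MinkowskiWave

local notation "Smooth" => ContDiff ℝ ∞
local notation "Scalar" => Spacetime → ℝ
local notation "jb[" p "]" => (1 + ‖Prod.snd p‖)
local notation "r[" p "]" => ‖Prod.snd p‖
local notation "good[" φ "," p "]" => (dv φ p ^ 2 + angSq φ p)
local notation "tw[" s "," e "]" => ENNReal.ofReal ((1 + s) ^ (e : ℝ))

noncomputable section

theorem pd_add {μ : Fin 4} {f g : Scalar} {p : Spacetime}
    (hf : DifferentiableAt ℝ f p := by fun_prop)
    (hg : DifferentiableAt ℝ g p := by fun_prop) :
    pd μ (fun q => f q + g q) p = pd μ f p + pd μ g p := by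
  simp only [pd]
  rw [fderiv_fun_add hf hg]; rfl

theorem pd_sub {μ : Fin 4} {f g : Scalar} {p : Spacetime}
    (hf : DifferentiableAt ℝ f p := by fun_prop)
    (hg : DifferentiableAt ℝ g p := by fun_prop) :
    pd μ (fun q => f q - g q) p = pd μ f p - pd μ g p := by
  simp only [pd]
  rw [fderiv_fun_sub hf hg]; rfl

theorem pd_neg {μ : Fin 4} {f : Scalar} {p : Spacetime} : pd μ (fun q => -f q) p = -pd μ f p := by
  simp only [pd]
  rw [fderiv_fun_neg]; rfl

theorem pd_mul {μ : Fin 4} {f g : Scalar} {p : Spacetime}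
    (hf : DifferentiableAt ℝ f p := by fun_prop)
    (hg : DifferentiableAt ℝ g p := by fun_prop) :
    pd μ (fun q => f q * g q) p = pd μ f p * g p + f p * pd μ g p := by
  simp only [pd]
  rw [fderiv_fun_mul hf hg]
  simp; ring

theorem pd_const {μ : Fin 4} {c : ℝ} {p : Spacetime} : pd μ (fun _ => c) p = 0 := by
  simp [pd]

theorem pd_const_mul {μ : Fin 4} {c : ℝ} {f : Scalar} {p : Spacetime}
    (hf : DifferentiableAt ℝ f p := by fun_prop) : pd μ (fun q => c * f q) p = c * pd μ f p := by
  rw [pd_mul (by fun_prop) hf, pd_const]; ring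

theorem pd_sq {μ : Fin 4} {f : Scalar} {p : Spacetime}
    (hf : DifferentiableAt ℝ f p := by fun_prop) : pd μ (fun q => f q ^ 2) p = 2 * f p * pd μ f p := by
  simp only [pow_two]
  rw [pd_mul hf hf]; ring

@[fun_prop]
theorem contDiff_pd {f : Scalar} (hf : Smooth f) (μ : Fin 4) : Smooth (pd μ f) := by
  have := hf.fderiv_right (m := ∞) (by simp)
  exact this.clm_apply contDiff_const

theorem differentiable_of_smooth {f : Scalar} (hf : Smooth f) :
    Differentiable ℝ f := hf.differentiable (by simp)

@[fun_prop]
theorem differentiableAt_of_smooth {E : Type*} [NormedAddCommGroup E] [NormedSpace ℝ E]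
    {f : E → ℝ} (hf : Smooth f) {p : E} : DifferentiableAt ℝ f p :=
  hf.differentiable (by simp) p

@[fun_prop]
theorem measurable_of_smooth {E : Type*} [NormedAddCommGroup E] [NormedSpace ℝ E]
    [MeasurableSpace E] [OpensMeasurableSpace E] {f : E → ℝ} (hf : Smooth f) : Measurable f :=
  hf.continuous.measurable

theorem pd_comm {f : Scalar} (hf : Smooth f) (μ ν : Fin 4) (p : Spacetime) :
    pd μ (pd ν f) p = pd ν (pd μ f) p := by
  have h1 : DifferentiableAt ℝ (fderiv ℝ f) p :=
    (hf.fderiv_right (m := ∞) (by simp)).differentiable (by simp) p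
  have key : ∀ v w, fderiv ℝ (fun q => fderiv ℝ f q v) p w = fderiv ℝ (fderiv ℝ f) p w v := by
    intro v w
    rw [fderiv_clm_apply h1 (by fun_prop)]
    simp
  simp only [pd]
  erw [key, key]
  have := ((contDiff_infty.1 hf 2).contDiffAt (x := p)).isSymmSndFDerivAt (by simp)
  exact this _ _

theorem pd_zero_time {k : ℝ → ℝ} {p : Spacetime} (hk : DifferentiableAt ℝ k p.1 := by fun_prop) :
    pd 0 (fun q => k q.1) p = deriv k p.1 := by
  have h : HasFDerivAt (fun q : Spacetime => k q.1)
      ((ContinuousLinearMap.toSpanSingleton ℝ (deriv k p.1)).comp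
        (ContinuousLinearMap.fst ℝ ℝ Space)) p :=
    HasFDerivAt.comp p hk.hasDerivAt.hasFDerivAt (hasFDerivAt_fst)
  rw [pd, h.fderiv]
  simp [basisVec]

theorem pd_succ_time {k : ℝ → ℝ} {i : Fin 3} {p : Spacetime} (hk : DifferentiableAt ℝ k p.1 := by fun_prop) :
    pd i.succ (fun q => k q.1) p = 0 := by
  have h : HasFDerivAt (fun q : Spacetime => k q.1)
      ((ContinuousLinearMap.toSpanSingleton ℝ (deriv k p.1)).comp
        (ContinuousLinearMap.fst ℝ ℝ Space)) p :=
    HasFDerivAt.comp p hk.hasDerivAt.hasFDerivAt (hasFDerivAt_fst)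
  rw [pd, h.fderiv]
  simp [basisVec]

/-- The squared radius, as a function on spacetime. -/
noncomputable def rsq (p : Spacetime) : ℝ := r[p] ^ 2

theorem rsq_eq (p : Spacetime) : rsq p = p.2 0 ^ 2 + p.2 1 ^ 2 + p.2 2 ^ 2 := by
  simp [rsq, EuclideanSpace.norm_sq_eq, Fin.sum_univ_three]

@[fun_prop]
theorem contDiff_rsq : Smooth rsq := (contDiff_norm_sq ℝ).comp contDiff_snd

theorem pd_zero_space {g : Space → ℝ} {p : Spacetime} (hg : DifferentiableAt ℝ g p.2) :
    pd 0 (fun q => g q.2) p = 0 := by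
  have h : HasFDerivAt (fun q : Spacetime => g q.2)
      ((fderiv ℝ g p.2).comp (ContinuousLinearMap.snd ℝ ℝ Space)) p :=
    HasFDerivAt.comp p hg.hasFDerivAt (hasFDerivAt_snd)
  rw [pd, h.fderiv]
  simp [basisVec]

theorem pd_succ_space {g : Space → ℝ} {i : Fin 3} {p : Spacetime} (hg : DifferentiableAt ℝ g p.2) :
    pd i.succ (fun q => g q.2) p = fderiv ℝ g p.2 (EuclideanSpace.single i 1) := by
  have h : HasFDerivAt (fun q : Spacetime => g q.2)
      ((fderiv ℝ g p.2).comp (ContinuousLinearMap.snd ℝ ℝ Space)) p :=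
    HasFDerivAt.comp p hg.hasFDerivAt (hasFDerivAt_snd)
  rw [pd, h.fderiv]
  simp [basisVec]

theorem pd_zero_coord {i : Fin 3} {p : Spacetime} : pd 0 (fun q => q.2 i) p = 0 :=
  pd_zero_space (g := fun x => x i) (by fun_prop)

theorem pd_succ_coord {i j : Fin 3} {p : Spacetime} :
    pd i.succ (fun q => q.2 j) p = if i = j then 1 else 0 := by
  rw [pd_succ_space (g := fun x => x j) (by fun_prop)]
  have : (fun x : Space => x j) = EuclideanSpace.proj (𝕜 := ℝ) j := rfl
  rw [this, ContinuousLinearMap.fderiv]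
  simp [eq_comm]

theorem pd_zero_radial {a : ℝ → ℝ} {p : Spacetime} (ha : DifferentiableAt ℝ a (rsq p) := by fun_prop) :
    pd 0 (fun q => a (rsq q)) p = 0 := by
  apply pd_zero_space (g := fun x => a (‖x‖ ^ 2))
  exact ha.comp (f := fun x : Space => ‖x‖ ^ 2) p.2 ((contDiff_norm_sq ℝ (n := 1)).differentiable (by simp) _)

theorem pd_succ_radial {a : ℝ → ℝ} {i : Fin 3} {p : Spacetime}
    (ha : DifferentiableAt ℝ a (rsq p) := by fun_prop) :
    pd i.succ (fun q => a (rsq q)) p = 2 * p.2 i * deriv a (rsq p) := by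
  have h : HasFDerivAt (fun q : Spacetime => a (rsq q)) _ p :=
    HasFDerivAt.comp p ha.hasDerivAt.hasFDerivAt
      ((hasStrictFDerivAt_norm_sq p.2).hasFDerivAt.comp p (hasFDerivAt_snd (𝕜 := ℝ) (E := ℝ)))
  rw [pd, h.fderiv]
  simp [basisVec, EuclideanSpace.inner_single_right]
  ring

/-- `x · ∇φ`. -/
def euler (φ : Scalar) (p : Spacetime) : ℝ := ∑ i : Fin 3, p.2 i * pd i.succ φ p

/-- `|∇φ|²`. -/
def spaceSq (φ : Scalar) (p : Spacetime) : ℝ := ∑ i : Fin 3, pd i.succ φ p ^ 2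

/-- `S = -(∂_t φ)² + |∇φ|²`. -/
def lagr (φ : Scalar) (p : Spacetime) : ℝ := -pd 0 φ p ^ 2 + spaceSq φ p

/-- The multiplier `k(t) (a(r²) ∂_t φ + b(r²) x·∇φ + c(r²) φ)`. -/
def mult (k a b c : ℝ → ℝ) (φ : Scalar) (p : Spacetime) : ℝ :=
  k p.1 * (a (rsq p) * pd 0 φ p + b (rsq p) * euler φ p + c (rsq p) * φ p)

/-- Time component of the energy current of `mult k a b c φ`. -/
def curT (k a b c : ℝ → ℝ) (φ : Scalar) (p : Spacetime) : ℝ :=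
  -(pd 0 φ p * mult k a b c φ p) - 1 / 2 * (k p.1 * (a (rsq p) * lagr φ p))
    + 1 / 2 * (φ p ^ 2 * (deriv k p.1 * c (rsq p)))

/-- Space components of the energy current of `mult k a b c φ`. -/
def curS (k a b c : ℝ → ℝ) (φ : Scalar) (i : Fin 3) (p : Spacetime) : ℝ :=
  pd i.succ φ p * mult k a b c φ p - 1 / 2 * (k p.1 * (p.2 i * (b (rsq p) * lagr φ p)))
    - φ p ^ 2 * (k p.1 * (p.2 i * deriv c (rsq p)))

/-- The bulk term in the divergence of the current. -/
def bulk (k a b c : ℝ → ℝ) (φ : Scalar) (p : Spacetime) : ℝ :=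
  lagr φ p * (k p.1 * c (rsq p) - 1 / 2 * (deriv k p.1 * a (rsq p))
      - 1 / 2 * (k p.1 * (3 * b (rsq p) + 2 * rsq p * deriv b (rsq p))))
    - pd 0 φ p * (deriv k p.1 * (a (rsq p) * pd 0 φ p + b (rsq p) * euler φ p))
    + 2 * k p.1 * deriv a (rsq p) * euler φ p * pd 0 φ p
    + k p.1 * (b (rsq p) * spaceSq φ p + 2 * deriv b (rsq p) * euler φ p ^ 2)
    - 1 / 2 * φ p ^ 2 * (-(deriv (deriv k) p.1 * c (rsq p))
      + k p.1 * (6 * deriv c (rsq p) + 4 * rsq p * deriv (deriv c) (rsq p)))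

/-- The divergence of a current on spacetime. -/
def divergence (J0 : Scalar) (J : Fin 3 → Scalar) (p : Spacetime) : ℝ :=
  pd 0 J0 p + ∑ i : Fin 3, pd i.succ (J i) p

@[fun_prop]
theorem contDiff_deriv {a : ℝ → ℝ} (ha : Smooth a) : Smooth (deriv a) :=
  (contDiff_infty_iff_deriv.1 ha).2

@[fun_prop]
theorem contDiff_euler {φ : Scalar} (hφ : Smooth φ) : Smooth (euler φ) := by
  unfold euler
  fun_prop

@[fun_prop]
theorem contDiff_lagr {φ : Scalar} (hφ : Smooth φ) : Smooth (lagr φ) := by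
  unfold lagr spaceSq
  fun_prop

@[fun_prop]
theorem contDiff_mult {k a b c : ℝ → ℝ} (hk : Smooth k) (ha : Smooth a)
    (hb : Smooth b) (hc : Smooth c) {φ : Scalar} (hφ : Smooth φ) :
    Smooth (mult k a b c φ) := by
  unfold mult
  fun_prop

@[fun_prop]
theorem contDiff_curT {k a b c : ℝ → ℝ} (hk : Smooth k) (ha : Smooth a)
    (hb : Smooth b) (hc : Smooth c) {φ : Scalar} (hφ : Smooth φ) :
    Smooth (curT k a b c φ) := by
  unfold curT
  fun_prop

@[fun_prop]
theorem contDiff_curS {k a b c : ℝ → ℝ} (hk : Smooth k) (ha : Smooth a)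
    (hb : Smooth b) (hc : Smooth c) {φ : Scalar} (hφ : Smooth φ)
    (i : Fin 3) : Smooth (curS k a b c φ i) := by
  unfold curS
  fun_prop

theorem pd_succ_euler {φ : Scalar} (hφ : Smooth φ) (j : Fin 3) (p : Spacetime) :
    pd j.succ (euler φ) p = pd j.succ φ p + ∑ i : Fin 3, p.2 i * pd j.succ (pd i.succ φ) p := by
  have : euler φ = fun p => p.2 0 * pd (Fin.succ 0) φ p + p.2 1 * pd (Fin.succ 1) φ p
      + p.2 2 * pd (Fin.succ 2) φ p := by
    funext p; simp [euler, Fin.sum_univ_three]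
  rw [this, pd_add, pd_add, pd_mul, pd_mul, pd_mul, Fin.sum_univ_three]
  simp only [pd_succ_coord]
  fin_cases j <;> simp <;> ring

theorem pd_zero_euler {φ : Scalar} (hφ : Smooth φ) (p : Spacetime) :
    pd 0 (euler φ) p = ∑ i : Fin 3, p.2 i * pd 0 (pd i.succ φ) p := by
  have : euler φ = fun p => p.2 0 * pd (Fin.succ 0) φ p + p.2 1 * pd (Fin.succ 1) φ p
      + p.2 2 * pd (Fin.succ 2) φ p := by
    funext p; simp [euler, Fin.sum_univ_three]
  rw [this, pd_add, pd_add, pd_mul, pd_mul, pd_mul, Fin.sum_univ_three]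
  simp only [pd_zero_coord]
  ring

theorem pd_lagr {φ : Scalar} (hφ : Smooth φ) (μ : Fin 4) (p : Spacetime) :
    pd μ (lagr φ) p = -(2 * pd 0 φ p * pd μ (pd 0 φ) p)
      + ∑ i : Fin 3, 2 * pd i.succ φ p * pd μ (pd i.succ φ) p := by
  have : lagr φ = fun p => -pd 0 φ p ^ 2 + (pd (Fin.succ 0) φ p ^ 2 + pd (Fin.succ 1) φ p ^ 2
      + pd (Fin.succ 2) φ p ^ 2) := by
    funext p; simp [lagr, spaceSq, Fin.sum_univ_three]
  rw [this, pd_add, pd_neg, pd_add, pd_add, pd_sq, pd_sq, pd_sq, pd_sq, Fin.sum_univ_three]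

theorem pd_mult_zero {k a b c : ℝ → ℝ} (hk : Smooth k) (ha : Smooth a)
    (hb : Smooth b) (hc : Smooth c) {φ : Scalar} (hφ : Smooth φ)
    (p : Spacetime) :
    pd 0 (mult k a b c φ) p =
      deriv k p.1 * (a (rsq p) * pd 0 φ p + b (rsq p) * euler φ p + c (rsq p) * φ p)
      + k p.1 * (a (rsq p) * pd 0 (pd 0 φ) p + b (rsq p) * pd 0 (euler φ) p
        + c (rsq p) * pd 0 φ p) := by
  have h0 := differentiable_of_smooth hφ
  unfold mult
  rw [pd_mul, pd_add, pd_add, pd_mul, pd_mul, pd_mul,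
    pd_zero_time, pd_zero_radial, pd_zero_radial, pd_zero_radial]
  ring

theorem pd_mult_succ {k a b c : ℝ → ℝ} (hk : Smooth k) (ha : Smooth a)
    (hb : Smooth b) (hc : Smooth c) {φ : Scalar} (hφ : Smooth φ)
    (i : Fin 3) (p : Spacetime) :
    pd i.succ (mult k a b c φ) p =
      k p.1 * (2 * p.2 i * (deriv a (rsq p) * pd 0 φ p + deriv b (rsq p) * euler φ p
          + deriv c (rsq p) * φ p)
        + a (rsq p) * pd i.succ (pd 0 φ) p + b (rsq p) * pd i.succ (euler φ) p
        + c (rsq p) * pd i.succ φ p) := by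
  have h0 := differentiable_of_smooth hφ
  unfold mult
  rw [pd_mul, pd_add, pd_add, pd_mul, pd_mul, pd_mul,
    pd_succ_time, pd_succ_radial, pd_succ_radial, pd_succ_radial]
  ring

theorem pd_curT {k a b c : ℝ → ℝ} (hk : Smooth k) (ha : Smooth a)
    (hb : Smooth b) (hc : Smooth c) {φ : Scalar} (hφ : Smooth φ)
    (p : Spacetime) :
    pd 0 (curT k a b c φ) p =
      -(pd 0 (pd 0 φ) p * mult k a b c φ p + pd 0 φ p * pd 0 (mult k a b c φ) p)
      - 1 / 2 * (deriv k p.1 * (a (rsq p) * lagr φ p) + k p.1 * (a (rsq p) * pd 0 (lagr φ) p))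
      + 1 / 2 * (2 * φ p * pd 0 φ p * (deriv k p.1 * c (rsq p))
        + φ p ^ 2 * (deriv (deriv k) p.1 * c (rsq p))) := by
  have h0 := differentiable_of_smooth hφ
  unfold curT
  rw [pd_add, pd_sub, pd_neg, pd_const_mul, pd_const_mul, pd_mul, pd_mul, pd_mul, pd_mul,
    pd_mul, pd_sq,
    pd_zero_time, pd_zero_time, pd_zero_radial, pd_zero_radial]
  ring

theorem pd_curS {k a b c : ℝ → ℝ} (hk : Smooth k) (ha : Smooth a)
    (hb : Smooth b) (hc : Smooth c) {φ : Scalar} (hφ : Smooth φ)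
    (i : Fin 3) (p : Spacetime) :
    pd i.succ (curS k a b c φ i) p =
      pd i.succ (pd i.succ φ) p * mult k a b c φ p + pd i.succ φ p * pd i.succ (mult k a b c φ) p
      - 1 / 2 * (k p.1 * (b (rsq p) * lagr φ p + p.2 i * (2 * p.2 i * deriv b (rsq p) * lagr φ p
          + b (rsq p) * pd i.succ (lagr φ) p)))
      - (2 * φ p * pd i.succ φ p * (k p.1 * (p.2 i * deriv c (rsq p)))
        + φ p ^ 2 * (k p.1 * (deriv c (rsq p)
          + p.2 i * (2 * p.2 i * deriv (deriv c) (rsq p))))) := by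
  have h0 := differentiable_of_smooth hφ
  unfold curS
  rw [pd_sub, pd_sub, pd_const_mul, pd_mul, pd_mul, pd_mul, pd_mul, pd_mul, pd_mul, pd_mul, pd_sq,
    pd_succ_time, pd_succ_radial, pd_succ_radial, pd_succ_coord]
  simp only [if_true]
  ring

/-- The energy identity for the multiplier `mult k a b c φ`, in differential form. -/
theorem divergence_cur {k a b c : ℝ → ℝ} (hk : Smooth k) (ha : Smooth a)
    (hb : Smooth b) (hc : Smooth c) {φ : Scalar} (hφ : Smooth φ)
    (p : Spacetime) :
    divergence (curT k a b c φ) (curS k a b c φ) p =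
      mult k a b c φ p * box φ p + bulk k a b c φ p := by
  have hc' : ∀ i j : Fin 3, pd i.succ (pd j.succ φ) p = pd j.succ (pd i.succ φ) p :=
    fun i j => pd_comm hφ _ _ _
  have h0 : ∀ j : Fin 3, pd j.succ (pd 0 φ) p = pd 0 (pd j.succ φ) p := fun j => pd_comm hφ _ _ _
  simp only [divergence, pd_curT hk ha hb hc hφ, pd_curS hk ha hb hc hφ, pd_lagr hφ,
    pd_mult_zero hk ha hb hc hφ, pd_mult_succ hk ha hb hc hφ, pd_zero_euler hφ, pd_succ_euler hφ,
    Fin.sum_univ_three, box, bulk, spaceSq, h0, rsq_eq]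
  rw [hc' 1 0, hc' 2 0, hc' 2 1]
  simp only [mult, lagr, spaceSq, euler, Fin.sum_univ_three]
  ring

local notation:max "timeT" k:max => curT k (fun _ => 1) (fun _ => 0) (fun _ => 0)
local notation:max "timeS" k:max => curS k (fun _ => 1) (fun _ => 0) (fun _ => 0)

/-- The parametrization of the leaf `Σ_τ` by physical space. -/
def leaf (R τ : ℝ) (x : Space) : Spacetime := (τ + max (‖x‖ - R) 0, x)

/-- Vanishing at late times. -/
def VanishAfter (N : ℝ) (u : Scalar) : Prop := ∀ p : Spacetime, N ≤ p.1 → u p = 0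

theorem VanishAfter.pd {N : ℝ} {u : Scalar} (hu : VanishAfter N u) (μ : Fin 4) :
    VanishAfter (N + 1) (pd μ u) := by
  intro p hp
  have : u =ᶠ[nhds p] fun _ => 0 := by
    have : {q : Spacetime | N < q.1} ∈ nhds p :=
      (isOpen_lt continuous_const continuous_fst).mem_nhds (by simp; linarith)
    filter_upwards [this] with q hq using hu q (le_of_lt hq)
  rw [MinkowskiWave.pd, this.fderiv_eq]
  simp

theorem lipschitz_leaf (R τ : ℝ) : LipschitzWith 1 (leaf R τ) := by
  apply LipschitzWith.of_dist_le_mul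
  intro x y
  simp only [leaf, Prod.dist_eq, NNReal.coe_one, one_mul]
  apply max_le _ le_rfl
  rw [dist_add_left, Real.dist_eq, dist_eq_norm]
  calc |max (‖x‖ - R) 0 - max (‖y‖ - R) 0| ≤ |(‖x‖ - R) - (‖y‖ - R)| := abs_max_sub_max_le_abs _ _ _
    _ = |‖x‖ - ‖y‖| := by congr 1; ring
    _ ≤ ‖x - y‖ := abs_norm_sub_norm_le x y

theorem continuous_leaf (R : ℝ) : Continuous (fun q : ℝ × Space => leaf R q.1 q.2) := by
  unfold leaf; fun_prop

theorem leaf_support {R N τ : ℝ} {u : Scalar} (hu : VanishAfter N u) {x : Space}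
    (hx : N - τ + R < ‖x‖) : u (leaf R τ x) = 0 := by
  apply hu
  simp only [leaf]
  have := le_max_left (‖x‖ - R) 0
  linarith

theorem hasFDerivAt_norm_of_ne {x : Space} (hx : x ≠ 0) :
    HasFDerivAt (fun y : Space => ‖y‖) (innerSL ℝ (radial x)) x := by
  have h := (hasStrictFDerivAt_norm_sq x).hasFDerivAt.sqrt (by simpa using hx)
  have e : (fun y : Space => √(‖y‖ ^ 2)) = fun y => ‖y‖ := by
    funext y; exact Real.sqrt_sq (norm_nonneg y)
  simp only [Real.sqrt_sq (norm_nonneg _)] at h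
  refine h.congr_fderiv ?_
  ext y
  have : ‖x‖ ≠ 0 := by simpa using hx
  simp [radial]
  field_simp

theorem lineDeriv_leaf {R τ : ℝ} (hR : 0 < R) {G : Scalar} (hG : ContDiff ℝ 1 G) (i : Fin 3)
    {x : Space} (hx : ‖x‖ ≠ R) :
    lineDeriv ℝ (fun y => G (leaf R τ y)) x (EuclideanSpace.single i 1) = pd i.succ G (leaf R τ x) +
        (if R < ‖x‖ then radial x i else 0) * pd 0 G (leaf R τ x) := by
  have hd := (hG.differentiable (by simp)) (leaf R τ x)
  rcases lt_or_gt_of_ne hx with h | h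
  · have h1 : HasFDerivAt (leaf R τ) (ContinuousLinearMap.prod (0 : Space →L[ℝ] ℝ)
        (ContinuousLinearMap.id ℝ Space)) x := by
      have : HasFDerivAt (fun y : Space => (τ, y)) (ContinuousLinearMap.prod (0 : Space →L[ℝ] ℝ)
        (ContinuousLinearMap.id ℝ Space)) x := (hasFDerivAt_const _ _).prodMk (hasFDerivAt_id _)
      refine this.congr_of_eventuallyEq ?_
      have : {y : Space | ‖y‖ < R} ∈ nhds x :=
        (isOpen_lt continuous_norm continuous_const).mem_nhds h
      filter_upwards [this] with y hy
      have hy : ‖y‖ < R := hy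
      have : ‖y‖ - R ≤ 0 := by linarith
      simp [leaf, max_eq_right this]
    have h2 := (hd.hasFDerivAt.comp x h1).hasLineDerivAt (EuclideanSpace.single i 1)
    have h3 := h2.lineDeriv
    simp only [Function.comp_def] at h3
    rw [h3]
    simp [pd, basisVec, not_lt.2 h.le]
  · have hx0 : x ≠ 0 := by rintro rfl; simp at h; linarith
    have h1 : HasFDerivAt (leaf R τ) (ContinuousLinearMap.prod (innerSL ℝ (radial x))
        (ContinuousLinearMap.id ℝ Space)) x := by
      have : HasFDerivAt (fun y : Space => (τ - R + ‖y‖, y)) (ContinuousLinearMap.prod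
        (innerSL ℝ (radial x)) (ContinuousLinearMap.id ℝ Space)) x :=
          ((hasFDerivAt_norm_of_ne hx0).const_add _).prodMk (hasFDerivAt_id _)
      refine this.congr_of_eventuallyEq ?_
      have : {y : Space | R < ‖y‖} ∈ nhds x :=
        (isOpen_lt continuous_const continuous_norm).mem_nhds h
      filter_upwards [this] with y hy
      have hy : R < ‖y‖ := hy
      have : 0 ≤ ‖y‖ - R := by linarith
      simp only [leaf, max_eq_left this]
      congr 1; ring
    have h2 := (hd.hasFDerivAt.comp x h1).hasLineDerivAt (EuclideanSpace.single i 1)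
    have h3 := h2.lineDeriv
    simp only [Function.comp_def] at h3
    rw [h3]
    simp only [pd, basisVec, if_pos h]
    have : ((ContinuousLinearMap.prod (innerSL ℝ (radial x))
        (ContinuousLinearMap.id ℝ Space)) (EuclideanSpace.single i 1) : Spacetime) =
        ((0 : ℝ), EuclideanSpace.single i (1 : ℝ)) + radial x i • ((1 : ℝ), (0 : Space)) := by
      ext <;> simp [EuclideanSpace.inner_single_right]
    rw [ContinuousLinearMap.comp_apply, this, map_add, map_smul, smul_eq_mul]
    rfl

theorem integral_lineDeriv_leaf {R N τ : ℝ} (hR : 0 < R) {G : Scalar} (hG : ContDiff ℝ 1 G)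
    (hN : VanishAfter N G) (i : Fin 3) :
    ∫ x, (pd i.succ G (leaf R τ x) +
        (if R < ‖x‖ then radial x i else 0) * pd 0 G (leaf R τ x)) = 0 := by
  set ρ : ℝ := |τ| + |N| + |R| + 1 with hρ
  have hρ0 : 0 < ρ := by positivity
  let f : ContDiffBump (0 : Spacetime) := ⟨ρ, ρ + 1, hρ0, by linarith⟩
  have hfG : ContDiff ℝ 1 (fun p => f p * G p) := f.contDiff.mul hG
  have hfs : HasCompactSupport (fun p => f p * G p) := f.hasCompactSupport.mul_right
  obtain ⟨C, hC⟩ := ContDiff.lipschitzWith_of_hasCompactSupport hfs hfG (by simp)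
  have hbound : ∀ x : Space, ρ < ‖x‖ → G (leaf R τ x) = 0 := by
    intro x hx
    apply leaf_support hN
    have := neg_abs_le τ; have := le_abs_self N; have := le_abs_self R
    linarith
  have hg : (fun x => f (leaf R τ x) * G (leaf R τ x)) = fun x => G (leaf R τ x) := by
    funext x
    by_cases h0 : G (leaf R τ x) = 0
    · simp [h0]
    · have hx : ‖x‖ ≤ ρ := by by_contra h; exact h0 (hbound x (not_le.1 h))
      have ht : τ + max (‖x‖ - R) 0 < N := by
        by_contra h; exact h0 (hN _ (not_lt.1 h))
      rw [f.one_of_mem_closedBall, one_mul]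
      simp only [mem_closedBall_zero_iff, leaf, Prod.norm_def, Real.norm_eq_abs]
      refine max_le ?_ hx
      change _ ≤ ρ
      rw [abs_le]
      have := neg_abs_le τ; have := le_abs_self N; have := abs_nonneg R
      have := abs_nonneg N; have := le_max_right (‖x‖ - R) 0; have := abs_nonneg τ
      constructor <;> linarith
  have hL : LipschitzWith (C * 1) (fun x => G (leaf R τ x)) := by
    rw [← hg]; exact hC.comp (lipschitz_leaf R τ)
  have hS : HasCompactSupport (fun x => G (leaf R τ x)) := by
    apply HasCompactSupport.intro (isCompact_closedBall (0 : Space) ρ)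
    intro x hx
    apply hbound
    simpa using hx
  have h1 := LipschitzWith.integral_lineDeriv_mul_eq (μ := volume)
    (LipschitzWith.const (α := Space) (1 : ℝ)) hL hS (-EuclideanSpace.single i 1)
  have h0 : ∀ x v : Space, lineDeriv ℝ (fun _ : Space => (1 : ℝ)) x v = 0 := fun x v => by
    simp [lineDeriv]
  simp only [h0, zero_mul, neg_neg, mul_one, integral_zero] at h1
  refine (integral_congr_ae ?_).trans h1.symm
  have : ∀ᵐ x : Space, ‖x‖ ≠ R := by
    have : (volume : Measure Space) (Metric.sphere 0 R) = 0 := Measure.addHaar_sphere _ _ _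
    rw [ae_iff]
    convert this using 2
    ext x; simp
  filter_upwards [this] with x hx
  exact (lineDeriv_leaf hR hG i hx).symm

/-- `x_i / |x|` outside the ball of radius `R`, and `0` inside. -/
def outerDir (R : ℝ) (i : Fin 3) (x : Space) : ℝ := if R < ‖x‖ then radial x i else 0

theorem measurable_radial (i : Fin 3) : Measurable (fun x : Space => radial x i) := by
  have : (fun x : Space => radial x i) = fun x => ‖x‖⁻¹ * x i := by
    funext x; simp [radial]
  rw [this]
  fun_prop

theorem measurable_outerDir (R : ℝ) (i : Fin 3) : Measurable (outerDir R i) :=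
  Measurable.ite (measurableSet_lt measurable_const measurable_norm) (measurable_radial i)
    measurable_const

theorem abs_radial_le (x : Space) (i : Fin 3) : |radial x i| ≤ 1 := by
  have h1 : |x i| ≤ ‖x‖ := by simpa using PiLp.norm_apply_le x i
  simp only [radial, PiLp.smul_apply, smul_eq_mul, abs_mul, abs_inv, abs_norm]
  rcases eq_or_ne x 0 with rfl | hx
  · simp
  · have : 0 < ‖x‖ := norm_pos_iff.2 hx
    rw [inv_mul_le_iff₀ this]; simpa using h1

theorem abs_outerDir_le (R : ℝ) (i : Fin 3) (x : Space) : |outerDir R i x| ≤ 1 := by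
  unfold outerDir
  split_ifs
  · exact abs_radial_le x i
  · simp

/-- The flux density of a current through the leaves `Σ_τ`, in terms of `dx`. -/
def fluxDens (R : ℝ) (J0 : Scalar) (J : Fin 3 → Scalar) (p : Spacetime) : ℝ :=
  -(J0 p - ∑ i : Fin 3, outerDir R i p.2 * J i p)

theorem integrable_leaf {R N τ : ℝ} {u : Scalar} (hu : Continuous u)
    (hN : VanishAfter N u) {w : Space → ℝ} (hw : Measurable w) (hw1 : ∀ x, |w x| ≤ 1) :
    Integrable (fun x => w x * u (leaf R τ x)) := by
  have h : Integrable (fun x => u (leaf R τ x)) := by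
    apply Continuous.integrable_of_hasCompactSupport
    · exact hu.comp (lipschitz_leaf R τ).continuous
    · apply HasCompactSupport.intro (isCompact_closedBall (0 : Space) (N - τ + R))
      intro x hx
      apply leaf_support hN
      simpa using hx
  exact h.bdd_mul hw.aestronglyMeasurable (c := 1) (Filter.Eventually.of_forall hw1)

theorem integrable_leaf_prod {R N τ₁ τ₂ : ℝ} {u : Scalar} (hu : Continuous u)
    (hN : VanishAfter N u) {w : Space → ℝ} (hw : Measurable w) (hw1 : ∀ x, |w x| ≤ 1)
    {e : ℝ → ℝ} (he : Continuous e) :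
    Integrable (fun q : ℝ × Space => e q.1 * (w q.2 * u (leaf R q.1 q.2)))
      ((volume.restrict (Icc τ₁ τ₂)).prod volume) := by
  have h : Integrable (fun q : ℝ × Space => e q.1 * u (leaf R q.1 q.2))
      ((volume.restrict (Icc τ₁ τ₂)).prod volume) := by
    have e1 : (volume.restrict (Icc τ₁ τ₂)).prod (volume : Measure Space) =
        (volume : Measure (ℝ × Space)).restrict (Icc τ₁ τ₂ ×ˢ univ) := by
      rw [Measure.volume_eq_prod, ← Measure.prod_restrict, Measure.restrict_univ]
    rw [e1]
    have hc : Continuous (fun q : ℝ × Space => e q.1 * u (leaf R q.1 q.2)) :=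
      (he.comp continuous_fst).mul (hu.comp (continuous_leaf R))
    have hK : IsCompact (Icc τ₁ τ₂ ×ˢ Metric.closedBall (0 : Space) (N - τ₁ + R)) :=
      isCompact_Icc.prod (isCompact_closedBall _ _)
    refine IntegrableOn.of_forall_sdiff_eq_zero (hc.continuousOn.integrableOn_compact hK)
      (measurableSet_Icc.prod MeasurableSet.univ) ?_
    rintro ⟨τ, x⟩ ⟨⟨h1, -⟩, h2⟩
    have : u (leaf R τ x) = 0 := by
      apply leaf_support hN
      by_contra h3
      refine h2 ⟨h1, ?_⟩
      simp only [mem_closedBall_zero_iff]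
      have h1 : τ₁ ≤ τ := h1.1
      linarith
    simp [this]
  have h2 := h.bdd_mul (f := fun q : ℝ × Space => w q.2) (c := 1)
    (hw.comp measurable_snd).aestronglyMeasurable
    (Filter.Eventually.of_forall fun q => hw1 q.2)
  refine h2.congr (Filter.Eventually.of_forall fun q => ?_)
  simp only; ring

theorem continuous_pd_of_contDiff_one {u : Scalar} (hu : ContDiff ℝ 1 u) (μ : Fin 4) :
    Continuous (pd μ u) :=
  (hu.continuous_fderiv (by simp)).clm_apply continuous_const

theorem hasDerivAt_leaf {R τ : ℝ} {u : Scalar} (hu : ContDiff ℝ 1 u) (x : Space) :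
    HasDerivAt (fun σ => u (leaf R σ x)) (pd 0 u (leaf R τ x)) τ := by
  have h1 : HasDerivAt (fun σ => leaf R σ x) ((1 : ℝ), (0 : Space)) τ :=
    ((hasDerivAt_id τ).add_const _).prodMk (hasDerivAt_const τ x)
  exact ((hu.differentiable (by simp)) (leaf R τ x)).hasFDerivAt.comp_hasDerivAt τ h1

theorem vanishAfter_divergence {N : ℝ} {J0 : Scalar} {J : Fin 3 → Scalar}
    (h0 : VanishAfter N J0) (hJ : ∀ i, VanishAfter N (J i)) :
    VanishAfter (N + 1) (divergence J0 J) := by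
  intro p hp
  simp [divergence, h0.pd 0 p hp, fun i : Fin 3 => (hJ i).pd i.succ p hp]

theorem continuous_divergence {J0 : Scalar} {J : Fin 3 → Scalar}
    (h0 : ContDiff ℝ 1 J0) (hJ : ∀ i, ContDiff ℝ 1 (J i)) : Continuous (divergence J0 J) := by
  have h1 := continuous_pd_of_contDiff_one h0 0
  have h2 := fun i : Fin 3 => continuous_pd_of_contDiff_one (hJ i) i.succ
  unfold divergence
  fun_prop

section identity
variable {R N τ₁ τ₂ : ℝ} {J0 : Scalar} {J : Fin 3 → Scalar}

theorem integrable_fluxDens (h0 : ContDiff ℝ 1 J0) (hJ : ∀ i, ContDiff ℝ 1 (J i))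
    (v0 : VanishAfter N J0) (vJ : ∀ i, VanishAfter N (J i)) (τ : ℝ) :
    Integrable (fun x => fluxDens R J0 J (leaf R τ x)) := by
  have h1 : Integrable (fun x => J0 (leaf R τ x)) := by
    simpa using integrable_leaf (τ := τ) h0.continuous v0 (w := fun _ => 1) measurable_const (by simp)
  have h2 : ∀ i, Integrable (fun x => outerDir R i x * J i (leaf R τ x)) := fun i =>
    integrable_leaf (hJ i).continuous (vJ i) (measurable_outerDir R i) (abs_outerDir_le R i)
  exact (h1.sub (integrable_finsetSum _ fun i _ => h2 i)).neg

theorem integrable_fluxDens_prod (h0 : ContDiff ℝ 1 J0) (hJ : ∀ i, ContDiff ℝ 1 (J i))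
    (v0 : VanishAfter N J0) (vJ : ∀ i, VanishAfter N (J i)) {e : ℝ → ℝ} (he : Continuous e) :
    Integrable (fun q : ℝ × Space => e q.1 * fluxDens R J0 J (leaf R q.1 q.2))
      ((volume.restrict (Icc τ₁ τ₂)).prod volume) := by
  have h1 : Integrable (fun q : ℝ × Space => e q.1 * J0 (leaf R q.1 q.2))
      ((volume.restrict (Icc τ₁ τ₂)).prod volume) := by
    simpa using integrable_leaf_prod h0.continuous v0 (w := fun _ => 1) measurable_const (by simp) he
  have h2 : ∀ i, Integrable (fun q : ℝ × Space =>
      e q.1 * (outerDir R i q.2 * J i (leaf R q.1 q.2)))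
      ((volume.restrict (Icc τ₁ τ₂)).prod volume) := fun i =>
    integrable_leaf_prod (hJ i).continuous (vJ i) (measurable_outerDir R i) (abs_outerDir_le R i) he
  refine ((h1.sub (integrable_finsetSum Finset.univ fun i _ => h2 i)).neg).congr
    (Filter.Eventually.of_forall fun q => ?_)
  simp only [fluxDens, Pi.neg_apply, Pi.sub_apply, Finset.mul_sum, leaf, mul_neg, mul_sub]

theorem integrable_divergence_prod (h0 : ContDiff ℝ 1 J0) (hJ : ∀ i, ContDiff ℝ 1 (J i))
    (v0 : VanishAfter N J0) (vJ : ∀ i, VanishAfter N (J i)) {e : ℝ → ℝ} (he : Continuous e) :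
    Integrable (fun q : ℝ × Space => e q.1 * divergence J0 J (leaf R q.1 q.2))
      ((volume.restrict (Icc τ₁ τ₂)).prod volume) := by
  simpa using integrable_leaf_prod (continuous_divergence h0 hJ) (vanishAfter_divergence v0 vJ)
    (w := fun _ => 1) measurable_const (by simp) he

/-- The divergence theorem for the region between two leaves, with an exponential weight. -/
theorem flux_identity (hR : 0 < R) (h0 : ContDiff ℝ 1 J0) (hJ : ∀ i, ContDiff ℝ 1 (J i))
    (v0 : VanishAfter N J0) (vJ : ∀ i, VanishAfter N (J i)) (l : ℝ) (h12 : τ₁ ≤ τ₂) :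
    (∫ x, exp (-(l * τ₂)) * fluxDens R J0 J (leaf R τ₂ x))
      + (∫ q : ℝ × Space, (exp (-(l * q.1)) * divergence J0 J (leaf R q.1 q.2)
          + exp (-(l * q.1)) * (l * fluxDens R J0 J (leaf R q.1 q.2)))
        ∂((volume.restrict (Icc τ₁ τ₂)).prod volume))
      = ∫ x, exp (-(l * τ₁)) * fluxDens R J0 J (leaf R τ₁ x) := by
  set e : ℝ → ℝ := fun τ => exp (-(l * τ)) with he_def
  have he : Continuous e := by fun_prop
  set ν := (volume.restrict (Icc τ₁ τ₂)).prod (volume : Measure Space) with hν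
  -- the time derivative of the flux density
  set dt : Scalar := fun p => -(pd 0 J0 p - ∑ i : Fin 3, outerDir R i p.2 * pd 0 (J i) p) with hdt
  have cpd0 := continuous_pd_of_contDiff_one h0 0
  have cpdJ := fun i : Fin 3 => continuous_pd_of_contDiff_one (hJ i) 0
  have hI1 : Integrable (fun q : ℝ × Space => e q.1 * dt (leaf R q.1 q.2)) ν := by
    have h1 : Integrable (fun q : ℝ × Space => e q.1 * pd 0 J0 (leaf R q.1 q.2)) ν := by
      simpa using integrable_leaf_prod cpd0 (v0.pd 0) (w := fun _ => 1) measurable_const (by simp) he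
    have h2 : ∀ i, Integrable (fun q : ℝ × Space =>
        e q.1 * (outerDir R i q.2 * pd 0 (J i) (leaf R q.1 q.2))) ν := fun i =>
      integrable_leaf_prod (cpdJ i) ((vJ i).pd 0) (measurable_outerDir R i) (abs_outerDir_le R i) he
    refine ((h1.sub (integrable_finsetSum Finset.univ fun i _ => h2 i)).neg).congr
      (Filter.Eventually.of_forall fun q => ?_)
    simp only [hdt, Pi.neg_apply, Pi.sub_apply, Finset.mul_sum, leaf, mul_neg, mul_sub]
  have hI2 : Integrable (fun q : ℝ × Space =>
      e q.1 * (l * fluxDens R J0 J (leaf R q.1 q.2))) ν := by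
    refine ((integrable_fluxDens_prod (R := R) h0 hJ v0 vJ he).const_mul l).congr
      (Filter.Eventually.of_forall fun q => ?_)
    simp only; ring
  have hI3 := integrable_divergence_prod (R := R) (τ₁ := τ₁) (τ₂ := τ₂) h0 hJ v0 vJ he
  -- fundamental theorem of calculus in `τ`
  have hftc : ∀ x : Space, e τ₂ * fluxDens R J0 J (leaf R τ₂ x)
      - e τ₁ * fluxDens R J0 J (leaf R τ₁ x)
      = ∫ τ in Icc τ₁ τ₂, (e τ * dt (leaf R τ x) - e τ * (l * fluxDens R J0 J (leaf R τ x))) := by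
    intro x
    rw [integral_Icc_eq_integral_Ioc, ← intervalIntegral.integral_of_le h12]
    symm
    apply intervalIntegral.integral_eq_sub_of_hasDerivAt
      (f := fun τ => e τ * fluxDens R J0 J (leaf R τ x))
    · intro τ _
      have d1 : HasDerivAt e (-l * e τ) τ := by
        have : HasDerivAt (fun τ => -(l * τ)) (-l) τ := by
          simpa using ((hasDerivAt_id τ).const_mul l).fun_neg
        simpa [he_def, mul_comm] using this.exp
      have d2 : HasDerivAt (fun τ => fluxDens R J0 J (leaf R τ x)) (dt (leaf R τ x)) τ := by
        have a0 := hasDerivAt_leaf (R := R) (τ := τ) h0 x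
        have ai := fun i : Fin 3 => (hasDerivAt_leaf (R := R) (τ := τ) (hJ i) x).const_mul
          (outerDir R i x)
        exact (a0.sub (HasDerivAt.fun_sum fun i _ => ai i)).neg
      refine (d1.fun_mul d2).congr_deriv ?_
      ring
    · apply Continuous.intervalIntegrable
      have c1 : ∀ u : Scalar, Continuous u → Continuous (fun τ => u (leaf R τ x)) :=
        fun u hu => hu.comp (by unfold leaf; fun_prop)
      have k1 := c1 _ cpd0
      have k2 := fun i => c1 _ (cpdJ i)
      have k3 := c1 _ h0.continuous
      have k4 := fun i => c1 _ (hJ i).continuous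
      simp only [hdt, fluxDens, leaf] at *
      fun_prop
  -- the slice integrals of the tangential divergence vanish
  have hslice : ∫ q : ℝ × Space, e q.1 * (divergence J0 J (leaf R q.1 q.2)
      + dt (leaf R q.1 q.2)) ∂ν = 0 := by
    have hint : Integrable (fun q : ℝ × Space => e q.1 * (divergence J0 J (leaf R q.1 q.2)
      + dt (leaf R q.1 q.2))) ν := by
      refine (hI3.add hI1).congr (Filter.Eventually.of_forall fun q => ?_)
      simp only [Pi.add_apply]; ring
    rw [integral_prod _ hint]
    have : ∀ τ, ∫ x, e τ * (divergence J0 J (leaf R τ x) + dt (leaf R τ x)) = 0 := by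
      intro τ
      rw [integral_const_mul]
      have e1 : ∀ x, divergence J0 J (leaf R τ x) + dt (leaf R τ x) = ∑ i : Fin 3,
          (pd i.succ (J i) (leaf R τ x) + outerDir R i x * pd 0 (J i) (leaf R τ x)) := by
        intro x
        simp only [divergence, hdt, Finset.sum_add_distrib, leaf]
        ring
      simp only [e1]
      rw [integral_finsetSum]
      · rw [Finset.sum_eq_zero, mul_zero]
        intro i _
        exact integral_lineDeriv_leaf hR (hJ i) (vJ i) i
      · intro i _
        refine Integrable.add ?_ (integrable_leaf (cpdJ i) ((vJ i).pd 0) (measurable_outerDir R i)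
          (abs_outerDir_le R i))
        simpa using integrable_leaf (R := R) (τ := τ) (continuous_pd_of_contDiff_one (hJ i) i.succ)
          ((vJ i).pd i.succ) (w := fun _ => 1) measurable_const (by simp)
    simp [this]
  have hI12 := hI1.sub hI2
  have key : ∫ q, (e q.1 * dt (leaf R q.1 q.2) - e q.1 * (l * fluxDens R J0 J (leaf R q.1 q.2))) ∂ν
      = (∫ x, e τ₂ * fluxDens R J0 J (leaf R τ₂ x))
        - ∫ x, e τ₁ * fluxDens R J0 J (leaf R τ₁ x) := by
    rw [← integral_sub ((integrable_fluxDens h0 hJ v0 vJ τ₂).const_mul _)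
      ((integrable_fluxDens h0 hJ v0 vJ τ₁).const_mul _)]
    simp only [hftc]
    exact integral_prod_symm _ hI12
  rw [integral_add hI3 hI2]
  rw [integral_sub hI1 hI2] at key
  have h4 : ∫ q : ℝ × Space, e q.1 * (divergence J0 J (leaf R q.1 q.2)
      + dt (leaf R q.1 q.2)) ∂ν = ∫ q : ℝ × Space, e q.1 * divergence J0 J (leaf R q.1 q.2) ∂ν
        + ∫ q : ℝ × Space, e q.1 * dt (leaf R q.1 q.2) ∂ν := by
    rw [← integral_add hI3 hI1]
    congr 1; funext q; ring
  rw [h4] at hslice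
  linarith

end identity

theorem lintegral_ofReal_ne_top {δ : Type*} [MeasurableSpace δ] {m : Measure δ} {u : δ → ℝ}
    (hu : Integrable u m) : (∫⁻ x, ofReal (u x) ∂m) ≠ ⊤ :=
  (lt_of_le_of_lt (lintegral_mono fun _ => Real.ofReal_le_enorm _) hu.2).ne

theorem lintegral_balance {α β γ : Type*} [MeasurableSpace α] [MeasurableSpace β]
    [MeasurableSpace γ] {μ : Measure α} {ν : Measure β} {κ : Measure γ} {f : α → ℝ} {g : β → ℝ}
    {h : γ → ℝ} (hf : Integrable f μ) (hg : Integrable g ν) (hh : Integrable h κ)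
    (heq : (∫ x, f x ∂μ) + ∫ x, g x ∂ν = ∫ x, h x ∂κ) :
    (∫⁻ x, ofReal (f x) ∂μ) + (∫⁻ x, ofReal (g x) ∂ν) ≤
      (∫⁻ x, ofReal (h x) ∂κ) + (∫⁻ x, ofReal (-f x) ∂μ) + ∫⁻ x, ofReal (-g x) ∂ν := by
  rw [integral_eq_lintegral_pos_part_sub_lintegral_neg_part hf,
    integral_eq_lintegral_pos_part_sub_lintegral_neg_part hg,
    integral_eq_lintegral_pos_part_sub_lintegral_neg_part hh] at heq
  have f1 := lintegral_ofReal_ne_top hf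
  have f2 := lintegral_ofReal_ne_top hf.neg
  have g1 := lintegral_ofReal_ne_top hg
  have g2 := lintegral_ofReal_ne_top hg.neg
  have h1 := lintegral_ofReal_ne_top hh
  have h2 := lintegral_ofReal_ne_top hh.neg
  simp only [Pi.neg_apply] at f2 g2 h2
  rw [← ENNReal.toReal_le_toReal (ENNReal.add_ne_top.2 ⟨f1, g1⟩)
    (ENNReal.add_ne_top.2 ⟨ENNReal.add_ne_top.2 ⟨h1, f2⟩, g2⟩), ENNReal.toReal_add f1 g1,
    ENNReal.toReal_add (ENNReal.add_ne_top.2 ⟨h1, f2⟩) g2, ENNReal.toReal_add h1 f2]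
  have := ENNReal.toReal_nonneg (a := ∫⁻ x, ofReal (-h x) ∂κ)
  linarith

theorem ENNReal.add_le_of_balance {a b n m p q A B C : ℝ≥0∞} (hn : n ≠ ⊤) (hm : m ≠ ⊤) (hp : p ≠ ⊤)
    (hq : q ≠ ⊤) (h1 : a + n ≤ p + A) (h2 : b + m ≤ q + B) (h3 : p + q ≤ C + n + m) :
    a + b ≤ A + C + B := by
  have h := add_le_add (add_le_add h1 h2) h3
  have hne : n + m + p + q ≠ ⊤ := by simp [hn, hm, hp, hq]
  refine (ENNReal.add_le_add_iff_right hne).1 ?_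
  refine le_trans (le_of_eq ?_) (h.trans (le_of_eq ?_)) <;> ring

/-- Energy inequality between two leaves: pointwise bounds for the flux density and for the
divergence of a current give a bound for the corresponding integrals. -/
theorem flux_inequality {R N τ₁ τ₂ : ℝ} {J0 : Scalar} {J : Fin 3 → Scalar}
    (hR : 0 < R) (h0 : ContDiff ℝ 1 J0) (hJ : ∀ i, ContDiff ℝ 1 (J i))
    (v0 : VanishAfter N J0) (vJ : ∀ i, VanishAfter N (J i)) {l : ℝ} (hl : 0 ≤ l)
    (hτ : 0 ≤ τ₁) (h12 : τ₁ ≤ τ₂) {lo lo' up G H : Scalar}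
    (hlo0 : ∀ x, 0 ≤ lo (leaf R τ₂ x))
    (hlo : ∀ x, lo (leaf R τ₂ x) ≤ fluxDens R J0 J (leaf R τ₂ x) + lo' (leaf R τ₂ x))
    (hup : ∀ x, fluxDens R J0 J (leaf R τ₁ x) ≤ up (leaf R τ₁ x))
    (hG0 : ∀ τ ∈ Icc τ₁ τ₂, ∀ x, 0 ≤ G (leaf R τ x))
    (hG : ∀ τ ∈ Icc τ₁ τ₂, ∀ x, G (leaf R τ x) ≤ divergence J0 J (leaf R τ x)
      + l * fluxDens R J0 J (leaf R τ x) + H (leaf R τ x)) :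
    (∫⁻ x, ofReal (lo (leaf R τ₂ x))) + (∫⁻ τ in Icc τ₁ τ₂, ∫⁻ x, ofReal (G (leaf R τ x))) ≤
    ofReal (exp (l * τ₂)) * ((∫⁻ x, ofReal (lo' (leaf R τ₂ x))) + (∫⁻ x, ofReal (up (leaf R τ₁ x)))
      + (∫⁻ τ in Icc τ₁ τ₂, ∫⁻ x, ofReal (H (leaf R τ x)))) := by
  set e : ℝ → ℝ := fun τ => exp (-(l * τ)) with he_def
  have hecont : Continuous e := by fun_prop
  have he0 : ∀ τ, 0 < e τ := fun τ => exp_pos _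
  have he1 : ∀ τ, 0 ≤ τ → e τ ≤ 1 := fun τ h => by
    apply Real.exp_le_one_iff.2; nlinarith
  set f2 : Space → ℝ := fun x => e τ₂ * fluxDens R J0 J (leaf R τ₂ x)
  set f1 : Space → ℝ := fun x => e τ₁ * fluxDens R J0 J (leaf R τ₁ x)
  set d : ℝ × Space → ℝ := fun q => e q.1 * divergence J0 J (leaf R q.1 q.2)
          + e q.1 * (l * fluxDens R J0 J (leaf R q.1 q.2)) with hd
  set ν := (volume.restrict (Icc τ₁ τ₂)).prod (volume : Measure Space) with hν
  have If2 : Integrable f2 := (integrable_fluxDens h0 hJ v0 vJ τ₂).const_mul _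
  have If1 : Integrable f1 := (integrable_fluxDens h0 hJ v0 vJ τ₁).const_mul _
  have Id : Integrable d ν := by
    refine (integrable_divergence_prod h0 hJ v0 vJ hecont).add ?_
    refine ((integrable_fluxDens_prod (R := R) h0 hJ v0 vJ hecont).const_mul l).congr
      (Filter.Eventually.of_forall fun q => ?_)
    simp only; ring
  have main := lintegral_balance If2 Id If1 (flux_identity hR h0 hJ v0 vJ l h12)
  have mfd : Measurable (fun p => fluxDens R J0 J p) := by
    have := h0.continuous.measurable
    have := fun i => (hJ i).continuous.measurable
    have : ∀ i, Measurable (fun p : Spacetime => outerDir R i p.2) :=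
      fun i => (measurable_outerDir R i).comp measurable_snd
    unfold fluxDens
    fun_prop
  have mleaf : Measurable (fun q : ℝ × Space => leaf R q.1 q.2) := (continuous_leaf R).measurable
  have mf2 : Measurable f2 := (mfd.comp (lipschitz_leaf R τ₂).continuous.measurable).const_mul _
  have md : Measurable d := by
    have m1 := (continuous_divergence h0 hJ).measurable.comp mleaf
    have m2 := mfd.comp mleaf
    simp only [Function.comp_def] at m1 m2
    simp only [hd]
    fun_prop
  have f2fin : (∫⁻ x, ofReal (-f2 x)) ≠ ⊤ := lintegral_ofReal_ne_top If2.neg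
  have dfin : (∫⁻ q, ofReal (-d q) ∂ν) ≠ ⊤ := lintegral_ofReal_ne_top Id.neg
  have prodeq : ∀ u : ℝ × Space → ℝ, Measurable u → (∫⁻ q, ofReal (u q) ∂ν) =
      ∫⁻ τ in Icc τ₁ τ₂, ∫⁻ x, ofReal (u (τ, x)) := fun u hu =>
    lintegral_prod _ hu.ennreal_ofReal.aemeasurable
  -- final leaf
  have hA : (∫⁻ x, ofReal (e τ₂ * lo (leaf R τ₂ x))) + (∫⁻ x, ofReal (-f2 x)) ≤
      (∫⁻ x, ofReal (f2 x)) + ∫⁻ x, ofReal (e τ₂ * lo' (leaf R τ₂ x)) := by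
    rw [← lintegral_add_right _ (by fun_prop), ← lintegral_add_left (by fun_prop)]
    refine lintegral_mono fun x => ?_
    have hx : e τ₂ * lo (leaf R τ₂ x) ≤ f2 x + e τ₂ * lo' (leaf R τ₂ x) := by
      have := mul_le_mul_of_nonneg_left (hlo x) (he0 τ₂).le
      simpa [f2, mul_add] using this
    have hx0 : 0 ≤ e τ₂ * lo (leaf R τ₂ x) := mul_nonneg (he0 _).le (hlo0 x)
    rcases le_total 0 (f2 x) with h | h
    · rw [ofReal_of_nonpos (by linarith : -f2 x ≤ 0), add_zero]
      exact (ofReal_le_ofReal hx).trans ofReal_add_le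
    · rw [ofReal_of_nonpos h, zero_add, ← ofReal_add hx0 (by linarith)]
      exact ofReal_le_ofReal (by linarith)
  have hB : (∫⁻ τ in Icc τ₁ τ₂, ∫⁻ x, ofReal (e τ * G (leaf R τ x))) + (∫⁻ q, ofReal (-d q) ∂ν) ≤
      (∫⁻ q, ofReal (d q) ∂ν)
      + ∫⁻ τ in Icc τ₁ τ₂, ∫⁻ x, ofReal (e τ * H (leaf R τ x)) := by
    rw [prodeq d md, prodeq (fun q => -d q) md.neg, ← lintegral_add_right _ (by fun_prop),
      ← lintegral_add_left (by fun_prop)]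
    refine lintegral_mono_ae ((ae_restrict_iff' measurableSet_Icc).2
      (Filter.Eventually.of_forall fun τ hτ' => ?_))
    rw [← lintegral_add_right _ (by fun_prop), ← lintegral_add_left (by fun_prop)]
    refine lintegral_mono fun x => ?_
    have hx : e τ * G (leaf R τ x) ≤ d (τ, x) + e τ * H (leaf R τ x) := by
      have := mul_le_mul_of_nonneg_left (hG τ hτ' x) (he0 τ).le
      simpa [d, mul_add] using this
    have hx0 : 0 ≤ e τ * G (leaf R τ x) := mul_nonneg (he0 _).le (hG0 τ hτ' x)
    rcases le_total 0 (d (τ, x)) with h | h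
    · rw [ofReal_of_nonpos (by linarith : -d (τ, x) ≤ 0), add_zero]
      exact (ofReal_le_ofReal hx).trans ofReal_add_le
    · rw [ofReal_of_nonpos h, zero_add, ← ofReal_add hx0 (by linarith)]
      exact ofReal_le_ofReal (by linarith)
  have hC : (∫⁻ x, ofReal (e τ₂ * lo (leaf R τ₂ x)))
      + (∫⁻ τ in Icc τ₁ τ₂, ∫⁻ x, ofReal (e τ * G (leaf R τ x))) ≤
      (∫⁻ x, ofReal (e τ₂ * lo' (leaf R τ₂ x))) + (∫⁻ x, ofReal (f1 x))
      + ∫⁻ τ in Icc τ₁ τ₂, ∫⁻ x, ofReal (e τ * H (leaf R τ x)) := by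
    exact ENNReal.add_le_of_balance f2fin dfin (lintegral_ofReal_ne_top If2)
      (lintegral_ofReal_ne_top Id) hA hB main
  have hD : ofReal (e τ₂) * ((∫⁻ x, ofReal (lo (leaf R τ₂ x)))
      + (∫⁻ τ in Icc τ₁ τ₂, ∫⁻ x, ofReal (G (leaf R τ x)))) ≤
      (∫⁻ x, ofReal (lo' (leaf R τ₂ x))) + (∫⁻ x, ofReal (up (leaf R τ₁ x)))
      + ∫⁻ τ in Icc τ₁ τ₂, ∫⁻ x, ofReal (H (leaf R τ x)) := by
    have shrink : ∀ τ, 0 ≤ τ → ∀ y, ofReal (e τ * y) ≤ ofReal y := by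
      intro τ h y
      rw [ofReal_mul (he0 τ).le]
      calc _ ≤ 1 * ofReal y := by
            gcongr; exact ENNReal.ofReal_le_one.2 (he1 τ h)
        _ = _ := one_mul _
    refine le_trans ?_ (hC.trans ?_)
    · rw [mul_add, ← lintegral_const_mul' _ _ ofReal_ne_top,
        ← lintegral_const_mul' _ _ ofReal_ne_top]
      simp only [← lintegral_const_mul' _ _ ofReal_ne_top, ← ofReal_mul (he0 τ₂).le]
      gcongr ?_ + ?_
      · exact le_rfl
      · refine lintegral_mono_ae ((ae_restrict_iff' measurableSet_Icc).2
          (Filter.Eventually.of_forall fun τ hτ' => lintegral_mono fun x => ?_))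
        refine ofReal_le_ofReal (mul_le_mul_of_nonneg_right ?_ (hG0 τ hτ' x))
        apply Real.exp_le_exp.2
        have := hτ'.2
        nlinarith
    · gcongr ?_ + ?_ + ?_
      · exact lintegral_mono fun x => shrink _ (hτ.trans h12) _
      · exact lintegral_mono fun x => (shrink _ hτ _).trans (ofReal_le_ofReal (hup x))
      · refine lintegral_mono_ae ((ae_restrict_iff' measurableSet_Icc).2
          (Filter.Eventually.of_forall fun τ hτ' => lintegral_mono fun x => ?_))
        exact shrink _ (hτ.trans hτ'.1) _
  have hexp : ofReal (exp (l * τ₂)) * ofReal (e τ₂) = 1 := by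
    rw [← ofReal_mul (exp_pos _).le, he_def, ← Real.exp_add]; simp
  calc _ = ofReal (exp (l * τ₂)) * (ofReal (e τ₂) * _) := by
        rw [← mul_assoc, hexp, one_mul]
    _ ≤ _ := by gcongr

section algebra
variable {φ : Scalar} {p : Spacetime}

theorem radial_apply (x : Space) (i : Fin 3) : radial x i = x i / ‖x‖ := by
  simp [radial, div_eq_inv_mul]

theorem coord_eq (p : Spacetime) (i : Fin 3) : p.2 i = r[p] * radial p.2 i := by
  rcases eq_or_ne p.2 0 with h | h
  · simp [h]
  · have : r[p] ≠ 0 := by simpa using h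
    rw [radial_apply]; field_simp

theorem dr_eq_sum : dr φ p = ∑ i : Fin 3, radial p.2 i * pd i.succ φ p := by
  have : ((0 : ℝ), radial p.2) = ∑ i : Fin 3, radial p.2 i • basisVec i.succ := by
    ext j
    · simp [basisVec, Prod.fst_sum]
    · fin_cases j <;> simp [basisVec, Fin.sum_univ_three]
  rw [dr, this, map_sum]
  simp [pd]

theorem euler_eq : euler φ p = r[p] * dr φ p := by
  rw [dr_eq_sum, euler, Finset.mul_sum]
  refine Finset.sum_congr rfl fun i _ => ?_
  rcases eq_or_ne p.2 0 with h | h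
  · simp [h]
  · have : r[p] ≠ 0 := by simpa using h
    rw [radial_apply]; field_simp

theorem sum_radial_sq (h : p.2 ≠ 0) : ∑ i : Fin 3, radial p.2 i ^ 2 = 1 := by
  have h1 : r[p] ≠ 0 := by simpa using h
  have h2 := rsq_eq p
  simp only [radial_apply, Fin.sum_univ_three, rsq] at *
  field_simp
  exact h2.symm

theorem spaceSq_eq (h : p.2 ≠ 0) : spaceSq φ p = dr φ p ^ 2 + angSq φ p := by
  have h1 := sum_radial_sq h
  have h2 := dr_eq_sum (φ := φ) (p := p)
  simp only [spaceSq, angSq, Fin.sum_univ_three] at *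
  linear_combination (-dr φ p ^ 2) * h1 - 2 * dr φ p * h2

theorem gradSq_eq : gradSq φ p = pd 0 φ p ^ 2 + spaceSq φ p := by
  simp [gradSq, spaceSq, Fin.sum_univ_succ]

theorem angSq_nonneg (φ : Scalar) (p : Spacetime) : 0 ≤ angSq φ p := Finset.sum_nonneg fun _ _ => sq_nonneg _

theorem gradSq_nonneg (φ : Scalar) (p : Spacetime) : 0 ≤ gradSq φ p := Finset.sum_nonneg fun _ _ => sq_nonneg _

theorem dr_sq_le : dr φ p ^ 2 ≤ spaceSq φ p := by
  rcases eq_or_ne p.2 0 with h | h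
  · have : dr φ p = 0 := by rw [dr_eq_sum]; simp [radial, h]
    rw [this]
    simpa [spaceSq] using Finset.sum_nonneg fun (i : Fin 3) _ => sq_nonneg (pd i.succ φ p)
  · rw [spaceSq_eq h]; linarith [angSq_nonneg φ p]

theorem gradSq_eq' (h : p.2 ≠ 0) : gradSq φ p = pd 0 φ p ^ 2 + dr φ p ^ 2 + angSq φ p := by
  rw [gradSq_eq, spaceSq_eq h]; ring

theorem dv_sq_add_le (h : p.2 ≠ 0) : dv φ p ^ 2 + angSq φ p ≤ 2 * gradSq φ p := by
  rw [gradSq_eq' h, dv]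
  nlinarith [sq_nonneg (pd 0 φ p - dr φ p), angSq_nonneg φ p]

theorem ne_zero_of_lt {R : ℝ} (hR : 0 < R) {x : Space} (h : R < ‖x‖) : x ≠ 0 := by
  rintro rfl; simp at h; linarith

theorem fluxDens_inner {R : ℝ} {J0 : Scalar} {J : Fin 3 → Scalar}
    (h : ¬ R < r[p]) : fluxDens R J0 J p = -J0 p := by
  simp [fluxDens, outerDir, h]

theorem fluxDens_cur_outer {R : ℝ} (hR : 0 < R) (k a b c : ℝ → ℝ) (h : R < r[p]) :
    fluxDens R (curT k a b c φ) (curS k a b c φ) p = dv φ p * mult k a b c φ p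
      + 1 / 2 * (k p.1 * ((a (rsq p) - r[p] * b (rsq p)) * lagr φ p))
      - 1 / 2 * (φ p ^ 2 * (deriv k p.1 * c (rsq p) + k p.1 * (2 * r[p] * deriv c (rsq p)))) := by
  have h0 := ne_zero_of_lt hR h
  have h1 := sum_radial_sq h0
  have h2 := dr_eq_sum (φ := φ) (p := p)
  have hn : r[p] ≠ 0 := by simpa using h0
  have h3 := coord_eq p
  simp only [fluxDens, outerDir, h, if_true, curT, curS, dv]
  simp only [h3, Fin.sum_univ_three] at *
  rw [h2]
  linear_combination (-(1 / 2) * k p.1 * r[p] * b (rsq p) * lagr φ p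
    - φ p ^ 2 * k p.1 * r[p] * deriv c (rsq p)) * h1

theorem box_radial_mul {ρ : ℝ → ℝ} (hρ : Smooth ρ) (hφ : Smooth φ) :
    box (fun q => ρ (rsq q) * φ q) p = ρ (rsq p) * box φ p + 4 * deriv ρ (rsq p) * euler φ p
      + (6 * deriv ρ (rsq p) + 4 * rsq p * deriv (deriv ρ) (rsq p)) * φ p := by
  have e0 : pd 0 (fun q => ρ (rsq q) * φ q) = fun q => ρ (rsq q) * pd 0 φ q := by
    funext q
    rw [pd_mul, pd_zero_radial]; ring
  have ei : ∀ i : Fin 3, pd i.succ (fun q => ρ (rsq q) * φ q) =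
      fun q => (2 * (q.2 i * deriv ρ (rsq q))) * φ q + ρ (rsq q) * pd i.succ φ q := by
    intro i; funext q
    rw [pd_mul, pd_succ_radial]; ring
  have e00 : pd 0 (fun q => ρ (rsq q) * pd 0 φ q) p = ρ (rsq p) * pd 0 (pd 0 φ) p := by
    rw [pd_mul, pd_zero_radial]; ring
  have eii : ∀ i : Fin 3, pd i.succ
      (fun q => (2 * (q.2 i * deriv ρ (rsq q))) * φ q + ρ (rsq q) * pd i.succ φ q) p =
      2 * (deriv ρ (rsq p) + p.2 i * (2 * p.2 i * deriv (deriv ρ) (rsq p))) * φ p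
        + 4 * (p.2 i * deriv ρ (rsq p)) * pd i.succ φ p
        + ρ (rsq p) * pd i.succ (pd i.succ φ) p := by
    intro i
    rw [pd_add, pd_mul, pd_const_mul, pd_mul, pd_mul, pd_succ_radial, pd_succ_radial, pd_succ_coord]
    simp only [if_true]
    ring
  have hs := rsq_eq p
  simp only [box, e0, ei, e00, eii, Fin.sum_univ_three, euler]
  linear_combination (-4 * deriv (deriv ρ) (rsq p) * φ p) * hs

theorem pd_radial_mul_zero {ρ : ℝ → ℝ} (hρ : Smooth ρ) (hφ : Smooth φ) :
    pd 0 (fun q => ρ (rsq q) * φ q) p = ρ (rsq p) * pd 0 φ p := by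
  rw [pd_mul, pd_zero_radial]; ring

theorem pd_radial_mul_succ {ρ : ℝ → ℝ} (hρ : Smooth ρ) (hφ : Smooth φ) (i : Fin 3) :
    pd i.succ (fun q => ρ (rsq q) * φ q) p =
      2 * p.2 i * deriv ρ (rsq p) * φ p + ρ (rsq p) * pd i.succ φ p := by
  rw [pd_mul, pd_succ_radial]

end algebra

section weights

/-- A smooth decreasing cutoff in time: `1` for `t ≤ N`, `0` for `t ≥ 2N`. -/
def cut (N t : ℝ) : ℝ := smoothTransition (2 - t / N)

@[fun_prop]
theorem contDiff_cut (N : ℝ) : Smooth (cut N) := by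
  have := smoothTransition.contDiff (n := ⊤)
  unfold cut
  fun_prop

theorem cut_nonneg (N t : ℝ) : 0 ≤ cut N t := smoothTransition.nonneg _
theorem cut_le_one (N t : ℝ) : cut N t ≤ 1 := smoothTransition.le_one _

theorem cut_eq_one {N t : ℝ} (hN : 0 < N) (h : t ≤ N) : cut N t = 1 := by
  apply smoothTransition.one_of_one_le
  have : t / N ≤ 1 := (div_le_one hN).2 h
  linarith

theorem cut_eq_zero {N t : ℝ} (hN : 0 < N) (h : 2 * N ≤ t) : cut N t = 0 := by
  apply smoothTransition.zero_of_nonpos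
  have : 2 ≤ t / N := (le_div_iff₀ hN).2 h
  linarith

theorem cut_mono {N M t : ℝ} (hN : 0 < N) (h : N ≤ M) (ht : 0 ≤ t) : cut N t ≤ cut M t := by
  apply smoothTransition.monotone
  have : t / M ≤ t / N := by gcongr
  linarith

theorem deriv_smoothTransition_nonneg (t : ℝ) : 0 ≤ deriv smoothTransition t :=
  smoothTransition.monotone.deriv_nonneg

theorem deriv_smoothTransition_eq_zero {t : ℝ} (h : t < 0 ∨ 1 < t) :
    deriv smoothTransition =ᶠ[nhds t] fun _ => 0 := by
  rcases h with h | h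
  · filter_upwards [Iio_mem_nhds h] with s hs
    have : smoothTransition =ᶠ[nhds s] fun _ => 0 := by
      filter_upwards [Iio_mem_nhds hs] with u hu
      exact smoothTransition.zero_of_nonpos (le_of_lt hu)
    rw [this.deriv_eq]; simp
  · filter_upwards [Ioi_mem_nhds h] with s hs
    have : smoothTransition =ᶠ[nhds s] fun _ => 1 := by
      filter_upwards [Ioi_mem_nhds hs] with u hu
      exact smoothTransition.one_of_one_le (le_of_lt hu)
    rw [this.deriv_eq]; simp

theorem exists_bound_smoothTransition : ∃ c : ℝ, 0 < c ∧ ∀ t,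
    |deriv smoothTransition t| ≤ c ∧ |deriv (deriv smoothTransition) t| ≤ c := by
  have h0 : Smooth smoothTransition := smoothTransition.contDiff
  have h1 := contDiff_deriv h0
  have h2 := contDiff_deriv h1
  have s1 : HasCompactSupport (deriv smoothTransition) := by
    apply HasCompactSupport.intro (isCompact_Icc (a := (0 : ℝ)) (b := 1))
    intro t ht
    exact (deriv_smoothTransition_eq_zero (by
      simp only [mem_Icc, not_and_or, not_le] at ht; exact ht)).self_of_nhds
  obtain ⟨c1, hc1⟩ := s1.exists_bound_of_continuous h1.continuous
  obtain ⟨c2, hc2⟩ := s1.deriv.exists_bound_of_continuous h2.continuous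
  refine ⟨max (max c1 c2) 1, by positivity, fun t => ⟨?_, ?_⟩⟩
  · exact (hc1 t).trans ((le_max_left _ _).trans (le_max_left _ _))
  · exact (hc2 t).trans ((le_max_right _ _).trans (le_max_left _ _))

theorem hasDerivAt_cut (N t : ℝ) :
    HasDerivAt (cut N) (-(deriv smoothTransition (2 - t / N) / N)) t := by
  have h0 : Smooth smoothTransition := smoothTransition.contDiff
  have h1 : HasDerivAt (fun t : ℝ => 2 - t / N) (-(1 / N)) t :=
    ((hasDerivAt_id t).div_const N).const_sub 2
  refine (((h0.differentiable (by simp)) (2 - t / N)).hasDerivAt.comp t h1).congr_deriv ?_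
  ring

theorem deriv_cut (N : ℝ) : deriv (cut N) = fun t => -(deriv smoothTransition (2 - t / N) / N) :=
  funext fun t => (hasDerivAt_cut N t).deriv

theorem deriv_deriv_cut (N t : ℝ) :
    deriv (deriv (cut N)) t = deriv (deriv smoothTransition) (2 - t / N) / N ^ 2 := by
  have h0 : Smooth smoothTransition := smoothTransition.contDiff
  have h1 : HasDerivAt (fun t : ℝ => 2 - t / N) (-(1 / N)) t :=
    ((hasDerivAt_id t).div_const N).const_sub 2
  have h2 := ((((contDiff_deriv h0).differentiable (by simp)) (2 - t / N)).hasDerivAt.comp t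
    h1).div_const N
  have h3 := h2.fun_neg.deriv
  rw [deriv_cut]
  simp only [Function.comp_def] at h3
  rw [h3]; ring

theorem deriv_cut_nonpos {N : ℝ} (hN : 0 < N) (t : ℝ) : deriv (cut N) t ≤ 0 := by
  rw [deriv_cut]
  have := deriv_smoothTransition_nonneg (2 - t / N)
  simp only [Left.neg_nonpos_iff]; positivity

/-- The first two derivatives of `cut N` are `O(1/N)` and `O(1/N²)`, supported in `[N, 2N]`. -/
theorem exists_bound_cut : ∃ c : ℝ, 0 < c ∧ ∀ N t, 0 < N →
    (|deriv (cut N) t| ≤ c / N ∧ |deriv (deriv (cut N)) t| ≤ c / N ^ 2) ∧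
    (2 * N < t → deriv (cut N) t = 0 ∧ deriv (deriv (cut N)) t = 0) := by
  obtain ⟨c, hc, h⟩ := exists_bound_smoothTransition
  refine ⟨c, hc, fun N t hN => ⟨⟨?_, ?_⟩, fun ht => ?_⟩⟩
  · rw [deriv_cut]
    simp only [abs_neg, abs_div, abs_of_pos hN]
    gcongr
    exact (h _).1
  · rw [deriv_deriv_cut, abs_div, abs_of_pos (by positivity : 0 < N ^ 2)]
    gcongr
    exact (h _).2
  · have : 2 - t / N < 0 := by
      have : 2 < t / N := (lt_div_iff₀ hN).2 ht
      linarith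
    have h0 := deriv_smoothTransition_eq_zero (Or.inl this)
    rw [deriv_deriv_cut, deriv_cut]
    refine ⟨by simp [h0.self_of_nhds], ?_⟩
    rw [h0.deriv_eq]; simp

/-- A smooth cutoff as a function of `s = r²`: `0` for `r ≤ R`, `1` for `r ≥ R + 1`. -/
def chi (R s : ℝ) : ℝ := smoothTransition ((s - R ^ 2) / (2 * R + 1))

@[fun_prop]
theorem contDiff_chi (R : ℝ) : Smooth (chi R) := by
  have := smoothTransition.contDiff (n := ⊤)
  unfold chi
  fun_prop

theorem chi_nonneg (R s : ℝ) : 0 ≤ chi R s := smoothTransition.nonneg _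
theorem chi_le_one (R s : ℝ) : chi R s ≤ 1 := smoothTransition.le_one _

theorem chi_eq_zero {R s : ℝ} (hR : 0 < R) (h : s ≤ R ^ 2) : chi R s = 0 := by
  apply smoothTransition.zero_of_nonpos
  apply div_nonpos_of_nonpos_of_nonneg <;> linarith

theorem chi_eq_one {R s : ℝ} (hR : 0 < R) (h : (R + 1) ^ 2 ≤ s) : chi R s = 1 := by
  apply smoothTransition.one_of_one_le
  rw [le_div_iff₀ (by linarith)]; nlinarith

theorem exists_bound_chi {R : ℝ} (hR : 0 < R) : ∃ c : ℝ, 0 < c ∧ ∀ s,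
    0 ≤ deriv (chi R) s ∧ deriv (chi R) s ≤ c ∧ ((R + 1) ^ 2 < s → deriv (chi R) s = 0) := by
  obtain ⟨c, hc, h⟩ := exists_bound_smoothTransition
  have h0 : Smooth smoothTransition := smoothTransition.contDiff
  have hd : ∀ s, deriv (chi R) s =
      deriv smoothTransition ((s - R ^ 2) / (2 * R + 1)) / (2 * R + 1) := by
    intro s
    have h1 : HasDerivAt (fun s : ℝ => (s - R ^ 2) / (2 * R + 1)) (1 / (2 * R + 1)) s :=
      ((hasDerivAt_id s).sub_const _).div_const _
    have := (((h0.differentiable (by simp)) ((s - R ^ 2) / (2 * R + 1))).hasDerivAt.comp s h1).deriv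
    simp only [Function.comp_def] at this
    unfold chi
    rw [this]; ring
  refine ⟨c, hc, fun s => ⟨?_, ?_, fun hs => ?_⟩⟩
  · rw [hd]
    have := deriv_smoothTransition_nonneg ((s - R ^ 2) / (2 * R + 1))
    positivity
  · rw [hd, div_le_iff₀ (by linarith)]
    have := (le_abs_self _).trans (h ((s - R ^ 2) / (2 * R + 1))).1
    nlinarith
  · rw [hd, (deriv_smoothTransition_eq_zero (Or.inr _)).self_of_nhds, zero_div]
    rw [lt_div_iff₀ (by linarith)]; nlinarith

theorem deriv_chi_eq_zero {R s : ℝ} (hR : 0 < R) (h : s < R ^ 2) : deriv (chi R) s = 0 := by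
  have : chi R =ᶠ[nhds s] fun _ => 0 := by
    filter_upwards [Iio_mem_nhds h] with u hu
    exact chi_eq_zero hR (le_of_lt hu)
  rw [this.deriv_eq]; simp

/-- The weight `χ(s) s^e`. -/
def chiPow (R e s : ℝ) : ℝ := chi R s * s ^ e

@[fun_prop]
theorem contDiff_chiPow {R : ℝ} (hR : 0 < R) (e : ℝ) : Smooth (chiPow R e) := by
  rw [contDiff_iff_contDiffAt]
  intro s
  rcases lt_or_ge s (R ^ 2) with h | h
  · have : chiPow R e =ᶠ[nhds s] fun _ => 0 := by
      filter_upwards [Iio_mem_nhds h] with u hu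
      simp [chiPow, chi_eq_zero hR (le_of_lt hu)]
    exact contDiffAt_const.congr_of_eventuallyEq this
  · have hs : s ≠ 0 := by have := pow_pos hR 2; linarith
    exact (contDiff_chi R).contDiffAt.mul (Real.contDiffAt_rpow_const_of_ne hs)

theorem deriv_chiPow {R : ℝ} (e : ℝ) {s : ℝ} (hs : 0 < s) :
    deriv (chiPow R e) s = deriv (chi R) s * s ^ e + chi R s * (e * s ^ (e - 1)) := by
  have h1 : HasDerivAt (chi R) (deriv (chi R) s) s :=
    (((contDiff_chi R).differentiable (by simp)) s).hasDerivAt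
  have h2 := Real.hasDerivAt_rpow_const (x := s) (p := e) (Or.inl hs.ne')
  exact (h1.fun_mul h2).deriv

theorem chiPow_eq_zero {R e s : ℝ} (hR : 0 < R) (h : s ≤ R ^ 2) : chiPow R e s = 0 := by
  simp [chiPow, chi_eq_zero hR h]

/-- All derivatives of a smooth function vanishing for `s ≤ s₀` vanish at `s ≤ s₀`. -/
theorem deriv_eq_zero_of_vanish {f : ℝ → ℝ} {s₀ s : ℝ} (hf : Smooth f)
    (h : ∀ u ≤ s₀, f u = 0) (hs : s ≤ s₀) : deriv f s = 0 := by
  have hd : DifferentiableAt ℝ f s := (hf.differentiable (by simp)) s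
  have h1 : HasDerivWithinAt f (deriv f s) (Iic s) s := hd.hasDerivAt.hasDerivWithinAt
  have h2 : HasDerivWithinAt f 0 (Iic s) s :=
    (hasDerivWithinAt_const s (Iic s) (0 : ℝ)).congr (fun u hu => h u (le_trans hu hs)) (h s hs)
  exact (uniqueDiffWithinAt_Iic s).eq_deriv _ h1 h2

end weights

section densities

/-- The energy density on the leaves. -/
def eDens (R : ℝ) (φ : Scalar) (p : Spacetime) : ℝ :=
  if R < r[p] then dv φ p ^ 2 + angSq φ p else gradSq φ p

/-- `∂_v(rφ)`. -/
def yDer (φ : Scalar) (p : Spacetime) : ℝ := r[p] * dv φ p + φ p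

/-- Density of `g(q, τ)`. -/
def gDens (R q : ℝ) (φ : Scalar) (p : Spacetime) : ℝ :=
  if R < r[p] then r[p] ^ (q - 2) * yDer φ p ^ 2 else 0

/-- Density of `ḡ(q, τ)`. -/
def mDens (R q : ℝ) (φ : Scalar) (p : Spacetime) : ℝ :=
  if R < r[p] then r[p] ^ (q - 2) * (yDer φ p ^ 2 + r[p] ^ 2 * angSq φ p) else 0

/-- Density of the local energy. -/
def iDens (α : ℝ) (φ : Scalar) (p : Spacetime) : ℝ :=
  (gradSq φ p + (φ p / jb[p]) ^ 2) / jb[p] ^ (1 + α)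

/-- The integral of `h` over the leaf `Σ_τ`. -/
def sInt (R τ : ℝ) (h : Scalar) : ℝ≥0∞ := ∫⁻ x, ofReal (h (leaf R τ x))

theorem eDens_nonneg {R : ℝ} {φ : Scalar} {p : Spacetime} : 0 ≤ eDens R φ p := by
  unfold eDens
  split_ifs
  · have := angSq_nonneg φ p; positivity
  · exact (gradSq_nonneg _ _)

theorem gDens_nonneg {R q : ℝ} {φ : Scalar} {p : Spacetime} : 0 ≤ gDens R q φ p := by
  unfold gDens; split_ifs <;> positivity

theorem mDens_nonneg {R q : ℝ} {φ : Scalar} {p : Spacetime} : 0 ≤ mDens R q φ p := by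
  have := angSq_nonneg φ p
  unfold mDens; split_ifs <;> positivity

theorem iDens_nonneg {α : ℝ} {φ : Scalar} {p : Spacetime} : 0 ≤ iDens α φ p := by
  have := gradSq_nonneg φ p
  unfold iDens; positivity

theorem ae_norm_ne (R : ℝ) : ∀ᵐ x : Space, ‖x‖ ≠ R := by
  have : (volume : Measure Space) (Metric.sphere 0 R) = 0 := Measure.addHaar_sphere _ _ _
  rw [ae_iff]
  convert this using 2
  ext x; simp

theorem pd_psi {φ : Scalar} (hφ : Smooth φ) {p : Spacetime} (hp : p.2 ≠ 0) :
    pd 0 (psi φ) p = r[p] * pd 0 φ p ∧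
    ∀ i : Fin 3, pd i.succ (psi φ) p = r[p] * pd i.succ φ p + radial p.2 i * φ p := by
  have hn := hasFDerivAt_norm_of_ne hp
  have hd : DifferentiableAt ℝ (fun q : Spacetime => ‖q.2‖) p :=
    hn.differentiableAt.comp p differentiableAt_snd
  refine ⟨?_, fun i => ?_⟩
  · unfold psi
    rw [pd_mul hd, pd_zero_space (g := fun x => ‖x‖) hn.differentiableAt]; ring
  · unfold psi
    rw [pd_mul hd, pd_succ_space (g := fun x => ‖x‖) hn.differentiableAt, hn.fderiv]
    simp [EuclideanSpace.inner_single_right]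
    ring

theorem dr_psi {φ : Scalar} (hφ : Smooth φ) {p : Spacetime} (hp : p.2 ≠ 0) :
    dr (psi φ) p = r[p] * dr φ p + φ p := by
  have h1 := sum_radial_sq hp
  have h2 := dr_eq_sum (φ := φ) (p := p)
  rw [dr_eq_sum]
  simp only [(pd_psi hφ hp).2, Fin.sum_univ_three] at *
  linear_combination φ p * h1 - r[p] * h2

theorem dv_psi {φ : Scalar} (hφ : Smooth φ) {p : Spacetime} (hp : p.2 ≠ 0) :
    dv (psi φ) p = yDer φ p := by
  rw [dv, dr_psi hφ hp, (pd_psi hφ hp).1, yDer, dv]; ring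

theorem angSq_psi {φ : Scalar} (hφ : Smooth φ) {p : Spacetime} (hp : p.2 ≠ 0) :
    angSq (psi φ) p = r[p] ^ 2 * angSq φ p := by
  simp only [angSq, dr_psi hφ hp, (pd_psi hφ hp).2, Finset.mul_sum]
  refine Finset.sum_congr rfl fun i _ => ?_
  ring

theorem leaf_outer {R τ : ℝ} {x : Space} (h : R ≤ ‖x‖) : leaf R τ x = (τ - R + ‖x‖, x) := by
  simp only [leaf, max_eq_left (sub_nonneg.2 h)]
  congr 1; ring

theorem leaf_inner {R τ : ℝ} {x : Space} (h : ‖x‖ ≤ R) : leaf R τ x = (τ, x) := by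
  simp [leaf, max_eq_right (sub_nonpos.2 h)]

theorem coneInt_eq {R τ : ℝ} {h h' : Scalar} (hh : ∀ p : Spacetime, R < r[p] → h' p = h p)
    (h0 : ∀ p : Spacetime, ¬ R < r[p] → h' p = 0) : coneInt R τ h = sInt R τ h' := by
  rw [coneInt, sInt, ← lintegral_indicator (measurableSet_le measurable_const measurable_norm)]
  refine lintegral_congr_ae ?_
  filter_upwards [ae_norm_ne R] with x hx
  by_cases hR : R ≤ ‖x‖
  · have hR' : R < ‖x‖ := lt_of_le_of_ne hR (Ne.symm hx)
    rw [indicator_of_mem (show x ∈ {x : Space | R ≤ ‖x‖} from hR), leaf_outer hR,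
      hh _ (by simpa using hR')]
  · rw [indicator_of_notMem (show x ∉ {x : Space | R ≤ ‖x‖} from hR),
      h0 _ (by simp only [leaf]; exact fun h => hR h.le)]
    simp

theorem gFlux_eq {R q τ : ℝ} (hR : 0 < R) {φ : Scalar} (hφ : Smooth φ) :
    gFlux R φ q τ = sInt R τ (gDens R q φ) :=
  coneInt_eq (fun p hp => by rw [gDens, if_pos hp, dv_psi hφ (ne_zero_of_lt hR hp)])
    (fun p hp => by rw [gDens, if_neg hp])

theorem gBarFlux_eq {R q τ : ℝ} (hR : 0 < R) {φ : Scalar} (hφ : Smooth φ) :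
    gBarFlux R φ q τ = sInt R τ (mDens R q φ) :=
  coneInt_eq (fun p hp => by
      rw [mDens, if_pos hp, dv_psi hφ (ne_zero_of_lt hR hp), angSq_psi hφ (ne_zero_of_lt hR hp)])
    (fun p hp => by rw [mDens, if_neg hp])

@[fun_prop]
theorem measurable_dr {φ : Scalar} (hφ : Smooth φ) : Measurable (dr φ) := by
  have h1 : ∀ i : Fin 3, Measurable (fun p : Spacetime => radial p.2 i) :=
    fun i => (measurable_radial i).comp measurable_snd
  have : dr φ = fun p => ∑ i : Fin 3, radial p.2 i * pd i.succ φ p := by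
    funext p; exact dr_eq_sum
  rw [this]; fun_prop

@[fun_prop]
theorem measurable_dv {φ : Scalar} (hφ : Smooth φ) : Measurable (dv φ) := by
  unfold dv; fun_prop

@[fun_prop]
theorem measurable_angSq {φ : Scalar} (hφ : Smooth φ) : Measurable (angSq φ) := by
  have h1 : ∀ i : Fin 3, Measurable (fun p : Spacetime => radial p.2 i) :=
    fun i => (measurable_radial i).comp measurable_snd
  unfold angSq; fun_prop

@[fun_prop]
theorem measurable_gradSq {φ : Scalar} (hφ : Smooth φ) : Measurable (gradSq φ) := by
  unfold gradSq; fun_prop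

theorem measurableSet_outer (R : ℝ) : MeasurableSet {p : Spacetime | R < r[p]} :=
  measurableSet_lt measurable_const (by fun_prop)

@[fun_prop]
theorem measurable_eDens {R : ℝ} {φ : Scalar} (hφ : Smooth φ) : Measurable (eDens R φ) := by
  exact Measurable.ite (measurableSet_outer R) (by fun_prop) (measurable_gradSq hφ)

@[fun_prop]
theorem measurable_yDer {φ : Scalar} (hφ : Smooth φ) : Measurable (yDer φ) := by
  unfold yDer; fun_prop

@[fun_prop]
theorem measurable_gDens {R q : ℝ} {φ : Scalar} (hφ : Smooth φ) : Measurable (gDens R q φ) := by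
  exact Measurable.ite (measurableSet_outer R) (by fun_prop) measurable_const

@[fun_prop]
theorem measurable_mDens {R q : ℝ} {φ : Scalar} (hφ : Smooth φ) : Measurable (mDens R q φ) := by
  exact Measurable.ite (measurableSet_outer R) (by fun_prop) measurable_const

@[fun_prop]
theorem measurable_iDens {α : ℝ} {φ : Scalar} (hφ : Smooth φ) : Measurable (iDens α φ) := by
  unfold iDens; fun_prop

@[fun_prop]
theorem measurable_sInt_integrand {h : Scalar} (hh : Measurable h) (R τ : ℝ) :
    Measurable (fun x => ofReal (h (leaf R τ x))) :=
  (hh.comp (lipschitz_leaf R τ).continuous.measurable).ennreal_ofReal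

theorem energy_eq {R τ : ℝ} {φ : Scalar} (hφ : Smooth φ) : energy R φ τ = sInt R τ (eDens R φ) := by
  have m1 : Measurable (fun p : Spacetime => if R < r[p] then dv φ p ^ 2 + angSq φ p else 0) := by
    exact Measurable.ite (measurableSet_outer R) (by fun_prop) measurable_const
  rw [energy, coneInt_eq (h' := fun p => if R < r[p] then dv φ p ^ 2 + angSq φ p else 0)
    (fun p hp => if_pos hp) (fun p hp => if_neg hp),
    ← lintegral_indicator (measurableSet_le measurable_norm measurable_const), sInt, sInt,
    ← lintegral_add_right _ (measurable_sInt_integrand m1 R τ)]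
  refine lintegral_congr fun x => ?_
  by_cases hR : ‖x‖ ≤ R
  · have : ¬ R < ‖x‖ := not_lt.2 hR
    rw [indicator_of_mem (show x ∈ {x : Space | ‖x‖ ≤ R} from hR), leaf_inner hR]
    simp [eDens, this]
  · rw [indicator_of_notMem (show x ∉ {x : Space | ‖x‖ ≤ R} from hR)]
    have : R < ‖x‖ := not_le.1 hR
    simp [eDens, leaf, this]

theorem bulkInt_eq {R τ₁ τ₂ : ℝ} {h : Scalar} :
    bulkInt R τ₁ τ₂ h = ∫⁻ τ in Icc τ₁ τ₂, sInt R τ h := rfl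

@[fun_prop]
theorem measurable_sInt {h : Scalar} (hh : Measurable h) (R : ℝ) :
    Measurable (fun τ => sInt R τ h) :=
  Measurable.lintegral_prod_right' (f := fun q : ℝ × Space => ofReal (h (leaf R q.1 q.2)))
    (hh.comp (continuous_leaf R).measurable).ennreal_ofReal

theorem sInt_mono {R τ : ℝ} {h h' : Scalar} (hh : ∀ x, h (leaf R τ x) ≤ h' (leaf R τ x)) :
    sInt R τ h ≤ sInt R τ h' :=
  lintegral_mono fun x => ofReal_le_ofReal (hh x)

theorem sInt_add_le {R τ : ℝ} {f g : Scalar} (hf : Measurable f) :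
    sInt R τ (fun p => f p + g p) ≤ sInt R τ f + sInt R τ g := by
  unfold sInt
  rw [← lintegral_add_left (measurable_sInt_integrand hf R τ)]
  exact lintegral_mono fun x => ofReal_add_le

theorem sInt_add {R τ : ℝ} {f g : Scalar} (hf : Measurable f) (hf0 : ∀ p, 0 ≤ f p)
    (hg0 : ∀ p, 0 ≤ g p) :
    sInt R τ (fun p => f p + g p) = sInt R τ f + sInt R τ g := by
  unfold sInt
  rw [← lintegral_add_left (measurable_sInt_integrand hf R τ)]
  exact lintegral_congr fun x => ofReal_add (hf0 _) (hg0 _)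

theorem sInt_const_mul {R τ c : ℝ} (hc : 0 ≤ c) (f : Scalar) :
    sInt R τ (fun p => c * f p) = ofReal c * sInt R τ f := by
  unfold sInt
  rw [← lintegral_const_mul' _ _ ofReal_ne_top]
  exact lintegral_congr fun x => ofReal_mul hc

theorem cut_tendsto {t : ℝ} :
    Filter.Tendsto (fun n : ℕ => cut ((n : ℝ) + 1) t) Filter.atTop (nhds 1) := by
  obtain ⟨n, hn⟩ := exists_nat_ge t
  refine tendsto_const_nhds.congr' ?_
  filter_upwards [Filter.eventually_ge_atTop n] with m hm
  have : (n : ℝ) ≤ m := by exact_mod_cast hm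
  exact (cut_eq_one (by positivity) (by linarith)).symm

theorem sInt_cut_tendsto {R τ : ℝ} (hτ : 0 ≤ τ) {f : Scalar} (hf : Measurable f)
    (hf0 : ∀ p, 0 ≤ f p) :
    Filter.Tendsto (fun n : ℕ => sInt R τ (fun p => cut ((n : ℝ) + 1) p.1 * f p)) Filter.atTop
      (nhds (sInt R τ f)) := by
  refine lintegral_tendsto_of_tendsto_of_monotone (fun n => ?_) ?_ ?_
  · have := (contDiff_cut ((n : ℝ) + 1)).continuous.measurable
    exact (measurable_sInt_integrand (h := fun p => cut ((n : ℝ) + 1) p.1 * f p)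
      (by fun_prop) R τ).aemeasurable
  · refine Filter.Eventually.of_forall fun x n m hnm => ofReal_le_ofReal ?_
    have : (n : ℝ) ≤ m := by exact_mod_cast hnm
    refine mul_le_mul_of_nonneg_right (cut_mono (by positivity) (by linarith) ?_) (hf0 _)
    have := le_max_right (‖x‖ - R) 0
    simp only [leaf]; linarith
  · refine Filter.Eventually.of_forall fun x => ?_
    apply ENNReal.tendsto_ofReal
    simpa using (cut_tendsto (t := (leaf R τ x).1)).mul_const (f (leaf R τ x))

theorem bulk_cut_tendsto {R τ₁ τ₂ : ℝ} (hτ : 0 ≤ τ₁) {f : Scalar} (hf : Measurable f)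
    (hf0 : ∀ p, 0 ≤ f p) :
    Filter.Tendsto (fun n : ℕ => ∫⁻ τ in Icc τ₁ τ₂,
        sInt R τ (fun p => cut ((n : ℝ) + 1) p.1 * f p)) Filter.atTop
      (nhds (∫⁻ τ in Icc τ₁ τ₂, sInt R τ f)) := by
  refine lintegral_tendsto_of_tendsto_of_monotone (fun n => ?_) ?_ ?_
  · have := (contDiff_cut ((n : ℝ) + 1)).continuous.measurable
    exact (measurable_sInt (h := fun p => cut ((n : ℝ) + 1) p.1 * f p) (by fun_prop) R).aemeasurable
  · refine (ae_restrict_iff' measurableSet_Icc).2 (Filter.Eventually.of_forall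
      fun τ hτ' n m hnm => sInt_mono fun x => ?_)
    have : (n : ℝ) ≤ m := by exact_mod_cast hnm
    refine mul_le_mul_of_nonneg_right (cut_mono (by positivity) (by linarith) ?_) (hf0 _)
    have := le_max_right (‖x‖ - R) 0
    have := hτ'.1
    simp only [leaf]; linarith
  · exact (ae_restrict_iff' measurableSet_Icc).2 (Filter.Eventually.of_forall
      fun τ hτ' => sInt_cut_tendsto (hτ.trans hτ'.1) hf hf0)

end densities

section pcurrent

/-- A smooth function of `s = r²` which equals `r` for `r ≥ R`. -/
def rho (R s : ℝ) : ℝ := smoothTransition ((s - R ^ 2 / 4) / (R ^ 2 / 4)) * s ^ (1 / 2 : ℝ)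

@[fun_prop]
theorem contDiff_rho {R : ℝ} (hR : 0 < R) : Smooth (rho R) := by
  rw [contDiff_iff_contDiffAt]
  intro s
  rcases le_or_gt s 0 with h | h
  · have : rho R =ᶠ[nhds s] fun _ => 0 := by
      have h' : s < R ^ 2 / 4 := lt_of_le_of_lt h (by positivity)
      filter_upwards [Iio_mem_nhds h'] with u hu
      rw [rho, smoothTransition.zero_of_nonpos, zero_mul]
      apply div_nonpos_of_nonpos_of_nonneg _ (by positivity)
      have hu : u < R ^ 2 / 4 := hu
      linarith
    exact contDiffAt_const.congr_of_eventuallyEq this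
  · have h1 : Smooth smoothTransition := smoothTransition.contDiff
    exact ContDiffAt.mul (ContDiff.contDiffAt (by fun_prop)) (Real.contDiffAt_rpow_const_of_ne h.ne')

theorem rho_eventuallyEq {R s : ℝ} (hR : 0 < R) (hs : R ^ 2 ≤ s) :
    rho R =ᶠ[nhds s] fun s => s ^ (1 / 2 : ℝ) := by
  have h' : R ^ 2 / 2 < s := by have := pow_pos hR 2; linarith
  filter_upwards [Ioi_mem_nhds h'] with u hu
  rw [rho, smoothTransition.one_of_one_le, one_mul]
  have hu : R ^ 2 / 2 < u := hu
  rw [le_div_iff₀ (by positivity)]; linarith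

theorem rpow_sq {r : ℝ} (hr : 0 < r) (e : ℝ) : (r ^ 2) ^ e = r ^ (2 * e) := by
  rw [← rpow_natCast, ← Real.rpow_mul hr.le]; norm_num

theorem rho_eq {R r : ℝ} (hR : 0 < R) (hr : R ≤ r) : rho R (r ^ 2) = r := by
  have h0 : 0 < r := hR.trans_le hr
  rw [(rho_eventuallyEq hR (by gcongr : R ^ 2 ≤ r ^ 2)).self_of_nhds]
  beta_reduce
  rw [rpow_sq h0]; norm_num

theorem deriv_rho_eq {R r : ℝ} (hR : 0 < R) (hr : R ≤ r) :
    deriv (rho R) (r ^ 2) = 1 / (2 * r) ∧ deriv (deriv (rho R)) (r ^ 2) = -(1 / (4 * r ^ 3)) := by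
  have h0 : 0 < r := hR.trans_le hr
  have hd : ∀ s, R ^ 2 ≤ s → deriv (rho R) s = 1 / 2 * s ^ (-(1 / 2) : ℝ) := by
    intro s hs
    have : 0 < s := (pow_pos hR 2).trans_le hs
    rw [(rho_eventuallyEq hR hs).deriv_eq, (Real.hasDerivAt_rpow_const (Or.inl this.ne')).deriv]
    norm_num
  have hs2 : R ^ 2 ≤ r ^ 2 := by gcongr
  have hd2 : ∀ s, R ^ 2 ≤ s → deriv (rho R) =ᶠ[nhds s] fun s => 1 / 2 * s ^ (-(1 / 2) : ℝ) := by
    intro s hs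
    filter_upwards [(rho_eventuallyEq hR hs).eventually_nhds,
      Ioi_mem_nhds ((pow_pos hR 2).trans_le hs)] with u hu hu0
    have hu0 : 0 < u := hu0
    rw [Filter.EventuallyEq.deriv_eq hu, (Real.hasDerivAt_rpow_const (Or.inl hu0.ne')).deriv]
    norm_num
  constructor
  · rw [hd _ hs2, rpow_sq h0]
    norm_num [Real.rpow_neg_one]; ring
  · rw [(hd2 _ hs2).deriv_eq, ((Real.hasDerivAt_rpow_const (p := -(1 / 2))
      (Or.inl (pow_pos h0 2).ne')).const_mul (1 / 2)).deriv, rpow_sq h0]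
    have : (2 * (-(1 / 2) - 1) : ℝ) = (-3 : ℤ) := by norm_num
    rw [this, Real.rpow_intCast, zpow_neg]
    norm_cast
    field_simp
    norm_num

/-- A smooth function which equals `rφ` for `r ≥ R`. -/
def psiHat (R : ℝ) (φ : Scalar) (p : Spacetime) : ℝ := rho R (rsq p) * φ p

@[fun_prop]
theorem contDiff_psiHat {R : ℝ} (hR : 0 < R) {φ : Scalar} (hφ : Smooth φ) : Smooth (psiHat R φ) :=
  ((contDiff_rho hR).comp contDiff_rsq).mul hφ

theorem psiHat_facts {R : ℝ} (hR : 0 < R) {φ : Scalar} (hφ : Smooth φ)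
    {p : Spacetime} (hp : R < r[p]) :
    pd 0 (psiHat R φ) p = r[p] * pd 0 φ p ∧
    euler (psiHat R φ) p = r[p] * (r[p] * dr φ p + φ p) ∧
    spaceSq (psiHat R φ) p = (r[p] * dr φ p + φ p) ^ 2 + r[p] ^ 2 * angSq φ p ∧
    box (psiHat R φ) p = r[p] * box φ p + 2 * dr φ p + 2 / r[p] * φ p := by
  have h0 := ne_zero_of_lt hR hp
  have hn : 0 < r[p] := hR.trans hp
  have hr := rho_eq hR hp.le
  have hd := deriv_rho_eq hR hp.le
  have hrs : rsq p = r[p] ^ 2 := rfl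
  have e0 : pd 0 (psiHat R φ) p = r[p] * pd 0 φ p := by
    unfold psiHat
    rw [pd_radial_mul_zero (contDiff_rho hR) hφ, hrs, hr]
  have ei : ∀ i : Fin 3, pd i.succ (psiHat R φ) p = r[p] * pd i.succ φ p + radial p.2 i * φ p := by
    intro i
    unfold psiHat
    rw [pd_radial_mul_succ (contDiff_rho hR) hφ, hrs, hr, hd.1, radial_apply]
    field_simp
    ring
  have h1 := sum_radial_sq h0
  have h2 := dr_eq_sum (φ := φ) (p := p)
  have h3 := spaceSq_eq (φ := φ) h0
  have h4 : dr (psiHat R φ) p = r[p] * dr φ p + φ p := by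
    rw [dr_eq_sum]
    simp only [ei, Fin.sum_univ_three] at *
    linear_combination φ p * h1 - r[p] * h2
  refine ⟨e0, ?_, ?_, ?_⟩
  · rw [euler_eq, h4]
  · rw [spaceSq_eq h0, h4]
    congr 1
    simp only [angSq, h4, ei, Finset.mul_sum]
    refine Finset.sum_congr rfl fun i _ => ?_
    ring
  · unfold psiHat
    rw [box_radial_mul (contDiff_rho hR) hφ, hrs, hr, hd.1, hd.2, euler_eq]
    field_simp
    ring

/-- Components of the current of the `r`-weighted outgoing multiplier. -/
def pCurT (R e : ℝ) (k : ℝ → ℝ) (φ : Scalar) : Scalar :=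
  curT k (chiPow R e) (chiPow R (e - 1 / 2)) (fun _ => 0) (psiHat R φ)

/-- Components of the current of the `r`-weighted outgoing multiplier. -/
def pCurS (R e : ℝ) (k : ℝ → ℝ) (φ : Scalar) : Fin 3 → Scalar :=
  curS k (chiPow R e) (chiPow R (e - 1 / 2)) (fun _ => 0) (psiHat R φ)

@[fun_prop]
theorem contDiff_pCurT {R : ℝ} (hR : 0 < R) (e : ℝ) {k : ℝ → ℝ} (hk : Smooth k)
    {φ : Scalar} (hφ : Smooth φ) : Smooth (pCurT R e k φ) :=
  contDiff_curT hk (contDiff_chiPow hR _) (contDiff_chiPow hR _) contDiff_const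
    (contDiff_psiHat hR hφ)

@[fun_prop]
theorem contDiff_pCurS {R : ℝ} (hR : 0 < R) (e : ℝ) {k : ℝ → ℝ} (hk : Smooth k)
    {φ : Scalar} (hφ : Smooth φ) (i : Fin 3) : Smooth (pCurS R e k φ i) :=
  contDiff_curS hk (contDiff_chiPow hR _) (contDiff_chiPow hR _) contDiff_const
    (contDiff_psiHat hR hφ) i

theorem rsq_le_of_inner {R : ℝ} {p : Spacetime} (hp : ¬ R < r[p]) : rsq p ≤ R ^ 2 := by
  have := not_lt.1 hp
  unfold rsq; gcongr

theorem fluxDens_pCur_inner {R e : ℝ} (hR : 0 < R) {k : ℝ → ℝ} {φ : Scalar}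
    {p : Spacetime} (hp : ¬ R < r[p]) : fluxDens R (pCurT R e k φ) (pCurS R e k φ) p = 0 := by
  have h := rsq_le_of_inner hp
  rw [fluxDens_inner hp]
  simp [pCurT, curT, mult, chiPow_eq_zero hR h]

theorem fluxDens_pCur_outer {R e : ℝ} (hR : 0 < R) {k : ℝ → ℝ} {φ : Scalar}
    (hφ : Smooth φ) {p : Spacetime} (hp : R < r[p]) :
    fluxDens R (pCurT R e k φ) (pCurS R e k φ) p =
      k p.1 * (chi R (rsq p) * r[p] ^ (2 * e)) * yDer φ p ^ 2 := by
  have hn : 0 < r[p] := hR.trans hp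
  obtain ⟨h0, h1, h2, -⟩ := psiHat_facts hR hφ hp
  have h4 : dv (psiHat R φ) p = yDer φ p := by
    have := euler_eq (φ := psiHat R φ) (p := p)
    rw [h1] at this
    have := mul_left_cancel₀ hn.ne' this
    rw [dv, ← this, h0, yDer, dv]; ring
  have hrs : rsq p = r[p] ^ 2 := rfl
  have hb : r[p] * chiPow R (e - 1 / 2) (rsq p) = chiPow R e (rsq p) := by
    simp only [chiPow, hrs, rpow_sq hn]
    rw [show 2 * (e - 1 / 2) = 2 * e - 1 by ring, rpow_sub_one hn.ne']
    field_simp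
  unfold pCurT pCurS
  rw [fluxDens_cur_outer hR _ _ _ _ hp, hb, h4]
  simp only [mult, h0, h1]
  have hb2 : chiPow R (e - 1 / 2) (rsq p) * (r[p] * (r[p] * dr φ p + φ p)) =
      chiPow R e (rsq p) * (r[p] * dr φ p + φ p) := by rw [← hb]; ring
  rw [hb2]
  have : chiPow R e (rsq p) = chi R (rsq p) * r[p] ^ (2 * e) := by
    simp only [chiPow, hrs, rpow_sq hn]
  rw [this]
  simp [yDer, dv]
  ring

theorem divergence_pCur_inner {R e : ℝ} (hR : 0 < R) {k : ℝ → ℝ} (hk : Smooth k)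
    {φ : Scalar} (hφ : Smooth φ)
    {p : Spacetime} (hp : ¬ R < r[p]) : divergence (pCurT R e k φ) (pCurS R e k φ) p = 0 := by
  have h := rsq_le_of_inner hp
  unfold pCurT pCurS
  rw [divergence_cur hk (contDiff_chiPow hR _) (contDiff_chiPow hR _) contDiff_const
    (contDiff_psiHat hR hφ)]
  have d1 : ∀ e, deriv (chiPow R e) (rsq p) = 0 := fun e =>
    deriv_eq_zero_of_vanish (contDiff_chiPow hR e) (fun u hu => chiPow_eq_zero hR hu) h
  simp [mult, bulk, chiPow_eq_zero hR h, d1]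

theorem divergence_pCur_outer {R e : ℝ} (hR : 0 < R) {k : ℝ → ℝ} (hk : Smooth k)
    {φ : Scalar} (hφ : Smooth φ) {p : Spacetime} (hp : R < r[p]) :
    divergence (pCurT R e k φ) (pCurS R e k φ) p =
      k p.1 * chi R (rsq p) * r[p] ^ (2 * e) * yDer φ p * r[p] * box φ p
      + (k p.1 * r[p] * deriv (chi R) (rsq p) * r[p] ^ (2 * e)
          + k p.1 * chi R (rsq p) * (e + 1) * r[p] ^ (2 * e) / r[p]
          - 1 / 2 * deriv k p.1 * chi R (rsq p) * r[p] ^ (2 * e)) * yDer φ p ^ 2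
      - (1 / 2 * deriv k p.1 * chi R (rsq p) * r[p] ^ (2 * e)
          + k p.1 * r[p] * deriv (chi R) (rsq p) * r[p] ^ (2 * e)
          + k p.1 * chi R (rsq p) * e * r[p] ^ (2 * e) / r[p]) * r[p] ^ 2 * angSq φ p := by
  have hn : 0 < r[p] := hR.trans hp
  obtain ⟨h0, h1, h2, h3⟩ := psiHat_facts hR hφ hp
  have hrs : rsq p = r[p] ^ 2 := rfl
  have hs : 0 < rsq p := by rw [hrs]; positivity
  unfold pCurT pCurS
  rw [divergence_cur hk (contDiff_chiPow hR _) (contDiff_chiPow hR _) contDiff_const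
    (contDiff_psiHat hR hφ)]
  simp only [mult, bulk, lagr, h0, h1, h2, h3, deriv_chiPow _ hs, chiPow, deriv_const', deriv_const,
    yDer, dv]
  have p1 : rsq p ^ (e - 1 / 2) = r[p] ^ (2 * e) / r[p] := by
    rw [hrs, rpow_sq hn, show 2 * (e - 1 / 2) = 2 * e - 1 by ring, rpow_sub_one hn.ne']
  have p2 : rsq p ^ (e - 1) = r[p] ^ (2 * e) / r[p] ^ 2 := by
    rw [rpow_sub_one hs.ne', hrs, rpow_sq hn]
  have p3 : rsq p ^ (e - 1 / 2 - 1) = r[p] ^ (2 * e) / r[p] ^ 3 := by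
    rw [rpow_sub_one hs.ne', p1, hrs]; field_simp
  have p4 : rsq p ^ e = r[p] ^ (2 * e) := by rw [hrs, rpow_sq hn]
  rw [p1, p2, p3, p4]
  generalize chi R (rsq p) = χ
  generalize deriv (chi R) (rsq p) = χ'
  rw [hrs]
  generalize r[p] ^ (2 * e) = P
  field_simp
  ring

end pcurrent

section helpers
variable {R τ τ₁ τ₂ : ℝ}

theorem sInt_le_two {f g h : Scalar} {a b : ℝ} (ha : 0 ≤ a) (hb : 0 ≤ b)
    (hg : Measurable g) (H : ∀ x, f (leaf R τ x) ≤ a * g (leaf R τ x) + b * h (leaf R τ x)) :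
    sInt R τ f ≤ ofReal a * sInt R τ g + ofReal b * sInt R τ h := by
  rw [← sInt_const_mul ha, ← sInt_const_mul hb]
  exact (sInt_mono (h' := fun p => a * g p + b * h p) H).trans (sInt_add_le (hg.const_mul a))

theorem sInt_le_const_mul {f g : Scalar} {a : ℝ} (ha : 0 ≤ a)
    (H : ∀ x, f (leaf R τ x) ≤ a * g (leaf R τ x)) :
    sInt R τ f ≤ ofReal a * sInt R τ g := by
  rw [← sInt_const_mul ha]
  exact sInt_mono (h' := fun p => a * g p) H

theorem bulkInt_mono_of_mem {f g : ℝ → ℝ≥0∞} (H : ∀ τ ∈ Icc τ₁ τ₂, f τ ≤ g τ) :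
    (∫⁻ τ in Icc τ₁ τ₂, f τ) ≤ ∫⁻ τ in Icc τ₁ τ₂, g τ :=
  lintegral_mono_ae ((ae_restrict_iff' measurableSet_Icc).2 (Filter.Eventually.of_forall H))

theorem bulkInt_le_two {f g h : Scalar} {a b : ℝ} (ha : 0 ≤ a) (hb : 0 ≤ b)
    (hg : Measurable g) (H : ∀ τ ∈ Icc τ₁ τ₂, ∀ x,
      f (leaf R τ x) ≤ a * g (leaf R τ x) + b * h (leaf R τ x)) :
    bulkInt R τ₁ τ₂ f ≤ ofReal a * bulkInt R τ₁ τ₂ g + ofReal b * bulkInt R τ₁ τ₂ h := by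
  simp only [bulkInt_eq]
  rw [← lintegral_const_mul' _ _ ofReal_ne_top, ← lintegral_const_mul' _ _ ofReal_ne_top,
    ← lintegral_add_left ((measurable_sInt hg R).const_mul _)]
  exact bulkInt_mono_of_mem fun τ hτ => sInt_le_two ha hb hg (H τ hτ)

theorem bulkInt_le_const_mul {f g : Scalar} {a : ℝ} (ha : 0 ≤ a)
    (H : ∀ τ ∈ Icc τ₁ τ₂, ∀ x, f (leaf R τ x) ≤ a * g (leaf R τ x)) :
    bulkInt R τ₁ τ₂ f ≤ ofReal a * bulkInt R τ₁ τ₂ g := by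
  simp only [bulkInt_eq]
  rw [← lintegral_const_mul' _ _ ofReal_ne_top]
  exact bulkInt_mono_of_mem fun τ hτ => sInt_le_const_mul ha (H τ hτ)

theorem exists_rpow_bound (hR : 0 < R) (e : ℝ) : ∃ C : ℝ, 0 < C ∧ ∀ r, R ≤ r → r ≤ R + 1 →
    r ^ e ≤ C := by
  refine ⟨R ^ e + (R + 1) ^ e, by positivity, fun r h1 h2 => ?_⟩
  have hr : 0 < r := hR.trans_le h1
  have p1 : 0 < R ^ e := by positivity
  have p2 : 0 < (R + 1) ^ e := by positivity
  rcases le_total 0 e with he | he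
  · have := rpow_le_rpow hr.le h2 he; linarith
  · have := rpow_le_rpow_of_nonpos hR h1 he; linarith

end helpers

section slice
variable {R τ N : ℝ}

/-- The derivative of `φ` along the leaf in the radial direction. -/
def rDer (R : ℝ) (φ : Scalar) (p : Spacetime) : ℝ := if R < r[p] then dv φ p else dr φ p

theorem rDer_sq_le {φ : Scalar} {p : Spacetime} : rDer R φ p ^ 2 ≤ eDens R φ p := by
  unfold rDer eDens
  split_ifs
  · linarith [angSq_nonneg φ p]
  · rw [gradSq_eq]; linarith [dr_sq_le (φ := φ) (p := p), sq_nonneg (pd 0 φ p)]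

/-- The divergence along the leaf of the vector field `x k(t) b(r²) φ²`. -/
def slDens (R : ℝ) (k b : ℝ → ℝ) (φ : Scalar) (p : Spacetime) : ℝ :=
  k p.1 * (3 * b (rsq p) + 2 * rsq p * deriv b (rsq p)) * φ p ^ 2
    + 2 * k p.1 * b (rsq p) * r[p] * φ p * rDer R φ p
    + if R < r[p] then r[p] * b (rsq p) * deriv k p.1 * φ p ^ 2 else 0

theorem slDens_eq (hR : 0 < R) {k b : ℝ → ℝ} (hk : Smooth k) (hb : Smooth b)
    {φ : Scalar} (hφ : Smooth φ) (p : Spacetime) :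
    ∑ i : Fin 3, (pd i.succ (fun q => q.2 i * (k q.1 * (b (rsq q) * φ q ^ 2))) p +
      outerDir R i p.2 * pd 0 (fun q => q.2 i * (k q.1 * (b (rsq q) * φ q ^ 2))) p) =
      slDens R k b φ p := by
  have e1 : ∀ i : Fin 3, pd i.succ (fun q => q.2 i * (k q.1 * (b (rsq q) * φ q ^ 2))) p =
      k p.1 * (b (rsq p) * φ p ^ 2) + p.2 i * (k p.1 * (2 * p.2 i * deriv b (rsq p) * φ p ^ 2
        + b (rsq p) * (2 * φ p * pd i.succ φ p))) := by
    intro i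
    rw [pd_mul, pd_mul, pd_mul, pd_sq, pd_succ_coord, pd_succ_time, pd_succ_radial]
    simp only [if_true]; ring
  have e0 : ∀ i : Fin 3, pd 0 (fun q => q.2 i * (k q.1 * (b (rsq q) * φ q ^ 2))) p =
      p.2 i * (deriv k p.1 * (b (rsq p) * φ p ^ 2) + k p.1 * (b (rsq p) *
        (2 * φ p * pd 0 φ p))) := by
    intro i
    rw [pd_mul, pd_mul, pd_mul, pd_sq, pd_zero_coord, pd_zero_time, pd_zero_radial]
    ring
  have hs := rsq_eq p
  have he := euler_eq (φ := φ) (p := p)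
  simp only [e1, e0]
  by_cases hp : R < r[p]
  · have hn : 0 < r[p] := hR.trans hp
    have h1 := sum_radial_sq (ne_zero_of_lt hR hp)
    have h3 := coord_eq p
    have h5 : radial p.2 0 * p.2 0 + radial p.2 1 * p.2 1 + radial p.2 2 * p.2 2 = r[p] := by
      rw [h3 0, h3 1, h3 2]
      simp only [Fin.sum_univ_three] at h1
      linear_combination r[p] * h1
    simp only [outerDir, slDens, rDer, dv, hp, if_true, Fin.sum_univ_three, euler] at *
    linear_combination (-2 * k p.1 * deriv b (rsq p) * φ p ^ 2) * hs
      + 2 * k p.1 * b (rsq p) * φ p * he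
      + (deriv k p.1 * (b (rsq p) * φ p ^ 2) + k p.1 * (b (rsq p) * (2 * φ p * pd 0 φ p))) * h5
  · simp only [outerDir, slDens, rDer, hp, if_false, Fin.sum_univ_three, euler] at *
    linear_combination (-2 * k p.1 * deriv b (rsq p) * φ p ^ 2) * hs
      + 2 * k p.1 * b (rsq p) * φ p * he

/-- Integration by parts along a leaf, as an inequality. -/
theorem slice_inequality (hR : 0 < R) {k b : ℝ → ℝ} (hk : Smooth k) (hb : Smooth b)
    (hkN : ∀ t, N ≤ t → k t = 0)
    {φ : Scalar} (hφ : Smooth φ) {G H : Scalar}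
    (hG0 : ∀ x, 0 ≤ G (leaf R τ x))
    (hG : ∀ x, G (leaf R τ x) ≤ slDens R k b φ (leaf R τ x) + H (leaf R τ x)) :
    sInt R τ G ≤ sInt R τ H := by
  set u : Fin 3 → Scalar := fun i q => q.2 i * (k q.1 * (b (rsq q) * φ q ^ 2)) with hu
  have hu1 : ∀ i, ContDiff ℝ 1 (u i) := by
    intro i
    have hr := contDiff_rsq
    have : Smooth (u i) := by simp only [hu]; fun_prop
    exact this.of_le (by simp)
  have hv : ∀ i, VanishAfter N (u i) := fun i p hp => by simp [hu, hkN _ hp]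
  have hint : ∀ i, Integrable (fun x => pd i.succ (u i) (leaf R τ x) +
      outerDir R i x * pd 0 (u i) (leaf R τ x)) := by
    intro i
    refine Integrable.add ?_ (integrable_leaf (continuous_pd_of_contDiff_one (hu1 i) 0)
      ((hv i).pd 0) (measurable_outerDir R i) (abs_outerDir_le R i))
    simpa using integrable_leaf (R := R) (τ := τ) (continuous_pd_of_contDiff_one (hu1 i) i.succ)
      ((hv i).pd i.succ) (w := fun _ => 1) measurable_const (by simp)
  have heq : ∀ x, slDens R k b φ (leaf R τ x) = ∑ i : Fin 3, (pd i.succ (u i) (leaf R τ x) +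
      outerDir R i x * pd 0 (u i) (leaf R τ x)) := fun x => (slDens_eq hR hk hb hφ _).symm
  have hI : Integrable (fun x => slDens R k b φ (leaf R τ x)) := by
    simp only [heq]
    exact integrable_finsetSum _ fun i _ => hint i
  have h0 : ∫ x, slDens R k b φ (leaf R τ x) = 0 := by
    simp only [heq]
    rw [integral_finsetSum _ fun i _ => hint i]
    exact Finset.sum_eq_zero fun i _ => integral_lineDeriv_leaf hR (hu1 i) (hv i) i
  rw [integral_eq_lintegral_pos_part_sub_lintegral_neg_part hI] at h0
  have f1 := lintegral_ofReal_ne_top hI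
  have f2 := lintegral_ofReal_ne_top hI.neg
  simp only [Pi.neg_apply] at f2
  have h1 := (ENNReal.toReal_eq_toReal_iff' f1 f2).1 (by linarith)
  have m1 : AEMeasurable (fun x => ofReal (slDens R k b φ (leaf R τ x))) :=
    hI.aestronglyMeasurable.aemeasurable.ennreal_ofReal
  have m2 : AEMeasurable (fun x => ofReal (-slDens R k b φ (leaf R τ x))) :=
    hI.aestronglyMeasurable.aemeasurable.neg.ennreal_ofReal
  refine (ENNReal.add_le_add_iff_right f2).1 ?_
  calc sInt R τ G + _ ≤ _ + sInt R τ H := by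
        unfold sInt
        rw [← lintegral_add_right' _ m2, ← lintegral_add_left' m1]
        refine lintegral_mono fun x => ?_
        have hx := hG x
        rcases le_total 0 (slDens R k b φ (leaf R τ x)) with h | h
        · rw [ofReal_of_nonpos (by linarith : -slDens R k b φ (leaf R τ x) ≤ 0), add_zero]
          exact (ofReal_le_ofReal hx).trans ofReal_add_le
        · rw [ofReal_of_nonpos h, zero_add, ← ofReal_add (hG0 x) (by linarith)]
          exact ofReal_le_ofReal (by linarith)
    _ = sInt R τ H + _ := by rw [h1, add_comm]

end slice

section onePow

/-- A smooth function equal to `(1 + s)^e` for `s ≥ 0`. -/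
def onePow (e s : ℝ) : ℝ := smoothTransition (4 * s + 2) * (1 + s) ^ e

@[fun_prop]
theorem contDiff_onePow (e : ℝ) : Smooth (onePow e) := by
  rw [contDiff_iff_contDiffAt]
  intro s
  rcases le_or_gt s (-(3 / 4)) with h | h
  · have : onePow e =ᶠ[nhds s] fun _ => 0 := by
      have h' : s < -(1 / 2) := by linarith
      filter_upwards [Iio_mem_nhds h'] with u hu
      have hu : u < -(1 / 2) := hu
      rw [onePow, smoothTransition.zero_of_nonpos (by linarith), zero_mul]
    exact contDiffAt_const.congr_of_eventuallyEq this
  · have h1 : Smooth smoothTransition := smoothTransition.contDiff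
    refine ContDiffAt.mul (ContDiff.contDiffAt (by fun_prop)) ?_
    exact ContDiffAt.rpow_const_of_ne (by fun_prop) (by linarith)

theorem onePow_eventuallyEq {e s : ℝ} (hs : 0 ≤ s) : onePow e =ᶠ[nhds s] fun s => (1 + s) ^ e := by
  have h' : -(1 / 4) < s := by linarith
  filter_upwards [Ioi_mem_nhds h'] with u hu
  have hu : -(1 / 4) < u := hu
  rw [onePow, smoothTransition.one_of_one_le (by linarith), one_mul]

theorem onePow_eq {e s : ℝ} (hs : 0 ≤ s) : onePow e s = (1 + s) ^ e :=
  (onePow_eventuallyEq hs).self_of_nhds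

theorem hasDerivAt_one_add_rpow {e s : ℝ} (hs : -1 < s) :
    HasDerivAt (fun s : ℝ => (1 + s) ^ e) (e * (1 + s) ^ (e - 1)) s := by
  have := ((hasDerivAt_id s).const_add 1).rpow_const (p := e) (Or.inl (by simp; linarith))
  simpa using this

theorem deriv_onePow {e s : ℝ} (hs : 0 ≤ s) : deriv (onePow e) s = e * (1 + s) ^ (e - 1) := by
  rw [(onePow_eventuallyEq hs).deriv_eq, (hasDerivAt_one_add_rpow (by linarith)).deriv]

theorem deriv_deriv_onePow {e s : ℝ} (hs : 0 ≤ s) :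
    deriv (deriv (onePow e)) s = e * ((e - 1) * (1 + s) ^ (e - 2)) := by
  have : deriv (onePow e) =ᶠ[nhds s] fun s => e * (1 + s) ^ (e - 1) := by
    have h' : -(1 / 4) < s := by linarith
    filter_upwards [(onePow_eventuallyEq (e := e) hs).eventually_nhds, Ioi_mem_nhds h'] with u hu h2
    have h2 : -(1 / 4) < u := h2
    rw [Filter.EventuallyEq.deriv_eq hu, (hasDerivAt_one_add_rpow (by linarith)).deriv]
  rw [this.deriv_eq, ((hasDerivAt_one_add_rpow (e := e - 1) (by linarith)).const_mul e).deriv]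
  congr 3; ring

end onePow

section hardy
variable {R τ : ℝ} {φ : Scalar}

theorem rsq_nonneg (p : Spacetime) : 0 ≤ rsq p := sq_nonneg _

/-- First step of Hardy's inequality: the inequality with a boundary term at infinity. -/
theorem hardy_cut (hR : 0 < R) (hφ : Smooth φ) {N : ℝ} (hN : 0 < N) :
    sInt R τ (fun p => 1 / 2 * (cut N p.1 * (φ p ^ 2 / (1 + rsq p)))) ≤
      sInt R τ (fun p => 2 * eDens R φ p +
        if R < r[p] then r[p] / (1 + rsq p) * -deriv (cut N) p.1 * φ p ^ 2 else 0) := by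
  refine slice_inequality hR (contDiff_cut N) (contDiff_onePow (-1)) (N := 2 * N)
    (fun t ht => cut_eq_zero hN ht) hφ (fun x => ?_) (fun x => ?_)
  · have := cut_nonneg N (leaf R τ x).1
    have := rsq_nonneg (leaf R τ x)
    positivity
  · set p := leaf R τ x
    have hs := rsq_nonneg p
    have hk := cut_nonneg N p.1
    have hk1 := cut_le_one N p.1
    have he := rDer_sq_le (R := R) (φ := φ) (p := p)
    have hr : r[p] ^ 2 = rsq p := rfl
    have hb : onePow (-1) (rsq p) = 1 / (1 + rsq p) := by
      rw [onePow_eq hs, Real.rpow_neg_one, one_div]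
    have hb' : deriv (onePow (-1)) (rsq p) = -(1 / (1 + rsq p) ^ 2) := by
      rw [deriv_onePow hs, show (-1 - 1 : ℝ) = -((2 : ℕ) : ℝ) by norm_num,
        rpow_neg (by linarith), rpow_natCast]
      ring
    have key : 1 / 2 * (φ p ^ 2 / (1 + rsq p)) ≤
        (3 * (1 / (1 + rsq p)) + 2 * rsq p * -(1 / (1 + rsq p) ^ 2)) * φ p ^ 2
          + 2 * (1 / (1 + rsq p)) * r[p] * φ p * rDer R φ p + 2 * rDer R φ p ^ 2 := by
      have h1 : 0 < 1 + rsq p := by linarith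
      rw [← sub_nonneg]
      have e : (3 * (1 / (1 + rsq p)) + 2 * rsq p * -(1 / (1 + rsq p) ^ 2)) * φ p ^ 2
          + 2 * (1 / (1 + rsq p)) * r[p] * φ p * rDer R φ p + 2 * rDer R φ p ^ 2
          - 1 / 2 * (φ p ^ 2 / (1 + rsq p)) =
          ((5 / 2 + 1 / 2 * rsq p) * φ p ^ 2 + 2 * (1 + rsq p) * r[p] * φ p * rDer R φ p
            + 2 * (1 + rsq p) ^ 2 * rDer R φ p ^ 2) / (1 + rsq p) ^ 2 := by
        field_simp; ring
      rw [e]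
      apply div_nonneg _ (by positivity)
      have h2 : 0 ≤ (r[p] * φ p + 2 * (1 + rsq p) * rDer R φ p) ^ 2 := sq_nonneg _
      nlinarith [sq_nonneg (φ p)]
    have key2 := mul_le_mul_of_nonneg_left key hk
    have h3 : cut N p.1 * (2 * rDer R φ p ^ 2) ≤ 2 * eDens R φ p := by
      calc _ ≤ 1 * (2 * rDer R φ p ^ 2) := by gcongr
        _ ≤ _ := by linarith
    simp only [slDens, hb, hb']
    split_ifs <;> linear_combination key2 + h3

theorem deriv_cut_eq_zero {N t : ℝ} (hN : 0 < N) (h : t < N) : deriv (cut N) t = 0 := by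
  have : cut N =ᶠ[nhds t] fun _ => 1 := by
    filter_upwards [Iio_mem_nhds h] with u hu
    exact cut_eq_one hN (le_of_lt hu)
  rw [this.deriv_eq]; simp

theorem slDens_neg {k b : ℝ → ℝ} (p : Spacetime) :
    slDens R k (fun s => -b s) φ p = -slDens R k b φ p := by
  simp only [slDens, deriv.fun_neg]
  split_ifs <;> ring

/-- Weighted Hardy inequality on the outgoing cone, with the boundary term at infinity. -/
theorem hardy_outer_cut (hR : 0 < R) (hφ : Smooth φ) {N q : ℝ} (hN : 0 < N) (hq : q ≤ 1 / 2) :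
    sInt R τ (fun p => if R < r[p] then
        1 / 4 * (cut N p.1 * (chi R (rsq p) * r[p] ^ (q - 2) * φ p ^ 2))
        + chi R (rsq p) * r[p] ^ (q - 2) * r[p] * -deriv (cut N) p.1 * φ p ^ 2 else 0) ≤
      sInt R τ (fun p => 4 * gDens R q φ p
        + 2 * (deriv (chi R) (rsq p) * rsq p * r[p] ^ (q - 2) * φ p ^ 2)) := by
  obtain ⟨c, -, hc⟩ := exists_bound_chi hR
  refine slice_inequality hR (contDiff_cut N) (contDiff_chiPow hR ((q - 2) / 2)).neg (N := 2 * N)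
    (fun t ht => cut_eq_zero hN ht) hφ (fun x => ?_) (fun x => ?_)
  · split_ifs
    · have := chi_nonneg R (rsq (leaf R τ x))
      have := cut_nonneg N (leaf R τ x).1
      have := deriv_cut_nonpos hN (leaf R τ x).1
      have : 0 ≤ -deriv (cut N) (leaf R τ x).1 := by linarith
      positivity
    · exact le_rfl
  · rw [slDens_neg]
    set p := leaf R τ x
    have hk := cut_nonneg N p.1
    have hk1 := cut_le_one N p.1
    have hχ := chi_nonneg R (rsq p)
    have hχ1 := chi_le_one R (rsq p)
    have hd := (hc (rsq p)).1
    have hs0 := rsq_nonneg p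
    by_cases hp : R < r[p]
    · have hn : 0 < r[p] := hR.trans hp
      have hr : rsq p = r[p] ^ 2 := rfl
      have hs : 0 < rsq p := by rw [hr]; positivity
      have hb : chiPow R ((q - 2) / 2) (rsq p) = chi R (rsq p) * r[p] ^ (q - 2) := by
        rw [chiPow, hr, rpow_sq hn]; congr 2; ring
      have hb' : rsq p * deriv (chiPow R ((q - 2) / 2)) (rsq p) =
          deriv (chi R) (rsq p) * rsq p * r[p] ^ (q - 2)
            + (q - 2) / 2 * chi R (rsq p) * r[p] ^ (q - 2) := by
        rw [deriv_chiPow _ hs, rpow_sub_one hs.ne', show rsq p ^ ((q - 2) / 2) =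
          r[p] ^ (q - 2) by rw [hr, rpow_sq hn]; congr 1; ring]
        field_simp
      have hP : 0 < r[p] ^ (q - 2) := by positivity
      simp only [slDens, gDens, hp, if_true, rDer, yDer, mul_assoc (2 : ℝ), hb', hb]
      generalize r[p] ^ (q - 2) = P at *
      generalize chi R (rsq p) = χ at *
      generalize deriv (chi R) (rsq p) = χ' at *
      generalize cut N p.1 = κ at *
      generalize deriv (cut N) p.1 = κ' at *
      rw [hr] at *
      generalize r[p] = r at *
      have e1 : 0 ≤ χ' * r ^ 2 * P * φ p ^ 2 * (1 - κ) := by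
        have : 0 ≤ 1 - κ := by linarith
        positivity
      have e2 : 0 ≤ P * (r * dv φ p + φ p) ^ 2 * (1 - κ * χ) := by
        have : κ * χ ≤ 1 := mul_le_one₀ hk1 hχ hχ1
        have : 0 ≤ 1 - κ * χ := by linarith
        positivity
      have e3 : 0 ≤ κ * χ * P * ((φ p / 2 - 2 * (r * dv φ p + φ p)) ^ 2
          + (1 / 2 - q) * φ p ^ 2) := by
        have : 0 ≤ 1 / 2 - q := by linarith
        positivity
      linear_combination 2 * e1 + 4 * e2 + e3
    · simp only [slDens, gDens, hp, if_false, chiPow_eq_zero hR (rsq_le_of_inner hp)]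
      have d1 : deriv (chiPow R ((q - 2) / 2)) (rsq p) = 0 :=
        deriv_eq_zero_of_vanish (contDiff_chiPow hR _) (fun u hu => chiPow_eq_zero hR hu)
          (rsq_le_of_inner hp)
      rw [d1]
      have : 0 ≤ deriv (chi R) (rsq p) * rsq p * r[p] ^ (q - 2) * φ p ^ 2 := by positivity
      linarith

/-- A bound for the terms with derivatives of the cutoff `chi`. -/
theorem exists_bound_deriv_chi (hR : 0 < R) (q e : ℝ) : ∃ C : ℝ, 0 < C ∧ ∀ p : Spacetime,
    deriv (chi R) (rsq p) * r[p] ^ q ≤ C * jb[p] ^ e := by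
  obtain ⟨c, hc0, hc⟩ := exists_bound_chi hR
  obtain ⟨C1, hC1, h1⟩ := exists_rpow_bound hR q
  obtain ⟨C2, hC2, h2⟩ := exists_rpow_bound (show 0 < 1 + R by linarith) (-e)
  refine ⟨c * C1 * C2, by positivity, fun p => ?_⟩
  have hr : rsq p = r[p] ^ 2 := rfl
  have hp : 0 < jb[p] ^ e := by positivity
  by_cases ha : r[p] < R
  · rw [deriv_chi_eq_zero hR (by rw [hr]; gcongr)]
    have : 0 ≤ c * C1 * C2 * jb[p] ^ e := by positivity
    linarith
  · by_cases hb : R + 1 < r[p]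
    · rw [(hc _).2.2 (by rw [hr]; gcongr)]
      have : 0 ≤ c * C1 * C2 * jb[p] ^ e := by positivity
      linarith
    · have a1 := h1 r[p] (not_lt.1 ha) (not_lt.1 hb)
      have a2 := h2 jb[p] (by linarith) (by linarith)
      have e1 : 1 ≤ C2 * jb[p] ^ e := by
        have : jb[p] ^ (-e) * jb[p] ^ e = 1 := by
          rw [← rpow_add (by positivity)]; simp
        exact this.symm.le.trans (mul_le_mul_of_nonneg_right a2 hp.le)
      have h0 := hc (rsq p)
      calc _ ≤ c * C1 := by
            have := h0.1
            exact mul_le_mul h0.2.1 a1 (by positivity) hc0.le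
        _ = c * C1 * 1 := by ring
        _ ≤ c * C1 * (C2 * jb[p] ^ e) := by gcongr
        _ = _ := by ring

theorem chi_cut_finite (hR : 0 < R) (hφ : Smooth φ) (q : ℝ) :
    sInt R τ (fun p => deriv (chi R) (rsq p) * rsq p * r[p] ^ (q - 2) * φ p ^ 2) < ⊤ := by
  obtain ⟨c, hc0, hc⟩ := exists_bound_chi hR
  obtain ⟨C, hC, h⟩ := exists_bound_deriv_chi hR q 0
  have hcont : Continuous (fun x : Space => φ (leaf R τ x) ^ 2) :=
    (hφ.continuous.comp (lipschitz_leaf R τ).continuous).pow 2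
  obtain ⟨B, hB⟩ := (isCompact_closedBall (0 : Space) (R + 1)).exists_bound_of_continuousOn
    hcont.continuousOn
  have hfin : (volume : Measure Space) (Metric.closedBall 0 (R + 1)) ≠ ⊤ :=
    measure_closedBall_lt_top.ne
  calc _ ≤ ∫⁻ x, (Metric.closedBall (0 : Space) (R + 1)).indicator
        (fun _ => ofReal (C * |B|)) x := by
        refine lintegral_mono fun x => ?_
        set p := leaf R τ x
        have hr : rsq p = r[p] ^ 2 := rfl
        have hpx : p.2 = x := rfl
        by_cases hx : x ∈ Metric.closedBall (0 : Space) (R + 1)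
        · rw [indicator_of_mem hx]
          apply ofReal_le_ofReal
          have e : deriv (chi R) (rsq p) * rsq p * r[p] ^ (q - 2) ≤ C := by
            rcases eq_or_lt_of_le (norm_nonneg p.2) with h0 | h0
            · rw [hr, ← h0]; simp [hC.le]
            · have := h p
              rw [rpow_zero, mul_one] at this
              convert this using 1
              rw [hr, mul_assoc, ← rpow_natCast, ← rpow_add h0]
              congr 2; push_cast; ring
          have h2 := hB x hx
          rw [Real.norm_of_nonneg (sq_nonneg _)] at h2
          exact mul_le_mul e (h2.trans (le_abs_self B)) (sq_nonneg _) hC.le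
        · rw [indicator_of_notMem hx]
          have : R + 1 < ‖x‖ := by simpa using hx
          have h3 : deriv (chi R) (rsq p) = 0 := (hc _).2.2 (by rw [hr, hpx]; gcongr)
          simp [h3]
    _ = _ := lintegral_indicator_const Metric.isClosed_closedBall.measurableSet _
    _ < ⊤ := ENNReal.mul_lt_top ofReal_lt_top hfin.lt_top

/-- Hardy's inequality on the leaf `Σ_τ`. -/
theorem hardy (hR : 0 < R) (hτ : 0 ≤ τ) (hφ : Smooth φ) (hE : sInt R τ (eDens R φ) ≠ ⊤)
    (hg : sInt R τ (gDens R 0 φ) ≠ ⊤) :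
    sInt R τ (fun p => φ p ^ 2 / (1 + rsq p)) ≤ 4 * sInt R τ (eDens R φ) := by
  obtain ⟨c, hc0, hc⟩ := exists_bound_cut
  set f : Scalar := fun p => φ p ^ 2 / (1 + rsq p) with hf
  have hf0 : ∀ p, 0 ≤ f p := fun p => by have := rsq_nonneg p; simp only [hf]; positivity
  have hfm : Measurable f := by
    simp only [hf]; fun_prop
  set bd : ℕ → Scalar := fun n p => if R < r[p] then
    r[p] / (1 + rsq p) * -deriv (cut ((n : ℝ) + 1)) p.1 * φ p ^ 2 else 0 with hbd
  set X := sInt R τ (fun p => 4 * gDens R 0 φ p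
        + 2 * (deriv (chi R) (rsq p) * rsq p * r[p] ^ (0 - 2 : ℝ) * φ p ^ 2)) with hX
  have hXfin : X ≠ ⊤ := by
    refine ne_top_of_le_ne_top ?_ (sInt_le_two (a := 4) (b := 2) (g := gDens R 0 φ) (h := fun p =>
      deriv (chi R) (rsq p) * rsq p * r[p] ^ (0 - 2 : ℝ) * φ p ^ 2) (by norm_num) (by norm_num)
      (measurable_gDens hφ) (fun x => le_rfl))
    exact ENNReal.add_ne_top.2 ⟨ENNReal.mul_ne_top ofReal_ne_top hg,
      ENNReal.mul_ne_top ofReal_ne_top (chi_cut_finite hR hφ 0).ne⟩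
  have hcut : ∀ n : ℕ, ofReal (1 / 2) * sInt R τ (fun p => cut ((n : ℝ) + 1) p.1 * f p) ≤
      ofReal 2 * sInt R τ (eDens R φ) + sInt R τ (bd n) := by
    intro n
    have h1 := hardy_cut (τ := τ) hR hφ (N := (n : ℝ) + 1) (by positivity)
    rw [sInt_const_mul (by norm_num)] at h1
    refine h1.trans ((sInt_add_le ((measurable_eDens hφ).const_mul 2)).trans ?_)
    rw [sInt_const_mul (by norm_num)]
  obtain ⟨n0, hn0⟩ := exists_nat_ge (τ + R + 1)
  have houter : ∀ n ≥ n0, ∀ x, (leaf R τ x).1 ≥ n + 1 → R + 1 ≤ ‖x‖ ∧ ‖x‖ ≤ (leaf R τ x).1 + R := by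
    intro n hn x hx
    have hn' : (n0 : ℝ) ≤ n := by exact_mod_cast hn
    have hl : (leaf R τ x).1 = τ + max (‖x‖ - R) 0 := rfl
    rw [hl] at hx ⊢
    rcases max_cases (‖x‖ - R) 0 with ⟨h1, h2⟩ | ⟨h1, h2⟩ <;> constructor <;> linarith
  have hb1 : ∀ n ≥ n0, sInt R τ (bd n) ≤ X := by
    intro n hn
    refine le_trans (sInt_mono fun x => ?_)
      (hardy_outer_cut (τ := τ) hR hφ (N := (n : ℝ) + 1) (q := 0) (by positivity) (by norm_num))
    set p := leaf R τ x
    simp only [hbd]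
    split_ifs with hp
    · have hk := cut_nonneg ((n : ℝ) + 1) p.1
      have hχ := chi_nonneg R (rsq p)
      have hk' := deriv_cut_nonpos (N := (n : ℝ) + 1) (by positivity) p.1
      have hn : 0 < r[p] := hR.trans hp
      have h0 : 0 ≤ 1 / 4 * (cut ((n : ℝ) + 1) p.1 *
          (chi R (rsq p) * r[p] ^ (0 - 2 : ℝ) * φ p ^ 2)) := by positivity
      refine le_trans ?_ (le_add_of_nonneg_left h0)
      rcases lt_or_ge p.1 (n + 1) with ht | ht
      · rw [deriv_cut_eq_zero (by positivity) ht]; simp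
      · have hx := (houter n ‹_› x ht).1
        have hr : rsq p = r[p] ^ 2 := rfl
        rw [chi_eq_one hR (by rw [hr]; gcongr; exact hx), one_mul]
        refine mul_le_mul_of_nonneg_right (mul_le_mul_of_nonneg_right ?_ (by linarith))
          (sq_nonneg _)
        rw [show (0 - 2 : ℝ) = -((2 : ℕ) : ℝ) by norm_num, rpow_neg hn.le,
          rpow_natCast, hr, div_le_iff₀ (by positivity)]
        field_simp
        linarith
    · exact le_rfl
  have hlim1 := sInt_cut_tendsto (R := R) hτ hfm hf0
  have hfin : sInt R τ f ≠ ⊤ := by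
    have h1 := ENNReal.Tendsto.const_mul (a := ofReal (1 / 2)) hlim1 (Or.inr ofReal_ne_top)
    have h2 : ofReal (1 / 2) * sInt R τ f ≤ ofReal 2 * sInt R τ (eDens R φ) + X :=
      le_of_tendsto h1 (Filter.eventually_atTop.2 ⟨n0, fun n hn => (hcut n).trans (by
        gcongr; exact hb1 n hn)⟩)
    intro htop
    rw [htop, ENNReal.mul_top (by simp)] at h2
    exact (ENNReal.add_ne_top.2 ⟨ENNReal.mul_ne_top ofReal_ne_top hE, hXfin⟩) (top_le_iff.1 h2)
  have hb2 : ∀ n ≥ n0, sInt R τ (bd n) ≤ ofReal (3 * c) * ∫⁻ x,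
      {x : Space | (n : ℝ) ≤ (leaf R τ x).1}.indicator (fun x => ofReal (f (leaf R τ x))) x := by
    intro n hn
    rw [← lintegral_const_mul' _ _ ofReal_ne_top]
    refine lintegral_mono fun x => ?_
    set p := leaf R τ x
    have hpx : p.2 = x := rfl
    by_cases hz : bd n p ≤ 0
    · rw [ofReal_of_nonpos hz]; exact zero_le
    have ht : ¬ p.1 < n + 1 := by
      intro ht
      apply hz
      simp only [hbd]
      rw [deriv_cut_eq_zero (by positivity) ht]
      simp
    have ht2 : ¬ 2 * ((n : ℝ) + 1) < p.1 := by
      intro ht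
      apply hz
      simp only [hbd]
      rw [((hc ((n : ℝ) + 1) p.1 (by positivity)).2 ht).1]
      simp
    have ho := houter n hn x (not_lt.1 ht)
    have hmem : x ∈ {x : Space | (n : ℝ) ≤ (leaf R τ x).1} := by
      show (n : ℝ) ≤ p.1
      linarith
    rw [indicator_of_mem hmem, ← ofReal_mul (by positivity)]
    apply ofReal_le_ofReal
    have hn' : (n0 : ℝ) ≤ n := by exact_mod_cast hn
    simp only [hbd, hf]
    rw [if_pos (by rw [hpx]; linarith [ho.1])]
    have hs := rsq_nonneg p
    have h3 := (hc ((n : ℝ) + 1) p.1 (by positivity)).1.1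
    have h4 := (neg_le_abs (deriv (cut ((n : ℝ) + 1)) p.1)).trans h3
    have h5 : r[p] * -deriv (cut ((n : ℝ) + 1)) p.1 ≤ 3 * c := by
      calc _ ≤ (3 * ((n : ℝ) + 1)) * (c / (n + 1)) := by
            refine mul_le_mul ?_ h4 ?_ (by positivity)
            · rw [hpx]; linarith [ho.2]
            · linarith [deriv_cut_nonpos (N := (n : ℝ) + 1) (by positivity) p.1]
        _ = 3 * c := by field_simp
    calc _ = r[p] * -deriv (cut ((n : ℝ) + 1)) p.1 * (φ p ^ 2 / (1 + rsq p)) := by ring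
      _ ≤ _ := by gcongr
  have hlim2 : Filter.Tendsto (fun n : ℕ => ∫⁻ x, {x : Space | (n : ℝ) ≤ (leaf R τ x).1}.indicator
      (fun x => ofReal (f (leaf R τ x))) x) Filter.atTop (nhds 0) := by
    have hm := measurable_sInt_integrand hfm R τ
    have hset : ∀ n : ℕ, MeasurableSet {x : Space | (n : ℝ) ≤ (leaf R τ x).1} := fun n =>
      measurableSet_le measurable_const (lipschitz_leaf R τ).continuous.measurable.fst
    have := tendsto_lintegral_of_dominated_convergence (μ := (volume : Measure Space))
      (f := fun _ => 0)
      (F := fun (n : ℕ) x => {x : Space | (n : ℝ) ≤ (leaf R τ x).1}.indicator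
        (fun x => ofReal (f (leaf R τ x))) x)
      (fun x => ofReal (f (leaf R τ x)))
      (fun n => hm.indicator (hset n))
      (fun n => Filter.Eventually.of_forall fun x => indicator_le_self _ _ _) hfin
      (Filter.Eventually.of_forall fun x => by
        obtain ⟨m, hm⟩ := exists_nat_gt (leaf R τ x).1
        refine tendsto_const_nhds.congr' ?_
        filter_upwards [Filter.eventually_ge_atTop m] with n hn
        have : (m : ℝ) ≤ n := by exact_mod_cast hn
        rw [indicator_of_notMem]
        show ¬ ((n : ℝ) ≤ (leaf R τ x).1)
        linarith)
    simpa using this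
  have h1 := ENNReal.Tendsto.const_mul (a := ofReal (1 / 2)) hlim1 (Or.inr ofReal_ne_top)
  have h2 := (ENNReal.Tendsto.const_mul (a := ofReal (3 * c)) hlim2
    (Or.inr ofReal_ne_top)).const_add (ofReal 2 * sInt R τ (eDens R φ))
  have h3 := le_of_tendsto_of_tendsto h1 h2 (Filter.eventually_atTop.2 ⟨n0, fun n hn =>
    (hcut n).trans (add_le_add_right (hb2 n hn) _)⟩)
  rw [mul_zero, add_zero] at h3
  calc sInt R τ f = ofReal 2 * (ofReal (1 / 2) * sInt R τ f) := by
        rw [← mul_assoc, ← ofReal_mul (by norm_num)]; norm_num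
    _ ≤ ofReal 2 * (ofReal 2 * sInt R τ (eDens R φ)) := by gcongr
    _ = _ := by rw [← mul_assoc, ← ofReal_mul (by norm_num)]; norm_num

/-- Weighted Hardy inequality on the outgoing cone. -/
theorem hardy_outer (hR : 0 < R) (hτ : 0 ≤ τ) (hφ : Smooth φ) {q : ℝ} (hq : q ≤ 1 / 2) :
    sInt R τ (fun p => if R < r[p] then chi R (rsq p) * r[p] ^ (q - 2) * φ p ^ 2 else 0) ≤
      ofReal 4 * sInt R τ (fun p => 4 * gDens R q φ p
        + 2 * (deriv (chi R) (rsq p) * rsq p * r[p] ^ (q - 2) * φ p ^ 2)) := by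
  set f : Scalar := fun p =>
    if R < r[p] then chi R (rsq p) * r[p] ^ (q - 2) * φ p ^ 2 else 0 with hf
  have hf0 : ∀ p, 0 ≤ f p := fun p => by
    have := chi_nonneg R (rsq p)
    simp only [hf]; split_ifs <;> positivity
  have hfm : Measurable f := by
    exact Measurable.ite (measurableSet_outer R) (by fun_prop) measurable_const
  refine le_of_tendsto (sInt_cut_tendsto (R := R) hτ hfm hf0) (Filter.Eventually.of_forall
    fun n => ?_)
  refine le_trans (sInt_le_const_mul (a := 4) (by norm_num) fun x => ?_) (mul_le_mul_right
    (hardy_outer_cut (τ := τ) hR hφ (N := (n : ℝ) + 1) (q := q) (by positivity) hq) _)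
  have hχ := chi_nonneg R (rsq (leaf R τ x))
  have hk' := deriv_cut_nonpos (N := (n : ℝ) + 1) (by positivity) (leaf R τ x).1
  simp only [hf]
  split_ifs
  · have : 0 ≤ chi R (rsq (leaf R τ x)) * ‖(leaf R τ x).2‖ ^ (q - 2) * ‖(leaf R τ x).2‖
        * -deriv (cut ((n : ℝ) + 1)) (leaf R τ x).1 * φ (leaf R τ x) ^ 2 := by
      have : 0 ≤ -deriv (cut ((n : ℝ) + 1)) (leaf R τ x).1 := by linarith
      positivity
    linarith
  · simp

end hardy

section pweighted
variable {R : ℝ} {φ : Scalar} {p : Spacetime}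

/-- The energy density together with a Hardy term. -/
def zDens (R : ℝ) (φ : Scalar) (p : Spacetime) : ℝ := eDens R φ p + φ p ^ 2 / (1 + rsq p)

/-- The source term in the weighted energy inequality. -/
def wDens (R β : ℝ) (φ : Scalar) (p : Spacetime) : ℝ :=
  if R < r[p] then r[p] ^ β * |yDer φ p| * |box φ p| else 0

theorem wDens_nonneg {β : ℝ} : 0 ≤ wDens R β φ p := by
  unfold wDens; split_ifs <;> positivity

theorem zDens_nonneg : 0 ≤ zDens R φ p := by
  have := eDens_nonneg (R := R) (φ := φ) (p := p)
  have := rsq_nonneg p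
  unfold zDens; positivity

@[fun_prop]
theorem contDiff_box (hφ : Smooth φ) : Smooth (box φ) := by
  have h1 := contDiff_pd (contDiff_pd hφ 0) 0
  have h2 := fun i : Fin 3 => contDiff_pd (contDiff_pd hφ i.succ) i.succ
  unfold box; fun_prop

@[fun_prop]
theorem measurable_zDens (hφ : Smooth φ) : Measurable (zDens R φ) := by
  unfold zDens; fun_prop

theorem exists_bound_one_sub_chi (hR : 0 < R) (q e : ℝ) : ∃ C : ℝ, 0 < C ∧ ∀ p : Spacetime,
    R < r[p] → (1 - chi R (rsq p)) * r[p] ^ q ≤ C * jb[p] ^ e := by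
  obtain ⟨C1, hC1, h1⟩ := exists_rpow_bound hR q
  obtain ⟨C2, hC2, h2⟩ := exists_rpow_bound (show 0 < 1 + R by linarith) (-e)
  refine ⟨C1 * C2, by positivity, fun p ha => ?_⟩
  have hr : rsq p = r[p] ^ 2 := rfl
  have hp : 0 < jb[p] ^ e := by positivity
  by_cases hb : R + 1 < r[p]
  · rw [chi_eq_one hR (by rw [hr]; gcongr)]
    have : 0 ≤ C1 * C2 * jb[p] ^ e := by positivity
    linarith
  · have a1 := h1 r[p] ha.le (not_lt.1 hb)
    have a2 := h2 jb[p] (by linarith) (by linarith)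
    have e1 : 1 ≤ C2 * jb[p] ^ e := by
      have : jb[p] ^ (-e) * jb[p] ^ e = 1 := by
        rw [← rpow_add (by positivity)]; simp
      exact this.symm.le.trans (mul_le_mul_of_nonneg_right a2 hp.le)
    have h0 := chi_nonneg R (rsq p)
    calc _ ≤ 1 * C1 := mul_le_mul (by linarith) a1 (by positivity) one_pos.le
      _ = C1 * 1 := by ring
      _ ≤ C1 * (C2 * jb[p] ^ e) := by gcongr
      _ = _ := by ring

theorem yDer_sq_add_le : yDer φ p ^ 2 + r[p] ^ 2 * angSq φ p ≤
    2 * jb[p] ^ 2 * (dv φ p ^ 2 + angSq φ p + (φ p / jb[p]) ^ 2) := by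
  have h1 := norm_nonneg p.2
  have h2 := angSq_nonneg φ p
  have e : 2 * jb[p] ^ 2 * (dv φ p ^ 2 + angSq φ p + (φ p / jb[p]) ^ 2) =
      2 * jb[p] ^ 2 * good[φ, p] + 2 * φ p ^ 2 := by field_simp
  rw [e, yDer]
  generalize r[p] = r at *
  generalize angSq φ p = a at *
  have h3 : 0 ≤ (1 + 2 * r) * dv φ p ^ 2 := by positivity
  have h4 : 0 ≤ (2 + 4 * r + r ^ 2) * a := by positivity
  nlinarith [sq_nonneg (r * dv φ p - φ p)]

theorem div_one_add_sq_le : (φ p / jb[p]) ^ 2 ≤ φ p ^ 2 / (1 + rsq p) := by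
  have h1 := norm_nonneg p.2
  have hr : rsq p = r[p] ^ 2 := rfl
  rw [div_pow, hr]
  gcongr
  nlinarith

theorem fluxDens_pCur_le {β : ℝ} (hR : 0 < R) (hφ : Smooth φ) {k : ℝ → ℝ}
    (hk : 0 ≤ k p.1) : fluxDens R (pCurT R ((β - 1) / 2) k φ) (pCurS R ((β - 1) / 2) k φ) p ≤
      k p.1 * gDens R (1 + β) φ p := by
  by_cases hp : R < r[p]
  · rw [fluxDens_pCur_outer hR hφ hp, gDens, if_pos hp, show 2 * ((β - 1) / 2) = 1 + β - 2 by ring]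
    have h1 := chi_le_one R (rsq p)
    have h0 := chi_nonneg R (rsq p)
    have hn : 0 < r[p] := hR.trans hp
    calc _ ≤ k p.1 * (1 * r[p] ^ (1 + β - 2)) * yDer φ p ^ 2 := by gcongr
      _ = _ := by ring
  · rw [fluxDens_pCur_inner hR hp, gDens, if_neg hp]; simp

theorem fluxDens_pCur_nonneg {e : ℝ} (hR : 0 < R) (hφ : Smooth φ) {k : ℝ → ℝ}
    (hk : 0 ≤ k p.1) : 0 ≤ fluxDens R (pCurT R e k φ) (pCurS R e k φ) p := by
  by_cases hp : R < r[p]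
  · rw [fluxDens_pCur_outer hR hφ hp]
    have h0 := chi_nonneg R (rsq p)
    positivity
  · rw [fluxDens_pCur_inner hR hp]

theorem exists_le_fluxDens_pCur (hR : 0 < R) (β e : ℝ) : ∃ C : ℝ, 0 < C ∧
    ∀ φ : Scalar, Smooth φ → ∀ (k : ℝ → ℝ) (p : Spacetime), 0 ≤ k p.1 →
    k p.1 * gDens R (1 + β) φ p ≤
      fluxDens R (pCurT R ((β - 1) / 2) k φ) (pCurS R ((β - 1) / 2) k φ) p
        + k p.1 * (if R < r[p] then C * jb[p] ^ e *
          (dv φ p ^ 2 + angSq φ p + (φ p / jb[p]) ^ 2) else 0) := by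
  obtain ⟨C, hC, h⟩ := exists_bound_one_sub_chi hR (β - 1) (e - 2)
  refine ⟨2 * C, by positivity, fun φ hφ k p hk => ?_⟩
  by_cases hp : R < r[p]
  · rw [fluxDens_pCur_outer hR hφ hp, gDens, if_pos hp, if_pos hp,
      show 2 * ((β - 1) / 2) = β - 1 by ring, show 1 + β - 2 = β - 1 by ring]
    have h1 := h p hp
    have h2 := yDer_sq_add_le (φ := φ) (p := p)
    have hn : 0 < r[p] := hR.trans hp
    have h3 : yDer φ p ^ 2 ≤ 2 * jb[p] ^ 2 * (dv φ p ^ 2 + angSq φ p + (φ p / jb[p]) ^ 2) := by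
      have : 0 ≤ r[p] ^ 2 * angSq φ p := by
        have := angSq_nonneg φ p
        positivity
      linarith
    have h4 : jb[p] ^ (e - 2) * jb[p] ^ 2 = jb[p] ^ e := by
      rw [← rpow_natCast, ← rpow_add (by positivity)]; congr 1; push_cast; ring
    have h5 := mul_le_mul h1 h3 (sq_nonneg _) (by positivity)
    have h6 : C * jb[p] ^ (e - 2) * (2 * jb[p] ^ 2 * (dv φ p ^ 2 + angSq φ p + (φ p / jb[p]) ^ 2)) =
        2 * C * jb[p] ^ e * (dv φ p ^ 2 + angSq φ p + (φ p / jb[p]) ^ 2) := by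
      rw [← h4]; ring
    rw [h6] at h5
    have h7 := mul_le_mul_of_nonneg_left h5 hk
    linear_combination h7
  · rw [fluxDens_pCur_inner hR hp, gDens, if_neg hp, if_neg hp]; simp

theorem exists_le_divergence_pCur (hR : 0 < R) {β : ℝ} (hβ0 : 0 ≤ β) (hβ : β ≤ 1 / 2) (e : ℝ) :
    ∃ C : ℝ, 0 < C ∧
    ∀ φ : Scalar, Smooth φ → ∀ (k : ℝ → ℝ) (p : Spacetime), Smooth k → 0 ≤ k p.1 → deriv k p.1 ≤ 0 →
    k p.1 * (1 / 4 * mDens R β φ p) ≤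
      divergence (pCurT R ((β - 1) / 2) k φ) (pCurS R ((β - 1) / 2) k φ) p + k p.1 * wDens R β φ p
        + k p.1 * (if R < r[p] then C * jb[p] ^ e *
          (dv φ p ^ 2 + angSq φ p + (φ p / jb[p]) ^ 2) else 0) := by
  obtain ⟨C, hC, h⟩ := exists_bound_one_sub_chi hR (β - 2) (e - 2)
  obtain ⟨C', hC', h'⟩ := exists_bound_deriv_chi hR (β + 2) e
  obtain ⟨c, hc0, hc⟩ := exists_bound_chi hR
  refine ⟨C + C', by positivity, fun φ hφ k p hks hk hk' => ?_⟩
  by_cases hp : R < r[p]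
  · rw [divergence_pCur_outer hR hks hφ hp, mDens, wDens, if_pos hp, if_pos hp, if_pos hp,
      show 2 * ((β - 1) / 2) = β - 1 by ring]
    have h1 := h p hp
    have h1' := h' p
    have h2 := yDer_sq_add_le (φ := φ) (p := p)
    have hn : 0 < r[p] := hR.trans hp
    have ha := angSq_nonneg φ p
    have hχ := chi_nonneg R (rsq p)
    have hχ1 := chi_le_one R (rsq p)
    have hχ' := (hc (rsq p)).1
    have h4 : jb[p] ^ (e - 2) * jb[p] ^ 2 = jb[p] ^ e := by
      rw [← rpow_natCast, ← rpow_add (by positivity)]; congr 1; push_cast; ring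
    have p1 : r[p] ^ (β - 1) = r[p] ^ (β - 2) * r[p] := by
      rw [← rpow_add_one hn.ne']; congr 1; ring
    have p2 : r[p] ^ β = r[p] ^ (β - 2) * r[p] ^ 2 := by
      rw [← rpow_natCast, ← rpow_add hn]; congr 1; push_cast; ring
    have p3 : r[p] ^ (β + 2) = r[p] ^ (β - 2) * r[p] ^ 4 := by
      rw [← rpow_natCast, ← rpow_add hn]; congr 1; push_cast; ring
    have p4 : ∀ x, x * (r[p] ^ (β - 2) * r[p]) / r[p] = x * r[p] ^ (β - 2) := by
      intro x; field_simp
    have h5 := mul_le_mul h1 h2 (by positivity) (by positivity)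
    have h6 : C * jb[p] ^ (e - 2) * (2 * jb[p] ^ 2 * (dv φ p ^ 2 + angSq φ p + (φ p / jb[p]) ^ 2)) =
        2 * C * jb[p] ^ e * (dv φ p ^ 2 + angSq φ p + (φ p / jb[p]) ^ 2) := by
      rw [← h4]; ring
    rw [h6] at h5
    have h7 : deriv (chi R) (rsq p) * r[p] ^ (β + 2) * angSq φ p ≤
        C' * jb[p] ^ e * (dv φ p ^ 2 + angSq φ p + (φ p / jb[p]) ^ 2) := by
      apply mul_le_mul h1' _ ha (by positivity)
      have := sq_nonneg (dv φ p)
      have := sq_nonneg (φ p / jb[p])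
      linarith
    have hw : -(|yDer φ p| * |box φ p|) ≤ yDer φ p * box φ p := by
      rw [← abs_mul]; exact neg_abs_le _
    rw [p3] at h7
    rw [p1, p2, p4, p4]
    have hX : 0 ≤ jb[p] ^ e * (dv φ p ^ 2 + angSq φ p + (φ p / jb[p]) ^ 2) := by
      positivity
    have hY : 0 ≤ |yDer φ p| * |box φ p| := by positivity
    have hP : 0 < r[p] ^ (β - 2) := by positivity
    rw [mul_assoc (2 * C), mul_comm (2 * C)] at h5
    rw [mul_assoc C', mul_comm C'] at h7
    rw [mul_assoc (C + C')]
    rw [mul_assoc _ (|yDer φ p|)]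
    generalize r[p] ^ (β - 2) = P at *
    generalize jb[p] ^ e * (dv φ p ^ 2 + angSq φ p + (φ p / jb[p]) ^ 2) = X at *
    generalize chi R (rsq p) = χ at *
    generalize deriv (chi R) (rsq p) = χ' at *
    generalize k p.1 = κ at *
    generalize deriv k p.1 = κ' at *
    generalize r[p] = r at *
    generalize |yDer φ p| * |box φ p| = Y at *
    generalize yDer φ p = y at *
    generalize angSq φ p = a at *
    generalize box φ p = b at *
    have g1 : 0 ≤ κ * χ * P * r ^ 2 * (y * b + Y) := by
      have : 0 ≤ y * b + Y := by linarith
      positivity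
    have g2 : 0 ≤ κ * (1 - χ) * P * r ^ 2 * Y := by
      have : 0 ≤ 1 - χ := by linarith
      positivity
    have g3 : 0 ≤ κ * χ' * P * r ^ 2 * y ^ 2 := by positivity
    have hk'' : 0 ≤ -κ' := by linarith
    have g4 : 0 ≤ -κ' * χ * P * r * y ^ 2 := by positivity
    have g5 : 0 ≤ -κ' * χ * P * r * r ^ 2 * a := by positivity
    have g6 : 0 ≤ κ * χ * P * (β / 2 + 1 / 4) * y ^ 2 := by positivity
    have g7 : 0 ≤ κ * χ * P * (1 / 4 - β / 2) * r ^ 2 * a := by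
      have : 0 ≤ 1 / 4 - β / 2 := by linarith
      positivity
    have g8 := mul_le_mul_of_nonneg_left h5 hk
    have g9 := mul_le_mul_of_nonneg_left h7 hk
    have g10 : 0 ≤ κ * C * X := by positivity
    linear_combination g1 + g2 + g3 + 1 / 2 * g4 + 1 / 2 * g5 + g6 + g7 + 1 / 4 * g8 + g9
      + 1 / 2 * g10
  · rw [divergence_pCur_inner hR hks hφ hp, mDens, wDens, if_neg hp, if_neg hp, if_neg hp]; simp

theorem outer_le_iDens (hR : 0 < R) (α : ℝ) {C : ℝ} (hC : 0 ≤ C) :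
    (if R < r[p] then C * jb[p] ^ (-(1 + α)) *
          (dv φ p ^ 2 + angSq φ p + (φ p / jb[p]) ^ 2) else 0) ≤ 2 * C * iDens α φ p := by
  split_ifs with hp
  · have h1 := dv_sq_add_le (φ := φ) (ne_zero_of_lt hR hp)
    have hn : 0 < 1 + r[p] := by have := hR.trans hp; linarith
    rw [iDens, rpow_neg hn.le]
    have : 0 < jb[p] ^ (1 + α) := by positivity
    rw [div_eq_mul_inv _ (jb[p] ^ (1 + α))]
    have h2 : dv φ p ^ 2 + angSq φ p + (φ p / jb[p]) ^ 2 ≤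
        2 * (gradSq φ p + (φ p / jb[p]) ^ 2) := by
      linarith [sq_nonneg (φ p / jb[p])]
    calc _ ≤ C * (jb[p] ^ (1 + α))⁻¹ * (2 * (gradSq φ p + (φ p / jb[p]) ^ 2)) := by
          gcongr
      _ = _ := by ring
  · have := iDens_nonneg (α := α) (φ := φ) (p := p)
    positivity

theorem outer_le_zDens {C : ℝ} (hC : 0 ≤ C) : (if R < r[p] then C * jb[p] ^ (0 : ℝ) *
          (dv φ p ^ 2 + angSq φ p + (φ p / jb[p]) ^ 2) else 0) ≤ C * zDens R φ p := by
  split_ifs with hp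
  · rw [rpow_zero, mul_one, zDens, eDens, if_pos hp]
    have := div_one_add_sq_le (φ := φ) (p := p)
    gcongr
  · have := zDens_nonneg (R := R) (φ := φ) (p := p)
    positivity

theorem bulkInt_const_mul {τ₁ τ₂ c : ℝ} (hc : 0 ≤ c) (f : Scalar) :
    bulkInt R τ₁ τ₂ (fun p => c * f p) = ofReal c * bulkInt R τ₁ τ₂ f := by
  simp only [bulkInt_eq]
  rw [← lintegral_const_mul' _ _ ofReal_ne_top]
  simp_rw [sInt_const_mul hc]

/-- The `r`-weighted energy inequality. -/
theorem p_weighted (hR : 0 < R) {β : ℝ} (hβ0 : 0 ≤ β) (hβ : β ≤ 1 / 2) (α : ℝ) :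
    ∃ C : ℝ, 0 < C ∧ ∀ φ : Scalar, Smooth φ → ∀ τ₁ τ₂, 0 ≤ τ₁ → τ₁ ≤ τ₂ →
      sInt R τ₂ (gDens R (1 + β) φ) + ofReal (1 / 4) * bulkInt R τ₁ τ₂ (mDens R β φ) ≤
        sInt R τ₁ (gDens R (1 + β) φ) + ofReal C * sInt R τ₂ (zDens R φ)
          + ofReal C * bulkInt R τ₁ τ₂ (iDens α φ) + bulkInt R τ₁ τ₂ (wDens R β φ) := by
  obtain ⟨C1, hC1, h1⟩ := exists_le_fluxDens_pCur hR β 0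
  obtain ⟨C2, hC2, h2⟩ := exists_le_divergence_pCur hR hβ0 hβ (-(1 + α))
  refine ⟨C1 + 2 * C2, by positivity, fun φ hφ τ₁ τ₂ hτ h12 => ?_⟩
  have main : ∀ n : ℕ, sInt R τ₂ (fun p => cut ((n : ℝ) + 1) p.1 * gDens R (1 + β) φ p)
      + ∫⁻ τ in Icc τ₁ τ₂, sInt R τ (fun p => cut ((n : ℝ) + 1) p.1 * (1 / 4 * mDens R β φ p)) ≤
        sInt R τ₁ (gDens R (1 + β) φ) + ofReal (C1 + 2 * C2) * sInt R τ₂ (zDens R φ)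
          + ofReal (C1 + 2 * C2) * bulkInt R τ₁ τ₂ (iDens α φ)
          + bulkInt R τ₁ τ₂ (wDens R β φ) := by
    intro n
    set N : ℝ := (n : ℝ) + 1 with hN
    have hN0 : 0 < N := by positivity
    have hk0 := cut_nonneg N
    have hk1 := cut_le_one N
    have hvan : ∀ p : Spacetime, 2 * N + 1 ≤ p.1 → cut N p.1 = 0 ∧ deriv (cut N) p.1 = 0 := by
      intro p hp
      refine ⟨cut_eq_zero hN0 (by linarith), ?_⟩
      obtain ⟨c, -, hc⟩ := exists_bound_cut
      exact ((hc N p.1 hN0).2 (by linarith)).1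
    have key := flux_inequality (R := R) (N := 2 * N + 1) (l := 0)
      (J0 := pCurT R ((β - 1) / 2) (cut N) φ) (J := pCurS R ((β - 1) / 2) (cut N) φ) hR
      ((contDiff_pCurT hR _ (contDiff_cut N) hφ).of_le (by simp))
      (fun i => (contDiff_pCurS hR _ (contDiff_cut N) hφ i).of_le (by simp))
      (fun p hp => by simp [pCurT, curT, mult, hvan p hp])
      (fun i p hp => by simp [pCurS, curS, mult, hvan p hp]) le_rfl hτ h12
      (lo := fun p => cut N p.1 * gDens R (1 + β) φ p) (lo' := fun p => C1 * zDens R φ p)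
      (up := gDens R (1 + β) φ) (G := fun p => cut N p.1 * (1 / 4 * mDens R β φ p))
      (H := fun p => wDens R β φ p + 2 * C2 * iDens α φ p)
      (fun x => mul_nonneg (hk0 _) gDens_nonneg)
      (fun x => by
        have a1 := h1 φ hφ (cut N) (leaf R τ₂ x) (hk0 _)
        have a2 := outer_le_zDens (R := R) (φ := φ) (p := leaf R τ₂ x) hC1.le
        have a3 : 0 ≤ C1 * zDens R φ (leaf R τ₂ x) := mul_nonneg hC1.le zDens_nonneg
        have a4 := mul_le_mul_of_nonneg_left a2 (hk0 (leaf R τ₂ x).1)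
        have a5 := mul_le_mul_of_nonneg_right (hk1 (leaf R τ₂ x).1) a3
        linarith)
      (fun x => (fluxDens_pCur_le hR hφ (hk0 _)).trans
        ((mul_le_mul_of_nonneg_right (hk1 _) gDens_nonneg).trans (one_mul _).le))
      (fun τ _ x => mul_nonneg (hk0 _) (mul_nonneg (by norm_num) mDens_nonneg))
      (fun τ _ x => by
        have a1 := h2 φ hφ (cut N) (leaf R τ x) (contDiff_cut N) (hk0 _) (deriv_cut_nonpos hN0 _)
        have a2 := outer_le_iDens (R := R) (φ := φ) (p := leaf R τ x) hR α hC2.le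
        have a3 : 0 ≤ 2 * C2 * iDens α φ (leaf R τ x) := mul_nonneg (by positivity) iDens_nonneg
        have a4 := mul_le_mul_of_nonneg_left a2 (hk0 (leaf R τ x).1)
        have a5 := mul_le_mul_of_nonneg_right (hk1 (leaf R τ x).1) a3
        have a6 := mul_le_mul_of_nonneg_right (hk1 (leaf R τ x).1)
          (wDens_nonneg (R := R) (β := β) (φ := φ) (p := leaf R τ x))
        linarith)
    rw [zero_mul, Real.exp_zero, ofReal_one, one_mul] at key
    refine key.trans ?_
    have b1 : sInt R τ₂ (fun p => C1 * zDens R φ p) ≤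
        ofReal (C1 + 2 * C2) * sInt R τ₂ (zDens R φ) := by
      rw [sInt_const_mul hC1.le]
      gcongr
      linarith
    have b2 : (∫⁻ τ in Icc τ₁ τ₂, sInt R τ fun p => wDens R β φ p + 2 * C2 * iDens α φ p) ≤
        ofReal (C1 + 2 * C2) * bulkInt R τ₁ τ₂ (iDens α φ) + bulkInt R τ₁ τ₂ (wDens R β φ) := by
      have := bulkInt_le_two (R := R) (τ₁ := τ₁) (τ₂ := τ₂) (a := 2 * C2) (b := 1)
        (f := fun p => wDens R β φ p + 2 * C2 * iDens α φ p) (h := wDens R β φ)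
        (by positivity) (by norm_num) (measurable_iDens (α := α) hφ) (fun τ _ x => by linarith)
      rw [ofReal_one, one_mul] at this
      refine this.trans ?_
      gcongr
      linarith
    calc _ ≤ ofReal (C1 + 2 * C2) * sInt R τ₂ (zDens R φ)
          + sInt R τ₁ (gDens R (1 + β) φ)
          + (ofReal (C1 + 2 * C2) * bulkInt R τ₁ τ₂ (iDens α φ)
          + bulkInt R τ₁ τ₂ (wDens R β φ)) := add_le_add (add_le_add b1 le_rfl) b2
      _ = _ := by ring
  have l1 := sInt_cut_tendsto (R := R) (hτ.trans h12) (measurable_gDens (R := R) (q := 1 + β) hφ)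
    (fun p => gDens_nonneg)
  have l2 := bulk_cut_tendsto (R := R) (τ₂ := τ₂) hτ
    ((measurable_mDens (R := R) (q := β) hφ).const_mul (1 / 4))
    (fun p => mul_nonneg (by norm_num) mDens_nonneg)
  have l3 := le_of_tendsto (l1.add l2) (Filter.Eventually.of_forall main)
  rw [← bulkInt_const_mul (by norm_num)]
  exact l3

end pweighted

section iled
variable {R α : ℝ} {φ : Scalar} {p : Spacetime}

/-- The coefficient `q(r²)` of the multiplier `q x·∇φ + q φ`. -/
def mor (α s : ℝ) : ℝ := 2 * onePow (-(1 / 2)) s - onePow (-((1 + α) / 2)) s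

@[fun_prop]
theorem contDiff_mor (α : ℝ) : Smooth (mor α) := by
  unfold mor; fun_prop

theorem deriv_mor (α : ℝ) : deriv (mor α) = fun s =>
    2 * deriv (onePow (-(1 / 2))) s - deriv (onePow (-((1 + α) / 2))) s := by
  funext s
  unfold mor
  rw [deriv_fun_sub (by fun_prop) (by fun_prop), deriv_const_mul _ (by fun_prop)]

theorem deriv_deriv_mor (α s : ℝ) : deriv (deriv (mor α)) s =
    2 * deriv (deriv (onePow (-(1 / 2)))) s - deriv (deriv (onePow (-((1 + α) / 2)))) s := by
  rw [deriv_mor, deriv_fun_sub (by fun_prop) (by fun_prop), deriv_const_mul _ (by fun_prop)]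

theorem mor_facts (h0 : 0 < α) (h1 : α ≤ 1 / 4) {s : ℝ} (hs : 0 ≤ s) :
    0 ≤ mor α s ∧ mor α s ^ 2 * (1 + s) ≤ 4 ∧ deriv (mor α) s ≤ 0 ∧
    -deriv (mor α) s * (s + 1) ≤ (1 + s) ^ (-(1 / 2) : ℝ) ∧
    α * (1 + s) ^ (-((1 + α) / 2)) ≤ mor α s + 2 * s * deriv (mor α) s ∧
    α * (1 + s) ^ (-((3 + α) / 2)) ≤ -(6 * deriv (mor α) s + 4 * s * deriv (deriv (mor α)) s) := by
  have hu : 1 ≤ 1 + s := by linarith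
  have hu0 : 0 < 1 + s := by linarith
  have hz : 1 ≤ (1 + s) ^ (α / 2) := one_le_rpow hu (by linarith)
  have hW : 0 < (1 + s) ^ (-((5 + α) / 2)) := by positivity
  have c1 : (1 + s) ^ (-(1 / 2) : ℝ) = (1 + s) ^ (-((5 + α) / 2)) * (1 + s) ^ (α / 2) * (1 + s) ^ 2 := by
    rw [← rpow_natCast, ← rpow_add hu0, ← rpow_add hu0]; congr 1; push_cast; ring
  have c2 : (1 + s) ^ (-(1 / 2) - 1 : ℝ) = (1 + s) ^ (-((5 + α) / 2)) * (1 + s) ^ (α / 2) * (1 + s) := by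
    rw [← rpow_add hu0, ← rpow_add_one hu0.ne']; congr 1; ring
  have c3 : (1 + s) ^ (-(1 / 2) - 2 : ℝ) = (1 + s) ^ (-((5 + α) / 2)) * (1 + s) ^ (α / 2) := by
    rw [← rpow_add hu0]; congr 1; ring
  have c4 : (1 + s) ^ (-((1 + α) / 2)) = (1 + s) ^ (-((5 + α) / 2)) * (1 + s) ^ 2 := by
    rw [← rpow_natCast, ← rpow_add hu0]; congr 1; push_cast; ring
  have c5 : (1 + s) ^ (-((1 + α) / 2) - 1) = (1 + s) ^ (-((5 + α) / 2)) * (1 + s) := by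
    rw [← rpow_add_one hu0.ne']; congr 1; ring
  have c6 : (1 + s) ^ (-((1 + α) / 2) - 2) = (1 + s) ^ (-((5 + α) / 2)) := by
    congr 1; ring
  have c7 : (1 + s) ^ (-((3 + α) / 2)) = (1 + s) ^ (-((5 + α) / 2)) * (1 + s) := by
    rw [← rpow_add_one hu0.ne']; congr 1; ring
  have c8 : ((1 + s) ^ (-(1 / 2) : ℝ)) ^ 2 * (1 + s) = 1 := by
    rw [← rpow_natCast, ← Real.rpow_mul hu0.le, ← rpow_add_one hu0.ne']
    norm_num
  have d0 : 0 ≤ mor α s ∧ mor α s ≤ 2 * (1 + s) ^ (-(1 / 2) : ℝ) := by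
    rw [mor, onePow_eq hs, onePow_eq hs, c1, c4]
    generalize (1 + s) ^ (-((5 + α) / 2)) = W at *
    generalize (1 + s) ^ (α / 2) = z at *
    constructor
    · have : 0 ≤ W * (1 + s) ^ 2 * (2 * z - 1) := by
        have : 0 ≤ 2 * z - 1 := by linarith
        positivity
      linarith
    · have : 0 ≤ W * (1 + s) ^ 2 := by positivity
      linarith
  refine ⟨d0.1, ?_, ?_, ?_, ?_, ?_⟩
  · have : mor α s ^ 2 ≤ (2 * (1 + s) ^ (-(1 / 2) : ℝ)) ^ 2 := pow_le_pow_left₀ d0.1 d0.2 2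
    calc _ ≤ (2 * (1 + s) ^ (-(1 / 2) : ℝ)) ^ 2 * (1 + s) := by gcongr
      _ = 4 * (((1 + s) ^ (-(1 / 2) : ℝ)) ^ 2 * (1 + s)) := by ring
      _ ≤ 4 := by rw [c8]; norm_num
  all_goals
    try rw [deriv_deriv_mor]
    simp only [deriv_mor, deriv_onePow hs, deriv_deriv_onePow hs, mor, onePow_eq hs]
    simp only [c1, c2, c3, c4, c5, c6, c7]
    generalize (1 + s) ^ (-((5 + α) / 2)) = W at *
    generalize (1 + s) ^ (α / 2) = z at *
  · have : 0 ≤ W * (1 + s) * (z - (1 + α) / 2) := by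
      have : 0 ≤ z - (1 + α) / 2 := by linarith
      positivity
    linarith
  · have : 0 ≤ W * (1 + s) ^ 2 * ((1 + α) / 2) := by positivity
    linarith
  · have : 0 ≤ W * (1 + s) * (2 * z - 1 - α) := by
      have : 0 ≤ 2 * z - 1 - α := by linarith
      positivity
    linarith
  · have : 0 ≤ W * (6 * z - (1 + α) * (3 + α) + α ^ 2 * (1 + s)) := by
      have : 0 ≤ 6 * z - (1 + α) * (3 + α) := by nlinarith
      positivity
    linarith

theorem euler_sq_le : euler φ p ^ 2 ≤ rsq p * spaceSq φ p := by
  rw [euler_eq, mul_pow]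
  exact mul_le_mul_of_nonneg_left dr_sq_le (sq_nonneg _)

theorem bulk_mor_ge (h0 : 0 < α) (h1 : α ≤ 1 / 4) {k : ℝ → ℝ} (hk : 0 ≤ k p.1)
    (hk' : deriv k p.1 ≤ 0) :
    k p.1 * (α / 2 * iDens α φ p) ≤ bulk k (fun _ => 14) (mor α) (mor α) φ p
      + φ p ^ 2 * |deriv (deriv k) p.1| * mor α (rsq p) := by
  have hs := rsq_nonneg p
  obtain ⟨f1, f2, f3, -, f4, f5⟩ := mor_facts h0 h1 hs
  have he := euler_sq_le (φ := φ) (p := p)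
  have hn := norm_nonneg p.2
  have hr : rsq p = r[p] ^ 2 := rfl
  have hsp : 0 ≤ spaceSq φ p := Finset.sum_nonneg fun _ _ => sq_nonneg _
  have hi : iDens α φ p ≤ (1 + rsq p) ^ (-((1 + α) / 2)) * gradSq φ p
      + (1 + rsq p) ^ (-((3 + α) / 2)) * φ p ^ 2 := by
    have hle : 1 + rsq p ≤ jb[p] ^ 2 := by rw [hr]; nlinarith
    have e1 : ∀ c : ℝ, 0 ≤ c → jb[p] ^ (-(2 * c)) ≤ (1 + rsq p) ^ (-c) := by
      intro c hc
      have : jb[p] ^ (-(2 * c)) = (jb[p] ^ 2) ^ (-c) := by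
        rw [rpow_sq (by positivity)]; congr 1; ring
      rw [this]
      exact rpow_le_rpow_of_nonpos (by linarith) hle (by linarith)
    have e2 := e1 ((1 + α) / 2) (by linarith)
    have e3 := e1 ((3 + α) / 2) (by linarith)
    have e4 : iDens α φ p = jb[p] ^ (-(2 * ((1 + α) / 2))) * gradSq φ p
        + jb[p] ^ (-(2 * ((3 + α) / 2))) * φ p ^ 2 := by
      have hp : 0 < 1 + r[p] := by linarith
      rw [iDens, show -(2 * ((1 + α) / 2)) = -(1 + α) by ring,
        show -(2 * ((3 + α) / 2)) = -(1 + α) - (2 : ℕ) by push_cast; ring, Real.rpow_sub_natCast hp.ne',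
        rpow_neg hp.le]
      field_simp
    rw [e4]
    have := gradSq_nonneg φ p
    gcongr
  refine (mul_le_mul_of_nonneg_left (mul_le_mul_of_nonneg_left hi (by linarith)) hk).trans ?_
  have hkk : -|deriv (deriv k) p.1| ≤ deriv (deriv k) p.1 := neg_abs_le _
  have hK : 0 ≤ |deriv (deriv k) p.1| := abs_nonneg _
  rw [gradSq_eq, bulk, lagr, deriv_const]
  simp only [mul_assoc (4 : ℝ)] at f5 ⊢
  generalize (1 + rsq p) ^ (-((1 + α) / 2)) = X at *
  generalize (1 + rsq p) ^ (-((3 + α) / 2)) = Y at *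
  generalize deriv (deriv k) p.1 = κ'' at *
  generalize |κ''| = K at *
  generalize k p.1 = κ at *
  generalize deriv k p.1 = κ' at *
  generalize rsq p * deriv (deriv (mor α)) (rsq p) = sq'' at *
  generalize mor α (rsq p) = q at *
  generalize deriv (mor α) (rsq p) = q' at *
  generalize rsq p = s at *
  generalize euler φ p = D at *
  generalize spaceSq φ p = S at *
  generalize pd 0 φ p = T at *
  have g1 := mul_le_mul_of_nonneg_left f4 (show 0 ≤ κ * (T ^ 2 + S) by positivity)
  have g2 := mul_le_mul_of_nonneg_left f5 (show 0 ≤ κ * φ p ^ 2 by positivity)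
  have hq' : 0 ≤ -q' := by linarith
  have hκ' : 0 ≤ -κ' := by linarith
  have g3 := mul_le_mul_of_nonneg_left he (show 0 ≤ κ * (-q') by positivity)
  have g4 : 0 ≤ -κ' * (6 * (T ^ 2 + S)) := by positivity
  have g5 : 0 ≤ -κ' * (T ^ 2 + S + q * D * T) := by
    apply mul_nonneg hκ'
    have a1 : q ^ 2 * D ^ 2 ≤ 4 * S := by
      calc _ ≤ q ^ 2 * (s * S) := by gcongr
        _ = (q ^ 2 * s) * S := by ring
        _ ≤ 4 * S := by
          gcongr
          have : 0 ≤ q ^ 2 := sq_nonneg _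
          linarith
    nlinarith [sq_nonneg (T + q * D / 2)]
  have g6 : 0 ≤ φ p ^ 2 * q * (K + κ'') := by
    have : 0 ≤ K + κ'' := by linarith
    positivity
  have g7 : 0 ≤ φ p ^ 2 * q * K := by positivity
  linear_combination 1 / 2 * g1 + 1 / 2 * g2 + 2 * g3 + g4 + g5 + 1 / 2 * g6 + 1 / 2 * g7

theorem mor_phi_sq_le (h0 : 0 < α) (h1 : α ≤ 1 / 4) :
    mor α (rsq p) ^ 2 * φ p ^ 2 ≤ 4 * (φ p ^ 2 / (1 + rsq p)) := by
  have hs := rsq_nonneg p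
  have h2 := (mor_facts h0 h1 hs).2.1
  have : 0 < 1 + rsq p := by linarith
  rw [← mul_div_assoc, le_div_iff₀ this]
  nlinarith [sq_nonneg (φ p)]

theorem mor_euler_sq_le (h0 : 0 < α) (h1 : α ≤ 1 / 4) :
    (mor α (rsq p) * euler φ p) ^ 2 ≤ 4 * spaceSq φ p := by
  have hs := rsq_nonneg p
  have h2 := (mor_facts h0 h1 hs).2.1
  have he := euler_sq_le (φ := φ) (p := p)
  have hsp : 0 ≤ spaceSq φ p := Finset.sum_nonneg fun _ _ => sq_nonneg _
  calc _ = mor α (rsq p) ^ 2 * euler φ p ^ 2 := by ring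
    _ ≤ mor α (rsq p) ^ 2 * (rsq p * spaceSq φ p) := by gcongr
    _ = (mor α (rsq p) ^ 2 * rsq p) * spaceSq φ p := by ring
    _ ≤ _ := by
      gcongr
      have : 0 ≤ mor α (rsq p) ^ 2 := sq_nonneg _
      linarith

theorem sq_div_le_iDens : φ p ^ 2 / (1 + rsq p) ≤ 2 * (φ p / jb[p]) ^ 2 := by
  have hr : rsq p = r[p] ^ 2 := rfl
  have hn := norm_nonneg p.2
  rw [div_pow, ← mul_div_assoc, div_le_div_iff₀ (by rw [hr]; positivity) (by positivity), hr]
  have : jb[p] ^ 2 ≤ 2 * (1 + r[p] ^ 2) := by nlinarith [sq_nonneg (1 - r[p])]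
  nlinarith [sq_nonneg (φ p)]

theorem mult_mor_box_le (h0 : 0 < α) (h1 : α ≤ 1 / 4) {k : ℝ → ℝ} (hk : 0 ≤ k p.1) :
    -(mult k (fun _ => 14) (mor α) (mor α) φ p * box φ p) ≤
      k p.1 * (α / 4 * iDens α φ p + 600 / α * (box φ p ^ 2 * jb[p] ^ (1 + α))) := by
  have a1 := mor_phi_sq_le (φ := φ) (p := p) h0 h1
  have a2 := mor_euler_sq_le (φ := φ) (p := p) h0 h1
  have a3 := sq_div_le_iDens (φ := φ) (p := p)
  have hn : 0 < 1 + r[p] := by positivity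
  have hw : 0 < jb[p] ^ (1 + α) := by positivity
  have hsp : 0 ≤ spaceSq φ p := Finset.sum_nonneg fun _ _ => sq_nonneg _
  have hM : (14 * pd 0 φ p + mor α (rsq p) * euler φ p + mor α (rsq p) * φ p) ^ 2 ≤
      600 * (gradSq φ p + (φ p / jb[p]) ^ 2) := by
    rw [gradSq_eq]
    generalize mor α (rsq p) * euler φ p = D at *
    rw [← mul_pow] at a1
    generalize mor α (rsq p) * φ p = f at *
    generalize φ p / jb[p] = f' at *
    nlinarith [sq_nonneg (14 * pd 0 φ p - D), sq_nonneg (14 * pd 0 φ p - f), sq_nonneg (D - f)]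
  have hi : gradSq φ p + (φ p / jb[p]) ^ 2 = iDens α φ p * jb[p] ^ (1 + α) := by
    rw [iDens]; field_simp
  rw [hi] at hM
  rw [mult, mul_assoc, ← mul_neg]
  apply mul_le_mul_of_nonneg_left _ hk
  generalize 14 * pd 0 φ p + mor α (rsq p) * euler φ p + mor α (rsq p) * φ p = M at *
  generalize jb[p] ^ (1 + α) = w at *
  generalize iDens α φ p = i at *
  generalize box φ p = b at *
  have key : 0 ≤ (α / 2400 / w) * (M + 1200 * w / α * b) ^ 2 := by positivity
  have e : (α / 2400 / w) * (M + 1200 * w / α * b) ^ 2 =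
      α / 2400 * (M ^ 2 / w) + M * b + 600 / α * (b ^ 2 * w) := by
    field_simp; ring
  rw [e] at key
  have h2 : M ^ 2 / w ≤ 600 * i := by rw [div_le_iff₀ hw]; linarith
  have h3 := mul_le_mul_of_nonneg_left h2 (show 0 ≤ α / 2400 by positivity)
  linarith

theorem le_fluxDens_mor (hR : 0 < R) (h0 : 0 < α) (h1 : α ≤ 1 / 4) {k : ℝ → ℝ} (hk : 0 ≤ k p.1)
    (hk1 : k p.1 ≤ 1) (hk' : deriv k p.1 ≤ 0) :
    k p.1 * (4 * eDens R φ p) ≤ fluxDens R (curT k (fun _ => 14) (mor α) (mor α) φ)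
      (curS k (fun _ => 14) (mor α) (mor α) φ) p + 1 / 2 * (φ p ^ 2 / (1 + rsq p)) := by
  have hs := rsq_nonneg p
  have a1 := mor_phi_sq_le (φ := φ) (p := p) h0 h1
  have a2 := mor_euler_sq_le (φ := φ) (p := p) h0 h1
  obtain ⟨f1, f2, f3, -, -, -⟩ := mor_facts h0 h1 hs
  have hsp : 0 ≤ spaceSq φ p := Finset.sum_nonneg fun _ _ => sq_nonneg _
  have hf : 0 ≤ φ p ^ 2 / (1 + rsq p) := by positivity
  have hk'' : 0 ≤ -deriv k p.1 := by linarith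
  have g1 : 0 ≤ (1 - k p.1) * (φ p ^ 2 / (1 + rsq p)) := mul_nonneg (by linarith) hf
  have g2 : 0 ≤ -deriv k p.1 * mor α (rsq p) * φ p ^ 2 := by positivity
  by_cases hp : R < r[p]
  · rw [fluxDens_cur_outer hR _ _ _ _ hp, eDens, if_pos hp, mult, lagr,
      spaceSq_eq (ne_zero_of_lt hR hp), euler_eq]
    have ha := angSq_nonneg φ p
    have hn := norm_nonneg p.2
    have hrq : r[p] * mor α (rsq p) ≤ 2 := by
      have : (r[p] * mor α (rsq p)) ^ 2 ≤ 2 ^ 2 := by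
        have hr : rsq p = r[p] ^ 2 := rfl
        rw [mul_pow, ← hr]
        have : 0 ≤ mor α (rsq p) ^ 2 := sq_nonneg _
        nlinarith
      exact le_of_sq_le_sq this (by norm_num)
    have hrq0 : 0 ≤ r[p] * mor α (rsq p) := by positivity
    have g3 : 0 ≤ k p.1 * (-(r[p] * deriv (mor α) (rsq p)) * φ p ^ 2) := by
      have : 0 ≤ -(r[p] * deriv (mor α) (rsq p)) := by nlinarith
      positivity
    have hX : 0 ≤ 7 * good[φ, p]
        + 1 / 2 * (r[p] * mor α (rsq p)) * (dv φ p ^ 2 - angSq φ p)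
        + mor α (rsq p) * φ p * dv φ p - 4 * good[φ, p]
        + 1 / 2 * (φ p ^ 2 / (1 + rsq p)) := by
      rw [← mul_pow] at a1
      generalize mor α (rsq p) * φ p = f at *
      generalize r[p] * mor α (rsq p) = m at *
      generalize dv φ p = L at *
      nlinarith [sq_nonneg (f + 4 * L), mul_nonneg hrq0 (sq_nonneg L),
        mul_nonneg (sub_nonneg.2 hrq) ha]
    have g4 := mul_nonneg hk hX
    rw [dv] at *
    linear_combination g4 + 1 / 2 * g1 + 1 / 2 * g2 + g3
  · rw [fluxDens_inner hp, curT, eDens, if_neg hp, mult, lagr, gradSq_eq]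
    have hX : 0 ≤ 7 * (pd 0 φ p ^ 2 + spaceSq φ p)
        + pd 0 φ p * (mor α (rsq p) * euler φ p) + pd 0 φ p * (mor α (rsq p) * φ p)
        - 4 * (pd 0 φ p ^ 2 + spaceSq φ p) + 1 / 2 * (φ p ^ 2 / (1 + rsq p)) := by
      rw [← mul_pow] at a1
      generalize mor α (rsq p) * φ p = f at *
      generalize mor α (rsq p) * euler φ p = D at *
      generalize pd 0 φ p = T at *
      nlinarith [sq_nonneg (f + 4 * T), sq_nonneg (T + D / 2)]
    have g4 := mul_nonneg hk hX
    linear_combination g4 + 1 / 2 * g1 + 1 / 2 * g2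

theorem fluxDens_mor_le (hR : 0 < R) (h0 : 0 < α) (h1 : α ≤ 1 / 4) {k : ℝ → ℝ} (hk : 0 ≤ k p.1)
    (hk1 : k p.1 ≤ 1) {K : ℝ} (hK0 : 0 ≤ K) (hK : -deriv k p.1 * mor α (rsq p) * φ p ^ 2 ≤
      K * (φ p ^ 2 / (1 + rsq p))) :
    fluxDens R (curT k (fun _ => 14) (mor α) (mor α) φ)
      (curS k (fun _ => 14) (mor α) (mor α) φ) p ≤ (K + 11) * zDens R φ p := by
  have hs := rsq_nonneg p
  have a1 := mor_phi_sq_le (φ := φ) (p := p) h0 h1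
  have a2 := mor_euler_sq_le (φ := φ) (p := p) h0 h1
  obtain ⟨f1, f2, f3, f4, -, -⟩ := mor_facts h0 h1 hs
  have hsp : 0 ≤ spaceSq φ p := Finset.sum_nonneg fun _ _ => sq_nonneg _
  have hf : 0 ≤ φ p ^ 2 / (1 + rsq p) := by positivity
  have hz : 0 ≤ K * eDens R φ p := mul_nonneg hK0 eDens_nonneg
  have hkf : k p.1 * (φ p ^ 2 / (1 + rsq p)) ≤ φ p ^ 2 / (1 + rsq p) := by
    calc _ ≤ 1 * (φ p ^ 2 / (1 + rsq p)) := by gcongr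
      _ = _ := one_mul _
  have hke : k p.1 * eDens R φ p ≤ eDens R φ p := by
    have := eDens_nonneg (R := R) (φ := φ) (p := p)
    calc _ ≤ 1 * eDens R φ p := by gcongr
      _ = _ := one_mul _
  have he0 := eDens_nonneg (R := R) (φ := φ) (p := p)
  have hKf : 0 ≤ K * (φ p ^ 2 / (1 + rsq p)) := by positivity
  by_cases hp : R < r[p]
  · have hrq : r[p] * mor α (rsq p) ≤ 2 := by
      have : (r[p] * mor α (rsq p)) ^ 2 ≤ 2 ^ 2 := by
        have hr : rsq p = r[p] ^ 2 := rfl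
        rw [mul_pow, ← hr]
        have : 0 ≤ mor α (rsq p) ^ 2 := sq_nonneg _
        nlinarith
      exact le_of_sq_le_sq this (by norm_num)
    have hrq0 : 0 ≤ r[p] * mor α (rsq p) := by positivity
    have ha := angSq_nonneg φ p
    have hE : eDens R φ p = dv φ p ^ 2 + angSq φ p := if_pos hp
    have g3 : -(r[p] * deriv (mor α) (rsq p)) * φ p ^ 2 ≤ φ p ^ 2 / (1 + rsq p) := by
      have hr : rsq p = r[p] ^ 2 := rfl
      have hu : 0 < 1 + rsq p := by linarith
      have h5 : r[p] ≤ (1 + rsq p) ^ (1 / 2 : ℝ) := by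
        rw [← Real.sqrt_eq_rpow]
        apply Real.le_sqrt_of_sq_le
        rw [hr]; linarith
      have h6 : (1 + rsq p) ^ (1 / 2 : ℝ) * (1 + rsq p) ^ (-(1 / 2) : ℝ) = 1 := by
        rw [← rpow_add hu]; norm_num
      have h7 : -(r[p] * deriv (mor α) (rsq p)) * (1 + rsq p) ≤ 1 := by
        calc _ = r[p] * (-deriv (mor α) (rsq p) * (rsq p + 1)) := by ring
          _ ≤ (1 + rsq p) ^ (1 / 2 : ℝ) * (1 + rsq p) ^ (-(1 / 2) : ℝ) := by
            apply mul_le_mul h5 f4 _ (by positivity)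
            exact mul_nonneg (by linarith) (by linarith)
          _ = 1 := h6
      rw [le_div_iff₀ hu]
      nlinarith [sq_nonneg (φ p)]
    have g3' := mul_le_mul_of_nonneg_left g3 hk
    have hX : 7 * good[φ, p]
        + 1 / 2 * (r[p] * mor α (rsq p)) * (dv φ p ^ 2 - angSq φ p)
        + mor α (rsq p) * φ p * dv φ p ≤ 9 * eDens R φ p + φ p ^ 2 / (1 + rsq p) := by
      rw [← mul_pow] at a1
      rw [hE]
      generalize mor α (rsq p) * φ p = f at *
      generalize r[p] * mor α (rsq p) = m at *
      generalize dv φ p = L at *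
      nlinarith [sq_nonneg (f - 2 * L), mul_nonneg hrq0 ha,
        mul_nonneg (sub_nonneg.2 hrq) (sq_nonneg L)]
    have g4 := mul_le_mul_of_nonneg_left hX hk
    rw [fluxDens_cur_outer hR _ _ _ _ hp, zDens, mult, lagr,
      spaceSq_eq (ne_zero_of_lt hR hp), euler_eq]
    rw [dv] at *
    linear_combination g4 + 1 / 2 * hK + g3' + 2 * hkf + 9 * hke + hz + 2 * he0 + 9 * hf
      + 1 / 2 * hKf
  · have hE : eDens R φ p = gradSq φ p := if_neg hp
    have hX : 7 * (pd 0 φ p ^ 2 + spaceSq φ p)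
        + pd 0 φ p * (mor α (rsq p) * euler φ p) + pd 0 φ p * (mor α (rsq p) * φ p)
        ≤ 9 * eDens R φ p + φ p ^ 2 / (1 + rsq p) := by
      rw [hE, gradSq_eq]
      rw [← mul_pow] at a1
      generalize mor α (rsq p) * φ p = f at *
      generalize mor α (rsq p) * euler φ p = D at *
      generalize pd 0 φ p = T at *
      nlinarith [sq_nonneg (f - 2 * T), sq_nonneg (T - D / 2)]
    have g4 := mul_le_mul_of_nonneg_left hX hk
    rw [fluxDens_inner hp, curT, zDens, mult, lagr]
    linear_combination g4 + 1 / 2 * hK + hkf + 9 * hke + hz + 2 * he0 + 10 * hf + 1 / 2 * hKf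

/-- On the leaves, derivatives of the time cutoff gain a factor `1 / r`. -/
theorem exists_cut_mor_bound (hR : 0 < R) : ∃ K : ℝ, 0 < K ∧ ∀ α : ℝ, 0 < α → α ≤ 1 / 4 →
    ∀ (φ : Scalar) (N : ℝ) (p : Spacetime), 1 ≤ N → r[p] ≤ p.1 + R →
    -deriv (cut N) p.1 * mor α (rsq p) * φ p ^ 2 ≤ K * (φ p ^ 2 / (1 + rsq p)) ∧
    φ p ^ 2 * |deriv (deriv (cut N)) p.1| * mor α (rsq p) ≤ K / N * (φ p ^ 2 / (1 + rsq p)) := by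
  obtain ⟨c, hc0, hc⟩ := exists_bound_cut
  refine ⟨2 * c * (3 + R), by positivity, fun α h0 h1 φ N p hN ht => ?_⟩
  have hs := rsq_nonneg p
  have hN0 : 0 < N := by linarith
  obtain ⟨⟨b1, b2⟩, b3⟩ := hc N p.1 hN0
  have hf : 0 ≤ φ p ^ 2 / (1 + rsq p) := by positivity
  obtain ⟨f1, f2, -⟩ := mor_facts h0 h1 hs
  by_cases hp : 2 * N < p.1
  · rw [(b3 hp).1, (b3 hp).2]
    constructor
    · have : 0 ≤ 2 * c * (3 + R) * (φ p ^ 2 / (1 + rsq p)) := by positivity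
      simpa using this
    · have : 0 ≤ 2 * c * (3 + R) / N * (φ p ^ 2 / (1 + rsq p)) := by positivity
      simpa using this
  have hu : 0 < 1 + rsq p := by linarith
  have hr : rsq p = r[p] ^ 2 := rfl
  have hn := norm_nonneg p.2
  have hm : mor α (rsq p) * (1 + rsq p) ≤ 2 * (3 + R) * N := by
    have h4 : 1 + rsq p ≤ ((3 + R) * N) ^ 2 := by
      have : 1 + r[p] ≤ (3 + R) * N := by nlinarith
      calc 1 + rsq p ≤ jb[p] ^ 2 := by rw [hr]; nlinarith
        _ ≤ _ := by gcongr
    have : (mor α (rsq p) * (1 + rsq p)) ^ 2 ≤ (2 * (3 + R) * N) ^ 2 := by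
      calc _ = mor α (rsq p) ^ 2 * (1 + rsq p) * (1 + rsq p) := by ring
        _ ≤ 4 * ((3 + R) * N) ^ 2 := by gcongr
        _ = _ := by ring
    exact le_of_sq_le_sq this (by positivity)
  have e : mor α (rsq p) * φ p ^ 2 = mor α (rsq p) * (1 + rsq p) * (φ p ^ 2 / (1 + rsq p)) := by
    field_simp
  constructor
  · calc _ = -deriv (cut N) p.1 * (mor α (rsq p) * (1 + rsq p) * (φ p ^ 2 / (1 + rsq p))) := by
          rw [← e]; ring
      _ ≤ c / N * (2 * (3 + R) * N * (φ p ^ 2 / (1 + rsq p))) := by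
          gcongr
          exact (neg_le_abs _).trans b1
      _ = _ := by field_simp
  · calc _ = |deriv (deriv (cut N)) p.1| * (mor α (rsq p) * (1 + rsq p) *
          (φ p ^ 2 / (1 + rsq p))) := by rw [← e]; ring
      _ ≤ c / N ^ 2 * (2 * (3 + R) * N * (φ p ^ 2 / (1 + rsq p))) := by gcongr
      _ = _ := by field_simp

/-- Energy bound and integrated local energy estimate with a general source term. -/
theorem local_energy (hR : 0 < R) : ∃ K : ℝ, 0 < K ∧ ∀ α : ℝ, 0 < α → α ≤ 1 / 4 →
    ∀ φ : Scalar, Smooth φ → ∀ τ₁ τ₂, 0 ≤ τ₁ → τ₁ ≤ τ₂ →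
    (∀ τ ∈ Icc τ₁ τ₂, sInt R τ (eDens R φ) ≠ ⊤) → (∀ τ ∈ Icc τ₁ τ₂, sInt R τ (gDens R 0 φ) ≠ ⊤) →
    bulkInt R τ₁ τ₂ (eDens R φ) ≠ ⊤ →
    ofReal 2 * sInt R τ₂ (eDens R φ)
      + ofReal (α / 4) * bulkInt R τ₁ τ₂ (iDens α φ) ≤
    ofReal K * sInt R τ₁ (eDens R φ) + ofReal (600 / α) *
      bulkInt R τ₁ τ₂ (fun p => box φ p ^ 2 * jb[p] ^ (1 + α)) := by
  obtain ⟨K, hK, hKb⟩ := exists_cut_mor_bound hR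
  refine ⟨5 * (K + 11), by positivity, fun α h0 h1 φ hφ τ₁ τ₂ hτ h12 hE hg hEb => ?_⟩
  set hd : Scalar := fun p => φ p ^ 2 / (1 + rsq p) with hhd
  set sr : Scalar := fun p => box φ p ^ 2 * jb[p] ^ (1 + α) with hsr
  have hdm : Measurable hd := by
    simp only [hhd]; fun_prop
  have hardy' : ∀ τ ∈ Icc τ₁ τ₂, sInt R τ hd ≤ 4 * sInt R τ (eDens R φ) := fun τ h =>
    hardy hR (hτ.trans h.1) hφ (hE τ h) (hg τ h)
  have hτ1 : τ₁ ∈ Icc τ₁ τ₂ := ⟨le_rfl, h12⟩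
  have hτ2 : τ₂ ∈ Icc τ₁ τ₂ := ⟨h12, le_rfl⟩
  have main : ∀ n : ℕ, sInt R τ₂ (fun p => cut ((n : ℝ) + 1) p.1 * (4 * eDens R φ p))
      + (∫⁻ τ in Icc τ₁ τ₂, sInt R τ (fun p => cut ((n : ℝ) + 1) p.1 * (α / 4 * iDens α φ p))) ≤
      ofReal (1 / 2) * sInt R τ₂ hd + ofReal (K + 11) * sInt R τ₁ (zDens R φ) +
        (ofReal (K / ((n : ℝ) + 1)) * bulkInt R τ₁ τ₂ hd
          + ofReal (600 / α) * bulkInt R τ₁ τ₂ sr) := by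
    intro n
    set N : ℝ := (n : ℝ) + 1 with hN
    have hN0 : 0 < N := by positivity
    have hN1 : 1 ≤ N := by rw [hN]; have : (0 : ℝ) ≤ n := by positivity
                           linarith
    have hk0 := cut_nonneg N
    have hk1 := cut_le_one N
    have hk' := deriv_cut_nonpos hN0
    have hvan : ∀ p : Spacetime, 2 * N + 1 ≤ p.1 → cut N p.1 = 0 ∧ deriv (cut N) p.1 = 0 := by
      intro p hp
      refine ⟨cut_eq_zero hN0 (by linarith), ?_⟩
      obtain ⟨c, -, hc⟩ := exists_bound_cut
      exact ((hc N p.1 hN0).2 (by linarith)).1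
    have hleaf : ∀ τ ∈ Icc τ₁ τ₂, ∀ x, ‖(leaf R τ x).2‖ ≤ (leaf R τ x).1 + R := by
      intro τ h x
      have := le_max_left (‖x‖ - R) 0
      have := h.1
      simp only [leaf]
      linarith
    have hb : ∀ τ ∈ Icc τ₁ τ₂, ∀ x, _ := fun τ h x => hKb α h0 h1 φ N (leaf R τ x) hN1 (hleaf τ h x)
    have key := flux_inequality (R := R) (N := 2 * N + 1) (l := 0)
      (J0 := curT (cut N) (fun _ => 14) (mor α) (mor α) φ)
      (J := curS (cut N) (fun _ => 14) (mor α) (mor α) φ) hR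
      ((contDiff_curT (contDiff_cut N) contDiff_const (contDiff_mor α) (contDiff_mor α)
        hφ).of_le (by simp))
      (fun i => (contDiff_curS (contDiff_cut N) contDiff_const (contDiff_mor α) (contDiff_mor α)
        hφ i).of_le (by simp))
      (fun p hp => by simp [curT, mult, hvan p hp])
      (fun i p hp => by simp [curS, mult, hvan p hp]) le_rfl hτ h12
      (lo := fun p => cut N p.1 * (4 * eDens R φ p)) (lo' := fun p => 1 / 2 * hd p)
      (up := fun p => (K + 11) * zDens R φ p) (G := fun p => cut N p.1 * (α / 4 * iDens α φ p))
      (H := fun p => K / N * hd p + 600 / α * sr p)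
      (fun x => mul_nonneg (hk0 _) (mul_nonneg (by norm_num) eDens_nonneg))
      (fun x => le_fluxDens_mor hR h0 h1 (hk0 _) (hk1 _) (hk' _))
      (fun x => fluxDens_mor_le hR h0 h1 (hk0 _) (hk1 _) hK.le (hb τ₁ hτ1 x).1)
      (fun τ _ x => mul_nonneg (hk0 _) (mul_nonneg (by linarith) iDens_nonneg))
      (fun τ h x => by
        set p := leaf R τ x
        have a1 := bulk_mor_ge (φ := φ) (p := p) h0 h1 (hk0 _) (hk' _)
        have a2 := mult_mor_box_le (φ := φ) (p := p) h0 h1 (hk0 p.1)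
        have a3 := (hb τ h x).2
        have a4 : 0 ≤ 600 / α * sr p := by simp only [hsr]; positivity
        have a5 := mul_le_mul_of_nonneg_right (hk1 p.1) a4
        rw [divergence_cur (contDiff_cut N) contDiff_const (contDiff_mor α) (contDiff_mor α) hφ]
        simp only [hsr, hhd] at *
        linarith)
    rw [zero_mul, Real.exp_zero, ofReal_one, one_mul] at key
    refine key.trans (add_le_add (add_le_add ?_ ?_) ?_)
    · exact (sInt_const_mul (by norm_num) _).le
    · exact (sInt_const_mul (by positivity) _).le
    · exact bulkInt_le_two (f := fun p => K / N * hd p + 600 / α * sr p) (h := sr)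
        (by positivity) (by positivity) hdm (fun τ _ x => le_rfl)
  have hbf : bulkInt R τ₁ τ₂ hd ≠ ⊤ := by
    have : bulkInt R τ₁ τ₂ hd ≤ 4 * bulkInt R τ₁ τ₂ (eDens R φ) := by
      simp only [bulkInt_eq]
      rw [← lintegral_const_mul' _ _ (by norm_num)]
      exact bulkInt_mono_of_mem hardy'
    exact ne_top_of_le_ne_top (ENNReal.mul_ne_top (by norm_num) hEb) this
  have l1 := sInt_cut_tendsto (R := R) (hτ.trans h12) ((measurable_eDens (R := R) hφ).const_mul 4)
    (fun p => mul_nonneg (by norm_num) eDens_nonneg)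
  have l2 := bulk_cut_tendsto (R := R) (τ₂ := τ₂) hτ
    ((measurable_iDens (α := α) hφ).const_mul (α / 4))
    (fun p => mul_nonneg (by linarith) iDens_nonneg)
  have l3 : Filter.Tendsto (fun n : ℕ => ofReal (K / ((n : ℝ) + 1)) * bulkInt R τ₁ τ₂ hd)
      Filter.atTop (nhds 0) := by
    have h5 : Filter.Tendsto (fun n : ℕ => K / ((n : ℝ) + 1)) Filter.atTop (nhds 0) := by
      have := (tendsto_one_div_add_atTop_nhds_zero_nat (𝕜 := ℝ)).const_mul K
      rw [mul_zero] at this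
      exact this.congr fun n => mul_one_div _ _
    have h6 := ENNReal.tendsto_ofReal h5
    rw [ENNReal.ofReal_zero] at h6
    simpa using ENNReal.Tendsto.mul_const (b := bulkInt R τ₁ τ₂ hd) h6 (Or.inr hbf)
  have l4 := le_of_tendsto_of_tendsto (l1.add l2)
    ((l3.add_const (ofReal (600 / α) * bulkInt R τ₁ τ₂ sr)).const_add
      (ofReal (1 / 2) * sInt R τ₂ hd + ofReal (K + 11) * sInt R τ₁ (zDens R φ)))
    (Filter.Eventually.of_forall main)
  rw [zero_add, sInt_const_mul (by norm_num)] at l4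
  have l4' : ofReal 4 * sInt R τ₂ (eDens R φ)
      + bulkInt R τ₁ τ₂ (fun p => α / 4 * iDens α φ p) ≤ _ := l4
  rw [bulkInt_const_mul (by linarith)] at l4'
  have z1 : sInt R τ₁ (zDens R φ) ≤ 5 * sInt R τ₁ (eDens R φ) := by
    calc _ ≤ sInt R τ₁ (eDens R φ) + sInt R τ₁ hd := sInt_add_le (measurable_eDens hφ)
      _ ≤ sInt R τ₁ (eDens R φ) + 4 * sInt R τ₁ (eDens R φ) := by gcongr; exact hardy' τ₁ hτ1
      _ = _ := by ring
  have z2 : ofReal (1 / 2) * sInt R τ₂ hd ≤ ofReal 2 * sInt R τ₂ (eDens R φ) := by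
    calc _ ≤ ofReal (1 / 2) * (4 * sInt R τ₂ (eDens R φ)) := by gcongr; exact hardy' τ₂ hτ2
      _ = _ := by
        rw [← mul_assoc, show (4 : ℝ≥0∞) = ofReal 4 by norm_num,
          ← ofReal_mul (by norm_num)]
        norm_num
  have hfin : ofReal 2 * sInt R τ₂ (eDens R φ) ≠ ⊤ :=
    ENNReal.mul_ne_top ofReal_ne_top (hE τ₂ hτ2)
  refine (ENNReal.add_le_add_iff_left hfin).1 ?_
  calc _ = ofReal 4 * sInt R τ₂ (eDens R φ)
      + ofReal (α / 4) * bulkInt R τ₁ τ₂ (iDens α φ) := by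
        rw [← add_assoc, ← add_mul, ← ofReal_add (by norm_num) (by norm_num)]; norm_num
    _ ≤ _ := l4'
    _ ≤ ofReal 2 * sInt R τ₂ (eDens R φ)
        + ofReal (K + 11) * (5 * sInt R τ₁ (eDens R φ))
        + ofReal (600 / α) * bulkInt R τ₁ τ₂ sr := by gcongr
    _ = _ := by
        rw [add_assoc, ofReal_mul (by norm_num : (0 : ℝ) ≤ 5)]
        norm_num
        ring

end iled

section timeWeight

/-- A decreasing time weight, bounded above and below. -/
def timeWeight (α K t : ℝ) : ℝ := exp (-(K * (t * mor α (t ^ 2))))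

@[fun_prop]
theorem contDiff_timeWeight (α K : ℝ) : Smooth (timeWeight α K) := by
  have := contDiff_mor α
  have h2 : Smooth (fun t : ℝ => mor α (t ^ 2)) := this.comp (by fun_prop)
  unfold timeWeight
  exact (ContDiff.neg (contDiff_const.mul (contDiff_id.mul h2))).exp

theorem timeWeight_bounds {α K : ℝ} (h0 : 0 < α) (h1 : α ≤ 1 / 4) (hK : 0 ≤ K) (t : ℝ) :
    exp (-(K * 2)) ≤ timeWeight α K t ∧ timeWeight α K t ≤ exp (K * 2) := by
  have h := (mor_facts h0 h1 (sq_nonneg t)).2.1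
  have h2 : |t * mor α (t ^ 2)| ≤ 2 := by
    apply abs_le_of_sq_le_sq _ (by norm_num)
    have : 0 ≤ mor α (t ^ 2) ^ 2 := sq_nonneg _
    rw [mul_pow]; nlinarith
  obtain ⟨h3, h4⟩ := abs_le.1 h2
  unfold timeWeight
  constructor <;> apply Real.exp_le_exp.2
  · have := mul_le_mul_of_nonneg_left h4 hK; linarith
  · have := mul_le_mul_of_nonneg_left h3 hK; linarith

theorem deriv_timeWeight {α K : ℝ} (h0 : 0 < α) (h1 : α ≤ 1 / 4) (hK : 0 ≤ K) (t : ℝ) :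
    deriv (timeWeight α K) t ≤ -(K * (α * (1 + t ^ 2) ^ (-((1 + α) / 2)))) * timeWeight α K t := by
  have hm : HasDerivAt (mor α) (deriv (mor α) (t ^ 2)) (t ^ 2) :=
    (((contDiff_mor α).differentiable (by simp)) _).hasDerivAt
  have h2 : HasDerivAt (fun t : ℝ => t ^ 2) (2 * t) t := by simpa using hasDerivAt_pow 2 t
  have hc : HasDerivAt (fun t : ℝ => mor α (t ^ 2)) (deriv (mor α) (t ^ 2) * (2 * t)) t :=
    HasDerivAt.comp (h := fun t : ℝ => t ^ 2) t hm h2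
  have h3 := (((hasDerivAt_id t).fun_mul hc).const_mul K).fun_neg.exp
  have h4 : deriv (timeWeight α K) t =
      -(K * (mor α (t ^ 2) + 2 * t ^ 2 * deriv (mor α) (t ^ 2))) * timeWeight α K t := by
    refine (h3.congr_deriv ?_).deriv
    simp only [timeWeight, id]
    ring_nf
  rw [h4]
  have h5 := (mor_facts h0 h1 (sq_nonneg t)).2.2.2.2.1
  have h6 := mul_le_mul_of_nonneg_left h5 hK
  have h7 : 0 < timeWeight α K t := exp_pos _
  apply mul_le_mul_of_nonneg_right _ h7.le
  linarith

/-- The time weight with a cutoff at late times. -/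
def cutWeight (α K N t : ℝ) : ℝ := cut N t * timeWeight α K t

@[fun_prop]
theorem contDiff_cutWeight (α K N : ℝ) : Smooth (cutWeight α K N) :=
  (contDiff_cut N).mul (contDiff_timeWeight α K)

theorem cutWeight_facts {α K N : ℝ} (h0 : 0 < α) (h1 : α ≤ 1 / 4) (hK : 0 ≤ K) (hN : 0 < N)
    (t : ℝ) :
    0 ≤ cutWeight α K N t ∧ cut N t * exp (-(K * 2)) ≤ cutWeight α K N t ∧
    cutWeight α K N t ≤ exp (K * 2) ∧
    deriv (cutWeight α K N) t ≤ -(K * (α * (1 + t ^ 2) ^ (-((1 + α) / 2)))) * cutWeight α K N t ∧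
    deriv (cutWeight α K N) t ≤ 0 := by
  obtain ⟨b1, b2⟩ := timeWeight_bounds h0 h1 hK t
  have b3 := deriv_timeWeight h0 h1 hK t
  have c0 := cut_nonneg N t
  have c1 := cut_le_one N t
  have c2 := deriv_cut_nonpos hN t
  have b0 : 0 < timeWeight α K t := exp_pos _
  have hd1 : HasDerivAt (cut N) (deriv (cut N) t) t :=
    (((contDiff_cut N).differentiable (by simp)) _).hasDerivAt
  have hd2 : HasDerivAt (timeWeight α K) (deriv (timeWeight α K) t) t :=
    (((contDiff_timeWeight α K).differentiable (by simp)) _).hasDerivAt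
  have hd : deriv (cutWeight α K N) t = deriv (cut N) t * timeWeight α K t
      + cut N t * deriv (timeWeight α K) t := (hd1.mul hd2).deriv
  have h5 : deriv (cutWeight α K N) t ≤
      -(K * (α * (1 + t ^ 2) ^ (-((1 + α) / 2)))) * cutWeight α K N t := by
    rw [hd, cutWeight]
    have h6 := mul_le_mul_of_nonneg_left b3 c0
    have h7 := mul_nonpos_of_nonpos_of_nonneg c2 b0.le
    linarith
  have hpos : 0 ≤ cutWeight α K N t := mul_nonneg c0 b0.le
  refine ⟨hpos, mul_le_mul_of_nonneg_left b1 c0, ?_, h5, h5.trans ?_⟩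
  · calc _ ≤ 1 * timeWeight α K t := mul_le_mul_of_nonneg_right c1 b0.le
      _ ≤ _ := by rwa [one_mul]
  · have : 0 ≤ K * (α * (1 + t ^ 2) ^ (-((1 + α) / 2))) * cutWeight α K N t := by positivity
    linarith

theorem cutWeight_eq_zero {α K N t : ℝ} (hN : 0 < N) (ht : 2 * N + 1 ≤ t) :
    cutWeight α K N t = 0 ∧ deriv (cutWeight α K N) t = 0 := by
  have h0 : ∀ s, 2 * N < s → cutWeight α K N s = 0 := fun s hs => by
    simp [cutWeight, cut_eq_zero hN hs.le]
  refine ⟨h0 t (by linarith), ?_⟩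
  have h2 : 2 * N < t := by linarith
  have : cutWeight α K N =ᶠ[nhds t] fun _ => 0 := by
    filter_upwards [Ioi_mem_nhds h2] with s hs
    exact h0 s hs
  rw [this.deriv_eq]; simp

end timeWeight

section currents
variable {R : ℝ} {φ : Scalar} {p : Spacetime} {k : ℝ → ℝ}

theorem divergence_add_const_mul {A0 B0 : Scalar} {A B : Fin 3 → Scalar} {c : ℝ}
    (hA0 : Smooth A0 := by fun_prop) (hB0 : Smooth B0 := by fun_prop)
    (hA : ∀ i, Smooth (A i) := by fun_prop) (hB : ∀ i, Smooth (B i) := by fun_prop) :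
    divergence (fun q => A0 q + c * B0 q) (fun i q => A i q + c * B i q) p =
      divergence A0 A p + c * divergence B0 B p := by
  simp only [divergence, Fin.sum_univ_three]
  rw [pd_add, pd_const_mul, pd_add, pd_const_mul, pd_add, pd_const_mul, pd_add, pd_const_mul]
  ring

theorem fluxDens_add_const_mul {A0 B0 : Scalar} {A B : Fin 3 → Scalar} {c : ℝ} :
    fluxDens R (fun q => A0 q + c * B0 q) (fun i q => A i q + c * B i q) p =
      fluxDens R A0 A p + c * fluxDens R B0 B p := by
  simp only [fluxDens, Fin.sum_univ_three]
  ring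

theorem fluxDens_time (hR : 0 < R) : fluxDens R (timeT k φ)
    (timeS k φ) p = 1 / 2 * (k p.1 * eDens R φ p) := by
  by_cases hp : R < r[p]
  · rw [fluxDens_cur_outer hR _ _ _ _ hp, eDens, if_pos hp, mult, lagr,
      spaceSq_eq (ne_zero_of_lt hR hp), dv, deriv_const]
    ring
  · rw [fluxDens_inner hp, eDens, if_neg hp, gradSq_eq, curT, mult, lagr]
    ring

theorem divergence_time (hk : Smooth k) (hφ : Smooth φ) : divergence (timeT k φ) (timeS k φ) p =
      k p.1 * (pd 0 φ p * box φ p) - 1 / 2 * (deriv k p.1 * gradSq φ p) := by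
  rw [divergence_cur hk contDiff_const contDiff_const contDiff_const hφ]
  simp only [mult, bulk, lagr, deriv_const, deriv_const', gradSq_eq]
  ring

/-- The density of the zeroth order functional. -/
def massT (k b : ℝ → ℝ) (φ : Scalar) (p : Spacetime) : ℝ := -(k p.1 * (b (rsq p) * φ p ^ 2))

@[fun_prop]
theorem contDiff_massT {b : ℝ → ℝ} (hk : Smooth k) (hb : Smooth b)
    (hφ : Smooth φ) : Smooth (massT k b φ) := by
  have := contDiff_rsq
  unfold massT; fun_prop

theorem pd_zero_massT {b : ℝ → ℝ} (hk : Smooth k) (hb : Smooth b)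
    (hφ : Smooth φ) : pd 0 (massT k b φ) p =
      -(deriv k p.1 * (b (rsq p) * φ p ^ 2)) - k p.1 * (b (rsq p) * (2 * φ p * pd 0 φ p)) := by
  unfold massT
  rw [pd_neg, pd_mul, pd_mul, pd_sq, pd_zero_time, pd_zero_radial]
  ring

theorem fluxDens_mass {b : ℝ → ℝ} : fluxDens R (massT k b φ) (fun _ _ => 0) p =
    k p.1 * (b (rsq p) * φ p ^ 2) := by
  simp [fluxDens, massT]

theorem divergence_mass {b : ℝ → ℝ} (hk : Smooth k) (hb : Smooth b)
    (hφ : Smooth φ) : divergence (massT k b φ) (fun _ _ => 0) p =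
      -(deriv k p.1 * (b (rsq p) * φ p ^ 2)) - k p.1 * (b (rsq p) * (2 * φ p * pd 0 φ p)) := by
  have : ∀ i : Fin 3, pd i.succ (fun _ => (0 : ℝ)) p = 0 := fun i => pd_const
  simp [divergence, pd_zero_massT hk hb hφ, this]

/-- Space components of the current giving Hardy's inequality on the cones. -/
def hardyS (k b : ℝ → ℝ) (φ : Scalar) (i : Fin 3) (p : Spacetime) : ℝ :=
  -(p.2 i * (k p.1 * (b (rsq p) * φ p ^ 2)))

@[fun_prop]
theorem contDiff_hardyS {b : ℝ → ℝ} (hk : Smooth k) (hb : Smooth b)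
    (hφ : Smooth φ) (i : Fin 3) : Smooth (hardyS k b φ i) := by
  have := contDiff_rsq
  unfold hardyS; fun_prop

theorem chiPow_half {e : ℝ} (hn : 0 < r[p]) :
    chiPow R (e + 1 / 2) (rsq p) = r[p] * chiPow R e (rsq p) := by
  have hr : rsq p = r[p] ^ 2 := rfl
  simp only [chiPow, hr, rpow_sq hn]
  rw [show 2 * (e + 1 / 2) = 2 * e + 1 by ring, rpow_add_one hn.ne']
  ring

theorem fluxDens_hardy (hR : 0 < R) {e : ℝ} :
    fluxDens R (massT k (chiPow R (e + 1 / 2)) φ) (hardyS k (chiPow R e) φ) p = 0 := by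
  by_cases hp : R < r[p]
  · have hn : 0 < r[p] := hR.trans hp
    have h1 := sum_radial_sq (ne_zero_of_lt hR hp)
    have h3 := coord_eq p
    simp only [fluxDens, massT, hardyS, outerDir, hp, if_true, chiPow_half hn,
      Fin.sum_univ_three] at *
    generalize chiPow R e (rsq p) = b
    rw [h3 0, h3 1, h3 2]
    linear_combination (-(k p.1 * b * φ p ^ 2 * r[p])) * h1
  · rw [fluxDens_inner hp, massT, chiPow_eq_zero hR (rsq_le_of_inner hp)]; simp

theorem divergence_hardy (hR : 0 < R) {e : ℝ} (hk : Smooth k) (hφ : Smooth φ) :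
    divergence (massT k (chiPow R (e + 1 / 2)) φ) (hardyS k (chiPow R e) φ) p =
      -slDens R k (chiPow R e) φ p := by
  have hb := contDiff_chiPow hR e
  have e1 : ∀ i : Fin 3, pd i.succ (hardyS k (chiPow R e) φ i) p =
      -pd i.succ (fun q => q.2 i * (k q.1 * (chiPow R e (rsq q) * φ q ^ 2))) p := by
    intro i; unfold hardyS; rw [pd_neg]
  have e0 : ∀ i : Fin 3, pd 0 (fun q => q.2 i * (k q.1 * (chiPow R e (rsq q) * φ q ^ 2))) p =
      p.2 i * (deriv k p.1 * (chiPow R e (rsq p) * φ p ^ 2) + k p.1 * (chiPow R e (rsq p) *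
        (2 * φ p * pd 0 φ p))) := by
    intro i
    rw [pd_mul, pd_mul, pd_mul, pd_sq, pd_zero_coord, pd_zero_time, pd_zero_radial]
    ring
  rw [divergence, pd_zero_massT hk (contDiff_chiPow hR _) hφ, ← slDens_eq hR hk hb hφ]
  simp only [e1, e0]
  by_cases hp : R < r[p]
  · have hn : 0 < r[p] := hR.trans hp
    have h1 := sum_radial_sq (ne_zero_of_lt hR hp)
    have h3 := coord_eq p
    simp only [outerDir, hp, if_true, chiPow_half hn, Fin.sum_univ_three] at *
    rw [h3 0, h3 1, h3 2]
    linear_combination (r[p] * (deriv k p.1 * (chiPow R e (rsq p) * φ p ^ 2)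
      + k p.1 * (chiPow R e (rsq p) * (2 * φ p * pd 0 φ p)))) * h1
  · simp only [outerDir, hp, if_false, chiPow_eq_zero hR (rsq_le_of_inner hp), Fin.sum_univ_three]
    ring

/-- Pointwise form of the weighted Hardy inequality on the cones. -/
theorem exists_le_divergence_hardy (hR : 0 < R) (e : ℝ) {q : ℝ} (hq : q ≤ 1 / 2) : ∃ C : ℝ, 0 < C ∧
    ∀ φ : Scalar, Smooth φ → ∀ (k : ℝ → ℝ) (p : Spacetime), Smooth k → 0 ≤ k p.1 → deriv k p.1 ≤ 0 →
      k p.1 * (1 / 4 * (if R < r[p] then r[p] ^ (q - 2) * φ p ^ 2 else 0)) ≤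
        divergence (massT k (chiPow R ((q - 2) / 2 + 1 / 2)) φ)
          (hardyS k (chiPow R ((q - 2) / 2)) φ) p
        + k p.1 * (4 * mDens R q φ p) + k p.1 * (C * (jb[p] ^ e * φ p ^ 2)) := by
  obtain ⟨C1, hC1, h1⟩ := exists_bound_deriv_chi hR q e
  obtain ⟨C2, hC2, h2⟩ := exists_bound_one_sub_chi hR (q - 2) e
  refine ⟨2 * C1 + C2, by positivity, fun φ hφ k p hks hk hk' => ?_⟩
  rw [divergence_hardy hR hks hφ]
  by_cases hp : R < r[p]
  · have hn : 0 < r[p] := hR.trans hp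
    have hr : rsq p = r[p] ^ 2 := rfl
    have hs : 0 < rsq p := by rw [hr]; positivity
    have hχ := chi_nonneg R (rsq p)
    have hχ1 := chi_le_one R (rsq p)
    have b1 := h1 p
    have b2 := h2 p hp
    have hq2 : r[p] ^ q = r[p] ^ (q - 2) * r[p] ^ 2 := by
      rw [← rpow_natCast, ← rpow_add hn]; congr 1; push_cast; ring
    have hb : chiPow R ((q - 2) / 2) (rsq p) = chi R (rsq p) * r[p] ^ (q - 2) := by
      rw [chiPow, hr, rpow_sq hn]; congr 2; ring
    have hb' : rsq p * deriv (chiPow R ((q - 2) / 2)) (rsq p) =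
        deriv (chi R) (rsq p) * rsq p * r[p] ^ (q - 2)
          + (q - 2) / 2 * chi R (rsq p) * r[p] ^ (q - 2) := by
      rw [deriv_chiPow _ hs, rpow_sub_one hs.ne', show rsq p ^ ((q - 2) / 2) =
        r[p] ^ (q - 2) by rw [hr, rpow_sq hn]; congr 1; ring]
      field_simp
    have hP : 0 < r[p] ^ (q - 2) := by positivity
    have ha := angSq_nonneg φ p
    simp only [slDens, mDens, hp, if_true, rDer, yDer, mul_assoc (2 : ℝ), hb', hb]
    rw [hq2] at b1
    have hE : 0 < jb[p] ^ e := by positivity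
    generalize jb[p] ^ e = E at *
    generalize r[p] ^ (q - 2) = P at *
    generalize chi R (rsq p) = χ at *
    generalize deriv (chi R) (rsq p) = χ' at *
    generalize k p.1 = κ at *
    generalize deriv k p.1 = κ' at *
    rw [hr] at *
    generalize r[p] = r at *
    generalize dv φ p = L at *
    generalize angSq φ p = a at *
    have e1 := mul_le_mul_of_nonneg_left b1 (show 0 ≤ κ * φ p ^ 2 by positivity)
    have e2 := mul_le_mul_of_nonneg_left b2 (show 0 ≤ κ * φ p ^ 2 by positivity)
    have e3 : 0 ≤ κ * χ * P * ((φ p / 2 - 2 * (r * L + φ p)) ^ 2 + (1 / 2 - q) * φ p ^ 2) := by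
      have : 0 ≤ 1 / 2 - q := by linarith
      positivity
    have hk'' : 0 ≤ -κ' := by linarith
    have e4 : 0 ≤ -κ' * χ * P * r * φ p ^ 2 := by positivity
    have e5 : 0 ≤ κ * (1 - χ) * P * (r * L + φ p) ^ 2 := by
      have : 0 ≤ 1 - χ := by linarith
      positivity
    have e6 : 0 ≤ κ * P * (r ^ 2 * a) := by positivity
    have e7 : 0 ≤ κ * (C2 * (E * φ p ^ 2)) := by positivity
    linear_combination 2 * e1 + 1 / 4 * e2 + e3 + e4 + 4 * e5 + 4 * e6 + 3 / 4 * e7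
  · have d1 : deriv (chiPow R ((q - 2) / 2)) (rsq p) = 0 :=
      deriv_eq_zero_of_vanish (contDiff_chiPow hR _) (fun u hu => chiPow_eq_zero hR hu)
        (rsq_le_of_inner hp)
    simp only [slDens, mDens, hp, if_false, chiPow_eq_zero hR (rsq_le_of_inner hp), d1]
    have : 0 ≤ k p.1 * ((2 * C1 + C2) * (jb[p] ^ e * φ p ^ 2)) := by positivity
    linarith

end currents

section boundedTime
variable {R α : ℝ} {φ F : Scalar} {p : Spacetime}

/-- The source is bounded by `F` and by first derivatives with decaying coefficients. -/
def SourceBound (R α Λ : ℝ) (F φ : Scalar) (p : Spacetime) : Prop :=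
  box φ p ^ 2 ≤ Λ * (F p ^ 2 + jb[p] ^ (-2 - 6 * α) * gradSq φ p
    + if R < r[p] then jb[p] ^ (-1 : ℝ) * good[φ, p] else 0)

/-- The good derivatives with an `r`-weight. -/
def goodDens (R β : ℝ) (φ : Scalar) (p : Spacetime) : ℝ :=
  if R < r[p] then jb[p] ^ β * good[φ, p] else 0

/-- The zeroth order term with an `r`-weight. -/
def hDens (R q : ℝ) (φ : Scalar) (p : Spacetime) : ℝ :=
  if R < r[p] then r[p] ^ (q - 2) * φ p ^ 2 else 0

theorem hDens_nonneg {q : ℝ} : 0 ≤ hDens R q φ p := by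
  unfold hDens; split_ifs <;> positivity

theorem exists_goodDens_le (hR : 0 < R) {β : ℝ} (hβ : 0 ≤ β) : ∃ C : ℝ, 0 < C ∧
    ∀ (φ : Scalar) (p : Spacetime), goodDens R β φ p ≤ C * (mDens R β φ p + hDens R β φ p) := by
  refine ⟨2 * (1 + 1 / R) ^ β, by positivity, fun φ p => ?_⟩
  unfold goodDens mDens hDens
  split_ifs with hp
  · have hn : 0 < r[p] := hR.trans hp
    have ha := angSq_nonneg φ p
    have h1 : jb[p] ^ β ≤ (1 + 1 / R) ^ β * r[p] ^ β := by
      rw [← Real.mul_rpow (by positivity) hn.le]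
      apply rpow_le_rpow (by positivity) _ hβ
      have : 1 ≤ r[p] / R := (one_le_div hR).2 hp.le
      calc _ ≤ r[p] / R + r[p] := by linarith
        _ = _ := by ring
    have h2 : r[p] ^ β = r[p] ^ (β - 2) * r[p] ^ 2 := by
      rw [← rpow_natCast, ← rpow_add hn]; congr 1; push_cast; ring
    have hP : 0 < r[p] ^ (β - 2) := by positivity
    have hC : 0 < (1 + 1 / R) ^ β := by positivity
    rw [h2] at h1
    calc _ ≤ (1 + 1 / R) ^ β * (r[p] ^ (β - 2) * r[p] ^ 2) * good[φ, p] := by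
          gcongr
      _ = (1 + 1 / R) ^ β * r[p] ^ (β - 2) * (r[p] ^ 2 * good[φ, p]) := by ring
      _ ≤ (1 + 1 / R) ^ β * r[p] ^ (β - 2) *
          (2 * (yDer φ p ^ 2 + r[p] ^ 2 * angSq φ p + φ p ^ 2)) := by
        refine mul_le_mul_of_nonneg_left ?_ (by positivity)
        rw [yDer]
        have : 0 ≤ r[p] ^ 2 * angSq φ p := by positivity
        nlinarith [sq_nonneg (r[p] * dv φ p + 2 * φ p)]
      _ = _ := by ring
  · simp

theorem one_add_rpow_le {a b r : ℝ} (hr : 0 ≤ r) (h : a ≤ b) : (1 + r) ^ a ≤ (1 + r) ^ b :=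
  rpow_le_rpow_of_exponent_le (by linarith) h

theorem SourceBound.weighted {Λ : ℝ} (hα : 0 < α) (hΛ : 0 ≤ Λ) (h : SourceBound R α Λ F φ p) :
    box φ p ^ 2 * jb[p] ^ (2 * α + 1) ≤ Λ * (F p ^ 2 * jb[p] ^ (2 * α + 1)
      + jb[p] ^ (-(1 + α)) * gradSq φ p + goodDens R (2 * α) φ p) := by
  have hn := norm_nonneg p.2
  have hw : 0 < jb[p] ^ (2 * α + 1) := by positivity
  have hg := gradSq_nonneg φ p
  have e1 : jb[p] ^ (-2 - 6 * α) * jb[p] ^ (2 * α + 1) ≤ jb[p] ^ (-(1 + α)) := by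
    rw [← rpow_add (by positivity)]
    exact one_add_rpow_le hn (by linarith)
  have e2 : jb[p] ^ (-1 : ℝ) * jb[p] ^ (2 * α + 1) = jb[p] ^ (2 * α) := by
    rw [← rpow_add (by positivity)]; congr 1; ring
  calc _ ≤ _ := mul_le_mul_of_nonneg_right h hw.le
    _ = Λ * (F p ^ 2 * jb[p] ^ (2 * α + 1) + jb[p] ^ (-2 - 6 * α) * jb[p] ^ (2 * α + 1) * gradSq φ p
      + goodDens R (2 * α) φ p) := by
        rw [goodDens, ← e2]
        split_ifs <;> ring
    _ ≤ _ := by gcongr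

theorem zeta_bounds (h1 : α ≤ 1 / 4) : jb[p] ^ (-3 : ℝ) ≤ onePow (-(3 / 2)) (rsq p) ∧
    onePow (-(3 / 2)) (rsq p) ≤ 8 * jb[p] ^ (-(1 + α)) ∧
    onePow (-(3 / 2)) (rsq p) ≤ 1 / (1 + rsq p) := by
  have hs := rsq_nonneg p
  have hn := norm_nonneg p.2
  have hr : rsq p = r[p] ^ 2 := rfl
  rw [onePow_eq hs]
  refine ⟨?_, ?_, ?_⟩
  · have : jb[p] ^ (-3 : ℝ) = (jb[p] ^ 2) ^ (-(3 / 2) : ℝ) := by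
      rw [rpow_sq (by positivity)]; norm_num
    rw [this]
    apply rpow_le_rpow_of_nonpos (by linarith) _ (by norm_num)
    rw [hr]; nlinarith
  · have h3 : (1 + rsq p) ^ (-(3 / 2) : ℝ) ≤ ((jb[p] / 2) ^ 2) ^ (-(3 / 2) : ℝ) := by
      apply rpow_le_rpow_of_nonpos (by positivity) _ (by norm_num)
      rw [hr]; nlinarith [sq_nonneg (r[p] - 1)]
    refine h3.trans ?_
    rw [rpow_sq (by positivity), show (2 * -(3 / 2) : ℝ) = -3 by norm_num,
      Real.div_rpow (by positivity) (by norm_num)]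
    have e : (2 : ℝ) ^ (-3 : ℝ) = 1 / 8 := by
      rw [show (-3 : ℝ) = -((3 : ℕ) : ℝ) by norm_num, rpow_neg (by norm_num), rpow_natCast]
      norm_num
    rw [e]
    have : jb[p] ^ (-3 : ℝ) ≤ jb[p] ^ (-(1 + α)) := one_add_rpow_le hn (by linarith)
    linarith
  · rw [one_div, ← Real.rpow_neg_one]
    exact one_add_rpow_le hs (by norm_num)

/-- The bulk term from the outgoing cutoffs is of lower order. -/
theorem outer_lower_le (hR : 0 < R) (h1 : α ≤ 1 / 4) {C : ℝ} (hC : 0 ≤ C) :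
    (if R < r[p] then C * jb[p] ^ (-3 : ℝ) * (dv φ p ^ 2 + angSq φ p + (φ p / jb[p]) ^ 2) else 0) ≤
    C * (2 * (jb[p] ^ (-(1 + α)) * gradSq φ p) + onePow (-(3 / 2)) (rsq p) * φ p ^ 2) ∧
    (if R < r[p] then C * jb[p] ^ (-3 : ℝ) * (dv φ p ^ 2 + angSq φ p + (φ p / jb[p]) ^ 2) else 0) ≤
    C * (eDens R φ p + onePow (-(3 / 2)) (rsq p) * φ p ^ 2) := by
  obtain ⟨z1, z2, z3⟩ := zeta_bounds (p := p) h1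
  have hn := norm_nonneg p.2
  have hz0 : 0 < jb[p] ^ (-3 : ℝ) := by positivity
  have hw : jb[p] ^ (-3 : ℝ) ≤ jb[p] ^ (-(1 + α)) := one_add_rpow_le hn (by linarith)
  have hw1 : jb[p] ^ (-3 : ℝ) ≤ 1 := by
    calc _ ≤ jb[p] ^ (0 : ℝ) := one_add_rpow_le hn (by norm_num)
      _ = 1 := rpow_zero _
  have hg := gradSq_nonneg φ p
  have he := eDens_nonneg (R := R) (φ := φ) (p := p)
  have hζ : 0 < onePow (-(3 / 2)) (rsq p) := hz0.trans_le z1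
  have hphi : jb[p] ^ (-3 : ℝ) * (φ p / jb[p]) ^ 2 ≤ onePow (-(3 / 2)) (rsq p) * φ p ^ 2 := by
    apply mul_le_mul z1 _ (sq_nonneg _) hζ.le
    rw [div_pow]
    exact div_le_self (sq_nonneg _) (by nlinarith)
  split_ifs with hp
  · have ha := angSq_nonneg φ p
    have h2 := dv_sq_add_le (φ := φ) (ne_zero_of_lt hR hp)
    constructor
    · calc _ = C * (jb[p] ^ (-3 : ℝ) * good[φ, p]
            + jb[p] ^ (-3 : ℝ) * (φ p / jb[p]) ^ 2) := by ring
        _ ≤ C * (jb[p] ^ (-(1 + α)) * (2 * gradSq φ p) + onePow (-(3 / 2)) (rsq p) * φ p ^ 2) := by gcongr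
        _ = _ := by ring
    · rw [eDens, if_pos hp]
      calc _ = C * (jb[p] ^ (-3 : ℝ) * good[φ, p]
            + jb[p] ^ (-3 : ℝ) * (φ p / jb[p]) ^ 2) := by ring
        _ ≤ C * (1 * good[φ, p] + onePow (-(3 / 2)) (rsq p) * φ p ^ 2) := by gcongr
        _ = _ := by ring
  · constructor <;> positivity

theorem wDens_le {β l : ℝ} (hR : 0 < R) (hβ : 0 ≤ β) (hl : 0 < l) :
    wDens R β φ p ≤ l * gDens R (1 + β) φ p + 1 / (4 * l) * (box φ p ^ 2 * jb[p] ^ (β + 1)) := by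
  unfold wDens gDens
  split_ifs with hp
  · have hn : 0 < r[p] := hR.trans hp
    have e1 : r[p] ^ β = r[p] ^ (1 + β - 2) * r[p] := by
      rw [← rpow_add_one hn.ne']; congr 1; ring
    have e2 : r[p] ^ (β + 1) = r[p] ^ (1 + β - 2) * r[p] ^ 2 := by
      rw [← rpow_natCast, ← rpow_add hn]; congr 1; push_cast; ring
    have e3 : r[p] ^ (β + 1) ≤ jb[p] ^ (β + 1) := rpow_le_rpow hn.le (by linarith) (by linarith)
    have hP : 0 < r[p] ^ (1 + β - 2) := by positivity
    have e4 : 1 / (4 * l) * (box φ p ^ 2 * r[p] ^ (β + 1)) ≤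
        1 / (4 * l) * (box φ p ^ 2 * jb[p] ^ (β + 1)) := by gcongr
    refine le_trans ?_ (add_le_add le_rfl e4)
    rw [e2, e1, ← sq_abs (yDer φ p), ← sq_abs (box φ p)]
    have : 0 ≤ r[p] ^ (1 + β - 2) * (l * (|yDer φ p| - 1 / (2 * l) * r[p] * |box φ p|) ^ 2) := by
      positivity
    have e5 : r[p] ^ (1 + β - 2) * (l * (|yDer φ p| - 1 / (2 * l) * r[p] * |box φ p|) ^ 2) =
        l * (r[p] ^ (1 + β - 2) * |yDer φ p| ^ 2)
        + 1 / (4 * l) * (|box φ p| ^ 2 * (r[p] ^ (1 + β - 2) * r[p] ^ 2))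
        - r[p] ^ (1 + β - 2) * r[p] * |yDer φ p| * |box φ p| := by
      field_simp; ring
    linarith
  · have : 0 ≤ 1 / (4 * l) * (box φ p ^ 2 * jb[p] ^ (β + 1)) := by positivity
    linarith

theorem time_source_le (hα : 0 < α) : -(pd 0 φ p * box φ p) ≤ jb[p] ^ (-(1 + α)) * gradSq φ p
      + 1 / 4 * (box φ p ^ 2 * jb[p] ^ (2 * α + 1)) := by
  have hn := norm_nonneg p.2
  have e1 : jb[p] ^ (1 + α) ≤ jb[p] ^ (2 * α + 1) := one_add_rpow_le hn (by linarith)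
  have e2 : jb[p] ^ (-(1 + α)) * jb[p] ^ (1 + α) = 1 := by
    rw [← rpow_add (by positivity)]; simp
  have hw : 0 < jb[p] ^ (-(1 + α)) := by positivity
  have e3 : 1 / 4 * (box φ p ^ 2 * jb[p] ^ (1 + α)) ≤
      1 / 4 * (box φ p ^ 2 * jb[p] ^ (2 * α + 1)) := by gcongr
  have hsp : 0 ≤ spaceSq φ p := Finset.sum_nonneg fun _ _ => sq_nonneg _
  refine le_trans ?_ (add_le_add le_rfl e3)
  rw [gradSq_eq]
  generalize jb[p] ^ (-(1 + α)) = w at *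
  generalize jb[p] ^ (1 + α) = v at *
  have h1 : 0 ≤ w * spaceSq φ p := by positivity
  have h2 : 0 ≤ w * (pd 0 φ p + v / 2 * box φ p) ^ 2 := by positivity
  have h3 : w * (pd 0 φ p + v / 2 * box φ p) ^ 2 = w * pd 0 φ p ^ 2 + (w * v) * (pd 0 φ p * box φ p)
      + 1 / 4 * (w * v) * (v * box φ p ^ 2) := by ring
  rw [h3, e2] at h2
  linarith

theorem iDens_le_mass (h0 : 0 < α) (h1 : α ≤ 1 / 4) : iDens α φ p ≤ jb[p] ^ (-(1 + α)) * gradSq φ p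
      + onePow (-(3 / 2)) (rsq p) * φ p ^ 2 := by
  have hn : 0 < 1 + r[p] := by positivity
  have e : iDens α φ p = jb[p] ^ (-(1 + α)) * gradSq φ p + jb[p] ^ (-(3 + α)) * φ p ^ 2 := by
    rw [iDens, show -(3 + α) = -(1 + α) - (2 : ℕ) by push_cast; ring, Real.rpow_sub_natCast hn.ne',
      rpow_neg hn.le]
    field_simp
  rw [e]
  have h2 : jb[p] ^ (-(3 + α)) ≤ onePow (-(3 / 2)) (rsq p) :=
    (one_add_rpow_le (norm_nonneg _) (by linarith)).trans (zeta_bounds h1).1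
  gcongr

theorem combine_divergence {κ P M Z g Zt D B X A Λ CX lam mu nu l K CP CH Cg dT dP dZ dH fT fP fZ : ℝ}
    (hκ : 0 ≤ κ) (hP : 0 ≤ P) (hM : 0 ≤ M) (hZ : 0 ≤ Z) (hg : 0 ≤ g) (hZt : 0 ≤ Zt)
    (hΛ : 0 ≤ Λ) (hlam : 0 < lam) (hmu : 0 ≤ mu) (hnu : 0 ≤ nu) (hl : 0 ≤ l)
    (hA : A = 1 / 2 * Λ * CX)
    (hB : B ≤ Λ * (D + P + X)) (hX : X ≤ CX * (M + Z))
    (h1 : κ * (K * P) ≤ dT + κ * (P + 1 / 4 * B))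
    (h2 : κ * (1 / 4 * M) ≤ dP + κ * (lam * g + 1 / (4 * lam) * B) + κ * (CP * (2 * P + Zt)))
    (h3 : 0 ≤ dZ + κ * (Zt + 8 * P))
    (h4 : κ * (1 / 4 * Z) ≤ dH + κ * (4 * M) + κ * (CH * Zt))
    (h5 : 0 ≤ fT) (h6 : κ * g ≤ fP + κ * (Cg * (2 * P + Zt))) (h7 : fZ = κ * Zt)
    (cM : 1 ≤ lam / 4 - 4 * mu - A) (cZ : 0 ≤ mu / 4 - A) (cg : 0 ≤ l * lam - lam ^ 2)
    (cZt : 1 ≤ l * nu - l * lam * Cg - lam * CP - nu - mu * CH)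
    (cP : 1 ≤ K - 1 - 1 / 2 * Λ - 2 * lam * CP - 8 * nu - 2 * l * lam * Cg) :
    κ * (P + M + Zt) ≤ dT + lam * dP + nu * dZ + mu * dH + l * (fT + lam * fP + nu * fZ)
      + κ * (Λ / 2 * D) := by
  have e1 := mul_le_mul_of_nonneg_left h2 hlam.le
  have e2 := mul_nonneg hnu h3
  have e3 := mul_le_mul_of_nonneg_left h4 hmu
  have e4 := mul_nonneg hl h5
  have e5 := mul_le_mul_of_nonneg_left h6 (mul_nonneg hl hlam.le)
  have e6 := mul_le_mul_of_nonneg_left hB hκ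
  have e7 := mul_le_mul_of_nonneg_left hX (mul_nonneg hκ hΛ)
  have f1 := mul_le_mul_of_nonneg_left cM (mul_nonneg hκ hM)
  have f2 := mul_nonneg (mul_nonneg hκ hZ) cZ
  have f3 := mul_nonneg (mul_nonneg hκ hg) cg
  have f4 := mul_le_mul_of_nonneg_left cZt (mul_nonneg hκ hZt)
  have f5 := mul_le_mul_of_nonneg_left cP (mul_nonneg hκ hP)
  have e8 : lam * (κ * (lam * g + 1 / (4 * lam) * B)) = κ * (lam ^ 2 * g) + κ * (1 / 4 * B) := by
    field_simp
  subst hA h7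
  linear_combination h1 + e1 + e2 + e3 + e4 + e5 + 1 / 2 * e6 + 1 / 2 * e7 + f1 + f2 + f3
    + f4 + f5 + e8

end boundedTime

section boundedTime
variable {R α : ℝ} {φ F : Scalar} {p : Spacetime}

/-- Time component of the current used on bounded time intervals. -/
def totT (R α lam mu nu : ℝ) (k : ℝ → ℝ) (φ : Scalar) (q : Spacetime) : ℝ := timeT k φ q
    + lam * pCurT R ((2 * α - 1) / 2) k φ q + nu * massT k (onePow (-(3 / 2))) φ q
    + mu * massT k (chiPow R ((2 * α - 2) / 2 + 1 / 2)) φ q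

/-- Space components of the current used on bounded time intervals. -/
def totS (R α lam mu nu : ℝ) (k : ℝ → ℝ) (φ : Scalar) (i : Fin 3) (q : Spacetime) : ℝ :=
  timeS k φ i q + lam * pCurS R ((2 * α - 1) / 2) k φ i q + nu * (fun _ _ => 0 : Fin 3 → Scalar) i q
    + mu * hardyS k (chiPow R ((2 * α - 2) / 2)) φ i q

theorem tot_facts (hR : 0 < R) {lam mu nu : ℝ} {k : ℝ → ℝ} (hk : Smooth k) (hφ : Smooth φ) :
    Smooth (totT R α lam mu nu k φ) ∧ (∀ i, Smooth (totS R α lam mu nu k φ i)) ∧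
    (∀ p, divergence (totT R α lam mu nu k φ) (totS R α lam mu nu k φ) p = divergence (timeT k φ)
        (timeS k φ) p
      + lam * divergence (pCurT R ((2 * α - 1) / 2) k φ) (pCurS R ((2 * α - 1) / 2) k φ) p
      + nu * divergence (massT k (onePow (-(3 / 2))) φ) (fun _ _ => 0) p
      + mu * divergence (massT k (chiPow R ((2 * α - 2) / 2 + 1 / 2)) φ)
          (hardyS k (chiPow R ((2 * α - 2) / 2)) φ) p) ∧
    ∀ p, fluxDens R (totT R α lam mu nu k φ) (totS R α lam mu nu k φ) p =
      1 / 2 * (k p.1 * eDens R φ p)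
      + lam * fluxDens R (pCurT R ((2 * α - 1) / 2) k φ) (pCurS R ((2 * α - 1) / 2) k φ) p
      + nu * (k p.1 * (onePow (-(3 / 2)) (rsq p) * φ p ^ 2)) := by
  refine ⟨by unfold totT; fun_prop, fun i => by unfold totS; fun_prop, fun p => ?_, fun p => ?_⟩
  · unfold totT totS
    rw [divergence_add_const_mul, divergence_add_const_mul, divergence_add_const_mul]
  · unfold totT totS
    rw [fluxDens_add_const_mul, fluxDens_add_const_mul, fluxDens_add_const_mul, fluxDens_hardy hR,
      fluxDens_mass, fluxDens_time hR, mul_zero, add_zero]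

theorem gDens_le_gDens (hR : 0 < R) {q q' : ℝ} (h : q ≤ q') :
    gDens R q φ p ≤ R ^ (q - q') * gDens R q' φ p := by
  unfold gDens
  split_ifs with hp
  · have hn : 0 < r[p] := hR.trans hp
    have e : r[p] ^ (q - 2) = r[p] ^ (q - q') * r[p] ^ (q' - 2) := by
      rw [← rpow_add hn]; congr 1; ring
    have := rpow_le_rpow_of_nonpos hR hp.le (show q - q' ≤ 0 by linarith)
    rw [e, mul_assoc]
    gcongr
  · simp

theorem leaf_time_bounds (hR : 0 < R) {τ T : ℝ} (h0 : 0 ≤ τ) (hT : τ ≤ T) (x : Space) :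
    0 ≤ (leaf R τ x).1 ∧ (leaf R τ x).1 ≤ T + ‖(leaf R τ x).2‖ := by
  have h1 := le_max_right (‖x‖ - R) 0
  have h2 : max (‖x‖ - R) 0 ≤ ‖x‖ := max_le (by linarith) (norm_nonneg x)
  simp only [leaf]
  constructor <;> linarith

theorem time_weight_lower {t r T : ℝ} (h0 : 0 < α) (ht : 0 ≤ t) (hr : 0 ≤ r) (hT : 0 ≤ T)
    (h : t ≤ T + r) : (1 + T) ^ (-(1 + α)) * (1 + r) ^ (-(1 + α)) ≤
      (1 + t ^ 2) ^ (-((1 + α) / 2)) := by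
  have e : (1 + T) ^ (-(1 + α)) * (1 + r) ^ (-(1 + α)) =
      (((1 + T) * (1 + r)) ^ 2) ^ (-((1 + α) / 2)) := by
    rw [rpow_sq (by positivity), ← Real.mul_rpow (by positivity) (by positivity)]
    congr 1; ring
  rw [e]
  apply rpow_le_rpow_of_nonpos (by positivity) _ (by linarith)
  have h1 : 1 + t ≤ (1 + T) * (1 + r) := by nlinarith
  calc 1 + t ^ 2 ≤ (1 + t) ^ 2 := by nlinarith
    _ ≤ _ := by gcongr

theorem bulkInt_add {τ₁ τ₂ : ℝ} {f g : Scalar} (hf : Measurable f) (hf0 : ∀ p, 0 ≤ f p)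
    (hg0 : ∀ p, 0 ≤ g p) :
    bulkInt R τ₁ τ₂ (fun p => f p + g p) = bulkInt R τ₁ τ₂ f + bulkInt R τ₁ τ₂ g := by
  simp only [bulkInt_eq]
  rw [← lintegral_add_left (measurable_sInt hf R)]
  simp_rw [sInt_add hf hf0 hg0]

set_option maxHeartbeats 1000000 in
/-- Estimates on bounded time intervals. -/
theorem bounded_time (hR : 0 < R) (h0 : 0 < α) (h1 : α ≤ 1 / 4) {T Λ : ℝ} (hT : 0 ≤ T)
    (hΛ : 0 ≤ Λ) : ∃ C : ℝ, 0 < C ∧ ∀ φ F : Scalar, Smooth φ →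
    ∀ τ₁ τ₂, 0 ≤ τ₁ → τ₁ ≤ τ₂ → τ₂ ≤ T →
    (∀ τ ∈ Icc τ₁ τ₂, ∀ x, SourceBound R α Λ F φ (leaf R τ x)) →
    sInt R τ₂ (eDens R φ) + sInt R τ₂ (gDens R (1 + 2 * α) φ)
      + (bulkInt R τ₁ τ₂ (iDens α φ) + bulkInt R τ₁ τ₂ (mDens R (2 * α) φ)) ≤
    ofReal C * (sInt R τ₁ (eDens R φ) + sInt R τ₁ (gDens R (1 + 2 * α) φ)
      + bulkInt R τ₁ τ₂ (fun p => F p ^ 2 * jb[p] ^ (2 * α + 1))) := by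
  obtain ⟨CX, hCX, hX⟩ := exists_goodDens_le hR (show 0 ≤ 2 * α by linarith)
  obtain ⟨CP, hCP, hP⟩ := exists_le_divergence_pCur hR (show 0 ≤ 2 * α by linarith)
    (show 2 * α ≤ 1 / 2 by linarith) (-3)
  obtain ⟨CH, hCH, hH⟩ := exists_le_divergence_hardy hR (-3) (show 2 * α ≤ 1 / 2 by linarith)
  obtain ⟨Cg, hCg, hg⟩ := exists_le_fluxDens_pCur hR (2 * α) (-3)
  set A : ℝ := 1 / 2 * Λ * CX with hA
  have hA0 : 0 ≤ A := by positivity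
  obtain ⟨mu, hmu⟩ : ∃ mu, mu = 4 * A := ⟨_, rfl⟩
  obtain ⟨lam, hlam⟩ : ∃ lam, lam = 4 * (1 + 17 * A) := ⟨_, rfl⟩
  obtain ⟨nu, hnu⟩ : ∃ nu, nu = lam * Cg + 1 := ⟨_, rfl⟩
  obtain ⟨l, hl⟩ : ∃ l, l = 1 + lam + lam * CP + nu + mu * CH := ⟨_, rfl⟩
  obtain ⟨K', hK'⟩ : ∃ K', K' = 2 + 1 / 2 * Λ + 2 * lam * CP + 8 * nu + 2 * l * lam * Cg := ⟨_, rfl⟩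
  have pmu : 0 ≤ mu := by rw [hmu]; positivity
  have plam : 0 < lam := by rw [hlam]; positivity
  have plam4 : 4 ≤ lam := by rw [hlam]; linarith
  have pnu : 0 < nu := by rw [hnu]; positivity
  have pl : 0 ≤ l := by rw [hl]; positivity
  have pK' : 0 ≤ K' := by rw [hK']; positivity
  set K : ℝ := 2 * K' * (1 + T) ^ (1 + α) / α with hK
  have pK : 0 ≤ K := by positivity
  set ε := exp (-(K * 2)) with hε
  set M := exp (K * 2) with hM
  have pε : 0 < ε := exp_pos _
  have pM : 0 < M := exp_pos _
  obtain ⟨θ, hθ⟩ : ∃ θ : ℝ, θ = 1 / (4 * Cg + 4) := ⟨_, rfl⟩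
  have pθ : 0 < θ := by rw [hθ]; positivity
  have θ1 : θ * Cg ≤ 1 / 4 - θ := by
    rw [hθ]; field_simp; linarith
  have θ2 : θ ≤ 1 / 4 := by
    have : 0 ≤ θ * Cg := by positivity
    linarith
  set c := exp (l * T) / (ε * θ) * (5 * (M * (lam + nu)) + M * (Λ / 2)) with hc
  have pc : 0 < c := by positivity
  refine ⟨c, pc, fun φ F hφ τ₁ τ₂ hτ h12 h2T hS => ?_⟩
  rcases eq_or_ne (sInt R τ₁ (eDens R φ)) ⊤ with hE | hE
  · rw [hE]; simp [ENNReal.mul_top, pc]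
  rcases eq_or_ne (sInt R τ₁ (gDens R (1 + 2 * α) φ)) ⊤ with hG | hG
  · rw [hG]; simp [ENNReal.mul_top, pc]
  set D : Scalar := fun p => F p ^ 2 * jb[p] ^ (2 * α + 1) with hD
  have hg0 : sInt R τ₁ (gDens R 0 φ) ≠ ⊤ := by
    refine ne_top_of_le_ne_top (ENNReal.mul_ne_top ofReal_ne_top hG)
      (sInt_le_const_mul (a := R ^ (0 - (1 + 2 * α))) (by positivity) fun x => ?_)
    exact gDens_le_gDens hR (by linarith)
  have hz : sInt R τ₁ (zDens R φ) ≤ 5 * sInt R τ₁ (eDens R φ) := by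
    calc _ ≤ sInt R τ₁ (eDens R φ) + sInt R τ₁ (fun p => φ p ^ 2 / (1 + rsq p)) :=
          sInt_add_le (measurable_eDens hφ)
      _ ≤ sInt R τ₁ (eDens R φ) + 4 * sInt R τ₁ (eDens R φ) := by
          gcongr; exact hardy hR hτ hφ hE hg0
      _ = _ := by ring
  have main : ∀ n : ℕ, sInt R τ₂ (fun p => cut ((n : ℝ) + 1) p.1 *
        (ε * θ * (eDens R φ p + gDens R (1 + 2 * α) φ p)))
      + (∫⁻ τ in Icc τ₁ τ₂, sInt R τ (fun p => cut ((n : ℝ) + 1) p.1 *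
        (ε * θ * (iDens α φ p + mDens R (2 * α) φ p)))) ≤
      ofReal (exp (l * τ₂)) * (ofReal (M * (lam + nu)) * sInt R τ₁ (fun p => zDens R φ p
            + gDens R (1 + 2 * α) φ p)
          + ofReal (M * (Λ / 2)) * bulkInt R τ₁ τ₂ D) := by
    intro n
    set N : ℝ := (n : ℝ) + 1
    have hN0 : 0 < N := by positivity
    set k := cutWeight α K N with hk
    have hks : Smooth k := contDiff_cutWeight α K N
    obtain ⟨t1, t2, t3, t4⟩ := tot_facts (α := α) (lam := lam) (mu := mu) (nu := nu) hR hks hφ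
    have hvan : ∀ p : Spacetime, 2 * N + 1 ≤ p.1 → k p.1 = 0 ∧ deriv k p.1 = 0 :=
      fun p hp => cutWeight_eq_zero hN0 hp
    have hkf := fun t => cutWeight_facts h0 h1 pK hN0 t
    have key := flux_inequality (R := R) (N := 2 * N + 1) (l := l) (τ₁ := τ₁) (τ₂ := τ₂)
      (J0 := totT R α lam mu nu k φ) (J := totS R α lam mu nu k φ) hR
      (t1.of_le (by simp)) (fun i => (t2 i).of_le (by simp))
      (fun p hp => by simp [totT, curT, pCurT, massT, mult, hvan p hp])
      (fun i p hp => by simp [totS, curS, pCurS, hardyS, mult, hvan p hp]) pl hτ h12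
      (lo := fun p => cut N p.1 * (ε * θ * (eDens R φ p + gDens R (1 + 2 * α) φ p)))
      (lo' := fun _ => 0)
      (up := fun p => M * (lam + nu) * (zDens R φ p + gDens R (1 + 2 * α) φ p))
      (G := fun p => cut N p.1 * (ε * θ * (iDens α φ p + mDens R (2 * α) φ p)))
      (H := fun p => M * (Λ / 2) * D p)
      (fun x => by
        have := eDens_nonneg (R := R) (φ := φ) (p := leaf R τ₂ x)
        have := gDens_nonneg (R := R) (q := 1 + 2 * α) (φ := φ) (p := leaf R τ₂ x)
        have := cut_nonneg N (leaf R τ₂ x).1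
        positivity)
      (fun x => by
        set p := leaf R τ₂ x
        obtain ⟨k0, k1, k2, -, -⟩ := hkf p.1
        have he := eDens_nonneg (R := R) (φ := φ) (p := p)
        have hgg := gDens_nonneg (R := R) (q := 1 + 2 * α) (φ := φ) (p := p)
        have a1 := hg φ hφ k p k0
        have a2 := fluxDens_pCur_nonneg (e := (2 * α - 1) / 2) hR hφ (k := k) (p := p) k0
        have a3 := mul_le_mul_of_nonneg_left (outer_lower_le (α := α) (φ := φ) (p := p) hR h1
          hCg.le).2 k0
        have hζ : 0 ≤ onePow (-(3 / 2)) (rsq p) :=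
          (by positivity : (0 : ℝ) ≤ jb[p] ^ (-3 : ℝ)).trans (zeta_bounds h1).1
        have hZ : 0 ≤ onePow (-(3 / 2)) (rsq p) * φ p ^ 2 := by positivity
        rw [t4, add_zero]
        generalize fluxDens R (pCurT R ((2 * α - 1) / 2) k φ)
          (pCurS R ((2 * α - 1) / 2) k φ) p = fP at *
        generalize onePow (-(3 / 2)) (rsq p) * φ p ^ 2 = Z at *
        have b1 := mul_le_mul_of_nonneg_left (a1.trans (add_le_add le_rfl a3)) pθ.le
        have b2 : θ * fP ≤ lam * fP := by gcongr; linarith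
        have b3 := mul_le_mul_of_nonneg_right k1 (show 0 ≤ θ * (eDens R φ p
          + gDens R (1 + 2 * α) φ p) by positivity)
        have b4 := mul_le_mul_of_nonneg_left θ1 (show 0 ≤ k p.1 * (eDens R φ p + Z) by positivity)
        have b5 : 0 ≤ k p.1 * Z * (nu - 1) := by
          have : 0 ≤ nu - 1 := by rw [hnu, add_sub_cancel_right]; positivity
          positivity
        have b6 : 0 ≤ k p.1 * Z := by positivity
        have b7 : 0 ≤ k p.1 * eDens R φ p := by positivity
        have b8 : 0 ≤ θ * (k p.1 * Z) := by positivity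
        linear_combination b1 + b2 + b3 + b4 + b5 + 3 / 4 * b6 + 1 / 4 * b7 + b8)
      (fun x => by
        set p := leaf R τ₁ x
        obtain ⟨k0, k1, k2, -, -⟩ := hkf p.1
        have he := eDens_nonneg (R := R) (φ := φ) (p := p)
        have hgg := gDens_nonneg (R := R) (q := 1 + 2 * α) (φ := φ) (p := p)
        have a1 := fluxDens_pCur_le (β := 2 * α) hR hφ (k := k) (p := p) k0
        have hs := rsq_nonneg p
        have hZ : onePow (-(3 / 2)) (rsq p) * φ p ^ 2 ≤ φ p ^ 2 / (1 + rsq p) := by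
          calc _ ≤ 1 / (1 + rsq p) * φ p ^ 2 :=
                mul_le_mul_of_nonneg_right (zeta_bounds h1).2.2 (sq_nonneg _)
            _ = _ := one_div_mul_eq_div _ _
        have hf : 0 ≤ φ p ^ 2 / (1 + rsq p) := by positivity
        rw [t4]
        simp only [zDens]
        generalize fluxDens R (pCurT R ((2 * α - 1) / 2) k φ)
          (pCurS R ((2 * α - 1) / 2) k φ) p = fP at *
        generalize onePow (-(3 / 2)) (rsq p) * φ p ^ 2 = Z at *
        generalize φ p ^ 2 / (1 + rsq p) = f at *
        generalize eDens R φ p = e at *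
        generalize gDens R (1 + 2 * α) φ p = g at *
        calc _ ≤ 1 / 2 * (k p.1 * e) + lam * (k p.1 * g) + nu * (k p.1 * f) := by gcongr
          _ ≤ (lam + nu) * (k p.1 * e) + (lam + nu) * (k p.1 * g) + (lam + nu) * (k p.1 * f) := by
            gcongr <;> linarith
          _ = k p.1 * ((lam + nu) * (e + f + g)) := by ring
          _ ≤ M * ((lam + nu) * (e + f + g)) := by gcongr
          _ = _ := by ring)
      (fun τ _ x => by
        have := iDens_nonneg (α := α) (φ := φ) (p := leaf R τ x)
        have := mDens_nonneg (R := R) (q := 2 * α) (φ := φ) (p := leaf R τ x)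
        have := cut_nonneg N (leaf R τ x).1
        positivity)
      (fun τ h x => by
        have hsb := (hS τ h x).weighted h0 hΛ
        obtain ⟨ht0, ht1⟩ := leaf_time_bounds hR (hτ.trans h.1) (h.2.trans h2T) x
        set p := leaf R τ x
        obtain ⟨k0, k1, k2, k3, k4⟩ := hkf p.1
        have hG := gradSq_nonneg φ p
        have hw : 0 < jb[p] ^ (-(1 + α)) := by positivity
        have hζ : 0 ≤ onePow (-(3 / 2)) (rsq p) :=
          (by positivity : (0 : ℝ) ≤ jb[p] ^ (-3 : ℝ)).trans (zeta_bounds h1).1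
        have hm := mDens_nonneg (R := R) (q := 2 * α) (φ := φ) (p := p)
        have hi := iDens_le_mass (φ := φ) (p := p) h0 h1
        have hi0 := iDens_nonneg (α := α) (φ := φ) (p := p)
        have lower := mul_le_mul_of_nonneg_left (outer_lower_le (α := α) (φ := φ) (p := p) hR h1
          hCP.le).1 k0
        have lower2 := mul_le_mul_of_nonneg_left (outer_lower_le (α := α) (φ := φ) (p := p) hR h1
          hCg.le).1 k0
        have i1 : k p.1 * (K' * (jb[p] ^ (-(1 + α)) * gradSq φ p)) ≤ divergence (timeT k φ)
              (timeS k φ) p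
            + k p.1 * (jb[p] ^ (-(1 + α)) * gradSq φ p
              + 1 / 4 * (box φ p ^ 2 * jb[p] ^ (2 * α + 1))) := by
          rw [divergence_time hks hφ]
          have a1 := mul_le_mul_of_nonneg_left (time_source_le (φ := φ) (p := p) h0) k0
          have a2 := time_weight_lower (r := r[p]) h0 ht0 (norm_nonneg _) hT ht1
          have a3 : K * (α * ((1 + T) ^ (-(1 + α)) * jb[p] ^ (-(1 + α)))) =
              2 * K' * jb[p] ^ (-(1 + α)) := by
            have : (1 + T) ^ (-(1 + α)) * (1 + T) ^ (1 + α) = 1 := by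
              rw [← rpow_add (by positivity)]; simp
            rw [hK]
            generalize (1 + T) ^ (-(1 + α)) = u at *
            generalize (1 + T) ^ (1 + α) = w at *
            generalize jb[p] ^ (-(1 + α)) = z at *
            calc _ = 2 * K' * z * (u * w) * (α / α) := by ring
              _ = _ := by rw [this, div_self h0.ne', mul_one, mul_one]
          have a4 : deriv k p.1 ≤ -(2 * K' * jb[p] ^ (-(1 + α))) * k p.1 := by
            refine k3.trans (mul_le_mul_of_nonneg_right (neg_le_neg ?_) k0)
            rw [← a3]
            gcongr
          have a5 := mul_le_mul_of_nonneg_right a4 hG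
          linarith
        have i2 : k p.1 * (1 / 4 * mDens R (2 * α) φ p) ≤
            divergence (pCurT R ((2 * α - 1) / 2) k φ) (pCurS R ((2 * α - 1) / 2) k φ) p
            + k p.1 * (lam * gDens R (1 + 2 * α) φ p
              + 1 / (4 * lam) * (box φ p ^ 2 * jb[p] ^ (2 * α + 1)))
            + k p.1 * (CP * (2 * (jb[p] ^ (-(1 + α)) * gradSq φ p)
              + onePow (-(3 / 2)) (rsq p) * φ p ^ 2)) := by
          have a1 := hP φ hφ k p hks k0 k4
          have a2 := mul_le_mul_of_nonneg_left (wDens_le (φ := φ) (p := p) (β := 2 * α) hR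
            (by linarith) plam) k0
          linarith
        have i3 : 0 ≤ divergence (massT k (onePow (-(3 / 2))) φ) (fun _ _ => 0) p
            + k p.1 * (onePow (-(3 / 2)) (rsq p) * φ p ^ 2
              + 8 * (jb[p] ^ (-(1 + α)) * gradSq φ p)) := by
          rw [divergence_mass hks (contDiff_onePow _) hφ]
          have hz2 := (zeta_bounds (p := p) h1).2.1
          have hT2 : pd 0 φ p ^ 2 ≤ gradSq φ p := by
            have : 0 ≤ spaceSq φ p := Finset.sum_nonneg fun _ _ => sq_nonneg _
            rw [gradSq_eq]; linarith
          have a1 : onePow (-(3 / 2)) (rsq p) * pd 0 φ p ^ 2 ≤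
              8 * jb[p] ^ (-(1 + α)) * gradSq φ p := by gcongr
          have a2 := mul_le_mul_of_nonneg_left a1 k0
          have a3 : 0 ≤ k p.1 * (onePow (-(3 / 2)) (rsq p) * (φ p - pd 0 φ p) ^ 2) := by positivity
          have a4 : 0 ≤ -deriv k p.1 * (onePow (-(3 / 2)) (rsq p) * φ p ^ 2) := by
            have : 0 ≤ -deriv k p.1 := by linarith
            positivity
          linarith
        have i4 : k p.1 * (1 / 4 * hDens R (2 * α) φ p) ≤
            divergence (massT k (chiPow R ((2 * α - 2) / 2 + 1 / 2)) φ)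
              (hardyS k (chiPow R ((2 * α - 2) / 2)) φ) p
            + k p.1 * (4 * mDens R (2 * α) φ p)
            + k p.1 * (CH * (onePow (-(3 / 2)) (rsq p) * φ p ^ 2)) := by
          refine (hH φ hφ k p hks k0 k4).trans (add_le_add le_rfl ?_)
          have := (zeta_bounds (p := p) h1).1
          gcongr
        have i6 : k p.1 * gDens R (1 + 2 * α) φ p ≤
            fluxDens R (pCurT R ((2 * α - 1) / 2) k φ) (pCurS R ((2 * α - 1) / 2) k φ) p
            + k p.1 * (Cg * (2 * (jb[p] ^ (-(1 + α)) * gradSq φ p)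
              + onePow (-(3 / 2)) (rsq p) * φ p ^ 2)) :=
          (hg φ hφ k p k0).trans (add_le_add le_rfl lower2)
        have comb := combine_divergence (κ := k p.1) k0
          (show 0 ≤ jb[p] ^ (-(1 + α)) * gradSq φ p by positivity) hm
          (hDens_nonneg (R := R) (q := 2 * α) (φ := φ) (p := p))
          (gDens_nonneg (R := R) (q := 1 + 2 * α) (φ := φ) (p := p))
          (show 0 ≤ onePow (-(3 / 2)) (rsq p) * φ p ^ 2 by positivity) hΛ plam pmu pnu.le pl hA
          hsb (hX φ p) i1 i2 i3 i4
          (show 0 ≤ 1 / 2 * (k p.1 * eDens R φ p) by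
            have := eDens_nonneg (R := R) (φ := φ) (p := p)
            positivity) i6 rfl
          (by rw [hlam, hmu]; linarith) (by rw [hmu]; linarith)
          (by
            have : lam ≤ l := by
              have : 0 ≤ lam * CP + nu + mu * CH := by positivity
              rw [hl]; linarith
            nlinarith)
          (by
            have : l * nu - l * lam * Cg = l := by rw [hnu]; ring
            rw [this, hl]; linarith)
          (by rw [hK']; linarith)
        rw [t3, t4]
        have hDp : 0 ≤ D p := by simp only [hD]; positivity
        have j1 : k p.1 * (Λ / 2 * D p) ≤ M * (Λ / 2 * D p) := by gcongr
        have j2 : cut N p.1 * (ε * θ * (iDens α φ p + mDens R (2 * α) φ p)) ≤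
            k p.1 * (jb[p] ^ (-(1 + α)) * gradSq φ p + mDens R (2 * α) φ p
              + onePow (-(3 / 2)) (rsq p) * φ p ^ 2) := by
          calc _ = cut N p.1 * ε * (θ * (iDens α φ p + mDens R (2 * α) φ p)) := by ring
            _ ≤ k p.1 * (1 * (iDens α φ p + mDens R (2 * α) φ p)) := by
              gcongr
              linarith
            _ ≤ _ := by
              refine mul_le_mul_of_nonneg_left ?_ k0
              linarith
        linarith)
    have z0 : (∫⁻ x : Space, ofReal ((fun _ : Spacetime => (0 : ℝ)) (leaf R τ₂ x))) = 0 := by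
      simp
    rw [z0, zero_add] at key
    refine key.trans (mul_le_mul_right (add_le_add ?_ ?_) _)
    · exact (sInt_const_mul (by positivity) _).le
    · exact (bulkInt_const_mul (by positivity) _).le
  have l1 := sInt_cut_tendsto (R := R) (hτ.trans h12) (((measurable_eDens (R := R) hφ).add
    (measurable_gDens (R := R) (q := 1 + 2 * α) hφ)).const_mul (ε * θ))
    (fun p => mul_nonneg (by positivity) (add_nonneg eDens_nonneg gDens_nonneg))
  have l2 := bulk_cut_tendsto (R := R) (τ₂ := τ₂) hτ (((measurable_iDens (α := α) hφ).add
    (measurable_mDens (R := R) (q := 2 * α) hφ)).const_mul (ε * θ))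
    (fun p => mul_nonneg (by positivity) (add_nonneg iDens_nonneg mDens_nonneg))
  have l3 : sInt R τ₂ (fun p => ε * θ * (eDens R φ p + gDens R (1 + 2 * α) φ p))
      + bulkInt R τ₁ τ₂ (fun p => ε * θ * (iDens α φ p + mDens R (2 * α) φ p)) ≤ _ :=
    le_of_tendsto (l1.add l2) (Filter.Eventually.of_forall main)
  rw [sInt_const_mul (by positivity), bulkInt_const_mul (by positivity),
    sInt_add (measurable_eDens hφ) (fun _ => eDens_nonneg) (fun _ => gDens_nonneg),
    bulkInt_add (measurable_iDens hφ) (fun _ => iDens_nonneg) (fun _ => mDens_nonneg),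
    ← mul_add] at l3
  have pεθ : 0 < ε * θ := by positivity
  have hfin : sInt R τ₁ (fun p => zDens R φ p + gDens R (1 + 2 * α) φ p) ≤
      5 * (sInt R τ₁ (eDens R φ) + sInt R τ₁ (gDens R (1 + 2 * α) φ)) := by
    refine (sInt_add_le (measurable_zDens hφ)).trans ?_
    rw [mul_add]
    refine add_le_add hz ?_
    calc _ = 1 * sInt R τ₁ (gDens R (1 + 2 * α) φ) := (one_mul _).symm
      _ ≤ _ := by gcongr; norm_num
  set X := sInt R τ₁ (eDens R φ) + sInt R τ₁ (gDens R (1 + 2 * α) φ)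
  calc _ = ofReal (1 / (ε * θ)) * (ofReal (ε * θ) *
        (sInt R τ₂ (eDens R φ) + sInt R τ₂ (gDens R (1 + 2 * α) φ)
      + (bulkInt R τ₁ τ₂ (iDens α φ) + bulkInt R τ₁ τ₂ (mDens R (2 * α) φ)))) := by
        rw [← mul_assoc, ← ofReal_mul (by positivity), one_div_mul_cancel pεθ.ne',
          ofReal_one, one_mul]
    _ ≤ ofReal (1 / (ε * θ)) * (ofReal (exp (l * T)) * (ofReal (M * (lam + nu)) * (5 * X)
          + ofReal (M * (Λ / 2)) * bulkInt R τ₁ τ₂ D)) := by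
        refine mul_le_mul_right (l3.trans ?_) _
        gcongr
    _ ≤ ofReal (1 / (ε * θ)) * (ofReal (exp (l * T)) *
        (ofReal (5 * (M * (lam + nu)) + M * (Λ / 2)) * (X + bulkInt R τ₁ τ₂ D))) := by
        refine mul_le_mul_right (mul_le_mul_right ?_ _) _
        rw [mul_add (ofReal (5 * (M * (lam + nu)) + M * (Λ / 2)))]
        refine add_le_add ?_ ?_
        · rw [← mul_assoc, mul_comm _ (5 : ℝ≥0∞), show (5 : ℝ≥0∞) = ofReal 5 by norm_num,
            ← ofReal_mul (by norm_num)]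
          gcongr
          have : 0 ≤ M * (Λ / 2) := by positivity
          linarith
        · gcongr
          have : 0 ≤ 5 * (M * (lam + nu)) := by positivity
          linarith
    _ = _ := by
        rw [← mul_assoc, ← mul_assoc, ← ofReal_mul (by positivity),
          ← ofReal_mul (by positivity), hc]
        congr 2
        ring

end boundedTime

section lateSource
variable {R α τ : ℝ} {φ F : Scalar} {p : Spacetime}

/-- The zeroth order term with an `r`-weight is controlled on each leaf. -/
theorem exists_sInt_hDens_le (hR : 0 < R) (α : ℝ) {β : ℝ} (hβ : β ≤ 1 / 2) :
    ∃ C : ℝ, 0 < C ∧ ∀ φ : Scalar, Smooth φ → ∀ τ, 0 ≤ τ → sInt R τ (hDens R β φ) ≤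
        ofReal C * (sInt R τ (mDens R β φ) + sInt R τ (iDens α φ)) := by
  obtain ⟨C1, hC1, h1⟩ := exists_bound_deriv_chi hR β (-(3 + α))
  obtain ⟨C2, hC2, h2⟩ := exists_bound_one_sub_chi hR (β - 2) (-(3 + α))
  refine ⟨16 + 8 * C1 + C2, by positivity, fun φ hφ τ hτ => ?_⟩
  have key : ∀ p : Spacetime, jb[p] ^ (-(3 + α)) * φ p ^ 2 ≤ iDens α φ p := by
    intro p
    have hn := norm_nonneg p.2
    have e : jb[p] ^ (3 + α) = jb[p] ^ 2 * jb[p] ^ (1 + α) := by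
      rw [← rpow_natCast, ← rpow_add (by positivity)]; congr 1; push_cast; ring
    have hg := gradSq_nonneg φ p
    rw [iDens, rpow_neg (by positivity), e, mul_inv, mul_comm, ← mul_assoc,
      ← div_eq_mul_inv, ← div_eq_mul_inv, ← div_pow]
    gcongr
    linarith
  have h3 : ∀ p : Spacetime, hDens R β φ p ≤ C2 * iDens α φ p +
      1 * (if R < r[p] then chi R (rsq p) * r[p] ^ (β - 2) * φ p ^ 2 else 0) := by
    intro p
    have hi := iDens_nonneg (α := α) (φ := φ) (p := p)
    unfold hDens
    split_ifs with hp
    · have := mul_le_mul_of_nonneg_right (h2 p hp) (sq_nonneg (φ p))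
      have := mul_le_mul_of_nonneg_left (key p) hC2.le
      linarith
    · positivity
  have h4 : ∀ p : Spacetime, 4 * gDens R β φ p
        + 2 * (deriv (chi R) (rsq p) * rsq p * r[p] ^ (β - 2) * φ p ^ 2) ≤
      4 * mDens R β φ p + 2 * C1 * iDens α φ p := by
    intro p
    have hi := iDens_nonneg (α := α) (φ := φ) (p := p)
    have ha := angSq_nonneg φ p
    have a1 : gDens R β φ p ≤ mDens R β φ p := by
      unfold gDens mDens
      split_ifs
      · gcongr
        have : 0 ≤ r[p] ^ 2 * angSq φ p := by positivity
        linarith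
      · exact le_rfl
    have a2 : deriv (chi R) (rsq p) * rsq p * r[p] ^ (β - 2) * φ p ^ 2 ≤ C1 * iDens α φ p := by
      rcases (norm_nonneg p.2).eq_or_lt with h | h
      · have : rsq p = 0 := by rw [show rsq p = r[p] ^ 2 from rfl, ← h]; norm_num
        rw [this]
        have : 0 ≤ C1 * iDens α φ p := by positivity
        simpa using this
      · have e : rsq p * r[p] ^ (β - 2) = r[p] ^ β := by
          rw [show rsq p = r[p] ^ 2 from rfl, ← rpow_natCast, ← rpow_add h]
          congr 1; push_cast; ring
        rw [mul_assoc (deriv _ _), e]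
        have := mul_le_mul_of_nonneg_right (h1 p) (sq_nonneg (φ p))
        have := mul_le_mul_of_nonneg_left (key p) hC1.le
        linarith
    linarith
  refine (sInt_le_two hC2.le zero_le_one (measurable_iDens (α := α) hφ) (h := fun p =>
    if R < r[p] then chi R (rsq p) * r[p] ^ (β - 2) * φ p ^ 2 else 0) fun x => h3 _).trans ?_
  have h5 := (hardy_outer hR hτ hφ hβ).trans (mul_le_mul_right (sInt_le_two
    (a := 4) (b := 2 * C1) (by norm_num) (by positivity) (measurable_mDens hφ)
    fun x => h4 _) _)
  calc _ ≤ ofReal C2 * sInt R τ (iDens α φ) + ofReal 1 * (ofReal 4 *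
        (ofReal 4 * sInt R τ (mDens R β φ) + ofReal (2 * C1) * sInt R τ (iDens α φ))) := by gcongr
    _ = ofReal 16 * sInt R τ (mDens R β φ) + ofReal (8 * C1 + C2) * sInt R τ (iDens α φ) := by
        rw [ofReal_one, one_mul, mul_add, ← mul_assoc, ← mul_assoc,
          ← ofReal_mul (by norm_num), ← ofReal_mul (by norm_num),
          add_left_comm, ← add_mul, ← ofReal_add hC2.le (by positivity)]
        norm_num
        ring_nf
    _ ≤ ofReal (16 + 8 * C1 + C2) * sInt R τ (mDens R β φ)
        + ofReal (16 + 8 * C1 + C2) * sInt R τ (iDens α φ) := by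
        gcongr <;> linarith
    _ = _ := (mul_add _ _ _).symm

theorem exists_sInt_goodDens_le (hR : 0 < R) (α : ℝ) {β : ℝ} (h0 : 0 ≤ β) (hβ : β ≤ 1 / 2) :
    ∃ C : ℝ, 0 < C ∧ ∀ φ : Scalar, Smooth φ → ∀ τ, 0 ≤ τ → sInt R τ (goodDens R β φ) ≤
        ofReal C * (sInt R τ (mDens R β φ) + sInt R τ (iDens α φ)) := by
  obtain ⟨C1, hC1, h1⟩ := exists_goodDens_le hR h0
  obtain ⟨C2, hC2, h2⟩ := exists_sInt_hDens_le hR α hβ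
  refine ⟨C1 + C1 * C2, by positivity, fun φ hφ τ hτ => ?_⟩
  have a1 := sInt_le_two (τ := τ) (R := R) hC1.le hC1.le (measurable_mDens (q := β) hφ)
    (fun x => (h1 φ (leaf R τ x)).trans_eq (mul_add _ _ _))
  refine a1.trans ?_
  calc _ ≤ ofReal C1 * sInt R τ (mDens R β φ) + ofReal C1 *
        (ofReal C2 * (sInt R τ (mDens R β φ) + sInt R τ (iDens α φ))) := by
        gcongr; exact h2 φ hφ τ hτ
    _ ≤ ofReal C1 * (sInt R τ (mDens R β φ) + sInt R τ (iDens α φ)) + ofReal C1 *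
        (ofReal C2 * (sInt R τ (mDens R β φ) + sInt R τ (iDens α φ))) := by
        gcongr; exact le_self_add
    _ = _ := by
        rw [← mul_assoc, ← add_mul, ← ofReal_mul hC1.le, ← ofReal_add hC1.le (by positivity)]

theorem exists_sInt_eDens_le (hR : 0 < R) {α : ℝ} (hα : 0 < α) {β : ℝ} (h0 : 0 ≤ β)
    (hβ : β ≤ 1 / 2) :
    ∃ C : ℝ, 0 < C ∧ ∀ φ : Scalar, Smooth φ → ∀ τ, 0 ≤ τ → sInt R τ (eDens R φ) ≤
        ofReal C * (sInt R τ (mDens R β φ) + sInt R τ (iDens α φ)) := by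
  obtain ⟨C1, hC1, h1⟩ := exists_sInt_goodDens_le hR α h0 hβ
  refine ⟨C1 + (1 + R) ^ (1 + α), by positivity, fun φ hφ τ hτ => ?_⟩
  have key : ∀ p : Spacetime, eDens R φ p ≤
      (1 + R) ^ (1 + α) * iDens α φ p + 1 * goodDens R β φ p := by
    intro p
    have hi := iDens_nonneg (α := α) (φ := φ) (p := p)
    have ha := angSq_nonneg φ p
    have hn := norm_nonneg p.2
    unfold eDens goodDens
    split_ifs with hp
    · have : 1 ≤ jb[p] ^ β := one_le_rpow (by linarith) h0
      have : 0 ≤ (1 + R) ^ (1 + α) * iDens α φ p := by positivity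
      nlinarith [sq_nonneg (dv φ p)]
    · rw [mul_zero, add_zero, iDens, mul_div_assoc']
      rw [le_div_iff₀ (by positivity), mul_comm]
      have : gradSq φ p ≤ gradSq φ p + (φ p / jb[p]) ^ 2 := by
        have := sq_nonneg (φ p / jb[p]); linarith
      have h3 := gradSq_nonneg φ p
      push Not at hp
      gcongr
  refine (sInt_le_two (by positivity) zero_le_one (measurable_iDens hφ) fun x => key _).trans ?_
  rw [ofReal_one, one_mul, ofReal_add hC1.le (by positivity), add_mul, add_comm]
  gcongr
  · exact h1 φ hφ τ hτ
  · exact le_add_self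

/-- Bounds for `□φ` at late times; `s` is `1 + τ`. -/
def LateSource (R α Λ s : ℝ) (F φ : Scalar) (p : Spacetime) : Prop :=
  box φ p ^ 2 ≤ Λ * (F p ^ 2 + jb[p] ^ (-2 - 6 * α) * gradSq φ p
    + if R < r[p] then s ^ (-1 - 8 * α) * (jb[p] ^ (-1 : ℝ) * good[φ, p]) else 0)

theorem le_add_of_sq_le_mul {x a b : ℝ} (ha : 0 ≤ a) (hb : 0 ≤ b) (h : x ^ 2 ≤ a * b) :
    x ≤ a + b := by
  refine le_of_sq_le_sq ?_ (by positivity)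
  nlinarith [mul_nonneg ha hb]

theorem full_weight_le {β r s : ℝ} (hα : 0 < α) (h1 : α ≤ 1 / 4) (hβ : 0 ≤ β)
    (hβα : β ≤ 2 * α) (hs : 1 ≤ s) (hr : 0 < r) :
    s ^ (α - 1) * (r ^ (2 * β) * (1 + r) ^ (-1 - 5 * α)) ≤
      2 * s ^ (-(2 * α)) * r ^ (β - 2) + s ^ (-1 - 2 * α) * r ^ (β - 1) := by
  have hs0 : 0 < s := by linarith
  have a1 : r ^ (2 * β) * (1 + r) ^ (-1 - 5 * α) ≤ r ^ β * (1 + r) ^ (-1 - 3 * α) := by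
    have e : r ^ (2 * β) = r ^ β * r ^ β := by rw [← rpow_add hr]; congr 1; ring
    have b1 : r ^ β ≤ (1 + r) ^ β := rpow_le_rpow hr.le (by linarith) hβ
    have b2 : (1 + r) ^ β * (1 + r) ^ (-1 - 5 * α) ≤ (1 + r) ^ (-1 - 3 * α) := by
      rw [← rpow_add (by positivity)]
      exact one_add_rpow_le hr.le (by linarith)
    rw [e, mul_assoc]
    gcongr
    exact (mul_le_mul_of_nonneg_right b1 (by positivity)).trans b2
  have n1 : 0 < s ^ (-(2 * α)) * r ^ (β - 2) := by positivity
  have n2 : 0 < s ^ (-1 - 2 * α) * r ^ (β - 1) := by positivity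
  have a2 := mul_le_mul_of_nonneg_left a1 (show 0 ≤ s ^ (α - 1) by positivity)
  refine a2.trans ?_
  rcases le_total r s with h | h
  · have e : r ^ β = r ^ (β - 2) * r ^ 2 := by
      rw [← rpow_natCast, ← rpow_add hr]; congr 1; push_cast; ring
    have b1 : r ^ 2 * (1 + r) ^ (-1 - 3 * α) ≤ 2 * s ^ (1 - 3 * α) := by
      calc _ ≤ (1 + r) ^ 2 * (1 + r) ^ (-1 - 3 * α) := by gcongr; linarith
        _ = (1 + r) ^ (1 - 3 * α) := by
          rw [← rpow_natCast, ← rpow_add (by positivity)]; congr 1; push_cast; ring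
        _ ≤ (2 * s) ^ (1 - 3 * α) := rpow_le_rpow (by positivity) (by linarith) (by linarith)
        _ = 2 ^ (1 - 3 * α) * s ^ (1 - 3 * α) := Real.mul_rpow (by norm_num) hs0.le
        _ ≤ 2 ^ (1 : ℝ) * s ^ (1 - 3 * α) := by
          gcongr
          · norm_num
          · linarith
        _ = _ := by rw [Real.rpow_one]
    have e2 : s ^ (α - 1) * s ^ (1 - 3 * α) = s ^ (-(2 * α)) := by
      rw [← rpow_add hs0]; congr 1; ring
    calc _ = s ^ (α - 1) * r ^ (β - 2) * (r ^ 2 * (1 + r) ^ (-1 - 3 * α)) := by rw [e]; ring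
      _ ≤ s ^ (α - 1) * r ^ (β - 2) * (2 * s ^ (1 - 3 * α)) := by gcongr
      _ = 2 * s ^ (-(2 * α)) * r ^ (β - 2) := by rw [← e2]; ring
      _ ≤ _ := by linarith
  · have e : r ^ β = r ^ (β - 1) * r := by
      rw [← rpow_add_one hr.ne']; congr 1; ring
    have b1 : r * (1 + r) ^ (-1 - 3 * α) ≤ s ^ (-(3 * α)) := by
      calc _ ≤ (1 + r) * (1 + r) ^ (-1 - 3 * α) := by gcongr; linarith
        _ = (1 + r) ^ (-(3 * α)) := by
          nth_rw 1 [← Real.rpow_one (1 + r)]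
          rw [← rpow_add (by positivity)]; congr 1; ring
        _ ≤ _ := rpow_le_rpow_of_nonpos hs0 (by linarith) (by linarith)
    have e2 : s ^ (α - 1) * s ^ (-(3 * α)) = s ^ (-1 - 2 * α) := by
      rw [← rpow_add hs0]; congr 1; ring
    calc _ = s ^ (α - 1) * r ^ (β - 1) * (r * (1 + r) ^ (-1 - 3 * α)) := by rw [e]; ring
      _ ≤ s ^ (α - 1) * r ^ (β - 1) * s ^ (-(3 * α)) := by gcongr
      _ = s ^ (-1 - 2 * α) * r ^ (β - 1) := by rw [← e2]; ring
      _ ≤ _ := by linarith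

theorem wDens_le_late {β s f Λ : ℝ} (hR : 0 < R) (hα : 0 < α) (h1 : α ≤ 1 / 4) (hβ : 0 ≤ β)
    (hβα : β ≤ 2 * α) (hs : 1 ≤ s) (hf0 : 0 ≤ f) (hΛ : 0 ≤ Λ)
    (hf : ∀ r, 0 < r → r ^ (2 * β) ≤ f * r ^ (2 * α + 1) *
      (s ^ (-α) * r ^ (β - 2) + s ^ (-1 - α / 2) * r ^ (β - 1)))
    (hL : LateSource R α Λ s F φ p) :
    wDens R β φ p ≤ (1 + Λ) * (3 * (s ^ (-α) * mDens R β φ p)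
      + 3 * (s ^ (-1 - α / 2) * gDens R (1 + β) φ p) + s ^ (1 - α) * iDens α φ p
      + s ^ (-α) * goodDens R β φ p + f * (F p ^ 2 * jb[p] ^ (2 * α + 1))) := by
  have hs0 : 0 < s := by linarith
  by_cases hp : R < r[p]
  swap
  · have := iDens_nonneg (α := α) (φ := φ) (p := p)
    simp only [wDens, mDens, gDens, goodDens, if_neg hp]
    have : 0 ≤ 1 + Λ := by linarith
    positivity
  rw [LateSource, if_pos hp] at hL
  have hr : 0 < r[p] := hR.trans hp
  have ha := angSq_nonneg φ p
  have hg := gradSq_nonneg φ p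
  have hi : jb[p] ^ (-1 - α) * gradSq φ p ≤ iDens α φ p := by
    rw [iDens, div_eq_mul_inv, ← rpow_neg (by positivity), mul_comm, show -(1 + α) = -1 - α by ring]
    gcongr
    have := sq_nonneg (φ p / jb[p]); linarith
  have hm : r[p] ^ (β - 2) * yDer φ p ^ 2 ≤ mDens R β φ p := by
    rw [mDens, if_pos hp]
    gcongr
    have : 0 ≤ r[p] ^ 2 * angSq φ p := by positivity
    linarith
  have hgd : gDens R (1 + β) φ p = r[p] ^ (β - 1) * yDer φ p ^ 2 := by
    rw [gDens, if_pos hp]; congr 2; ring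
  have hgo : goodDens R β φ p = jb[p] ^ β * good[φ, p] := by
    rw [goodDens, if_pos hp]
  rw [wDens, if_pos hp]
  have hfw := full_weight_le (α := α) hα h1 hβ hβα hs hr
  have hff := hf _ hr
  rw [hgd, hgo]
  generalize r[p] = r at *
  have hG : 0 ≤ dv φ p ^ 2 + angSq φ p := by positivity
  generalize dv φ p ^ 2 + angSq φ p = G at *
  generalize yDer φ p = y at *
  generalize iDens α φ p = I at *
  generalize mDens R β φ p = M at *
  generalize gradSq φ p = e at *
  generalize F p = F' at *
  have er : r ^ (2 * β) = r ^ β * r ^ β := by rw [← rpow_add hr]; congr 1; ring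
  have eb : r ^ β = r ^ (β - 1) * r := by
    rw [← rpow_add_one hr.ne']; congr 1; ring
  set A := s ^ (1 - α) * ((1 + r) ^ (-1 - α) * e) + s ^ (-α) * ((1 + r) ^ β * G)
    + f * (F' ^ 2 * r ^ (2 * α + 1)) with hA
  set B := 3 * (s ^ (-α) * (r ^ (β - 2) * y ^ 2)) + 3 * (s ^ (-1 - α / 2) * (r ^ (β - 1) * y ^ 2))
    with hB
  have hA0 : 0 ≤ A := by positivity
  have hB0 : 0 ≤ B := by positivity
  have m1 : s ^ (-1 - 2 * α) ≤ s ^ (-1 - α / 2) := rpow_le_rpow_of_exponent_le hs (by linarith)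
  have m2 : s ^ (-(2 * α)) ≤ s ^ (-α) := rpow_le_rpow_of_exponent_le hs (by linarith)
  have m3 : s ^ (-1 - α) ≤ s ^ (-1 - α / 2) := rpow_le_rpow_of_exponent_le hs (by linarith)
  have t1 : r ^ (2 * β) * y ^ 2 * F' ^ 2 ≤ f * (F' ^ 2 * r ^ (2 * α + 1)) * B := by
    calc _ ≤ f * r ^ (2 * α + 1) * (s ^ (-α) * r ^ (β - 2) + s ^ (-1 - α / 2) * r ^ (β - 1))
          * y ^ 2 * F' ^ 2 := by gcongr
      _ = f * (F' ^ 2 * r ^ (2 * α + 1)) * (s ^ (-α) * (r ^ (β - 2) * y ^ 2)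
          + s ^ (-1 - α / 2) * (r ^ (β - 1) * y ^ 2)) := by ring
      _ ≤ _ := by
          refine mul_le_mul_of_nonneg_left ?_ (by positivity)
          have : 0 ≤ s ^ (-α) * (r ^ (β - 2) * y ^ 2) := by positivity
          have : 0 ≤ s ^ (-1 - α / 2) * (r ^ (β - 1) * y ^ 2) := by positivity
          linarith
  have t2 : r ^ (2 * β) * y ^ 2 * ((1 + r) ^ (-2 - 6 * α) * e) ≤
      s ^ (1 - α) * ((1 + r) ^ (-1 - α) * e) * B := by
    have e1 : (1 + r) ^ (-2 - 6 * α) = (1 + r) ^ (-1 - α) * (1 + r) ^ (-1 - 5 * α) := by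
      rw [← rpow_add (by positivity)]; congr 1; ring
    have e2 : s ^ (1 - α) * s ^ (α - 1) = 1 := by rw [← rpow_add hs0]; simp
    calc _ = s ^ (1 - α) * s ^ (α - 1) * (r ^ (2 * β) * y ^ 2 * ((1 + r) ^ (-2 - 6 * α) * e)) := by
          rw [e2, one_mul]
      _ = s ^ (1 - α) * ((1 + r) ^ (-1 - α) * e) *
          (s ^ (α - 1) * (r ^ (2 * β) * (1 + r) ^ (-1 - 5 * α)) * y ^ 2) := by rw [e1]; ring
      _ ≤ s ^ (1 - α) * ((1 + r) ^ (-1 - α) * e) *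
          ((2 * s ^ (-(2 * α)) * r ^ (β - 2) + s ^ (-1 - 2 * α) * r ^ (β - 1)) * y ^ 2) := by
          gcongr
      _ = s ^ (1 - α) * ((1 + r) ^ (-1 - α) * e) * (2 * (s ^ (-(2 * α)) * (r ^ (β - 2) * y ^ 2))
          + s ^ (-1 - 2 * α) * (r ^ (β - 1) * y ^ 2)) := by ring
      _ ≤ s ^ (1 - α) * ((1 + r) ^ (-1 - α) * e) * (3 * (s ^ (-α) * (r ^ (β - 2) * y ^ 2))
          + 3 * (s ^ (-1 - α / 2) * (r ^ (β - 1) * y ^ 2))) := by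
          refine mul_le_mul_of_nonneg_left (add_le_add (by gcongr; norm_num) ?_) (by positivity)
          calc _ ≤ 1 * (s ^ (-1 - α / 2) * (r ^ (β - 1) * y ^ 2)) := by rw [one_mul]; gcongr
            _ ≤ _ := by gcongr; norm_num
  have t3 : r ^ (2 * β) * y ^ 2 * (s ^ (-1 - 8 * α) * ((1 + r) ^ (-1 : ℝ) * G)) ≤
      s ^ (-α) * ((1 + r) ^ β * G) * B := by
    have e1 : s ^ (-1 - 8 * α) = s ^ (-1 - α) * s ^ (-(7 * α)) := by
      rw [← rpow_add hs0]; congr 1; ring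
    have m4 : s ^ (-(7 * α)) ≤ s ^ (-α) := rpow_le_rpow_of_exponent_le hs (by linarith)
    have e2 : r * (1 + r) ^ (-1 : ℝ) ≤ 1 := by
      rw [Real.rpow_neg_one, ← div_eq_mul_inv, div_le_one (by positivity)]; linarith
    have e3 : r ^ β ≤ (1 + r) ^ β := rpow_le_rpow hr.le (by linarith) hβ
    calc _ = s ^ (-(7 * α)) * (r ^ β * G) * (s ^ (-1 - α) * (r ^ (β - 1) * y ^ 2))
          * (r * (1 + r) ^ (-1 : ℝ)) := by rw [er, e1]; nth_rw 1 [eb]; ring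
      _ ≤ s ^ (-α) * ((1 + r) ^ β * G) * (s ^ (-1 - α / 2) * (r ^ (β - 1) * y ^ 2)) * 1 := by
          gcongr
      _ ≤ _ := by
          rw [mul_one]
          refine mul_le_mul_of_nonneg_left ?_ (by positivity)
          have : 0 ≤ s ^ (-α) * (r ^ (β - 2) * y ^ 2) := by positivity
          have : 0 ≤ s ^ (-1 - α / 2) * (r ^ (β - 1) * y ^ 2) := by positivity
          linarith
  have hX : (r ^ β * |y| * |box φ p|) ^ 2 ≤ ((1 + Λ) * A) * ((1 + Λ) * B) := by
    calc _ = r ^ (2 * β) * y ^ 2 * box φ p ^ 2 := by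
          rw [mul_pow, mul_pow, sq_abs, sq_abs, er]; ring
      _ ≤ r ^ (2 * β) * y ^ 2 * (Λ * (F' ^ 2 + (1 + r) ^ (-2 - 6 * α) * e
          + s ^ (-1 - 8 * α) * ((1 + r) ^ (-1 : ℝ) * G))) := by gcongr
      _ = Λ * (r ^ (2 * β) * y ^ 2 * F' ^ 2 + r ^ (2 * β) * y ^ 2 * ((1 + r) ^ (-2 - 6 * α) * e)
          + r ^ (2 * β) * y ^ 2 * (s ^ (-1 - 8 * α) * ((1 + r) ^ (-1 : ℝ) * G))) := by ring
      _ ≤ Λ * (A * B) := by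
          refine mul_le_mul_of_nonneg_left ?_ hΛ
          rw [hA, add_mul, add_mul]
          linarith
      _ ≤ (1 + Λ) ^ 2 * (A * B) := by
          have : 0 ≤ A * B := by positivity
          gcongr; nlinarith
      _ = _ := by ring
  refine (le_add_of_sq_le_mul (by positivity) (by positivity) hX).trans ?_
  rw [← mul_add]
  refine mul_le_mul_of_nonneg_left ?_ (by positivity)
  have l1 : s ^ (1 - α) * ((1 + r) ^ (-1 - α) * e) ≤ s ^ (1 - α) * I := by gcongr
  have l2 : s ^ (-α) * (r ^ (β - 2) * y ^ 2) ≤ s ^ (-α) * M := by gcongr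
  have l3 : f * (F' ^ 2 * r ^ (2 * α + 1)) ≤ f * (F' ^ 2 * (1 + r) ^ (2 * α + 1)) := by
    gcongr; linarith
  rw [hA, hB]
  linarith

end lateSource

section absorption

theorem lintegral_Icc_deriv {F f : ℝ → ℝ} {a b : ℝ} (hab : a ≤ b)
    (hF : ∀ x ∈ Icc a b, HasDerivAt F (f x) x) (hf : ContinuousOn f (Icc a b))
    (h0 : ∀ x ∈ Icc a b, 0 ≤ f x) :
    (∫⁻ x in Icc a b, ofReal (f x)) = ofReal (F b - F a) := by
  rw [← ofReal_integral_eq_lintegral_ofReal (hf.integrableOn_compact isCompact_Icc)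
    ((ae_restrict_iff' measurableSet_Icc).2 (Filter.Eventually.of_forall h0)),
    integral_Icc_eq_integral_Ioc, ← intervalIntegral.integral_of_le hab,
    intervalIntegral.integral_eq_sub_of_hasDerivAt]
  · rwa [uIcc_of_le hab]
  · exact (hf.mono (by rw [uIcc_of_le hab])).intervalIntegrable

theorem continuousOn_one_add_rpow {a b : ℝ} (ha : 0 ≤ a) (c γ : ℝ) :
    ContinuousOn (fun s : ℝ => c * (1 + s) ^ γ) (Icc a b) := by
  refine continuousOn_const.mul (ContinuousOn.rpow_const (by fun_prop) fun x hx => Or.inl ?_)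
  have := hx.1
  linarith

theorem lintegral_rpow_le {a b γ : ℝ} (ha : 0 ≤ a) (hab : a ≤ b) (hγ : 0 < γ) :
    (∫⁻ s in Icc a b, tw[s, -1 - γ]) ≤ ofReal (1 / γ * (1 + a) ^ (-γ)) := by
  have h := lintegral_Icc_deriv (F := fun s => -(1 / γ) * (1 + s) ^ (-γ))
    (f := fun s => 1 * (1 + s) ^ (-1 - γ)) hab (fun x hx => by
      have := (hasDerivAt_one_add_rpow (s := x) (e := -γ) (by linarith [ha.trans hx.1])).const_mul (-(1 / γ))
      refine this.congr_deriv ?_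
      rw [show -1 - γ = -γ - 1 by ring]
      field_simp) (continuousOn_one_add_rpow ha 1 _)
    (fun x hx => by have := ha.trans hx.1; positivity)
  simp only [one_mul] at h
  rw [h]
  refine ofReal_le_ofReal ?_
  have : 0 ≤ 1 / γ * (1 + b) ^ (-γ) := by have := ha.trans hab; positivity
  linarith

/-- Integration of a weight against tails. -/
theorem lintegral_weight_mul {a b γ : ℝ} (ha : 0 ≤ a) (hγ : 0 ≤ γ) {h : ℝ → ℝ≥0∞}
    (hh : Measurable h) :
    (∫⁻ s in Icc a b, tw[s, γ] * h s) = tw[a, γ] * (∫⁻ s in Icc a b, h s)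
        + ∫⁻ τ in Icc a b, ofReal (γ * (1 + τ) ^ (γ - 1)) * ∫⁻ s in Icc τ b, h s := by
  have hρ : Measurable (fun τ : ℝ => ofReal (γ * (1 + τ) ^ (γ - 1))) := by fun_prop
  set ρ := fun τ : ℝ => ofReal (γ * (1 + τ) ^ (γ - 1)) with hρd
  have h1 : ∀ s ∈ Icc a b, tw[s, γ] * h s = tw[a, γ] * h s
        + ∫⁻ τ in Icc a b, if τ ≤ s then ρ τ * h s else 0 := by
    intro s hs
    have e1 : (∫⁻ τ in Icc a b, if τ ≤ s then ρ τ * h s else 0) = (∫⁻ τ in Icc a s, ρ τ) * h s := by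
      rw [← lintegral_mul_const _ hρ, ← lintegral_indicator measurableSet_Icc,
        ← lintegral_indicator measurableSet_Icc]
      refine lintegral_congr fun τ => ?_
      simp only [indicator, mem_Icc]
      have := hs.2
      by_cases c1 : a ≤ τ <;> by_cases c2 : τ ≤ s <;> simp [c1, c2]
      intro; linarith
    have e2 := lintegral_Icc_deriv (F := fun s => (1 + s) ^ γ) hs.1
      (fun x hx => hasDerivAt_one_add_rpow (by linarith [ha.trans hx.1])) (continuousOn_one_add_rpow ha _ _)
      (fun x hx => by have := ha.trans hx.1; positivity)
    have e3 : (1 + a) ^ γ ≤ (1 + s) ^ γ := rpow_le_rpow (by linarith) (by linarith [hs.1]) hγ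
    rw [e1, e2, ← add_mul, ← ofReal_add (by positivity) (by linarith)]
    congr 2
    ring
  rw [setLIntegral_congr_fun measurableSet_Icc h1,
    lintegral_add_left (hh.const_mul _), lintegral_const_mul _ hh]
  congr 1
  rw [lintegral_lintegral_swap]
  · refine lintegral_congr_ae ((ae_restrict_iff' measurableSet_Icc).2
      (Filter.Eventually.of_forall fun τ hτ => ?_))
    beta_reduce
    rw [← lintegral_const_mul _ hh, ← lintegral_indicator measurableSet_Icc,
      ← lintegral_indicator measurableSet_Icc]
    refine lintegral_congr fun s => ?_
    simp only [indicator, mem_Icc]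
    have := hτ.1
    by_cases c1 : a ≤ s <;> by_cases c2 : τ ≤ s <;> simp [c1, c2, hρd]
    intro; linarith
  · refine Measurable.aemeasurable ?_
    exact Measurable.ite (measurableSet_le measurable_snd measurable_fst)
      ((hρ.comp measurable_snd).mul (hh.comp measurable_fst)) measurable_const

theorem exists_rpow_neg_le {γ ε : ℝ} (hγ : 0 < γ) (hε : 0 < ε) :
    ∃ T : ℝ, 0 ≤ T ∧ ∀ a, T ≤ a → (1 + a) ^ (-γ) ≤ ε := by
  have h := (tendsto_rpow_neg_atTop hγ).eventually (ge_mem_nhds hε)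
  obtain ⟨T, hT⟩ := Filter.eventually_atTop.1 h
  refine ⟨max T 0, le_max_right _ _, fun a ha => hT _ ?_⟩
  have := (le_max_left T 0).trans ha
  linarith

theorem absorb_linear {C1 C2 C3 κ l : ℝ≥0} {N W M G : ℝ≥0∞} (hW : W ≠ ⊤) (hM : M ≠ ⊤)
    (hG : G ≠ ⊤) (h1 : W ≤ C1 * (N + κ * (C3 * (M + W))))
    (h2 : G ≤ C2 * (N + C1 * N + κ * M + l * G + W))
    (h3 : M ≤ C2 * (N + C1 * N + κ * M + l * G + W))
    (s1 : 2 * (C1 * C3 * κ) ≤ 1) (s2 : 32 * (C2 * C1 * C3 * κ) ≤ 1) (s3 : 16 * (C2 * κ) ≤ 1)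
    (s4 : 8 * (C2 * l) ≤ 1) :
    G + M + W ≤ (1 + 6 * C1 + 12 * C2 + 16 * C1 * C2 : ℝ≥0) * N := by
  rcases eq_or_ne N ⊤ with rfl | hN
  · rw [ENNReal.mul_top (by positivity)]; exact le_top
  lift W to ℝ≥0 using hW
  lift M to ℝ≥0 using hM
  lift G to ℝ≥0 using hG
  lift N to ℝ≥0 using hN
  norm_cast at *
  rw [← NNReal.coe_le_coe] at *
  push_cast at *
  have n1 := C1.2
  have n2 := C2.2
  have n3 := C3.2
  have n4 := κ.2
  have n5 := l.2
  have n6 := W.2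
  have n7 := M.2
  have n8 := G.2
  have n9 := N.2
  simp only [NNReal.val_eq_coe] at *
  generalize (C1 : ℝ) = C1 at *
  generalize (C2 : ℝ) = C2 at *
  generalize (C3 : ℝ) = C3 at *
  generalize (κ : ℝ) = κ at *
  generalize (l : ℝ) = l at *
  generalize (W : ℝ) = W at *
  generalize (M : ℝ) = M at *
  generalize (G : ℝ) = G at *
  generalize (N : ℝ) = N at *
  have a1 : W ≤ 2 * C1 * N + 2 * (C1 * C3 * κ) * M := by
    have := mul_le_mul_of_nonneg_right s1 n6
    linarith
  have a2 : C2 * W ≤ C2 * (2 * C1 * N + 2 * (C1 * C3 * κ) * M) := mul_le_mul_of_nonneg_left a1 n2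
  have a3 := mul_le_mul_of_nonneg_right s2 n7
  have a4 := mul_le_mul_of_nonneg_right s3 n7
  have a5 := mul_le_mul_of_nonneg_right s4 n8
  have a6 := mul_le_mul_of_nonneg_right s1 n7
  have b1 : 0 ≤ C2 * N := by positivity
  have b2 : 0 ≤ C1 * C2 * N := by positivity
  have b3 : 0 ≤ C1 * N := by positivity
  linarith

end absorption

section absorption

theorem ofReal_rpow_mul {x u v : ℝ} (hx : 0 < x) :
    ofReal (x ^ u) * ofReal (x ^ v) = ofReal (x ^ (u + v)) := by
  rw [← ofReal_mul (by positivity), rpow_add hx]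

theorem lintegral_weight_tail_le {α a b : ℝ} (h0 : 0 < α) (h1 : α ≤ 1) (ha : 0 ≤ a) (hab : a ≤ b)
    {C1 : ℝ≥0} {E i d m : ℝ → ℝ≥0∞} (hi : Measurable i) (hd : Measurable d)
    (hm : Measurable m) (hI : ∀ τ ∈ Icc a b, (∫⁻ s in Icc τ b, i s) ≤ C1 * (E τ
      + (∫⁻ s in Icc τ b, d s)
      + ∫⁻ s in Icc τ b, tw[s, -1 - 8 * α] * m s)) :
    (∫⁻ s in Icc a b, tw[s, 1 - α] * i s) ≤
      C1 * ((tw[a, 1 - α] * E a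
        + (∫⁻ s in Icc a b, tw[s, 1 - α] * d s)
        + ∫⁻ s in Icc a b, tw[s, -(9 * α)] * m s)
        + ∫⁻ s in Icc a b, tw[s, -α] * E s) := by
  have hw : Measurable (fun s : ℝ => tw[s, -1 - 8 * α] * m s) := by fun_prop
  set h : ℝ → ℝ≥0∞ := fun s => d s + tw[s, -1 - 8 * α] * m s with hh
  have mh : Measurable h := hd.add hw
  have eh : ∀ τ, (∫⁻ s in Icc τ b, h s) = (∫⁻ s in Icc τ b, d s)
      + ∫⁻ s in Icc τ b, tw[s, -1 - 8 * α] * m s := fun τ =>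
    lintegral_add_left hd _
  have e1 : (∫⁻ s in Icc a b, tw[s, 1 - α] * h s) =
      (∫⁻ s in Icc a b, tw[s, 1 - α] * d s)
        + ∫⁻ s in Icc a b, tw[s, -(9 * α)] * m s := by
    rw [← lintegral_add_left (by fun_prop)]
    refine setLIntegral_congr_fun measurableSet_Icc fun s hs => ?_
    have : 0 < 1 + s := by linarith [ha.trans hs.1]
    simp only [hh]
    rw [mul_add, ← mul_assoc, ofReal_rpow_mul this]
    congr 4
    ring
  have hI' : ∀ τ ∈ Icc a b, (∫⁻ s in Icc τ b, i s) ≤ C1 * (E τ + ∫⁻ s in Icc τ b, h s) := by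
    intro τ hτ
    rw [eh, ← add_assoc]
    exact hI τ hτ
  have hγ : 0 ≤ 1 - α := by linarith
  have mtail : Measurable fun τ => ofReal ((1 - α) * (1 + τ) ^ (1 - α - 1)) *
      ∫⁻ s in Icc τ b, h s := by
    have anti : Antitone fun τ => ∫⁻ s in Icc τ b, h s := fun x y hxy =>
      lintegral_mono_set (Icc_subset_Icc_left hxy)
    exact Measurable.mul (by fun_prop) anti.measurable
  rw [lintegral_weight_mul ha hγ hi]
  have e2 := lintegral_weight_mul (b := b) ha hγ mh
  rw [e1] at e2
  calc _ ≤ tw[a, 1 - α] * (C1 * (E a + ∫⁻ s in Icc a b, h s))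
        + ∫⁻ τ in Icc a b, (C1 * (ofReal ((1 - α) * (1 + τ) ^ (1 - α - 1)) *
            (∫⁻ s in Icc τ b, h s) + tw[τ, -α] * E τ)) := by
        refine add_le_add (mul_le_mul_right (hI' a ⟨le_rfl, hab⟩) _)
          (bulkInt_mono_of_mem fun τ hτ => ?_)
        · have hτ0 : 0 < 1 + τ := by linarith [ha.trans hτ.1]
          have e3 : ofReal ((1 - α) * (1 + τ) ^ (1 - α - 1)) ≤
              tw[τ, -α] := by
            refine ofReal_le_ofReal ?_
            rw [show 1 - α - 1 = -α by ring]
            have : 0 < (1 + τ) ^ (-α) := by positivity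
            nlinarith
          calc _ ≤ ofReal ((1 - α) * (1 + τ) ^ (1 - α - 1)) *
                (C1 * (E τ + ∫⁻ s in Icc τ b, h s)) := by gcongr; exact hI' τ hτ
            _ = C1 * (ofReal ((1 - α) * (1 + τ) ^ (1 - α - 1)) *
                (∫⁻ s in Icc τ b, h s) + ofReal ((1 - α) * (1 + τ) ^ (1 - α - 1)) * E τ) := by
                ring
            _ ≤ _ := by gcongr
    _ = C1 * (tw[a, 1 - α] * E a
        + (tw[a, 1 - α] * (∫⁻ s in Icc a b, h s)
        + ∫⁻ τ in Icc a b, ofReal ((1 - α) * (1 + τ) ^ (1 - α - 1)) *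
            (∫⁻ s in Icc τ b, h s)) + ∫⁻ s in Icc a b, tw[s, -α] * E s) := by
        rw [lintegral_const_mul' _ _ ENNReal.coe_ne_top, lintegral_add_left mtail]
        ring
    _ = _ := by rw [← e2]; ring

/-- Closing the coupled estimates at late times. -/
theorem late_absorption {α : ℝ} (h0 : 0 < α) (h1 : α ≤ 1) (C1 C2 C3 : ℝ≥0) :
    ∃ (T : ℝ) (C : ℝ≥0), 0 ≤ T ∧ ∀ a b : ℝ, T ≤ a → a ≤ b → ∀ (E g m i d n : ℝ → ℝ≥0∞) (D : ℝ≥0∞),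
    Measurable m → Measurable i → Measurable d → Measurable n →
    (∀ τ τ', a ≤ τ → τ ≤ τ' → τ' ≤ b → E τ' + (∫⁻ s in Icc τ τ', i s) ≤ C1 * (E τ
      + (∫⁻ s in Icc τ τ', d s)
      + ∫⁻ s in Icc τ τ', tw[s, -1 - 8 * α] * n s)) →
    (∀ τ', a ≤ τ' → τ' ≤ b → g τ' + (∫⁻ s in Icc a τ', m s) ≤ C2 * (g a + E τ'
      + (∫⁻ s in Icc a b, tw[s, -α] * m s)
      + (∫⁻ s in Icc a b, tw[s, -1 - α / 2] * g s)
      + (∫⁻ s in Icc a b, tw[s, 1 - α] * i s) + D)) →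
    (∀ τ ∈ Icc a b, E τ ≤ C3 * (m τ + i τ)) →
    (⨆ τ ∈ Icc a b, g τ) ≠ ⊤ → (∫⁻ s in Icc a b, m s) ≠ ⊤ → (∫⁻ s in Icc a b, i s) ≠ ⊤ →
    (⨆ τ ∈ Icc a b, g τ) + (∫⁻ s in Icc a b, m s)
      + (∫⁻ s in Icc a b, tw[s, 1 - α] * i s) ≤
    C * (g a + tw[a, 1 - α] * E a
      + (∫⁻ s in Icc a b, tw[s, 1 - α] * d s)
      + (∫⁻ s in Icc a b, tw[s, -(9 * α)] * n s) + D) := by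
  set ε : ℝ≥0 := 1 / (1 + 2 * (C1 * C3) + 32 * (C2 * C1 * C3) + 16 * C2
    + 16 * C2 * (1 / α).toNNReal) with hε
  have hS : (1 + 2 * (C1 * C3) + 32 * (C2 * C1 * C3) + 16 * C2
      + 16 * C2 * (1 / α).toNNReal) * ε = 1 := by
    rw [hε]; exact mul_one_div_cancel (by positivity)
  have hε0 : (0 : ℝ) < ε := by rw [NNReal.coe_pos, hε]; positivity
  obtain ⟨T1, hT1, t1⟩ := exists_rpow_neg_le h0 hε0
  obtain ⟨T2, hT2, t2⟩ := exists_rpow_neg_le (show 0 < α / 2 by linarith) hε0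
  refine ⟨max T1 T2, 1 + 6 * C1 + 12 * C2 + 16 * C1 * C2, hT1.trans (le_max_left _ _), fun a b hTa hab E g m i d n D hm hi hd hn
    hI hP hE fg fm fi => ?_⟩
  have ha1 := (le_max_left T1 T2).trans hTa
  have ha2 := (le_max_right T1 T2).trans hTa
  have ha := hT1.trans ha1
  have hb := ha.trans hab
  set G := ⨆ τ ∈ Icc a b, g τ with hG
  set M := ∫⁻ s in Icc a b, m s with hM
  set W := ∫⁻ s in Icc a b, tw[s, 1 - α] * i s with hW
  set N := g a + tw[a, 1 - α] * E a
      + (∫⁻ s in Icc a b, tw[s, 1 - α] * d s)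
      + (∫⁻ s in Icc a b, tw[s, -(9 * α)] * n s) + D with hN
  have fW : W ≠ ⊤ := by
    have : W ≤ tw[b, 1 - α] * ∫⁻ s in Icc a b, i s := by
      rw [← lintegral_const_mul _ hi]
      refine bulkInt_mono_of_mem fun s hs => ?_
      have := ha.trans hs.1
      gcongr
      exact hs.2
    exact (this.trans_lt (ENNReal.mul_lt_top ofReal_lt_top fi.lt_top)).ne
  have hiW : (∫⁻ s in Icc a b, i s) ≤ W := by
    refine bulkInt_mono_of_mem fun s hs => ?_
    have : 1 ≤ (1 + s) ^ (1 - α) := one_le_rpow (by linarith [hs.1]) (by linarith)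
    calc i s = ofReal 1 * i s := by simp
      _ ≤ _ := by gcongr
  have hκ : ∀ h : ℝ → ℝ≥0∞, (∫⁻ s in Icc a b, tw[s, -α] * h s) ≤
      ε * ∫⁻ s in Icc a b, h s := by
    intro h
    rw [← lintegral_const_mul' _ _ ENNReal.coe_ne_top]
    refine bulkInt_mono_of_mem fun s hs => ?_
    gcongr
    rw [← ofReal_coe_nnreal]
    exact ofReal_le_ofReal (t1 s (ha1.trans hs.1))
  have hg : (∫⁻ s in Icc a b, tw[s, -1 - α / 2] * g s) ≤
      (2 * (1 / α).toNNReal * ε : ℝ≥0) * G := by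
    calc _ ≤ ∫⁻ s in Icc a b, tw[s, -1 - α / 2] * G := by
          refine bulkInt_mono_of_mem fun s hs => ?_
          gcongr
          exact le_iSup₂ (f := fun τ (_ : τ ∈ Icc a b) => g τ) s hs
      _ = (∫⁻ s in Icc a b, tw[s, -1 - α / 2]) * G :=
          lintegral_mul_const _ (by fun_prop)
      _ ≤ ofReal (1 / (α / 2) * (1 + a) ^ (-(α / 2))) * G := by
          gcongr
          exact lintegral_rpow_le ha hab (by linarith)
      _ ≤ _ := by
          gcongr
          rw [← ofReal_coe_nnreal]
          refine ofReal_le_ofReal ?_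
          push_cast
          rw [Real.coe_toNNReal _ (by positivity)]
          have := t2 a ha2
          calc _ = 2 * (1 / α) * (1 + a) ^ (-(α / 2)) := by field_simp
            _ ≤ _ := by gcongr
  have hE' : (∫⁻ s in Icc a b, tw[s, -α] * E s) ≤ ε * (C3 * (M + W)) := by
    refine (hκ E).trans ?_
    gcongr
    calc _ ≤ ∫⁻ s in Icc a b, C3 * (m s + i s) := bulkInt_mono_of_mem hE
      _ = C3 * (M + ∫⁻ s in Icc a b, i s) := by
          rw [lintegral_const_mul' _ _ ENNReal.coe_ne_top, lintegral_add_left hm]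
      _ ≤ _ := by gcongr
  have hWle : W ≤ C1 * (N + ε * (C3 * (M + W))) := by
    refine (lintegral_weight_tail_le h0 h1 ha hab hi hd hn fun τ hτ =>
      le_add_self.trans (hI τ b hτ.1 hτ.2 le_rfl)).trans ?_
    refine mul_le_mul_right (add_le_add ?_ hE') _
    rw [hN]
    calc _ ≤ _ + (g a + D) := le_self_add
      _ = _ := by ring
  have hEle : ∀ τ', a ≤ τ' → τ' ≤ b → E τ' ≤ C1 * N := by
    intro τ' h1 h2
    refine (le_self_add.trans (hI a τ' le_rfl h1 h2)).trans (mul_le_mul_right ?_ _)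
    have b1 : E a ≤ tw[a, 1 - α] * E a := by
      have : 1 ≤ (1 + a) ^ (1 - α) := one_le_rpow (by linarith) (by linarith)
      calc E a = ofReal 1 * E a := by simp
        _ ≤ _ := by gcongr
    have b2 : (∫⁻ s in Icc a τ', d s) ≤
        ∫⁻ s in Icc a b, tw[s, 1 - α] * d s := by
      refine (lintegral_mono_set (Icc_subset_Icc_right h2)).trans
        (bulkInt_mono_of_mem fun s hs => ?_)
      have : 1 ≤ (1 + s) ^ (1 - α) := one_le_rpow (by linarith [hs.1]) (by linarith)
      calc d s = ofReal 1 * d s := by simp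
        _ ≤ _ := by gcongr
    have b3 : (∫⁻ s in Icc a τ', tw[s, -1 - 8 * α] * n s) ≤
        ∫⁻ s in Icc a b, tw[s, -(9 * α)] * n s := by
      refine (lintegral_mono_set (Icc_subset_Icc_right h2)).trans
        (bulkInt_mono_of_mem fun s hs => ?_)
      gcongr
      · linarith [hs.1]
      · linarith
    rw [hN]
    calc _ ≤ _ := add_le_add (add_le_add b1 b2) b3
      _ ≤ _ + (g a + D) := le_self_add
      _ = _ := by ring
  have hP' : ∀ τ', a ≤ τ' → τ' ≤ b → g τ' + (∫⁻ s in Icc a τ', m s) ≤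
      C2 * (N + C1 * N + ε * M + (2 * (1 / α).toNNReal * ε : ℝ≥0) * G + W) := by
    intro τ' h1 h2
    refine (hP τ' h1 h2).trans (mul_le_mul_right ?_ _)
    have b1 : g a + D ≤ N := by
      rw [hN]
      calc _ ≤ g a + D + (tw[a, 1 - α] * E a
            + (∫⁻ s in Icc a b, tw[s, 1 - α] * d s)
            + ∫⁻ s in Icc a b, tw[s, -(9 * α)] * n s) := le_self_add
        _ = _ := by ring
    calc _ = g a + D + E τ' + (∫⁻ s in Icc a b, tw[s, -α] * m s)
          + (∫⁻ s in Icc a b, tw[s, -1 - α / 2] * g s) + W := by ring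
      _ ≤ _ := add_le_add (add_le_add (add_le_add (add_le_add b1 (hEle τ' h1 h2)) (hκ m)) hg) le_rfl
  refine absorb_linear fW fm fg hWle (iSup₂_le fun τ hτ => le_self_add.trans (hP' τ hτ.1 hτ.2))
    (le_add_self.trans (hP' b hab le_rfl)) ?_ ?_ ?_ ?_
  all_goals
    refine le_trans ?_ hS.le
    rw [← NNReal.coe_le_coe]
    push_cast
    have n1 : (0 : ℝ) ≤ C1 * C3 * ε := by positivity
    have n2 : (0 : ℝ) ≤ C2 * C1 * C3 * ε := by positivity
    have n3 : (0 : ℝ) ≤ C2 * ε := by positivity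
    have n4 : (0 : ℝ) ≤ C2 * (1 / α).toNNReal * ε := by positivity
    linarith

end absorption

section lateTime
variable {R α τ : ℝ} {φ F : Scalar} {p : Spacetime}

/-- A bound for `□φ` in which the full gradient has the small coefficient `ε`. -/
def SmallSource (R α Λ ε s : ℝ) (F φ : Scalar) (p : Spacetime) : Prop :=
  box φ p ^ 2 ≤ 3 * (F p ^ 2 + ε ^ 2 * jb[p] ^ (-2 - 2 * α) * gradSq φ p + Λ * if R < r[p] then
        s ^ (-1 - 8 * α) * (jb[p] ^ (-1 : ℝ) * good[φ, p]) else 0)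

theorem LateSource.sourceBound {Λ s : ℝ} (h0 : 0 < α) (hΛ : 0 ≤ Λ) (hs : 1 ≤ s)
    (h : LateSource R α Λ s F φ p) : SourceBound R α Λ F φ p := by
  refine h.trans (mul_le_mul_of_nonneg_left (add_le_add le_rfl ?_) hΛ)
  have ha := angSq_nonneg φ p
  split_ifs
  · have : s ^ (-1 - 8 * α) ≤ 1 := Real.rpow_le_one_of_one_le_of_nonpos hs (by linarith)
    have : 0 ≤ jb[p] ^ (-1 : ℝ) * good[φ, p] := by positivity
    nlinarith
  · exact le_rfl

theorem SmallSource.weighted {Λ ε s : ℝ} (h0 : 0 < α) (hΛ : 0 ≤ Λ) (hs : 1 ≤ s)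
    (h : SmallSource R α Λ ε s F φ p) :
    box φ p ^ 2 * jb[p] ^ (1 + α) ≤ 3 * ε ^ 2 * iDens α φ p
      + (3 * Λ * s ^ (-1 - 8 * α) * goodDens R (2 * α) φ p
      + 3 * (F p ^ 2 * jb[p] ^ (α + 1))) := by
  have hn := norm_nonneg p.2
  have ha := angSq_nonneg φ p
  have hg := gradSq_nonneg φ p
  have hi : jb[p] ^ (-1 - α) * gradSq φ p ≤ iDens α φ p := by
    rw [iDens, div_eq_mul_inv, ← rpow_neg (by positivity), mul_comm, show -(1 + α) = -1 - α by ring]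
    gcongr
    have := sq_nonneg (φ p / jb[p]); linarith
  have e1 : jb[p] ^ (-2 - 2 * α) * jb[p] ^ (1 + α) = jb[p] ^ (-1 - α) := by
    rw [← rpow_add (by positivity)]; congr 1; ring
  have e2 : jb[p] ^ (-1 : ℝ) * jb[p] ^ (1 + α) ≤ jb[p] ^ (2 * α) := by
    rw [← rpow_add (by positivity)]; exact one_add_rpow_le hn (by linarith)
  have e3 : (if R < r[p] then
        s ^ (-1 - 8 * α) * (jb[p] ^ (-1 : ℝ) * good[φ, p]) else 0)
      * jb[p] ^ (1 + α) ≤ s ^ (-1 - 8 * α) * goodDens R (2 * α) φ p := by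
    unfold goodDens
    split_ifs
    · calc _ = s ^ (-1 - 8 * α) * ((jb[p] ^ (-1 : ℝ) * jb[p] ^ (1 + α))
            * good[φ, p]) := by ring
        _ ≤ _ := by gcongr
    · simp
  calc _ ≤ 3 * (F p ^ 2 + ε ^ 2 * jb[p] ^ (-2 - 2 * α) * gradSq φ p
    + Λ * if R < r[p] then
        s ^ (-1 - 8 * α) * (jb[p] ^ (-1 : ℝ) * good[φ, p]) else 0)
        * jb[p] ^ (1 + α) := mul_le_mul_of_nonneg_right h (by positivity)
    _ = 3 * ε ^ 2 * ((jb[p] ^ (-2 - 2 * α) * jb[p] ^ (1 + α)) * gradSq φ p)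
      + (3 * Λ * ((if R < r[p] then
        s ^ (-1 - 8 * α) * (jb[p] ^ (-1 : ℝ) * good[φ, p]) else 0)
        * jb[p] ^ (1 + α)) + 3 * (F p ^ 2 * jb[p] ^ (1 + α))) := by ring
    _ ≤ _ := by
      rw [e1, mul_assoc (3 * Λ), add_comm 1 α] at *
      gcongr

@[fun_prop]
theorem measurable_goodDens {β : ℝ} (hφ : Smooth φ) : Measurable (goodDens R β φ) := by
  exact Measurable.ite (measurableSet_outer R) (by fun_prop) measurable_const

@[fun_prop]
theorem measurable_weightedSource {e : ℝ} (hF : Measurable F) :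
    Measurable (fun p : Spacetime => F p ^ 2 * jb[p] ^ e) := by fun_prop

/-- The integrals over leaves stay finite on a bounded time interval. -/
theorem leaf_finite (hR : 0 < R) (h0 : 0 < α) (h1 : α ≤ 1 / 4) {Λ a b : ℝ} (hΛ : 0 ≤ Λ)
    (ha : 0 ≤ a) (hab : a ≤ b) (hφ : Smooth φ)
    (hS : ∀ τ ∈ Icc a b, ∀ x, SourceBound R α Λ F φ (leaf R τ x))
    (fE : sInt R a (eDens R φ) ≠ ⊤) (fg : sInt R a (gDens R (1 + 2 * α) φ) ≠ ⊤)
    (fD : bulkInt R a b (fun p => F p ^ 2 * jb[p] ^ (2 * α + 1)) ≠ ⊤) :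
    ∃ K : ℝ≥0, (∀ τ ∈ Icc a b, sInt R τ (eDens R φ) ≤ K ∧ sInt R τ (gDens R (1 + 2 * α) φ) ≤ K) ∧
      bulkInt R a b (iDens α φ) ≤ K ∧ bulkInt R a b (mDens R (2 * α) φ) ≤ K := by
  obtain ⟨C, hC, h⟩ := bounded_time hR h0 h1 (ha.trans hab) hΛ
  have key : ∀ τ ∈ Icc a b, _ := fun τ hτ => h φ F hφ a τ ha hτ.1 hτ.2
    fun σ hσ => hS σ ⟨hσ.1, hσ.2.trans hτ.2⟩
  set K := ofReal C * (sInt R a (eDens R φ) + sInt R a (gDens R (1 + 2 * α) φ)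
      + bulkInt R a b (fun p => F p ^ 2 * jb[p] ^ (2 * α + 1)))
  have fK : K ≠ ⊤ := ENNReal.mul_ne_top ofReal_ne_top
    (ENNReal.add_ne_top.2 ⟨ENNReal.add_ne_top.2 ⟨fE, fg⟩, fD⟩)
  have key2 : ∀ τ ∈ Icc a b, sInt R τ (eDens R φ) + sInt R τ (gDens R (1 + 2 * α) φ)
      + (bulkInt R a τ (iDens α φ) + bulkInt R a τ (mDens R (2 * α) φ)) ≤ K := by
    intro τ hτ
    refine (key τ hτ).trans (mul_le_mul_right (add_le_add le_rfl ?_) _)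
    exact lintegral_mono_set (Icc_subset_Icc_right hτ.2)
  clear_value K
  lift K to ℝ≥0 using fK
  refine ⟨K, fun τ hτ => ⟨?_, ?_⟩, ?_, ?_⟩
  · exact (le_self_add.trans le_self_add).trans (key2 τ hτ)
  · exact (le_add_self.trans le_self_add).trans (key2 τ hτ)
  · exact (le_self_add.trans le_add_self).trans (key2 b ⟨hab, le_rfl⟩)
  · exact (le_add_self.trans le_add_self).trans (key2 b ⟨hab, le_rfl⟩)

theorem absorb_ofReal {c : ℝ} {X Y A : ℝ≥0∞} (hc : 0 < c) (hY : Y ≠ ⊤)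
    (h : ofReal 2 * X + ofReal (2 * c) * Y ≤ A + ofReal c * Y) :
    ofReal 2 * X + ofReal c * Y ≤ A := by
  have f : ofReal c * Y ≠ ⊤ := ENNReal.mul_ne_top ofReal_ne_top hY
  rw [two_mul, ofReal_add hc.le hc.le, add_mul, ← add_assoc] at h
  exact (ENNReal.add_le_add_iff_right f).1 h

/-- Local energy estimate at late times. -/
theorem late_slab (hR : 0 < R) (h0 : 0 < α) (h1 : α ≤ 1 / 4) {Λ ε : ℝ} (hΛ : 0 ≤ Λ)
    (hε : 28800 * ε ^ 2 ≤ α ^ 2) : ∃ (T : ℝ) (C : ℝ≥0), 0 ≤ T ∧ ∀ φ F : Scalar,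
    Smooth φ → Measurable F → ∀ a b, T ≤ a → a ≤ b →
    (∀ τ ∈ Icc a b, ∀ x, SmallSource R α Λ ε (1 + τ) F φ (leaf R τ x)) →
    (∀ τ ∈ Icc a b, sInt R τ (eDens R φ) ≠ ⊤) →
    (∀ τ ∈ Icc a b, sInt R τ (gDens R (1 + 2 * α) φ) ≠ ⊤) →
    bulkInt R a b (eDens R φ) ≠ ⊤ → bulkInt R a b (iDens α φ) ≠ ⊤ →
    sInt R b (eDens R φ) + bulkInt R a b (iDens α φ) ≤ C * (sInt R a (eDens R φ)
      + bulkInt R a b (fun p => F p ^ 2 * jb[p] ^ (α + 1))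
      + ∫⁻ s in Icc a b, tw[s, -1 - 8 * α] * sInt R s (mDens R (2 * α) φ)) := by
  obtain ⟨K, hK, hloc⟩ := local_energy hR
  obtain ⟨C1, hC1, hgood⟩ := exists_sInt_goodDens_le hR α (show 0 ≤ 2 * α by linarith)
    (show 2 * α ≤ 1 / 2 by linarith)
  obtain ⟨T, hT, ht⟩ := exists_rpow_neg_le (γ := 1 + 8 * α) (by linarith)
    (show 0 < α ^ 2 / (28800 * (1 + Λ * C1)) by positivity)
  refine ⟨T, (8 / α * (K + 1800 / α * (1 + Λ * C1))).toNNReal, hT,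
    fun φ F hφ hF a b hTa hab hS fE fg fEb fi => ?_⟩
  have ha := hT.trans hTa
  set m := fun s => sInt R s (mDens R (2 * α) φ) with hm
  set w := fun s : ℝ => tw[s, -1 - 8 * α] with hw
  have mw : Measurable w := by fun_prop
  have mm : Measurable m := measurable_sInt (measurable_mDens hφ) R
  have mi : Measurable fun s => sInt R s (iDens α φ) := measurable_sInt (measurable_iDens hφ) R
  have fg0 : ∀ τ ∈ Icc a b, sInt R τ (gDens R 0 φ) ≠ ⊤ := by
    intro τ hτ
    refine ((sInt_le_const_mul (a := R ^ (0 - (1 + 2 * α))) (by positivity)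
      fun x => gDens_le_gDens hR (q' := 1 + 2 * α) (by linarith)).trans_lt
      (ENNReal.mul_lt_top ofReal_lt_top (fg τ hτ).lt_top)).ne
  have b1 := hloc α h0 h1 φ hφ a b ha hab fE fg0 fEb
  have b2 : bulkInt R a b (fun p => box φ p ^ 2 * jb[p] ^ (1 + α)) ≤
      ofReal (α ^ 2 / 4800) * bulkInt R a b (iDens α φ)
      + (ofReal (3 * (1 + Λ * C1)) * (∫⁻ s in Icc a b, w s * m s) + ofReal (3 * (1 + Λ * C1)) *
          bulkInt R a b (fun p => F p ^ 2 * jb[p] ^ (α + 1))) := by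
    have s1 : ∀ τ ∈ Icc a b, sInt R τ (fun p => box φ p ^ 2 * jb[p] ^ (1 + α)) ≤
        ofReal (α ^ 2 / 4800) * sInt R τ (iDens α φ)
        + (ofReal (3 * (1 + Λ * C1)) * (w τ * m τ) + ofReal (3 * (1 + Λ * C1)) *
          sInt R τ (fun p => F p ^ 2 * jb[p] ^ (α + 1))) := by
      intro τ hτ
      have hτ0 : 0 ≤ τ := ha.trans hτ.1
      have ww : 0 ≤ 3 * Λ * (1 + τ) ^ (-1 - 8 * α) := by positivity
      have t1 : sInt R τ (fun p => box φ p ^ 2 * jb[p] ^ (1 + α)) ≤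
          sInt R τ (fun p => 3 * ε ^ 2 * iDens α φ p
            + (3 * Λ * (1 + τ) ^ (-1 - 8 * α) * goodDens R (2 * α) φ p
            + 3 * (F p ^ 2 * jb[p] ^ (α + 1)))) :=
        sInt_mono fun x => (hS τ hτ x).weighted h0 hΛ (by linarith)
      refine t1.trans ((sInt_add_le ((measurable_iDens hφ).const_mul _)).trans ?_)
      rw [sInt_const_mul (by positivity)]
      have t2 := sInt_add_le (R := R) (τ := τ) (g := fun p => 3 * (F p ^ 2 * jb[p] ^ (α + 1)))
        ((measurable_goodDens (R := R) (β := 2 * α) hφ).const_mul (3 * Λ * (1 + τ) ^ (-1 - 8 * α)))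
      rw [sInt_const_mul ww, sInt_const_mul (by norm_num)] at t2
      refine (add_le_add le_rfl t2).trans ?_
      have t3 := hgood φ hφ τ hτ0
      have e3 : (1 + τ) ^ (-1 - 8 * α) ≤ α ^ 2 / (28800 * (1 + Λ * C1)) := by
        have := ht τ (hTa.trans hτ.1)
        rwa [neg_add'] at this
      have hwm : ofReal (3 * Λ * (1 + τ) ^ (-1 - 8 * α)) * (ofReal C1 * m τ) ≤
          ofReal (3 * (1 + Λ * C1)) * (w τ * m τ) := by
        rw [← mul_assoc, ← mul_assoc, ← ofReal_mul ww, hw, ← ofReal_mul (by positivity)]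
        refine mul_le_mul_left (ofReal_le_ofReal ?_) _
        have : 0 < (1 + τ) ^ (-1 - 8 * α) := by positivity
        linarith
      have hwi : ofReal (3 * Λ * (1 + τ) ^ (-1 - 8 * α)) * (ofReal C1 * sInt R τ (iDens α φ)) ≤
          ofReal (α ^ 2 / 9600) * sInt R τ (iDens α φ) := by
        rw [← mul_assoc, ← ofReal_mul ww]
        gcongr
        calc _ = 3 * (Λ * C1) * (1 + τ) ^ (-1 - 8 * α) := by ring
          _ ≤ 3 * (1 + Λ * C1) * (α ^ 2 / (28800 * (1 + Λ * C1))) := by gcongr; linarith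
          _ = _ := by field_simp; norm_num
      have hei : ofReal (3 * ε ^ 2) * sInt R τ (iDens α φ) ≤
          ofReal (α ^ 2 / 9600) * sInt R τ (iDens α φ) := by
        gcongr; linarith
      have hd : ofReal 3 * sInt R τ (fun p => F p ^ 2 * jb[p] ^ (α + 1)) ≤
          ofReal (3 * (1 + Λ * C1)) * sInt R τ (fun p => F p ^ 2 * jb[p] ^ (α + 1)) := by
        gcongr
        have : 0 ≤ Λ * C1 := by positivity
        linarith
      calc _ ≤ ofReal (α ^ 2 / 9600) * sInt R τ (iDens α φ)
            + (ofReal (3 * Λ * (1 + τ) ^ (-1 - 8 * α)) *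
              (ofReal C1 * (m τ + sInt R τ (iDens α φ))) + _) :=
            add_le_add hei (add_le_add (mul_le_mul_right t3 _) hd)
        _ = ofReal (α ^ 2 / 9600) * sInt R τ (iDens α φ)
            + (ofReal (3 * Λ * (1 + τ) ^ (-1 - 8 * α)) *
              (ofReal C1 * m τ) + ofReal (3 * Λ * (1 + τ) ^ (-1 - 8 * α)) *
              (ofReal C1 * sInt R τ (iDens α φ)) + _) := by rw [mul_add, mul_add]
        _ ≤ ofReal (α ^ 2 / 9600) * sInt R τ (iDens α φ)
            + (ofReal (3 * (1 + Λ * C1)) * (w τ * m τ) +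
              ofReal (α ^ 2 / 9600) * sInt R τ (iDens α φ) + _) := by gcongr
        _ = _ := by
          rw [show α ^ 2 / 4800 = α ^ 2 / 9600 + α ^ 2 / 9600 by ring,
            ofReal_add (by positivity) (by positivity)]
          ring
    refine (bulkInt_mono_of_mem s1).trans_eq ?_
    have mwm : Measurable fun s => w s * m s := mw.mul mm
    rw [lintegral_add_left (mi.const_mul _), lintegral_const_mul _ mi,
      lintegral_add_left (mwm.const_mul _), lintegral_const_mul _ mwm,
      lintegral_const_mul' _ _ ofReal_ne_top]
    rfl
  set I := bulkInt R a b (iDens α φ)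
  set D := bulkInt R a b (fun p => F p ^ 2 * jb[p] ^ (α + 1))
  set M := ∫⁻ s in Icc a b, w s * m s
  have b3 : ofReal 2 * sInt R b (eDens R φ) + ofReal (2 * (α / 8)) * I ≤
      (ofReal K * sInt R a (eDens R φ) + ofReal (1800 / α * (1 + Λ * C1)) * (M + D))
        + ofReal (α / 8) * I := by
    rw [show 2 * (α / 8) = α / 4 by ring]
    refine b1.trans ?_
    calc _ ≤ ofReal K * sInt R a (eDens R φ) + ofReal (600 / α) * _ :=
          add_le_add le_rfl (mul_le_mul_right b2 _)
      _ = ofReal K * sInt R a (eDens R φ) + (ofReal (600 / α) * ofReal (3 * (1 + Λ * C1))) * (M + D)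
          + (ofReal (600 / α) * ofReal (α ^ 2 / 4800)) * I := by ring
      _ = _ := by
          rw [← ofReal_mul (by positivity), ← ofReal_mul (by positivity),
            show 600 / α * (3 * (1 + Λ * C1)) = 1800 / α * (1 + Λ * C1) by ring,
            show 600 / α * (α ^ 2 / 4800) = α / 8 by field_simp; norm_num]
  have b4 := absorb_ofReal (by positivity) fi b3
  have hc : ∀ X : ℝ≥0∞, ofReal (8 / α) * (ofReal (α / 8) * X) = X := by
    intro X
    rw [← mul_assoc, ← ofReal_mul (by positivity),
      show 8 / α * (α / 8) = 1 by field_simp, ofReal_one, one_mul]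
  calc _ = ofReal (8 / α) * (ofReal (α / 8) * sInt R b (eDens R φ)
        + ofReal (α / 8) * I) := by rw [mul_add, hc, hc]
    _ ≤ ofReal (8 / α) * (ofReal 2 * sInt R b (eDens R φ)
        + ofReal (α / 8) * I) := by gcongr; linarith
    _ ≤ ofReal (8 / α) * (ofReal K * sInt R a (eDens R φ)
        + ofReal (1800 / α * (1 + Λ * C1)) * (M + D)) := by gcongr
    _ ≤ ofReal (8 / α) * (ofReal (K + 1800 / α * (1 + Λ * C1)) * sInt R a (eDens R φ)
        + ofReal (K + 1800 / α * (1 + Λ * C1)) * (M + D)) := by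
        gcongr
        · have : 0 ≤ 1800 / α * (1 + Λ * C1) := by positivity
          linarith
        · linarith
    _ = _ := by
        rw [← mul_add, ← mul_assoc, ← ofReal_mul (by positivity), add_comm M D, ← add_assoc]
        rfl

end lateTime

section lateTime
variable {R α τ : ℝ} {φ F : Scalar} {p : Spacetime}

theorem sInt_zDens_le (hR : 0 < R) (hτ : 0 ≤ τ) (hφ : Smooth φ)
    (hE : sInt R τ (eDens R φ) ≠ ⊤) (hg : sInt R τ (gDens R 0 φ) ≠ ⊤) :
    sInt R τ (zDens R φ) ≤ 5 * sInt R τ (eDens R φ) := by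
  calc _ ≤ sInt R τ (eDens R φ) + sInt R τ (fun p => φ p ^ 2 / (1 + rsq p)) :=
        sInt_add_le (measurable_eDens hφ)
    _ ≤ sInt R τ (eDens R φ) + 4 * sInt R τ (eDens R φ) := by
        gcongr; exact hardy hR hτ hφ hE hg
    _ = _ := by ring

/-- Admissible time weights for the inhomogeneity in the weighted energy estimates. -/
def AdmissibleWeight (α β : ℝ) (f : ℝ → ℝ) : Prop :=
  ∀ s, 1 ≤ s → 0 ≤ f s ∧ ∀ r, 0 < r → r ^ (2 * β) ≤ f s * r ^ (2 * α + 1) *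
      (s ^ (-α) * r ^ (β - 2) + s ^ (-1 - α / 2) * r ^ (β - 1))

theorem admissibleWeight_top (α : ℝ) : AdmissibleWeight α (2 * α) (fun s => s ^ (1 + α / 2)) := by
  refine fun s hs => ⟨by positivity, fun r hr => ?_⟩
  have hs0 : 0 < s := by linarith
  have e1 : s ^ (1 + α / 2) * s ^ (-1 - α / 2) = 1 := by
    rw [← rpow_add hs0]; ring_nf; exact rpow_zero s
  have e2 : r ^ (2 * (2 * α)) = r ^ (2 * α + 1) * r ^ (2 * α - 1) := by
    rw [← rpow_add hr]; ring_nf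
  calc r ^ (2 * (2 * α)) = s ^ (1 + α / 2) * s ^ (-1 - α / 2) * (r ^ (2 * α + 1) * r ^ (2 * α - 1)) := by
        rw [e1, e2, one_mul]
    _ = s ^ (1 + α / 2) * r ^ (2 * α + 1) * (s ^ (-1 - α / 2) * r ^ (2 * α - 1)) := by ring
    _ ≤ _ := by
        refine mul_le_mul_of_nonneg_left (le_add_of_nonneg_left ?_) ?_ <;> positivity

theorem admissibleWeight_zero (h0 : 0 < α) (h1 : α ≤ 1 / 4) :
    AdmissibleWeight α 0 (fun s => s ^ (1 - α)) := by
  refine fun s hs => ⟨by positivity, fun r hr => ?_⟩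
  have hs0 : 0 < s := by linarith
  have n1 : 0 < s ^ (-α) * r ^ (0 - 2 : ℝ) := by positivity
  have n2 : 0 < s ^ (-1 - α / 2) * r ^ (0 - 1 : ℝ) := by positivity
  rw [mul_zero, rpow_zero]
  rcases le_total r s with h | h
  · have e : s ^ (1 - α) * r ^ (2 * α + 1) * (s ^ (-α) * r ^ (0 - 2 : ℝ)) =
        s ^ (1 - 2 * α) * r ^ (-(1 - 2 * α)) := by
      rw [show s ^ (1 - 2 * α) = s ^ (1 - α) * s ^ (-α) by rw [← rpow_add hs0]; ring_nf,
        show r ^ (-(1 - 2 * α)) = r ^ (2 * α + 1) * r ^ (0 - 2 : ℝ) by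
          rw [← rpow_add hr]; ring_nf]
      ring
    calc (1 : ℝ) ≤ s ^ (1 - 2 * α) * r ^ (-(1 - 2 * α)) := by
          rw [rpow_neg hr.le, ← div_eq_mul_inv, one_le_div (by positivity)]
          exact rpow_le_rpow hr.le h (by linarith)
      _ = _ := e.symm
      _ ≤ _ := by gcongr; linarith
  · have e : s ^ (1 - α) * r ^ (2 * α + 1) * (s ^ (-1 - α / 2) * r ^ (0 - 1 : ℝ)) =
        s ^ (-(3 * α / 2)) * r ^ (2 * α) := by
      rw [show s ^ (-(3 * α / 2)) = s ^ (1 - α) * s ^ (-1 - α / 2) by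
          rw [← rpow_add hs0]; ring_nf,
        show r ^ (2 * α) = r ^ (2 * α + 1) * r ^ (0 - 1 : ℝ) by
          rw [← rpow_add hr]; ring_nf]
      ring
    calc (1 : ℝ) ≤ s ^ (-(3 * α / 2)) * s ^ (2 * α) := by
          rw [← rpow_add hs0]
          exact one_le_rpow hs (by linarith)
      _ ≤ s ^ (-(3 * α / 2)) * r ^ (2 * α) := by gcongr
      _ = _ := e.symm
      _ ≤ _ := mul_le_mul_of_nonneg_left (le_add_of_nonneg_left n1.le) (by positivity)

/-- Weighted energy estimate at late times. -/
theorem late_p_weighted (hR : 0 < R) (h0 : 0 < α) (h1 : α ≤ 1 / 4) {Λ β : ℝ} (hΛ : 0 ≤ Λ)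
    (hβ : 0 ≤ β) (hβα : β ≤ 2 * α) : ∃ C : ℝ≥0, ∀ (φ F : Scalar) (f : ℝ → ℝ),
    AdmissibleWeight α β f → Smooth φ → Measurable F → ∀ a b, 0 ≤ a → a ≤ b →
    (∀ τ ∈ Icc a b, ∀ x, LateSource R α Λ (1 + τ) F φ (leaf R τ x)) →
    sInt R b (eDens R φ) ≠ ⊤ → sInt R b (gDens R 0 φ) ≠ ⊤ →
    sInt R b (gDens R (1 + β) φ) + bulkInt R a b (mDens R β φ) ≤
      C * (sInt R a (gDens R (1 + β) φ) + sInt R b (eDens R φ)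
      + (∫⁻ s in Icc a b, tw[s, -α] * sInt R s (mDens R β φ))
      + (∫⁻ s in Icc a b, tw[s, -1 - α / 2] * sInt R s (gDens R (1 + β) φ))
      + (∫⁻ s in Icc a b, tw[s, 1 - α] * sInt R s (iDens α φ))
      + ∫⁻ s in Icc a b, ofReal (f (1 + s)) *
          sInt R s (fun p => F p ^ 2 * jb[p] ^ (2 * α + 1))) := by
  obtain ⟨C1, hC1, hp⟩ := p_weighted hR hβ (show β ≤ 1 / 2 by linarith) α
  obtain ⟨C2, hC2, hgood⟩ := exists_sInt_goodDens_le hR α hβ (show β ≤ 1 / 2 by linarith)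
  set K : ℝ := 1 + 5 * C1 + C1 + (1 + Λ) * (3 + C2) with hK
  have pΛ : 0 ≤ (1 + Λ) * (3 + C2) := by positivity
  refine ⟨(4 * K).toNNReal, fun φ F f hf hφ hF a b ha hab hS fE fg => ?_⟩
  set m := fun s => sInt R s (mDens R β φ) with hm
  set g := fun s => sInt R s (gDens R (1 + β) φ) with hg
  set i := fun s => sInt R s (iDens α φ) with hi
  set d := fun s => sInt R s (fun p => F p ^ 2 * jb[p] ^ (2 * α + 1)) with hd
  have mm : Measurable m := measurable_sInt (measurable_mDens hφ) R
  have mg : Measurable g := measurable_sInt (measurable_gDens hφ) R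
  have mi : Measurable i := measurable_sInt (measurable_iDens hφ) R
  set wm := fun s => tw[s, -α] * m s with hwm
  set wg := fun s => tw[s, -1 - α / 2] * g s with hwg
  set wi := fun s => tw[s, 1 - α] * i s with hwi
  set wd := fun s => ofReal (f (1 + s)) * d s with hwd
  have m1 : Measurable wm := by fun_prop
  have m2 : Measurable wg := by fun_prop
  have m3 : Measurable wi := by fun_prop
  have hw : ∀ τ ∈ Icc a b, sInt R τ (wDens R β φ) ≤
      ofReal ((1 + Λ) * (3 + C2)) * (wm τ + wg τ + wi τ + wd τ) := by
    intro τ hτ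
    have hτ0 : 0 ≤ τ := ha.trans hτ.1
    have hs : 1 ≤ 1 + τ := by linarith
    obtain ⟨hf0, hf1⟩ := hf _ hs
    have t1 : sInt R τ (wDens R β φ) ≤ ofReal (1 + Λ) * sInt R τ (fun p =>
        3 * (1 + τ) ^ (-α) * mDens R β φ p + (3 * (1 + τ) ^ (-1 - α / 2) * gDens R (1 + β) φ p
        + ((1 + τ) ^ (1 - α) * iDens α φ p + ((1 + τ) ^ (-α) * goodDens R β φ p
        + f (1 + τ) * (F p ^ 2 * jb[p] ^ (2 * α + 1)))))) := by
      refine sInt_le_const_mul (by linarith) fun x => ?_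
      have := wDens_le_late hR h0 h1 hβ hβα hs hf0 hΛ hf1 (hS τ hτ x)
      refine this.trans_eq ?_
      ring
    have t2 := sInt_add_le (R := R) (τ := τ) (g := fun p =>
        3 * (1 + τ) ^ (-1 - α / 2) * gDens R (1 + β) φ p
        + ((1 + τ) ^ (1 - α) * iDens α φ p + ((1 + τ) ^ (-α) * goodDens R β φ p
        + f (1 + τ) * (F p ^ 2 * jb[p] ^ (2 * α + 1)))))
      ((measurable_mDens (R := R) (q := β) hφ).const_mul (3 * (1 + τ) ^ (-α)))
    have t3 := sInt_add_le (R := R) (τ := τ) (g := fun p =>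
        (1 + τ) ^ (1 - α) * iDens α φ p + ((1 + τ) ^ (-α) * goodDens R β φ p
        + f (1 + τ) * (F p ^ 2 * jb[p] ^ (2 * α + 1))))
      ((measurable_gDens (R := R) (q := 1 + β) hφ).const_mul (3 * (1 + τ) ^ (-1 - α / 2)))
    have t4 := sInt_add_le (R := R) (τ := τ) (g := fun p => (1 + τ) ^ (-α) * goodDens R β φ p
        + f (1 + τ) * (F p ^ 2 * jb[p] ^ (2 * α + 1)))
      ((measurable_iDens (α := α) hφ).const_mul ((1 + τ) ^ (1 - α)))
    have t5 := sInt_add_le (R := R) (τ := τ)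
      (g := fun p => f (1 + τ) * (F p ^ 2 * jb[p] ^ (2 * α + 1)))
      ((measurable_goodDens (R := R) (β := β) hφ).const_mul ((1 + τ) ^ (-α)))
    rw [sInt_const_mul (by positivity)] at t2 t3 t4
    rw [sInt_const_mul (by positivity), sInt_const_mul hf0] at t5
    have t6 : tw[τ, -α] * sInt R τ (goodDens R β φ) ≤ ofReal C2 * (wm τ + wi τ) := by
      calc _ ≤ tw[τ, -α] * (ofReal C2 * (m τ + i τ)) :=
            mul_le_mul_right (hgood φ hφ τ hτ0) _
        _ = ofReal C2 * (tw[τ, -α] * m τ + tw[τ, -α] * i τ) := by ring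
        _ ≤ _ := by
            refine mul_le_mul_right (add_le_add le_rfl (mul_le_mul_left (ofReal_le_ofReal ?_) _)) _
            exact rpow_le_rpow_of_exponent_le hs (by linarith)
    rw [ofReal_mul (by positivity)] at t2 t3
    refine t1.trans ?_
    rw [ofReal_mul (by linarith), mul_assoc, ofReal_add (by norm_num) hC2.le]
    refine mul_le_mul_right ?_ _
    calc _ ≤ ofReal 3 * tw[τ, -α] * m τ
          + (ofReal 3 * tw[τ, -1 - α / 2] * g τ
          + (tw[τ, 1 - α] * i τ
          + (ofReal C2 * (wm τ + wi τ) + ofReal (f (1 + τ)) * d τ))) :=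
          t2.trans (add_le_add le_rfl (t3.trans (add_le_add le_rfl (t4.trans
            (add_le_add le_rfl (t5.trans (add_le_add t6 le_rfl)))))))
      _ = ofReal 3 * (wm τ + wg τ) + wi τ + ofReal C2 * (wm τ + wi τ) + wd τ := by
          simp only [hwm, hwg, hwi, hwd]; ring
      _ ≤ ofReal 3 * (wm τ + wg τ) + ofReal 3 * (wi τ)
          + ofReal C2 * (wm τ + wg τ + wi τ + wd τ) + ofReal 3 * wd τ := by
          have o3 : (1 : ℝ≥0∞) ≤ ofReal 3 := by norm_num
          refine add_le_add (add_le_add (add_le_add le_rfl ?_) (mul_le_mul_right ?_ _)) ?_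
          · simpa using mul_le_mul_left o3 (wi τ)
          · calc _ ≤ wm τ + wi τ + (wg τ + wd τ) := le_self_add
              _ = _ := by ring
          · simpa using mul_le_mul_left o3 (wd τ)
      _ = _ := by ring
  have hz := sInt_zDens_le hR (ha.trans hab) hφ fE fg
  have hib : bulkInt R a b (iDens α φ) ≤ ∫⁻ s in Icc a b, wi s := by
    refine bulkInt_mono_of_mem fun s hs => ?_
    have : 1 ≤ (1 + s) ^ (1 - α) := one_le_rpow (by linarith [ha.trans hs.1]) (by linarith)
    calc i s = ofReal 1 * i s := by simp
      _ ≤ _ := by simp only [hwi]; gcongr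
  have hwb : bulkInt R a b (wDens R β φ) ≤ ofReal ((1 + Λ) * (3 + C2)) *
      ((∫⁻ s in Icc a b, wm s) + (∫⁻ s in Icc a b, wg s) + (∫⁻ s in Icc a b, wi s)
        + ∫⁻ s in Icc a b, wd s) := by
    refine (bulkInt_mono_of_mem hw).trans_eq ?_
    have m12 : Measurable fun s => wm s + wg s := m1.add m2
    have m123 : Measurable fun s => wm s + wg s + wi s := m12.add m3
    rw [lintegral_const_mul' _ _ ofReal_ne_top, lintegral_add_left m123,
      lintegral_add_left m12, lintegral_add_left m1]
  have hpp := hp φ hφ a b ha hab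
  set Wm := ∫⁻ s in Icc a b, wm s
  set Wg := ∫⁻ s in Icc a b, wg s
  set Wi := ∫⁻ s in Icc a b, wi s
  set Wd := ∫⁻ s in Icc a b, wd s
  set X := g a + sInt R b (eDens R φ) + Wm + Wg + Wi + Wd with hX
  have x1 : g a ≤ X := by
    simp only [hX, add_assoc]; exact le_self_add
  have x2 : sInt R b (eDens R φ) ≤ X := by
    calc _ ≤ sInt R b (eDens R φ) + (g a + Wm + Wg + Wi + Wd) := le_self_add
      _ = _ := by rw [hX]; ring
  have x3 : Wi ≤ X := by
    calc _ ≤ Wi + (g a + sInt R b (eDens R φ) + Wm + Wg + Wd) := le_self_add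
      _ = _ := by rw [hX]; ring
  have x4 : Wm + Wg + Wi + Wd ≤ X := by
    calc _ ≤ Wm + Wg + Wi + Wd + (g a + sInt R b (eDens R φ)) := le_self_add
      _ = _ := by rw [hX]; ring
  have final : g b + ofReal (1 / 4) * bulkInt R a b (mDens R β φ) ≤ ofReal K * X := by
    refine hpp.trans ?_
    calc _ ≤ X + ofReal C1 * (5 * X) + ofReal C1 * X
          + ofReal ((1 + Λ) * (3 + C2)) * X :=
          add_le_add (add_le_add (add_le_add x1 (mul_le_mul_right (hz.trans
            (mul_le_mul_right x2 _)) _)) (mul_le_mul_right (hib.trans x3) _))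
            (hwb.trans (mul_le_mul_right x4 _))
      _ = _ := by
          rw [hK, ofReal_add (by positivity) pΛ, ofReal_add (by positivity) hC1.le,
            ofReal_add (by norm_num) (by positivity),
            ofReal_mul (p := 5) (q := C1) (by norm_num), ofReal_one,
            show ofReal 5 = 5 by norm_num]
          ring
  calc g b + bulkInt R a b (mDens R β φ) ≤ ofReal 4 *
        (g b + ofReal (1 / 4) * bulkInt R a b (mDens R β φ)) := by
        rw [mul_add, ← mul_assoc, ← ofReal_mul (by norm_num)]
        refine add_le_add ?_ (by norm_num)
        have o4 : (1 : ℝ≥0∞) ≤ ofReal 4 := by norm_num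
        simpa using mul_le_mul_left o4 (g b)
    _ ≤ ofReal 4 * (ofReal K * X) := mul_le_mul_right final _
    _ = _ := by
        rw [← mul_assoc, ← ofReal_mul (by norm_num)]
        rfl

end lateTime

section lateTime
variable {R α τ : ℝ} {φ F : Scalar} {p : Spacetime}

theorem mDens_le_mDens (hR : 0 < R) {q q' : ℝ} (h : q ≤ q') :
    mDens R q φ p ≤ R ^ (q - q') * mDens R q' φ p := by
  have ha := angSq_nonneg φ p
  unfold mDens
  split_ifs with hp
  · have hn : 0 < r[p] := hR.trans hp
    have e : r[p] ^ (q - 2) = r[p] ^ (q - q') * r[p] ^ (q' - 2) := by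
      rw [← rpow_add hn]; congr 1; ring
    have := rpow_le_rpow_of_nonpos hR hp.le (show q - q' ≤ 0 by linarith)
    rw [e, mul_assoc]
    gcongr
  · simp

/-- The hypotheses on a solution on the late time interval `[a, b]`. -/
structure LateSolution (R α Λ ε : ℝ) (F φ : Scalar) (a b : ℝ) : Prop where
  smooth : Smooth φ
  measurable : Measurable F
  late : ∀ τ ∈ Icc a b, ∀ x, LateSource R α Λ (1 + τ) F φ (leaf R τ x)
  small : ∀ τ ∈ Icc a b, ∀ x, SmallSource R α Λ ε (1 + τ) F φ (leaf R τ x)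
  energy_finite : sInt R a (eDens R φ) ≠ ⊤
  flux_finite : sInt R a (gDens R (1 + 2 * α) φ) ≠ ⊤
  source_finite : bulkInt R a b (fun p => F p ^ 2 * jb[p] ^ (2 * α + 1)) ≠ ⊤

theorem LateSolution.finite {Λ ε a b : ℝ} (hR : 0 < R) (h0 : 0 < α) (h1 : α ≤ 1 / 4)
    (hΛ : 0 ≤ Λ) (ha : 0 ≤ a) (hab : a ≤ b) (h : LateSolution R α Λ ε F φ a b) {q : ℝ}
    (hq : q ≤ 2 * α) :
    (∀ τ ∈ Icc a b, sInt R τ (eDens R φ) ≠ ⊤) ∧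
    (∀ τ ∈ Icc a b, sInt R τ (gDens R (1 + 2 * α) φ) ≠ ⊤) ∧
    bulkInt R a b (eDens R φ) ≠ ⊤ ∧ bulkInt R a b (iDens α φ) ≠ ⊤ ∧
    (⨆ τ ∈ Icc a b, sInt R τ (gDens R (1 + q) φ)) ≠ ⊤ ∧ bulkInt R a b (mDens R q φ) ≠ ⊤ := by
  obtain ⟨K, hK, hi, hm⟩ := leaf_finite hR h0 h1 hΛ ha hab h.smooth
    (fun τ hτ x => (h.late τ hτ x).sourceBound h0 hΛ (by linarith [hτ.1])) h.energy_finite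
    h.flux_finite h.source_finite
  refine ⟨fun τ hτ => ((hK τ hτ).1.trans_lt ENNReal.coe_lt_top).ne,
    fun τ hτ => ((hK τ hτ).2.trans_lt ENNReal.coe_lt_top).ne, ?_,
    (hi.trans_lt ENNReal.coe_lt_top).ne, ?_, ?_⟩
  · have : bulkInt R a b (eDens R φ) ≤ ∫⁻ _ in Icc a b, (K : ℝ≥0∞) :=
      bulkInt_mono_of_mem fun τ hτ => (hK τ hτ).1
    refine (this.trans_lt ?_).ne
    rw [setLIntegral_const, Real.volume_Icc]
    exact ENNReal.mul_lt_top ENNReal.coe_lt_top ofReal_lt_top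
  · have : (⨆ τ ∈ Icc a b, sInt R τ (gDens R (1 + q) φ)) ≤
        ofReal (R ^ (1 + q - (1 + 2 * α))) * K := iSup₂_le fun τ hτ =>
      (sInt_le_const_mul (by positivity) fun x => gDens_le_gDens hR
        (by linarith)).trans (mul_le_mul_right (hK τ hτ).2 _)
    exact (this.trans_lt (ENNReal.mul_lt_top ofReal_lt_top ENNReal.coe_lt_top)).ne
  · have : bulkInt R a b (mDens R q φ) ≤ ofReal (R ^ (q - 2 * α)) * K :=
      (bulkInt_le_const_mul (by positivity) fun τ _ x => mDens_le_mDens hR hq).trans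
        (mul_le_mul_right hm _)
    exact (this.trans_lt (ENNReal.mul_lt_top ofReal_lt_top ENNReal.coe_lt_top)).ne

theorem LateSolution.slab (hR : 0 < R) (h0 : 0 < α) (h1 : α ≤ 1 / 4) {Λ ε : ℝ} (hΛ : 0 ≤ Λ)
    (hε : 28800 * ε ^ 2 ≤ α ^ 2) : ∃ (T : ℝ) (C : ℝ≥0), 0 ≤ T ∧ ∀ (φ F : Scalar) (a b : ℝ),
    T ≤ a → a ≤ b → LateSolution R α Λ ε F φ a b → ∀ τ τ', a ≤ τ → τ ≤ τ' → τ' ≤ b →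
    sInt R τ' (eDens R φ) + (∫⁻ s in Icc τ τ', sInt R s (iDens α φ)) ≤ C * (sInt R τ (eDens R φ)
      + (∫⁻ s in Icc τ τ', sInt R s (fun p => F p ^ 2 * jb[p] ^ (α + 1)))
      + ∫⁻ s in Icc τ τ', tw[s, -1 - 8 * α] * sInt R s (mDens R (2 * α) φ)) := by
  obtain ⟨T, C, hT, h⟩ := late_slab hR h0 h1 hΛ hε
  refine ⟨T, C, hT, fun φ F a b hTa hab hs τ τ' h2 h3 h4 => ?_⟩
  obtain ⟨fE, fg, fEb, fi, -, -⟩ := hs.finite hR h0 h1 hΛ (hT.trans hTa) hab le_rfl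
  have sub : Icc τ τ' ⊆ Icc a b := Icc_subset_Icc h2 h4
  exact h φ F hs.smooth hs.measurable τ τ' (hTa.trans h2) h3
    (fun σ hσ => hs.small σ (sub hσ)) (fun σ hσ => fE σ (sub hσ)) (fun σ hσ => fg σ (sub hσ))
    ((lintegral_mono_set sub).trans_lt fEb.lt_top).ne
    ((lintegral_mono_set sub).trans_lt fi.lt_top).ne

/-- The closed weighted estimate at late times. -/
theorem LateSolution.closed (hR : 0 < R) (h0 : 0 < α) (h1 : α ≤ 1 / 4) {Λ ε β : ℝ} (hΛ : 0 ≤ Λ)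
    (hε : 28800 * ε ^ 2 ≤ α ^ 2) (hβ : 0 ≤ β) (hβα : β ≤ 2 * α) {f : ℝ → ℝ}
    (hf : AdmissibleWeight α β f) :
    ∃ (T : ℝ) (C : ℝ≥0), 0 ≤ T ∧ ∀ (φ F : Scalar) (a b : ℝ),
    T ≤ a → a ≤ b → LateSolution R α Λ ε F φ a b →
    (⨆ τ ∈ Icc a b, sInt R τ (gDens R (1 + β) φ)) + bulkInt R a b (mDens R β φ)
      + (∫⁻ s in Icc a b, tw[s, 1 - α] * sInt R s (iDens α φ)) ≤
    C * (sInt R a (gDens R (1 + β) φ) + tw[a, 1 - α] * sInt R a (eDens R φ)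
      + (∫⁻ s in Icc a b, tw[s, 1 - α] * sInt R s (fun p => F p ^ 2 * jb[p] ^ (α + 1)))
      + (∫⁻ s in Icc a b, tw[s, -(9 * α)] * sInt R s (mDens R (2 * α) φ))
      + ∫⁻ s in Icc a b, ofReal (f (1 + s)) *
          sInt R s (fun p => F p ^ 2 * jb[p] ^ (2 * α + 1))) := by
  obtain ⟨T1, C1, hT1, hslab⟩ := LateSolution.slab hR h0 h1 hΛ hε
  obtain ⟨C2, hp⟩ := late_p_weighted hR h0 h1 hΛ hβ hβα
  obtain ⟨C3, hC3, hE⟩ := exists_sInt_eDens_le hR h0 hβ (show β ≤ 1 / 2 by linarith)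
  obtain ⟨T2, C, hT2, habs⟩ := late_absorption h0 (show α ≤ 1 by linarith) C1 C2 C3.toNNReal
  refine ⟨max T1 T2, C, hT1.trans (le_max_left _ _), fun φ F a b hTa hab hs => ?_⟩
  have hTa1 := (le_max_left _ _).trans hTa
  have hTa2 := (le_max_right _ _).trans hTa
  have ha := hT1.trans hTa1
  obtain ⟨fE, fg, -, fi, fG, fM⟩ := hs.finite hR h0 h1 hΛ ha hab hβα
  have hφ := hs.smooth
  have hI := hslab φ F a b hTa1 hab hs
  have hEE : ∀ τ ∈ Icc a b, sInt R τ (eDens R φ) ≤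
      (C3.toNNReal : ℝ≥0∞) * (sInt R τ (mDens R β φ) + sInt R τ (iDens α φ)) :=
    fun τ hτ => hE φ hφ τ (ha.trans hτ.1)
  have mm := measurable_sInt (measurable_mDens (R := R) (q := β) hφ) R
  have mi := measurable_sInt (measurable_iDens (α := α) hφ) R
  have md := measurable_sInt (measurable_weightedSource (e := α + 1) hs.measurable) R
  have mn := measurable_sInt (measurable_mDens (R := R) (q := 2 * α) hφ) R
  rw [bulkInt_eq] at fi fM ⊢
  refine habs a b hTa2 hab (fun s => sInt R s (eDens R φ)) (fun s => sInt R s (gDens R (1 + β) φ))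
    (fun s => sInt R s (mDens R β φ)) (fun s => sInt R s (iDens α φ))
    (fun s => sInt R s (fun p => F p ^ 2 * jb[p] ^ (α + 1)))
    (fun s => sInt R s (mDens R (2 * α) φ)) (∫⁻ s in Icc a b, ofReal (f (1 + s)) *
          sInt R s (fun p => F p ^ 2 * jb[p] ^ (2 * α + 1))) mm mi md mn
    hI (fun τ' h2 h3 => ?_) hEE fG fM fi
  have fg0 : sInt R τ' (gDens R 0 φ) ≠ ⊤ :=
    ((sInt_le_const_mul (a := R ^ (0 - (1 + 2 * α))) (by positivity)
      fun x => gDens_le_gDens hR (q' := 1 + 2 * α) (by linarith)).trans_lt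
      (ENNReal.mul_lt_top ofReal_lt_top (fg τ' ⟨h2, h3⟩).lt_top)).ne
  refine (hp φ F f hf hφ hs.measurable a τ' ha h2
    (fun σ hσ => hs.late σ ⟨hσ.1, hσ.2.trans h3⟩) (fE τ' ⟨h2, h3⟩) fg0).trans
    (mul_le_mul_right ?_ _)
  have sub : Icc a τ' ⊆ Icc a b := Icc_subset_Icc_right h3
  exact add_le_add (add_le_add (add_le_add (add_le_add le_rfl (lintegral_mono_set sub))
    (lintegral_mono_set sub)) (lintegral_mono_set sub)) (lintegral_mono_set sub)

theorem absorb_half {Y Z N : ℝ≥0∞} {C k : ℝ≥0} (hY : Y ≠ ⊤) (hk : 2 * (C * k) ≤ 1)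
    (h : Z + Y ≤ C * (N + k * Y)) : Z + Y ≤ (2 * C : ℝ≥0) * N := by
  rcases eq_or_ne N ⊤ with rfl | hN
  · rcases eq_or_ne C 0 with rfl | hC
    · simpa using h
    · rw [ENNReal.mul_top (by simpa using hC)]; exact le_top
  have hZ : Z ≠ ⊤ := by
    refine ((le_self_add.trans h).trans_lt ?_).ne
    exact ENNReal.mul_lt_top ENNReal.coe_lt_top
      (ENNReal.add_lt_top.2 ⟨hN.lt_top, ENNReal.mul_lt_top ENNReal.coe_lt_top hY.lt_top⟩)
  lift Z to ℝ≥0 using hZ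
  lift Y to ℝ≥0 using hY
  lift N to ℝ≥0 using hN
  norm_cast at *
  rw [← NNReal.coe_le_coe] at *
  push_cast at *
  have := mul_le_mul_of_nonneg_right hk Y.2
  have := Z.2
  simp only [NNReal.val_eq_coe] at *
  linarith

/-- The closed top order weighted estimate at late times. -/
theorem LateSolution.closed_top (hR : 0 < R) (h0 : 0 < α) (h1 : α ≤ 1 / 4) {Λ ε : ℝ} (hΛ : 0 ≤ Λ)
    (hε : 28800 * ε ^ 2 ≤ α ^ 2) :
    ∃ (T : ℝ) (C : ℝ≥0), 0 ≤ T ∧ ∀ (φ F : Scalar) (a b : ℝ),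
    T ≤ a → a ≤ b → LateSolution R α Λ ε F φ a b →
    (⨆ τ ∈ Icc a b, sInt R τ (gDens R (1 + 2 * α) φ)) + bulkInt R a b (mDens R (2 * α) φ) ≤
    C * (sInt R a (gDens R (1 + 2 * α) φ) + tw[a, 1 - α] * sInt R a (eDens R φ)
      + ∫⁻ s in Icc a b, tw[s, 1 + α / 2] * sInt R s (fun p => F p ^ 2 * jb[p] ^ (2 * α + 1))) := by
  obtain ⟨T1, C, hT1, h⟩ := LateSolution.closed hR h0 h1 hΛ hε (show 0 ≤ 2 * α by linarith) le_rfl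
    (admissibleWeight_top α)
  obtain ⟨T2, hT2, ht⟩ := exists_rpow_neg_le (γ := 9 * α) (by linarith)
    (show (0 : ℝ) < 1 / (1 + 2 * C) by positivity)
  refine ⟨max T1 T2, 2 * (2 * C), hT1.trans (le_max_left _ _), fun φ F a b hTa hab hs => ?_⟩
  have hTa1 := (le_max_left _ _).trans hTa
  have hTa2 := (le_max_right _ _).trans hTa
  have ha := hT1.trans hTa1
  obtain ⟨-, -, -, -, -, fM⟩ := hs.finite hR h0 h1 hΛ ha hab le_rfl
  have key := le_self_add.trans (h φ F a b hTa1 hab hs)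
  set D := ∫⁻ s in Icc a b, tw[s, 1 + α / 2] *
          sInt R s (fun p => F p ^ 2 * jb[p] ^ (2 * α + 1)) with hD
  have b1 : (∫⁻ s in Icc a b, tw[s, 1 - α] *
      sInt R s (fun p => F p ^ 2 * jb[p] ^ (α + 1))) ≤ D := by
    refine bulkInt_mono_of_mem fun s hs => mul_le_mul' (ofReal_le_ofReal ?_) (sInt_mono fun x => ?_)
    · exact rpow_le_rpow_of_exponent_le (by linarith [hs.1]) (by linarith)
    · exact mul_le_mul_of_nonneg_left (one_add_rpow_le (norm_nonneg _) (by linarith)) (sq_nonneg _)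
  have b2 : (∫⁻ s in Icc a b, tw[s, -(9 * α)] * sInt R s (mDens R (2 * α) φ)) ≤
      (1 / (1 + 2 * C) : ℝ≥0) * bulkInt R a b (mDens R (2 * α) φ) := by
    rw [bulkInt_eq, ← lintegral_const_mul' _ _ ENNReal.coe_ne_top]
    refine bulkInt_mono_of_mem fun s hs => ?_
    gcongr
    rw [← ofReal_coe_nnreal]
    refine ofReal_le_ofReal ((ht s (hTa2.trans hs.1)).trans_eq ?_)
    push_cast; rfl
  set X := sInt R a (gDens R (1 + 2 * α) φ) + tw[a, 1 - α] * sInt R a (eDens R φ)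
  refine (absorb_half (C := C) (N := X + D + D) (k := 1 / (1 + 2 * C)) fM ?_ (key.trans ?_)).trans ?_
  · rw [← mul_assoc, mul_one_div]
    exact div_le_one_of_le₀ le_add_self (by positivity)
  · refine mul_le_mul_right ?_ _
    calc _ ≤ X + D + (1 / (1 + 2 * C) : ℝ≥0) * bulkInt R a b (mDens R (2 * α) φ) + D :=
          add_le_add (add_le_add (add_le_add le_rfl b1) b2) le_rfl
      _ = _ := by ring
  · calc _ ≤ (2 * C : ℝ≥0) * (X + D + (X + D)) := by gcongr; exact le_add_self
      _ = _ := by push_cast; ring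

end lateTime

section estimates
variable {R α τ : ℝ} {φ F : Scalar} {p : Spacetime}

/-- Right-hand side of the energy estimates. -/
def energyRhs (R α : ℝ) (F φ : Scalar) (a b : ℝ) : ℝ≥0∞ := sInt R a (eDens R φ) + DNorm R α F a b
    + tw[a, -α] * DNorm R (2 * α) F a b
    + tw[a, -1 - 2 * α] * (sInt R a (gDens R (1 + 2 * α) φ) + DIter R α F a b)

/-- Right-hand side of the weighted estimate of order one. -/
def lowRhs (R α : ℝ) (F φ : Scalar) (a b : ℝ) : ℝ≥0∞ := sInt R a (gDens R 1 φ)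
    + tw[a, 1 - α] * DNorm R (2 * α) F a b
    + tw[a, 1 - α] * sInt R a (eDens R φ)
    + (∫⁻ τ in Icc a b, tw[τ, -α] * DNorm R (2 * α) F τ b)
    + tw[a, -(2 * α)] * DIter R α F a b
    + tw[a, -(2 * α)] * sInt R a (gDens R (1 + 2 * α) φ)

/-- Right-hand side of the weighted estimate of top order. -/
def topRhs (R α : ℝ) (F φ : Scalar) (a b : ℝ) : ℝ≥0∞ := sInt R a (gDens R (1 + 2 * α) φ)
    + tw[a, 1 - α] * sInt R a (eDens R φ)
    + DIter R α F a b
    + tw[a, 1 + α / 2] * DNorm R (2 * α) F a b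

/-- The energy, local energy and weighted energy estimates on `[a, b]`. -/
structure Estimates (R α : ℝ) (F φ : Scalar) (C : ℝ≥0) (a b : ℝ) : Prop where
  energy : sInt R b (eDens R φ) + bulkInt R a b (iDens α φ) ≤ C * energyRhs R α F φ a b
  low : sInt R b (gDens R 1 φ) + (∫⁻ τ in Icc a b, sInt R τ (eDens R φ)) ≤ C * lowRhs R α F φ a b
  top : sInt R b (gDens R (1 + 2 * α) φ) + bulkInt R a b (mDens R (2 * α) φ) ≤
    C * topRhs R α F φ a b

theorem ofReal_rpow_mul_le {A u v w : ℝ} (hA : 1 ≤ A) (h : u + v ≤ w) (X : ℝ≥0∞) :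
    ofReal (A ^ u) * (ofReal (A ^ v) * X) ≤ ofReal (A ^ w) * X := by
  rw [← mul_assoc, ofReal_rpow_mul (by linarith)]
  gcongr

theorem ofReal_rpow_le_one {A u : ℝ} (hA : 1 ≤ A) (h : u ≤ 0) : ofReal (A ^ u) ≤ 1 := by
  rw [← ofReal_one]
  exact ofReal_le_ofReal (Real.rpow_le_one_of_one_le_of_nonpos hA h)

theorem weighted_source_top_le (h0 : 0 < α) (h1 : α ≤ 1 / 4) (hF : Measurable F) {a b : ℝ}
    (ha : 1 ≤ a) :
    (∫⁻ s in Icc a b, tw[s, 1 + α / 2] * sInt R s (fun p => F p ^ 2 * jb[p] ^ (2 * α + 1))) ≤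
      tw[a, 1 + α / 2] * DNorm R (2 * α) F a b + 4 * DIter R α F a b := by
  rw [lintegral_weight_mul (by linarith) (by linarith)
    (measurable_sInt (measurable_weightedSource (e := 2 * α + 1) hF) R)]
  refine add_le_add le_rfl ?_
  rw [DIter, ← lintegral_const_mul' _ _ (by norm_num)]
  refine bulkInt_mono_of_mem fun τ hτ => ?_
  have hτ1 : 1 ≤ τ := ha.trans hτ.1
  rw [← mul_assoc]
  refine mul_le_mul_left ?_ _
  rw [show (4 : ℝ≥0∞) = ofReal 4 by norm_num, ← ofReal_mul (by norm_num)]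
  refine ofReal_le_ofReal ?_
  rw [show 1 + α / 2 - 1 = α / 2 by ring]
  have e1 : (1 + τ) ^ (α / 2) ≤ 2 * τ ^ (α / 2) := by
    calc _ ≤ (2 * τ) ^ (α / 2) := rpow_le_rpow (by linarith) (by linarith) (by linarith)
      _ = 2 ^ (α / 2) * τ ^ (α / 2) := Real.mul_rpow (by norm_num) (by linarith)
      _ ≤ 2 ^ (1 : ℝ) * τ ^ (α / 2) := by
        gcongr
        · norm_num
        · linarith
      _ = _ := by rw [Real.rpow_one]
  have : 0 < τ ^ (α / 2) := by positivity
  nlinarith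

theorem weighted_source_low_le (h0 : 0 < α) (h1 : α ≤ 1 / 4) (hF : Measurable F) {a b : ℝ}
    (ha : 0 ≤ a) :
    (∫⁻ s in Icc a b, tw[s, 1 - α] * sInt R s (fun p => F p ^ 2 * jb[p] ^ (2 * α + 1))) ≤
      tw[a, 1 - α] * DNorm R (2 * α) F a b
        + ∫⁻ τ in Icc a b, tw[τ, -α] * DNorm R (2 * α) F τ b := by
  rw [lintegral_weight_mul ha (by linarith)
    (measurable_sInt (measurable_weightedSource (e := 2 * α + 1) hF) R)]
  refine add_le_add le_rfl (bulkInt_mono_of_mem fun τ hτ => ?_)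
  refine mul_le_mul' (ofReal_le_ofReal ?_) le_rfl
  rw [show 1 - α - 1 = -α by ring]
  have : 0 < (1 + τ) ^ (-α) := Real.rpow_pos_of_pos (by linarith [hτ.1]) _
  nlinarith

theorem late_estimates (hR : 0 < R) (h0 : 0 < α) (h1 : α ≤ 1 / 4) {Λ ε : ℝ} (hΛ : 0 ≤ Λ)
    (hε : 28800 * ε ^ 2 ≤ α ^ 2) :
    ∃ (T : ℝ) (C : ℝ≥0), 1 ≤ T ∧ ∀ (φ F : Scalar) (a b : ℝ),
    T ≤ a → a ≤ b → LateSolution R α Λ ε F φ a b → Estimates R α F φ C a b := by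
  obtain ⟨T1, C1, hT1, hslab⟩ := LateSolution.slab hR h0 h1 hΛ hε
  obtain ⟨T2, C2, hT2, htop⟩ := LateSolution.closed_top hR h0 h1 hΛ hε
  obtain ⟨T3, C3, hT3, hlow⟩ := LateSolution.closed hR h0 h1 hΛ hε le_rfl
    (show 0 ≤ 2 * α by linarith) (admissibleWeight_zero h0 h1)
  obtain ⟨C4, hC4, hE⟩ := exists_sInt_eDens_le hR h0 le_rfl (show (0 : ℝ) ≤ 1 / 2 by norm_num)
  obtain ⟨c4, hE'⟩ : ∃ c4 : ℝ≥0, ∀ φ : Scalar, Smooth φ → ∀ τ, 0 ≤ τ →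
      sInt R τ (eDens R φ) ≤ c4 * (sInt R τ (mDens R 0 φ) + sInt R τ (iDens α φ)) := ⟨_, hE⟩
  refine ⟨max 1 (max T1 (max T2 T3)), C1 * (1 + 4 * C2) + (1 + c4) * (C3 * (2 + 4 * C2)) + 4 * C2,
    le_max_left _ _, fun φ F a b hTa hab hs => ?_⟩
  simp only [max_le_iff] at hTa
  obtain ⟨ha1, hTa1, hTa2, hTa3⟩ := hTa
  have hA : 1 ≤ 1 + a := by linarith
  have hφ := hs.smooth
  set Ea := sInt R a (eDens R φ) with hEa
  set ga := sInt R a (gDens R (1 + 2 * α) φ) with hga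
  set D2 := DNorm R (2 * α) F a b with hD2
  set DI := DIter R α F a b with hDI
  set M := bulkInt R a b (mDens R (2 * α) φ) with hM
  have b1 : (⨆ τ ∈ Icc a b, sInt R τ (gDens R (1 + 2 * α) φ)) + M ≤
      (4 * C2 : ℝ≥0) * topRhs R α F φ a b := by
    refine (htop φ F a b hTa2 hab hs).trans ?_
    calc _ ≤ C2 * (ga + tw[a, 1 - α] * Ea
          + (tw[a, 1 + α / 2] * D2 + 4 * DI)) :=
          mul_le_mul_right (add_le_add le_rfl (weighted_source_top_le h0 h1 hs.measurable ha1)) _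
      _ ≤ C2 * (4 * (ga + tw[a, 1 - α] * Ea) + (4 * (tw[a, 1 + α / 2] * D2) + 4 * DI)) := by
          have o4 : (1 : ℝ≥0∞) ≤ 4 := by norm_num
          refine mul_le_mul_right (add_le_add ?_ (add_le_add ?_ le_rfl)) _
          · simpa using mul_le_mul_left o4 (ga + tw[a, 1 - α] * Ea)
          · simpa using mul_le_mul_left o4 (tw[a, 1 + α / 2] * D2)
      _ = _ := by rw [topRhs]; push_cast; ring
  have b2 : M ≤ (4 * C2 : ℝ≥0) * topRhs R α F φ a b := le_add_self.trans b1
  have b3 : sInt R b (gDens R (1 + 2 * α) φ) + M ≤ (4 * C2 : ℝ≥0) * topRhs R α F φ a b :=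
    (add_le_add (le_iSup₂ (f := fun τ (_ : τ ∈ Icc a b) => sInt R τ (gDens R (1 + 2 * α) φ)) b
      ⟨hab, le_rfl⟩) le_rfl).trans b1
  have hweight : ∀ γ : ℝ, 0 ≤ γ → (∫⁻ s in Icc a b, tw[s, -γ] *
      sInt R s (mDens R (2 * α) φ)) ≤ tw[a, -γ] * M := by
    intro γ hγ
    rw [hM, bulkInt_eq, ← lintegral_const_mul' _ _ ofReal_ne_top]
    refine bulkInt_mono_of_mem fun s hs => mul_le_mul_left (ofReal_le_ofReal ?_) _
    exact rpow_le_rpow_of_nonpos (by linarith) (by linarith [hs.1]) (by linarith)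
  have c1 : tw[a, -1 - 8 * α] * topRhs R α F φ a b ≤ energyRhs R α F φ a b := by
    rw [topRhs, energyRhs, mul_add, mul_add, mul_add]
    calc _ ≤ tw[a, -1 - 2 * α] * ga + 1 * Ea
          + tw[a, -1 - 2 * α] * DI
          + tw[a, -α] * D2 := by
          refine add_le_add (add_le_add (add_le_add ?_ ?_) ?_) ?_
          · exact mul_le_mul_left (ofReal_le_ofReal
              (rpow_le_rpow_of_exponent_le hA (by linarith))) _
          · refine (ofReal_rpow_mul_le hA (w := 0) (by linarith) _).trans ?_
            exact mul_le_mul_left (ofReal_rpow_le_one hA le_rfl) _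
          · exact mul_le_mul_left (ofReal_le_ofReal
              (rpow_le_rpow_of_exponent_le hA (by linarith))) _
          · exact ofReal_rpow_mul_le hA (by linarith) _
      _ ≤ _ + DNorm R α F a b := le_self_add
      _ = _ := by ring
  have c2 : tw[a, -(9 * α)] * topRhs R α F φ a b ≤ lowRhs R α F φ a b := by
    rw [topRhs, lowRhs, mul_add, mul_add, mul_add]
    calc _ ≤ tw[a, -(2 * α)] * ga
          + tw[a, 1 - α] * Ea
          + tw[a, -(2 * α)] * DI
          + tw[a, 1 - α] * D2 := by
          refine add_le_add (add_le_add (add_le_add ?_ ?_) ?_) ?_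
          · exact mul_le_mul_left (ofReal_le_ofReal
              (rpow_le_rpow_of_exponent_le hA (by linarith))) _
          · exact ofReal_rpow_mul_le hA (by linarith) _
          · exact mul_le_mul_left (ofReal_le_ofReal
              (rpow_le_rpow_of_exponent_le hA (by linarith))) _
          · exact ofReal_rpow_mul_le hA (by linarith) _
      _ ≤ _ + (sInt R a (gDens R 1 φ) + ∫⁻ τ in Icc a b, tw[τ, -α] * DNorm R (2 * α) F τ b) :=
          le_self_add
      _ = _ := by ring
  have e1 : sInt R b (eDens R φ) + bulkInt R a b (iDens α φ) ≤
      (C1 * (1 + 4 * C2) : ℝ≥0) * energyRhs R α F φ a b := by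
    refine (hslab φ F a b hTa1 hab hs a b le_rfl hab le_rfl).trans ?_
    have w8 := hweight (1 + 8 * α) (by linarith)
    simp only [neg_add'] at w8
    have k1 : Ea + DNorm R α F a b ≤ energyRhs R α F φ a b := by
      rw [energyRhs, add_assoc (Ea + DNorm R α F a b)]; exact le_self_add
    calc _ ≤ C1 * (energyRhs R α F φ a b + tw[a, -1 - 8 * α] *
          ((4 * C2 : ℝ≥0) * topRhs R α F φ a b)) :=
          mul_le_mul_right (add_le_add k1 (w8.trans (mul_le_mul_right b2 _))) _
      _ = C1 * (energyRhs R α F φ a b + (4 * C2 : ℝ≥0) * (tw[a, -1 - 8 * α] *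
          topRhs R α F φ a b)) := by ring
      _ ≤ C1 * (energyRhs R α F φ a b + (4 * C2 : ℝ≥0) * energyRhs R α F φ a b) := by gcongr
      _ = _ := by push_cast; ring
  have e2 : sInt R b (gDens R 1 φ) + (∫⁻ τ in Icc a b, sInt R τ (eDens R φ)) ≤
      ((1 + c4) * (C3 * (2 + 4 * C2)) : ℝ≥0) * lowRhs R α F φ a b := by
    have k0 := hlow φ F a b hTa3 hab hs
    simp only [add_zero] at k0
    set G := ⨆ τ ∈ Icc a b, sInt R τ (gDens R 1 φ) with hG
    set M0 := bulkInt R a b (mDens R 0 φ) with hM0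
    set W := ∫⁻ s in Icc a b, tw[s, 1 - α] * sInt R s (iDens α φ) with hW
    have k1 := weighted_source_low_le (R := R) (b := b) h0 h1 hs.measurable (show 0 ≤ a by linarith)
    have k2 : (∫⁻ s in Icc a b, tw[s, 1 - α] * sInt R s (fun p => F p ^ 2 * jb[p] ^ (α + 1))) ≤
        ∫⁻ s in Icc a b, tw[s, 1 - α] *
        sInt R s (fun p => F p ^ 2 * jb[p] ^ (2 * α + 1)) := by
      refine bulkInt_mono_of_mem fun s hs => mul_le_mul_right (sInt_mono fun x => ?_) _
      exact mul_le_mul_of_nonneg_left (one_add_rpow_le (norm_nonneg _) (by linarith)) (sq_nonneg _)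
    have k3 := hweight (9 * α) (by linarith)
    set Z := tw[a, 1 - α] * D2 + ∫⁻ τ in Icc a b, tw[τ, -α] * DNorm R (2 * α) F τ b with hZ
    have k4 : G + M0 + W ≤ (C3 * (2 + 4 * C2) : ℝ≥0) * lowRhs R α F φ a b := by
      have l1 : sInt R a (gDens R 1 φ) + tw[a, 1 - α] * Ea + Z ≤ lowRhs R α F φ a b := by
        rw [lowRhs, hZ]
        calc _ ≤ _ + (tw[a, -(2 * α)] * DI
              + tw[a, -(2 * α)] * ga) := le_self_add
          _ = _ := by ring
      have l2 : Z ≤ lowRhs R α F φ a b := le_add_self.trans l1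
      refine k0.trans ?_
      calc _ ≤ C3 * (sInt R a (gDens R 1 φ) + tw[a, 1 - α] * Ea + Z
            + tw[a, -(9 * α)] * ((4 * C2 : ℝ≥0) * topRhs R α F φ a b)
            + Z) :=
            mul_le_mul_right (add_le_add (add_le_add (add_le_add le_rfl (k2.trans k1))
              (k3.trans (mul_le_mul_right b2 _))) k1) _
        _ = C3 * ((sInt R a (gDens R 1 φ) + tw[a, 1 - α] * Ea + Z)
            + (4 * C2 : ℝ≥0) * (tw[a, -(9 * α)] * topRhs R α F φ a b)
            + Z) := by ring
        _ ≤ C3 * (lowRhs R α F φ a b + (4 * C2 : ℝ≥0) * lowRhs R α F φ a b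
            + lowRhs R α F φ a b) := by gcongr
        _ = _ := by push_cast; ring
    have hiW : bulkInt R a b (iDens α φ) ≤ W := by
      refine bulkInt_mono_of_mem fun s hs => ?_
      have : 1 ≤ (1 + s) ^ (1 - α) := one_le_rpow (by linarith [hs.1]) (by linarith)
      calc sInt R s (iDens α φ) = ofReal 1 * sInt R s (iDens α φ) := by simp
        _ ≤ _ := by gcongr
    have k5 : (∫⁻ τ in Icc a b, sInt R τ (eDens R φ)) ≤ c4 * (G + M0 + W) := by
      calc _ ≤ ∫⁻ τ in Icc a b, c4 * (sInt R τ (mDens R 0 φ) + sInt R τ (iDens α φ)) :=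
            bulkInt_mono_of_mem fun τ hτ => hE' φ hφ τ (by linarith [hτ.1])
        _ = c4 * (M0 + bulkInt R a b (iDens α φ)) := by
            rw [lintegral_const_mul' _ _ ENNReal.coe_ne_top,
              lintegral_add_left (measurable_sInt (measurable_mDens hφ) R)]
            rfl
        _ ≤ c4 * (M0 + W) := by gcongr
        _ ≤ _ := by
            rw [add_assoc]
            exact mul_le_mul_right le_add_self _
    have k6 : sInt R b (gDens R 1 φ) ≤ G + M0 + W := by
      refine le_trans ?_ (le_self_add.trans le_self_add)
      exact le_iSup₂ (f := fun τ (_ : τ ∈ Icc a b) => sInt R τ (gDens R 1 φ)) b ⟨hab, le_rfl⟩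
    calc _ ≤ G + M0 + W + c4 * (G + M0 + W) := add_le_add k6 k5
      _ = (1 + c4 : ℝ≥0) * (G + M0 + W) := by push_cast; ring
      _ ≤ (1 + c4 : ℝ≥0) * ((C3 * (2 + 4 * C2) : ℝ≥0) * lowRhs R α F φ a b) := by gcongr
      _ = _ := by push_cast; ring
  refine ⟨e1.trans (mul_le_mul_left ?_ _), e2.trans (mul_le_mul_left ?_ _),
    b3.trans (mul_le_mul_left ?_ _)⟩
  · rw [add_assoc]; exact_mod_cast le_self_add
  · rw [add_right_comm]; exact_mod_cast le_add_self
  · exact_mod_cast le_add_self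

end estimates

section combine
variable {R α τ : ℝ} {φ F : Scalar} {p : Spacetime}

/-- The data controlling a solution on a bounded time interval. -/
def dataSize (R α : ℝ) (F φ : Scalar) (a b : ℝ) : ℝ≥0∞ :=
  sInt R a (eDens R φ) + sInt R a (gDens R (1 + 2 * α) φ) + DNorm R (2 * α) F a b

theorem DNorm_mono_right {β a b b' : ℝ} (h : b ≤ b') : DNorm R β F a b ≤ DNorm R β F a b' :=
  lintegral_mono_set (Icc_subset_Icc_right h)

theorem DNorm_mono_left {β a a' b : ℝ} (h : a ≤ a') : DNorm R β F a' b ≤ DNorm R β F a b :=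
  lintegral_mono_set (Icc_subset_Icc_left h)

theorem DIter_mono_left {a a' b : ℝ} (h : a ≤ a') : DIter R α F a' b ≤ DIter R α F a b :=
  lintegral_mono_set (Icc_subset_Icc_left h)

theorem one_le_ofReal_mul {T a u : ℝ} (ha : 0 ≤ a) (haT : a ≤ T) (hu : -2 ≤ u) :
    1 ≤ ofReal ((1 + T) ^ 2) * tw[a, u] := by
  rw [← ofReal_mul (by positivity), ← ofReal_one]
  refine ofReal_le_ofReal ?_
  calc (1 : ℝ) = (1 + a) ^ 2 * (1 + a) ^ (-2 : ℝ) := by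
        rw [← rpow_natCast, ← rpow_add (by linarith)]; simp
    _ ≤ (1 + T) ^ 2 * (1 + a) ^ u := by
        gcongr
        linarith

theorem ofReal_rpow_le_mul {T a u : ℝ} (ha : 0 ≤ a) (haT : a ≤ T) (hu0 : 0 ≤ u) (hu : u ≤ 2) :
    tw[T, u] ≤ ofReal ((1 + T) ^ 2) * tw[a, u] := by
  rw [← ofReal_mul (by positivity)]
  refine ofReal_le_ofReal ?_
  have h1 : 1 ≤ (1 + a) ^ u := one_le_rpow (by linarith) hu0
  have h2 : (1 + T) ^ u ≤ (1 + T) ^ 2 := by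
    rw [← rpow_natCast]
    exact rpow_le_rpow_of_exponent_le (by linarith) (by exact_mod_cast hu)
  nlinarith [sq_nonneg (1 + T)]

theorem dataSize_le (h0 : 0 < α) (h1 : α ≤ 1 / 4) {T a b : ℝ} (ha : 0 ≤ a) (haT : a ≤ T) :
    dataSize R α F φ a b ≤ ofReal ((1 + T) ^ 2) * energyRhs R α F φ a b ∧
    dataSize R α F φ a b ≤ ofReal ((1 + T) ^ 2) * lowRhs R α F φ a b ∧
    dataSize R α F φ a b ≤ ofReal ((1 + T) ^ 2) * topRhs R α F φ a b := by
  have key : ∀ u : ℝ, -2 ≤ u → ∀ X : ℝ≥0∞, X ≤ ofReal ((1 + T) ^ 2) * (tw[a, u] * X) := by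
    intro u hu X
    rw [← mul_assoc]
    simpa using mul_le_mul_left (one_le_ofReal_mul ha haT hu) X
  have key0 : ∀ X : ℝ≥0∞, X ≤ ofReal ((1 + T) ^ 2) * X := by
    intro X
    simpa using key 0 (by norm_num) X
  set k := ofReal ((1 + T) ^ 2)
  refine ⟨?_, ?_, ?_⟩
  · rw [dataSize, energyRhs]
    refine (add_le_add (add_le_add (key0 _) (key (-1 - 2 * α) (by linarith) _))
      (key (-α) (by linarith) _)).trans ?_
    calc _ ≤ _ + (k * DNorm R α F a b
          + k * (tw[a, -1 - 2 * α] * DIter R α F a b)) := le_self_add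
      _ = _ := by ring
  · rw [dataSize, lowRhs]
    refine (add_le_add (add_le_add (key (1 - α) (by linarith) _) (key (-(2 * α)) (by linarith) _))
      (key (1 - α) (by linarith) _)).trans ?_
    calc _ ≤ _ + (k * sInt R a (gDens R 1 φ)
          + k * (∫⁻ τ in Icc a b, tw[τ, -α] * DNorm R (2 * α) F τ b)
          + k * (tw[a, -(2 * α)] * DIter R α F a b)) := le_self_add
      _ = _ := by ring
  · rw [dataSize, topRhs]
    refine (add_le_add (add_le_add (key (1 - α) (by linarith) _) (key0 _))
      (key (1 + α / 2) (by linarith) _)).trans ?_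
    calc _ ≤ _ + k * DIter R α F a b := le_self_add
      _ = _ := by ring

theorem Estimates.of_top (h0 : 0 < α) (h1 : α ≤ 1 / 4) {a b : ℝ} (ha : 0 ≤ a) {C : ℝ≥0}
    (hC : C ≠ 0) (h : dataSize R α F φ a b = ⊤) : Estimates R α F φ C a b := by
  obtain ⟨h2, h3, h4⟩ := dataSize_le (R := R) (F := F) (φ := φ) (b := b) h0 h1 ha le_rfl
  rw [h, top_le_iff] at h2 h3 h4
  have key : ∀ X : ℝ≥0∞, ofReal ((1 + a) ^ 2) * X = ⊤ → (C : ℝ≥0∞) * X = ⊤ := by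
    intro X hX
    have : X = ⊤ := by
      by_contra hne
      exact ENNReal.mul_ne_top ofReal_ne_top hne hX
    rw [this, ENNReal.mul_top (by simpa using hC)]
  exact ⟨by rw [key _ h2]; exact le_top, by rw [key _ h3]; exact le_top,
    by rw [key _ h4]; exact le_top⟩

theorem Estimates.mono {a b : ℝ} {C C' : ℝ≥0} (hC : C ≤ C') (h : Estimates R α F φ C a b) :
    Estimates R α F φ C' a b where
  energy := h.energy.trans (mul_le_mul_left (by exact_mod_cast hC) _)
  low := h.low.trans (mul_le_mul_left (by exact_mod_cast hC) _)
  top := h.top.trans (mul_le_mul_left (by exact_mod_cast hC) _)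

theorem lintegral_Icc_le_add {a b c : ℝ} {f : ℝ → ℝ≥0∞} :
    (∫⁻ s in Icc a b, f s) ≤ (∫⁻ s in Icc a c, f s) + ∫⁻ s in Icc c b, f s :=
  (lintegral_mono_set Icc_subset_Icc_union_Icc).trans (lintegral_union_le _ _ _)

theorem bounded_estimates (hR : 0 < R) (h0 : 0 < α) (h1 : α ≤ 1 / 4) {T Λ : ℝ} (hT : 0 ≤ T)
    (hΛ : 0 ≤ Λ) : ∃ C : ℝ≥0, ∀ φ F : Scalar, Smooth φ →
    ∀ a b, 0 ≤ a → a ≤ b → b ≤ T →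
    (∀ τ ∈ Icc a b, ∀ x, SourceBound R α Λ F φ (leaf R τ x)) →
    sInt R b (eDens R φ) + bulkInt R a b (iDens α φ) ≤ C * dataSize R α F φ a b ∧
    sInt R b (gDens R 1 φ) + (∫⁻ τ in Icc a b, sInt R τ (eDens R φ)) ≤ C * dataSize R α F φ a b ∧
    sInt R b (gDens R (1 + 2 * α) φ) + bulkInt R a b (mDens R (2 * α) φ) ≤
      C * dataSize R α F φ a b := by
  obtain ⟨C, hC, h⟩ := bounded_time hR h0 h1 hT hΛ
  obtain ⟨c, hc⟩ : ∃ c : ℝ≥0, (c : ℝ≥0∞) = ofReal C := ⟨_, rfl⟩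
  obtain ⟨r, hr⟩ : ∃ r : ℝ≥0, (r : ℝ≥0∞) = ofReal (R ^ (1 - (1 + 2 * α))) := ⟨_, rfl⟩
  obtain ⟨t, ht⟩ : ∃ t : ℝ≥0, (t : ℝ≥0∞) = ofReal T := ⟨_, rfl⟩
  refine ⟨c * (1 + r + t), fun φ F hφ a b ha hab hbT hS => ?_⟩
  have key : ∀ τ ∈ Icc a b, sInt R τ (eDens R φ) + sInt R τ (gDens R (1 + 2 * α) φ)
      + (bulkInt R a τ (iDens α φ) + bulkInt R a τ (mDens R (2 * α) φ)) ≤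
      c * dataSize R α F φ a b := by
    intro τ hτ
    rw [hc]
    refine (h φ F hφ a τ ha hτ.1 (hτ.2.trans hbT)
      fun σ hσ => hS σ ⟨hσ.1, hσ.2.trans hτ.2⟩).trans (mul_le_mul_right ?_ _)
    exact add_le_add le_rfl (DNorm_mono_right hτ.2)
  set S := (c : ℝ≥0∞) * dataSize R α F φ a b with hS'
  have kb := key b ⟨hab, le_rfl⟩
  have e : ((c * (1 + r + t) : ℝ≥0) : ℝ≥0∞) * dataSize R α F φ a b = S + r * S + t * S := by
    rw [hS']; push_cast; ring
  rw [e]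
  have s1 : S ≤ S + r * S + t * S := by rw [add_assoc]; exact le_self_add
  refine ⟨le_trans (le_trans ?_ kb) s1, ?_, le_trans (le_trans ?_ kb) s1⟩
  · exact add_le_add le_self_add le_self_add
  · have k1 : sInt R b (gDens R 1 φ) ≤ r * S := by
      rw [hr]
      refine (sInt_le_const_mul (by positivity) fun x => gDens_le_gDens hR
        (q' := 1 + 2 * α) (by linarith)).trans (mul_le_mul_right ?_ _)
      exact (le_add_self.trans le_self_add).trans kb
    have k2 : (∫⁻ τ in Icc a b, sInt R τ (eDens R φ)) ≤ t * S := by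
      calc _ ≤ ∫⁻ _ in Icc a b, S := bulkInt_mono_of_mem fun τ hτ =>
            (le_self_add.trans le_self_add).trans (key τ hτ)
        _ = S * ofReal (b - a) := by rw [setLIntegral_const, Real.volume_Icc]
        _ ≤ S * t := by
            rw [ht]
            exact mul_le_mul_right (ofReal_le_ofReal (by linarith)) _
        _ = _ := mul_comm _ _
    rw [add_assoc]
    exact (add_le_add k1 k2).trans le_add_self
  · exact add_le_add le_add_self le_add_self

theorem rhs_le_of_le (hR : 0 < R) (h0 : 0 < α) (h1 : α ≤ 1 / 4) {T : ℝ} (hT : 0 ≤ T) :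
    ∃ k : ℝ≥0, ∀ (φ F : Scalar) (a b : ℝ), 0 ≤ a → a ≤ T →
    energyRhs R α F φ T b ≤ k * (sInt R T (eDens R φ) + sInt R T (gDens R (1 + 2 * α) φ)
      + energyRhs R α F φ a b) ∧
    lowRhs R α F φ T b ≤ k * (sInt R T (eDens R φ) + sInt R T (gDens R (1 + 2 * α) φ)
      + lowRhs R α F φ a b) ∧
    topRhs R α F φ T b ≤ k * (sInt R T (eDens R φ) + sInt R T (gDens R (1 + 2 * α) φ)
      + topRhs R α F φ a b) := by
  obtain ⟨κ, hκ⟩ : ∃ κ : ℝ≥0, (κ : ℝ≥0∞) = ofReal ((1 + T) ^ 2) := ⟨_, rfl⟩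
  obtain ⟨r, hr⟩ : ∃ r : ℝ≥0, (r : ℝ≥0∞) = ofReal (R ^ (1 - (1 + 2 * α))) := ⟨_, rfl⟩
  refine ⟨1 + r + κ, fun φ F a b ha haT => ?_⟩
  set E := sInt R T (eDens R φ)
  set g := sInt R T (gDens R (1 + 2 * α) φ)
  have hT1 : 1 ≤ 1 + T := by linarith
  have anti : ∀ u : ℝ, u ≤ 0 → tw[T, u] ≤ tw[a, u] := fun u hu => ofReal_le_ofReal
      (rpow_le_rpow_of_nonpos (by linarith) (by linarith) hu)
  have up : ∀ u : ℝ, 0 ≤ u → u ≤ 2 → tw[T, u] ≤ κ * tw[a, u] := fun u hu hu2 => by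
    rw [hκ]; exact ofReal_rpow_le_mul ha haT hu hu2
  have up0 : ∀ u : ℝ, u ≤ 2 → tw[T, u] ≤ κ := fun u hu2 => by
    rw [hκ]
    refine ofReal_le_ofReal ?_
    rw [← rpow_natCast]
    exact rpow_le_rpow_of_exponent_le hT1 (by exact_mod_cast hu2)
  have d1 := DNorm_mono_left (R := R) (F := F) (β := α) (b := b) haT
  have d2 := DNorm_mono_left (R := R) (F := F) (β := 2 * α) (b := b) haT
  have d3 := DIter_mono_left (R := R) (F := F) (α := α) (b := b) haT
  have scale : ∀ {X Y : ℝ≥0∞}, X ≤ (1 + r + κ : ℝ≥0) * Y ↔ X ≤ Y + r * Y + κ * Y := by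
    intro X Y; push_cast; rw [add_mul, add_mul, one_mul]
  refine ⟨scale.2 ?_, scale.2 ?_, scale.2 ?_⟩
  · refine le_trans ?_ (le_self_add.trans le_self_add)
    rw [energyRhs, energyRhs, mul_add, mul_add]
    have l1 : tw[T, -1 - 2 * α] * g ≤ g := by
      simpa using mul_le_mul_left (ofReal_rpow_le_one hT1 (u := -1 - 2 * α) (by linarith)) g
    calc _ ≤ E + DNorm R α F a b + tw[a, -α] * DNorm R (2 * α) F a b
          + (g + tw[a, -1 - 2 * α] * DIter R α F a b) :=
          add_le_add (add_le_add (add_le_add le_rfl d1) (mul_le_mul' (anti _ (by linarith)) d2))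
            (add_le_add l1 (mul_le_mul' (anti _ (by linarith)) d3))
      _ ≤ _ + (sInt R a (eDens R φ) + tw[a, -1 - 2 * α] *
          sInt R a (gDens R (1 + 2 * α) φ)) := le_self_add
      _ = _ := by ring
  · rw [lowRhs]
    have l1 : sInt R T (gDens R 1 φ) ≤ r * g := by
      rw [hr]
      exact sInt_le_const_mul (by positivity) fun x => gDens_le_gDens hR (by linarith)
    have l2 : tw[T, -(2 * α)] * g ≤ g := by
      simpa using mul_le_mul_left (ofReal_rpow_le_one hT1 (u := -(2 * α)) (by linarith)) g
    have l3 : (∫⁻ τ in Icc T b, tw[τ, -α] * DNorm R (2 * α) F τ b) ≤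
        ∫⁻ τ in Icc a b, tw[τ, -α] * DNorm R (2 * α) F τ b :=
      lintegral_mono_set (Icc_subset_Icc_left haT)
    set L := ∫⁻ τ in Icc a b, tw[τ, -α] * DNorm R (2 * α) F τ b with hL
    calc _ ≤ r * g + κ * tw[a, 1 - α] * DNorm R (2 * α) F a b + κ * E + L
          + tw[a, -(2 * α)] * DIter R α F a b + g :=
          add_le_add (add_le_add (add_le_add (add_le_add (add_le_add l1
            (mul_le_mul' (up _ (by linarith) (by linarith)) d2))
            (mul_le_mul_left (up0 _ (by linarith)) _)) l3)
            (mul_le_mul' (anti _ (by linarith)) d3)) l2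
      _ = (g + L + tw[a, -(2 * α)] * DIter R α F a b) + r * g
          + κ * (E + tw[a, 1 - α] * DNorm R (2 * α) F a b) := by ring
      _ ≤ _ := by
          have q1 : g + L + tw[a, -(2 * α)] * DIter R α F a b ≤ E + g + lowRhs R α F φ a b := by
            rw [lowRhs, ← hL]
            calc _ ≤ _ + (E + sInt R a (gDens R 1 φ)
                + tw[a, 1 - α] * DNorm R (2 * α) F a b
                + tw[a, 1 - α] * sInt R a (eDens R φ)
                + tw[a, -(2 * α)] * sInt R a (gDens R (1 + 2 * α) φ)) :=
                le_self_add
              _ = _ := by ring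
          have q2 : E + tw[a, 1 - α] * DNorm R (2 * α) F a b ≤ E + g + lowRhs R α F φ a b := by
            refine add_le_add le_self_add ?_
            rw [lowRhs, ← hL]
            calc _ ≤ _ + (sInt R a (gDens R 1 φ) + L
                + tw[a, 1 - α] * sInt R a (eDens R φ)
                + tw[a, -(2 * α)] * DIter R α F a b
                + tw[a, -(2 * α)] * sInt R a (gDens R (1 + 2 * α) φ)) :=
                le_self_add
              _ = _ := by ring
          have q3 : g ≤ E + g + lowRhs R α F φ a b := le_add_self.trans le_self_add
          gcongr
  · rw [topRhs]
    calc _ ≤ g + κ * E + DIter R α F a b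
          + κ * tw[a, 1 + α / 2] * DNorm R (2 * α) F a b :=
          add_le_add (add_le_add (add_le_add le_rfl (mul_le_mul_left (up0 _ (by linarith)) _)) d3)
            (mul_le_mul' (up _ (by linarith) (by linarith)) d2)
      _ = (g + DIter R α F a b) + κ * (E + tw[a, 1 + α / 2] * DNorm R (2 * α) F a b) := by ring
      _ ≤ _ := by
          have q1 : g + DIter R α F a b ≤ E + g + topRhs R α F φ a b := by
            refine add_le_add le_add_self ?_
            rw [topRhs, add_assoc]
            exact le_self_add.trans le_add_self
          have q2 : E + tw[a, 1 + α / 2] * DNorm R (2 * α) F a b ≤ E + g + topRhs R α F φ a b := by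
            refine add_le_add le_self_add ?_
            rw [topRhs]
            exact le_add_self
          exact add_le_add (q1.trans le_self_add) (mul_le_mul_right q2 _)

/-- The estimates for all times, from the bounds on the source term. -/
theorem estimates_of_source (hR : 0 < R) (h0 : 0 < α) (h1 : α ≤ 1 / 4) {Λ ε T₀ : ℝ} (hΛ : 0 ≤ Λ)
    (hε : 28800 * ε ^ 2 ≤ α ^ 2) : ∃ C : ℝ≥0, ∀ φ F : Scalar, Smooth φ →
    Measurable F → (∀ τ, 0 ≤ τ → ∀ x, SourceBound R α Λ F φ (leaf R τ x)) →
    (∀ τ, T₀ ≤ τ → ∀ x, LateSource R α Λ (1 + τ) F φ (leaf R τ x) ∧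
      SmallSource R α Λ ε (1 + τ) F φ (leaf R τ x)) →
    ∀ a b, 0 ≤ a → a ≤ b → Estimates R α F φ C a b := by
  obtain ⟨T1, CL, hT1, hlate⟩ := late_estimates hR h0 h1 hΛ hε
  set T := max T1 T₀ with hTdef
  have hTT1 : T1 ≤ T := le_max_left _ _
  have hT : 0 ≤ T := by linarith
  obtain ⟨CB, hbd⟩ := bounded_estimates hR h0 h1 hT hΛ
  obtain ⟨k, hk⟩ := rhs_le_of_le hR h0 h1 hT
  obtain ⟨κ, hκ⟩ : ∃ κ : ℝ≥0, (κ : ℝ≥0∞) = ofReal ((1 + T) ^ 2) := ⟨_, rfl⟩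
  refine ⟨1 + CL + CB * κ + CL * (k * (2 * CB * κ + 1)), fun φ F hφ hF hS hL a b ha hab => ?_⟩
  set C := 1 + CL + CB * κ + CL * (k * (2 * CB * κ + 1)) with hC
  by_cases htop : dataSize R α F φ a b = ⊤
  · exact Estimates.of_top h0 h1 ha (by rw [hC]; positivity) htop
  have fdat := htop
  simp only [dataSize, ENNReal.add_eq_top, not_or] at fdat
  obtain ⟨⟨fE, fg⟩, fD⟩ := fdat
  rcases le_total T a with hTa | haT
  · refine Estimates.mono ?_ (hlate φ F a b (hTT1.trans hTa) hab ⟨hφ, hF,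
      fun τ hτ x => (hL τ ((le_max_right _ _).trans (hTa.trans hτ.1)) x).1,
      fun τ hτ x => (hL τ ((le_max_right _ _).trans (hTa.trans hτ.1)) x).2, fE, fg, fD⟩)
    rw [hC, add_comm (1 : ℝ≥0), add_assoc, add_assoc]
    exact le_self_add
  obtain ⟨s1, s2, s3⟩ := dataSize_le (R := R) (F := F) (φ := φ) (b := b) h0 h1 ha haT
  rw [← hκ] at s1 s2 s3
  rcases le_total b T with hbT | hTb
  · obtain ⟨e1, e2, e3⟩ := hbd φ F hφ a b ha hab hbT fun τ hτ => hS τ (ha.trans hτ.1)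
    have hCC : CB * κ ≤ C := by
      rw [hC, add_comm (1 + CL), add_assoc]; exact le_self_add
    have key : ∀ {X Y : ℝ≥0∞}, X ≤ CB * dataSize R α F φ a b → dataSize R α F φ a b ≤ κ * Y →
        X ≤ C * Y := by
      intro X Y h2 h3
      calc X ≤ CB * (κ * Y) := h2.trans (mul_le_mul_right h3 _)
        _ = (CB * κ : ℝ≥0) * Y := by push_cast; ring
        _ ≤ _ := mul_le_mul_left (by exact_mod_cast hCC) _
    exact ⟨key e1 s1, key e2 s2, key e3 s3⟩
  · obtain ⟨e1, e2, e3⟩ := hbd φ F hφ a T ha haT le_rfl fun τ hτ => hS τ (ha.trans hτ.1)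
    have hmono : dataSize R α F φ a T ≤ dataSize R α F φ a b :=
      add_le_add le_rfl (DNorm_mono_right hTb)
    set S := dataSize R α F φ a b with hSd
    have fS : (CB : ℝ≥0∞) * S ≠ ⊤ := ENNReal.mul_ne_top ENNReal.coe_ne_top htop
    replace e1 := e1.trans (mul_le_mul_right hmono _)
    replace e2 := e2.trans (mul_le_mul_right hmono _)
    replace e3 := e3.trans (mul_le_mul_right hmono _)
    have gE := le_self_add.trans e1
    have gg := le_self_add.trans e3
    have hest := hlate φ F T b hTT1 hTb ⟨hφ, hF,
      fun τ hτ x => (hL τ ((le_max_right _ _).trans hτ.1) x).1,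
      fun τ hτ x => (hL τ ((le_max_right _ _).trans hτ.1) x).2,
      (gE.trans_lt fS.lt_top).ne, (gg.trans_lt fS.lt_top).ne,
      ((DNorm_mono_left haT).trans_lt (lt_top_iff_ne_top.2 fD)).ne⟩
    obtain ⟨k1, k2, k3⟩ := hk φ F a b ha haT
    have key : ∀ {X1 X2 I I1 I2 Y Z : ℝ≥0∞}, I ≤ I1 + I2 → X1 + I1 ≤ CB * S →
        X2 + I2 ≤ CL * Z → Z ≤ k * (sInt R T (eDens R φ) + sInt R T (gDens R (1 + 2 * α) φ) + Y) →
        S ≤ κ * Y → X2 + I ≤ C * Y := by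
      intro X1 X2 I I1 I2 Y Z hI hI1 hX hZ hSY
      calc X2 + I ≤ X2 + (I1 + I2) := add_le_add le_rfl hI
        _ = I1 + (X2 + I2) := by ring
        _ ≤ CB * S + CL * (k * (CB * S + CB * S + Y)) :=
            add_le_add (le_add_self.trans hI1) (hX.trans (mul_le_mul_right (hZ.trans
              (mul_le_mul_right (add_le_add (add_le_add gE gg) le_rfl) _)) _))
        _ ≤ CB * (κ * Y) + CL * (k * (CB * (κ * Y) + CB * (κ * Y) + Y)) := by gcongr
        _ = (CB * κ + CL * (k * (2 * CB * κ + 1)) : ℝ≥0) * Y := by push_cast; ring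
        _ ≤ _ := by
            refine mul_le_mul_left ?_ _
            rw [hC, add_assoc (1 + CL)]
            exact_mod_cast le_add_self
    exact ⟨key lintegral_Icc_le_add e1 hest.energy k1 s1,
      key lintegral_Icc_le_add e2 hest.low k2 s2, key lintegral_Icc_le_add e3 hest.top k3 s3⟩

end combine

section nullForms
variable {Φ φ : Scalar} {p : Spacetime}

/-- The sum of the absolute values of the entries. -/
def entrySum (B : Matrix (Fin 4) (Fin 4) ℝ) : ℝ := ∑ μ, ∑ ν, |B μ ν|

theorem entrySum_nonneg (B : Matrix (Fin 4) (Fin 4) ℝ) : 0 ≤ entrySum B :=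
  Finset.sum_nonneg fun _ _ => Finset.sum_nonneg fun _ _ => abs_nonneg _

/-- The bilinear form of a matrix. -/
def bil (B : Matrix (Fin 4) (Fin 4) ℝ) (a b : Fin 4 → ℝ) : ℝ := ∑ μ, ∑ ν, B μ ν * a μ * b ν

theorem abs_le_sqrt_sum_sq {n : ℕ} (a : Fin n → ℝ) (i : Fin n) : |a i| ≤ √(∑ j, a j ^ 2) :=
  Real.abs_le_sqrt (Finset.single_le_sum (f := fun j => a j ^ 2) (fun _ _ => sq_nonneg _)
    (Finset.mem_univ i))

theorem abs_bil_le (B : Matrix (Fin 4) (Fin 4) ℝ) (a b : Fin 4 → ℝ) :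
    |bil B a b| ≤ entrySum B * (√(∑ μ, a μ ^ 2) * √(∑ μ, b μ ^ 2)) := by
  rw [entrySum, Finset.sum_mul]
  refine (Finset.abs_sum_le_sum_abs _ _).trans (Finset.sum_le_sum fun μ _ => ?_)
  rw [Finset.sum_mul]
  refine (Finset.abs_sum_le_sum_abs _ _).trans (Finset.sum_le_sum fun ν _ => ?_)
  rw [abs_mul, abs_mul, mul_assoc]
  have := abs_le_sqrt_sum_sq a μ
  have := abs_le_sqrt_sum_sq b ν
  gcongr

theorem nullForm_eq_bil (B : Matrix (Fin 4) (Fin 4) ℝ) :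
    nullForm B Φ φ p = bil B (fun μ => pd μ Φ p) (fun ν => pd ν φ p) := rfl

theorem abs_nullForm_le (B : Matrix (Fin 4) (Fin 4) ℝ) :
    |nullForm B Φ φ p| ≤ entrySum B * (√(gradSq Φ p) * √(gradSq φ p)) :=
  abs_bil_le B _ _

/-- The part of the derivatives transversal to the outgoing cones. -/
def badDer (f : Scalar) (p : Spacetime) : ℝ := (pd 0 f p - dr f p) / 2

/-- The part of the gradient tangential to the outgoing cones. -/
def goodGrad (f : Scalar) (p : Spacetime) : Fin 4 → ℝ :=
  Fin.cons (pd 0 f p - badDer f p) (fun i => pd i.succ f p + badDer f p * radial p.2 i)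

/-- The null covector. -/
def nullVec (p : Spacetime) : Fin 4 → ℝ := Fin.cons 1 (fun i => -radial p.2 i)

theorem bil_decomp (B : Matrix (Fin 4) (Fin 4) ℝ) : bil B (fun μ => pd μ Φ p) (fun ν => pd ν φ p) =
      badDer Φ p * badDer φ p * bil B (nullVec p) (nullVec p)
      + badDer Φ p * bil B (nullVec p) (goodGrad φ p)
      + bil B (goodGrad Φ p) (fun ν => pd ν φ p) := by
  have h : ∀ f μ, pd μ f p = badDer f p * nullVec p μ + goodGrad f p μ := by
    intro f μ
    refine Fin.cases ?_ (fun i => ?_) μ <;> simp [nullVec, goodGrad]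
  have h1 : bil B (fun μ => pd μ Φ p) (fun ν => pd ν φ p) =
      badDer Φ p * bil B (nullVec p) (fun ν => pd ν φ p)
        + bil B (goodGrad Φ p) (fun ν => pd ν φ p) := by
    simp only [bil, Finset.mul_sum, ← Finset.sum_add_distrib]
    refine Finset.sum_congr rfl fun μ _ => Finset.sum_congr rfl fun ν _ => ?_
    rw [h Φ μ]; ring
  have h2 : bil B (nullVec p) (fun ν => pd ν φ p) =
      badDer φ p * bil B (nullVec p) (nullVec p) + bil B (nullVec p) (goodGrad φ p) := by
    simp only [bil, Finset.mul_sum, ← Finset.sum_add_distrib]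
    refine Finset.sum_congr rfl fun μ _ => Finset.sum_congr rfl fun ν _ => ?_
    rw [h φ ν]; ring
  rw [h1, h2]; ring

theorem sum_nullVec_sq (hp : p.2 ≠ 0) : ∑ μ, nullVec p μ ^ 2 = 2 := by
  have := sum_radial_sq hp
  rw [Fin.sum_univ_succ]
  simp [nullVec, this]
  norm_num

theorem bil_nullVec {B : Matrix (Fin 4) (Fin 4) ℝ} (hB : NullCondition B) (hp : p.2 ≠ 0) :
    bil B (nullVec p) (nullVec p) = 0 := by
  refine hB _ ?_
  have := sum_radial_sq hp
  rw [Fin.sum_univ_three] at this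
  have e1 : nullVec p 0 = 1 := rfl
  have e2 : nullVec p 1 = -radial p.2 0 := rfl
  have e3 : nullVec p 2 = -radial p.2 1 := rfl
  have e4 : nullVec p 3 = -radial p.2 2 := rfl
  rw [e1, e2, e3, e4]
  linarith

theorem sum_goodGrad_sq (hp : p.2 ≠ 0) : ∑ μ, goodGrad φ p μ ^ 2 ≤ dv φ p ^ 2 + angSq φ p := by
  have h1 := sum_radial_sq hp
  have h2 := spaceSq_eq (φ := φ) hp
  have h3 := dr_eq_sum (φ := φ) (p := p)
  have e : ∑ i : Fin 3, (pd i.succ φ p + badDer φ p * radial p.2 i) ^ 2 =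
      spaceSq φ p + 2 * badDer φ p * dr φ p + badDer φ p ^ 2 := by
    rw [h3, spaceSq, Finset.mul_sum, ← mul_one (badDer φ p ^ 2), ← h1, Finset.mul_sum,
      ← Finset.sum_add_distrib, ← Finset.sum_add_distrib]
    exact Finset.sum_congr rfl fun i _ => by ring
  rw [Fin.sum_univ_succ]
  simp only [goodGrad, Fin.cons_zero, Fin.cons_succ]
  rw [e, h2, badDer, dv]
  nlinarith [sq_nonneg (pd 0 φ p + dr φ p)]

theorem badDer_sq_le : 2 * badDer φ p ^ 2 ≤ gradSq φ p := by
  have := dr_sq_le (φ := φ) (p := p)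
  rw [gradSq_eq, badDer]
  nlinarith [sq_nonneg (pd 0 φ p + dr φ p)]

/-- Null forms do not contain the product of two transversal derivatives. -/
theorem abs_nullForm_le_good {B : Matrix (Fin 4) (Fin 4) ℝ} (hB : NullCondition B) (hp : p.2 ≠ 0) :
    |nullForm B Φ φ p| ≤ entrySum B * (√(gradSq Φ p) * √good[φ, p]
      + √good[Φ, p] * √(gradSq φ p)) := by
  have hs := entrySum_nonneg B
  rw [nullForm_eq_bil, bil_decomp, bil_nullVec hB hp, mul_zero, zero_add, mul_add]
  refine (abs_add_le _ _).trans (add_le_add ?_ ?_)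
  · rw [abs_mul]
    have h1 := abs_bil_le B (nullVec p) (goodGrad φ p)
    rw [sum_nullVec_sq hp] at h1
    have h2 : |badDer Φ p| * √2 ≤ √(gradSq Φ p) := by
      rw [← Real.sqrt_sq_eq_abs, ← Real.sqrt_mul (sq_nonneg _), mul_comm]
      exact Real.sqrt_le_sqrt badDer_sq_le
    have h3 := Real.sqrt_le_sqrt (sum_goodGrad_sq (φ := φ) hp)
    calc _ ≤ |badDer Φ p| * (entrySum B * (√2 * √(∑ μ, goodGrad φ p μ ^ 2))) := by gcongr
      _ = entrySum B * ((|badDer Φ p| * √2) * √(∑ μ, goodGrad φ p μ ^ 2)) := by ring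
      _ ≤ _ := by gcongr
  · refine (abs_bil_le B _ _).trans ?_
    have h3 := Real.sqrt_le_sqrt (sum_goodGrad_sq (φ := Φ) hp)
    have : √(∑ μ, pd μ φ p ^ 2) = √(gradSq φ p) := rfl
    rw [this]
    gcongr

theorem NullCondition.eq_minkowski {B : Matrix (Fin 4) (Fin 4) ℝ} (hB : NullCondition B)
    (hs : B.IsSymm) (a b : Fin 4 → ℝ) :
    bil B a b = B 0 0 * (a 0 * b 0 - a 1 * b 1 - a 2 * b 2 - a 3 * b 3) := by
  have s : ∀ μ ν, B ν μ = B μ ν := fun μ ν => hs.apply μ ν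
  have q : ∀ x y z w : ℝ, x ^ 2 = y ^ 2 + z ^ 2 + w ^ 2 → B 0 0 * x ^ 2 + B 1 1 * y ^ 2
      + B 2 2 * z ^ 2 + B 3 3 * w ^ 2 + 2 * (B 0 1 * x * y + B 0 2 * x * z + B 0 3 * x * w
      + B 1 2 * y * z + B 1 3 * y * w + B 2 3 * z * w) = 0 := by
    intro x y z w h
    have := hB ![x, y, z, w] (by simpa using h)
    simp [Fin.sum_univ_four] at this
    have s1 := s 0 1
    have s2 := s 0 2
    have s3 := s 0 3
    have s4 := s 1 2
    have s5 := s 1 3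
    have s6 := s 2 3
    rw [s1, s2, s3, s4, s5, s6] at this
    linarith
  have h1 := q 1 1 0 0 (by norm_num)
  have h2 := q 1 (-1) 0 0 (by norm_num)
  have h3 := q 1 0 1 0 (by norm_num)
  have h4 := q 1 0 (-1) 0 (by norm_num)
  have h5 := q 1 0 0 1 (by norm_num)
  have h6 := q 1 0 0 (-1) (by norm_num)
  have h7 := q 5 3 4 0 (by norm_num)
  have h8 := q 5 3 0 4 (by norm_num)
  have h9 := q 5 0 3 4 (by norm_num)
  norm_num at h1 h2 h3 h4 h5 h6 h7 h8 h9
  have b01 : B 0 1 = 0 := by linarith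
  have b02 : B 0 2 = 0 := by linarith
  have b03 : B 0 3 = 0 := by linarith
  have b11 : B 1 1 = -B 0 0 := by linarith
  have b22 : B 2 2 = -B 0 0 := by linarith
  have b33 : B 3 3 = -B 0 0 := by linarith
  have b12 : B 1 2 = 0 := by linarith
  have b13 : B 1 3 = 0 := by linarith
  have b23 : B 2 3 = 0 := by linarith
  simp only [bil, Fin.sum_univ_four, s 0 1, s 0 2, s 0 3, s 1 2, s 1 3, s 2 3, b01, b02, b03, b11,
    b22, b33, b12, b13, b23]
  ring

/-- For symmetric null forms only the outgoing derivative of the first factor is needed. -/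
theorem abs_nullForm_le_of_symm {B : Matrix (Fin 4) (Fin 4) ℝ} (hB : NullCondition B)
    (hs : B.IsSymm) (hp : p.2 ≠ 0) :
    |nullForm B Φ φ p| ≤ entrySum B * (2 * √(gradSq Φ p) * √good[φ, p]
      + |dv Φ p| * √(gradSq φ p)) := by
  have e0 : |B 0 0| ≤ entrySum B :=
    (Finset.single_le_sum (f := fun ν => |B 0 ν|) (fun _ _ => abs_nonneg _)
      (Finset.mem_univ 0)).trans (Finset.single_le_sum (f := fun μ => ∑ ν, |B μ ν|)
      (fun _ _ => Finset.sum_nonneg fun _ _ => abs_nonneg _) (Finset.mem_univ 0))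
  have e1 : ∀ f : Scalar, |badDer f p| ≤ √(gradSq f p) := fun f =>
    Real.abs_le_sqrt (by
      have := badDer_sq_le (φ := f) (p := p)
      have := sq_nonneg (badDer f p)
      linarith)
  have e2 : |dv φ p| ≤ √good[φ, p] := Real.abs_le_sqrt (by linarith [angSq_nonneg φ p])
  set A := ∑ i : Fin 3, (pd i.succ Φ p - radial p.2 i * dr Φ p) *
    (pd i.succ φ p - radial p.2 i * dr φ p) with hA
  have e3 : |A| ≤ √(gradSq Φ p) * √good[φ, p] := by
    have cs : A ^ 2 ≤ angSq Φ p * angSq φ p := Finset.sum_mul_sq_le_sq_mul_sq _ _ _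
    calc |A| ≤ √(angSq Φ p * angSq φ p) := Real.abs_le_sqrt cs
      _ = √(angSq Φ p) * √(angSq φ p) := Real.sqrt_mul (angSq_nonneg _ _) _
      _ ≤ _ := by
        gcongr
        · rw [gradSq_eq' hp]
          nlinarith [sq_nonneg (pd 0 Φ p), sq_nonneg (dr Φ p)]
        · nlinarith [sq_nonneg (dv φ p)]
  have e4 : nullForm B Φ φ p = B 0 0 * (dv Φ p * badDer φ p + badDer Φ p * dv φ p - A) := by
    have h1 := sum_radial_sq hp
    have h2 := dr_eq_sum (φ := Φ) (p := p)
    have h3 := dr_eq_sum (φ := φ) (p := p)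
    have hA' : A = ∑ i : Fin 3, pd i.succ Φ p * pd i.succ φ p - dr Φ p * dr φ p := by
      have : A = ∑ i : Fin 3, pd i.succ Φ p * pd i.succ φ p
          - (∑ i : Fin 3, radial p.2 i * pd i.succ Φ p) * dr φ p
          - (∑ i : Fin 3, radial p.2 i * pd i.succ φ p) * dr Φ p
          + (∑ i : Fin 3, radial p.2 i ^ 2) * (dr Φ p * dr φ p) := by
        rw [Finset.sum_mul, Finset.sum_mul, Finset.sum_mul, ← Finset.sum_sub_distrib,
          ← Finset.sum_sub_distrib, ← Finset.sum_add_distrib]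
        exact Finset.sum_congr rfl fun i _ => by ring
      rw [this, ← h2, ← h3, h1]; ring
    rw [nullForm_eq_bil, hB.eq_minkowski hs, hA', Fin.sum_univ_three, badDer, badDer, dv, dv]
    have c1 : (Fin.succ 0 : Fin 4) = 1 := rfl
    have c2 : (Fin.succ 1 : Fin 4) = 2 := rfl
    have c3 : (Fin.succ 2 : Fin 4) = 3 := rfl
    rw [c1, c2, c3]
    ring
  rw [e4, abs_mul]
  have e5 : |dv Φ p * badDer φ p + badDer Φ p * dv φ p - A| ≤
      2 * √(gradSq Φ p) * √good[φ, p] + |dv Φ p| * √(gradSq φ p) := by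
    calc _ ≤ |dv Φ p| * |badDer φ p| + |badDer Φ p| * |dv φ p| + |A| := by
          rw [← abs_mul, ← abs_mul]
          exact (abs_sub _ _).trans (add_le_add (abs_add_le _ _) le_rfl)
      _ ≤ |dv Φ p| * √(gradSq φ p) + √(gradSq Φ p) * √good[φ, p] + √(gradSq Φ p) * √good[φ, p] := by
          gcongr
          exact e1 _
          exact e1 _
      _ = _ := by ring
  exact mul_le_mul e0 e5 (abs_nonneg _) (entrySum_nonneg B)

theorem abs_linTerm_le {L : Fin 4 → Scalar} {k : ℝ} (hL : ∀ μ, |L μ p| ≤ k) :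
    |linTerm L φ p| ≤ 4 * k * √(gradSq φ p) := by
  have hk : 0 ≤ k := (abs_nonneg _).trans (hL 0)
  calc |linTerm L φ p| ≤ ∑ μ, |L μ p * pd μ φ p| := Finset.abs_sum_le_sum_abs _ _
    _ ≤ ∑ _ : Fin 4, k * √(gradSq φ p) := by
        refine Finset.sum_le_sum fun μ _ => ?_
        rw [abs_mul]
        have := abs_le_sqrt_sum_sq (fun μ => pd μ φ p) μ
        exact mul_le_mul (hL μ) this (abs_nonneg _) hk
    _ = _ := by simp; ring

end nullForms

section outgoing
variable {G : Scalar} {R₁ t₀ C₀ α : ℝ}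

theorem radial_smul {c : ℝ} (hc : 0 < c) (x : Space) : radial (c • x) = radial x := by
  rw [radial, radial, norm_smul, Real.norm_of_nonneg hc.le, smul_smul]
  congr 1
  field_simp

theorem hasDerivAt_ray (hG : Differentiable ℝ G) {x : Space} (hx : x ≠ 0) {s : ℝ} (hs : 0 ≤ s)
    (t : ℝ) :
    HasDerivAt (fun σ => G (t + σ, (1 + σ / ‖x‖) • x)) (dv G (t + s, (1 + s / ‖x‖) • x)) s := by
  have hr : 0 < ‖x‖ := norm_pos_iff.2 hx
  have h1 : HasDerivAt (fun σ : ℝ => (t + σ, (1 + σ / ‖x‖) • x)) ((1 : ℝ), radial x) s := by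
    have e1 : HasDerivAt (fun σ : ℝ => t + σ) 1 s := (hasDerivAt_id s).const_add t
    have e2 : HasDerivAt (fun σ : ℝ => (1 + σ / ‖x‖) • x) ((1 / ‖x‖) • x) s :=
      (((hasDerivAt_id s).div_const ‖x‖).const_add 1).smul_const x
    rw [one_div] at e2
    exact e1.prodMk e2
  have h2 := (hG (t + s, (1 + s / ‖x‖) • x)).hasFDerivAt.comp_hasDerivAt s h1
  refine h2.congr_deriv ?_
  have hc : 0 < 1 + s / ‖x‖ := by positivity
  rw [dv, pd, dr, ← map_add]
  simp [basisVec, radial_smul hc]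

theorem norm_ray {x : Space} (hx : x ≠ 0) {s : ℝ} (hs : 0 ≤ s) : ‖(1 + s / ‖x‖) • x‖ = ‖x‖ + s := by
  have hr : 0 < ‖x‖ := norm_pos_iff.2 hx
  rw [norm_smul, Real.norm_of_nonneg (by positivity)]
  field_simp

theorem abs_ray_sub_le (hG : Differentiable ℝ G) (hR : 0 < R₁) (hα : 0 < α) (hC : 0 ≤ C₀)
    (hdv : ∀ t x, t₀ ≤ t → R₁ ≤ ‖x‖ → |dv G (t, x)| ≤ C₀ * (1 + ‖x‖) ^ (-1 - 3 * α))
    {t : ℝ} {x : Space} (ht : t₀ ≤ t) (hx : R₁ ≤ ‖x‖) {s : ℝ} (hs : 0 ≤ s) :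
    |G (t + s, (1 + s / ‖x‖) • x) - G (t, x)| ≤ C₀ / (3 * α) * (1 + ‖x‖) ^ (-(3 * α)) := by
  have hx0 : x ≠ 0 := norm_pos_iff.1 (hR.trans_le hx)
  have hd : ∀ σ, 0 ≤ σ → HasDerivAt
      (fun σ => C₀ / (3 * α) * ((1 + ‖x‖) ^ (-(3 * α)) - (1 + (‖x‖ + σ)) ^ (-(3 * α))))
      (C₀ * (1 + (‖x‖ + σ)) ^ (-1 - 3 * α)) σ := by
    intro σ hσ
    have h1 := hasDerivAt_one_add_rpow (e := -(3 * α)) (s := ‖x‖ + σ) (by linarith [norm_nonneg x])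
    have h2 : HasDerivAt (fun σ : ℝ => ‖x‖ + σ) 1 σ := (hasDerivAt_id σ).const_add _
    have h3 := (((h1.comp σ h2).const_sub ((1 + ‖x‖) ^ (-(3 * α)))).const_mul (C₀ / (3 * α)))
    refine h3.congr_deriv ?_
    have : -(3 * α) - 1 = -1 - 3 * α := by ring
    rw [this]
    field_simp
  have key := image_norm_le_of_norm_deriv_right_le_deriv_boundary' (a := 0) (b := s)
    (f := fun σ => G (t + σ, (1 + σ / ‖x‖) • x) - G (t, x))
    (f' := fun σ => dv G (t + σ, (1 + σ / ‖x‖) • x))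
    (B := fun σ => C₀ / (3 * α) * ((1 + ‖x‖) ^ (-(3 * α)) - (1 + (‖x‖ + σ)) ^ (-(3 * α))))
    (B' := fun σ => C₀ * (1 + (‖x‖ + σ)) ^ (-1 - 3 * α))
    (fun σ hσ => ((hasDerivAt_ray hG hx0 hσ.1 t).sub_const _).continuousAt.continuousWithinAt)
    (fun σ hσ => ((hasDerivAt_ray hG hx0 hσ.1 t).sub_const _).hasDerivWithinAt)
    (by simp) (fun σ hσ => (hd σ hσ.1).continuousAt.continuousWithinAt)
    (fun σ hσ => (hd σ hσ.1).hasDerivWithinAt)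
    (fun σ hσ => by
      have := hdv (t + σ) ((1 + σ / ‖x‖) • x) (by linarith [hσ.1])
        (by rw [norm_ray hx0 hσ.1]; linarith [hσ.1])
      rwa [norm_ray hx0 hσ.1] at this)
    (right_mem_Icc.2 hs)
  refine (le_of_eq (Real.norm_eq_abs _).symm).trans (key.trans ?_)
  have : 0 ≤ (1 + (‖x‖ + s)) ^ (-(3 * α)) := by positivity
  gcongr
  linarith

theorem abs_time_sub_le (hG : Differentiable ℝ G) {t : ℝ} {x : Space} {k : ℝ}
    (hdt : ∀ s, t ≤ s → |pd 0 G (s, x)| ≤ k) {h : ℝ} (hh : 0 ≤ h) :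
    |G (t + h, x) - G (t, x)| ≤ k * h := by
  have hd : ∀ s, HasDerivAt (fun s => G (s, x)) (pd 0 G (s, x)) s := by
    intro s
    have e1 : HasDerivAt (fun s : ℝ => (s, x)) ((1 : ℝ), (0 : Space)) s :=
      (hasDerivAt_id s).prodMk (hasDerivAt_const s x)
    exact (hG (s, x)).hasFDerivAt.comp_hasDerivAt s e1
  have := (convex_Icc t (t + h)).norm_image_sub_le_of_norm_hasDerivWithin_le
    (fun s _ => (hd s).hasDerivWithinAt) (fun s hs => hdt s hs.1)
    (left_mem_Icc.2 (by linarith)) (right_mem_Icc.2 (by linarith))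
  simpa [abs_of_nonneg hh] using this

/-- Integrability of the outgoing derivative and decay along the timelike lines give decay of the
function itself. -/
theorem abs_le_of_outgoing (hG : Differentiable ℝ G) (hR : 0 < R₁) (hα : 0 < α) (hC : 0 ≤ C₀)
    (hdv : ∀ t x, t₀ ≤ t → R₁ ≤ ‖x‖ → |dv G (t, x)| ≤ C₀ * (1 + ‖x‖) ^ (-1 - 3 * α))
    (hdt : ∀ t x, t₀ ≤ t → R₁ ≤ ‖x‖ → |pd 0 G (t, x)| ≤ C₀ * (1 + ‖x‖) ^ (-(1 / 2) : ℝ))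
    {t : ℝ} {x : Space} (ht : t₀ ≤ t) (hx : R₁ ≤ ‖x‖)
    (hlim : Filter.Tendsto (fun h => G (t + h, x)) Filter.atTop (nhds 0)) :
    |G (t, x)| ≤ 2 * (C₀ / (3 * α)) * (1 + ‖x‖) ^ (-(3 * α)) := by
  have hx0 : x ≠ 0 := norm_pos_iff.1 (hR.trans_le hx)
  set K := C₀ / (3 * α) * (1 + ‖x‖) ^ (-(3 * α)) with hK
  have step : ∀ h, 0 ≤ h → |G (t, x)| ≤ 2 * K + |G (t + h, x)| := by
    intro h hh
    have b : ∀ s, 0 ≤ s → |G (t, x)| ≤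
        2 * K + |G (t + h, x)| + C₀ * (1 + (‖x‖ + s)) ^ (-(1 / 2) : ℝ) * h := by
      intro s hs
      have h1 := abs_ray_sub_le hG hR hα hC hdv ht hx hs
      have h2 := abs_ray_sub_le hG hR hα hC hdv (t := t + h) (by linarith) hx hs
      have h3 := abs_time_sub_le hG (t := t + s) (x := (1 + s / ‖x‖) • x)
        (k := C₀ * (1 + (‖x‖ + s)) ^ (-(1 / 2) : ℝ)) (fun σ hσ => by
          have := hdt σ ((1 + s / ‖x‖) • x) (by linarith) (by rw [norm_ray hx0 hs]; linarith)
          rwa [norm_ray hx0 hs] at this) hh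
      have e : t + s + h = t + h + s := by ring
      rw [e] at h3
      rw [← hK] at h1 h2
      have a1 := abs_le.1 h1
      have a2 := abs_le.1 h2
      have a3 := abs_le.1 h3
      have a4 := abs_le.1 (le_refl |G (t + h, x)|)
      exact abs_le.2 ⟨by linarith [a1.2, a2.1, a3.1, a4.1], by linarith [a1.1, a2.2, a3.1, a4.2]⟩
    have l : Filter.Tendsto (fun s : ℝ =>
        2 * K + |G (t + h, x)| + C₀ * (1 + (‖x‖ + s)) ^ (-(1 / 2) : ℝ) * h) Filter.atTop
        (nhds (2 * K + |G (t + h, x)| + C₀ * 0 * h)) := by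
      refine Filter.Tendsto.const_add _ (Filter.Tendsto.mul_const _ (Filter.Tendsto.const_mul _ ?_))
      exact (tendsto_rpow_neg_atTop (y := 1 / 2) (by norm_num)).comp
        (Filter.tendsto_atTop_add_const_left _ _
          (Filter.tendsto_atTop_add_const_left _ _ Filter.tendsto_id))
    have := ge_of_tendsto l (Filter.eventually_atTop.2 ⟨0, b⟩)
    simpa using this
  have l2 : Filter.Tendsto (fun h => 2 * K + |G (t + h, x)|) Filter.atTop
      (nhds (2 * K + |(0 : ℝ)|)) := hlim.abs.const_add _
  have := ge_of_tendsto l2 (Filter.eventually_atTop.2 ⟨0, step⟩)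
  rw [mul_assoc]
  simpa using this

theorem sum_rot_sq (Φ : Scalar) {p : Spacetime} (hp : p.2 ≠ 0) :
    ∑ i, ∑ j, rot i j Φ p ^ 2 = 2 * (r[p] ^ 2 * angSq Φ p) := by
  have hr : r[p] ≠ 0 := by simpa using hp
  have h2 := spaceSq_eq (φ := Φ) hp
  have h1 : r[p] ^ 2 = ∑ i, p.2 i ^ 2 := EuclideanSpace.real_norm_sq_eq _
  have h3 : r[p] * dr Φ p = ∑ i : Fin 3, p.2 i * pd i.succ Φ p := by
    rw [dr_eq_sum, Finset.mul_sum]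
    refine Finset.sum_congr rfl fun i _ => ?_
    rw [radial_apply]; field_simp
  have h4 : r[p] ^ 2 * angSq Φ p = r[p] ^ 2 * spaceSq Φ p - (r[p] * dr Φ p) ^ 2 := by
    rw [h2]; ring
  rw [h4, h3, h1, spaceSq]
  simp only [rot, Fin.sum_univ_three]
  ring

theorem rot_abs_le {Φ : Scalar} {p : Spacetime} (i j : Fin 3) :
    |rot i j Φ p| ≤ 2 * r[p] * √(gradSq Φ p) := by
  have h : ∀ i : Fin 3, |p.2 i| ≤ r[p] := fun i => by
    have := PiLp.norm_apply_le p.2 i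
    simpa using this
  have h2 : ∀ μ, |pd μ Φ p| ≤ √(gradSq Φ p) := fun μ =>
    abs_le_sqrt_sum_sq (fun μ => pd μ Φ p) μ
  calc |rot i j Φ p| ≤ |p.2 i| * |pd j.succ Φ p| + |p.2 j| * |pd i.succ Φ p| := by
        rw [← abs_mul, ← abs_mul]; exact abs_sub _ _
    _ ≤ r[p] * √(gradSq Φ p) + r[p] * √(gradSq Φ p) := by
        gcongr
        all_goals first | exact h _ | exact h2 _
    _ = _ := by ring

/-- If the rotations of a weak wave are weak waves, its angular gradient decays like the outgoing
derivative. -/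
theorem IsWeakWave.angSq_le {δ : ℝ} {Φ : Scalar} (hΦ : IsWeakWave δ α t₀ R₁ C₀ Φ)
    (hrot : ∀ i j, IsWeakWave δ α t₀ R₁ C₀ (rot i j Φ)) {t : ℝ} {x : Space} (ht : t₀ ≤ t)
    (hx : R₁ ≤ ‖x‖) :
    √(angSq Φ (t, x)) ≤ 3 * (C₀ / α) * ((1 + R₁) / R₁) * (1 + ‖x‖) ^ (-1 - 3 * α) := by
  have hα := hΦ.α_pos
  have hC := hΦ.C₀_pos
  have hR := hΦ.R₁_pos
  have hr : 0 < ‖x‖ := hR.trans_le hx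
  have hx0 : x ≠ 0 := norm_pos_iff.1 hr
  have hG : ∀ i j, |rot i j Φ (t, x)| ≤ C₀ / α * (1 + ‖x‖) ^ (-(3 * α)) := by
    intro i j
    have hw := hrot i j
    have := abs_le_of_outgoing (hw.smooth.differentiable (by simp)) hR hα hC.le hw.outgoing
      (fun t x ht hx => by
        have h1 := abs_le_sqrt_sum_sq (fun μ => pd μ (rot i j Φ) (t, x)) 0
        refine h1.trans ((hw.exterior t x ht hx).trans ?_)
        refine mul_le_of_le_one_right (by positivity) ?_
        exact Real.rpow_le_one_of_one_le_of_nonpos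
          (by linarith [le_max_right (t - ‖x‖) 0]) (by linarith)) ht hx (by
        refine squeeze_zero_norm' (a := fun h : ℝ => 2 * ‖x‖ * (C₀ * (1 + ‖x‖) ^ (-(1 / 2) : ℝ)
          * (1 + max (t + h - ‖x‖) 0) ^ (-(1 / 2 + 4 * α)))) ?_ ?_
        · refine Filter.eventually_atTop.2 ⟨0, fun h hh => ?_⟩
          have h2 := hΦ.exterior (t + h) x (by linarith) hx
          rw [show -(1 / 2) - 4 * α = -(1 / 2 + 4 * α) by ring] at h2
          refine (rot_abs_le i j).trans ?_
          gcongr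
        · have l : Filter.Tendsto (fun h : ℝ => (1 + max (t + h - ‖x‖) 0) ^ (-(1 / 2 + 4 * α)))
              Filter.atTop (nhds 0) := by
            refine (tendsto_rpow_neg_atTop (y := 1 / 2 + 4 * α) (by positivity)).comp ?_
            refine Filter.tendsto_atTop_mono (f := fun h : ℝ => (1 + t - ‖x‖) + h)
              (fun h => by linarith [le_max_left (t + h - ‖x‖) 0]) ?_
            exact Filter.tendsto_atTop_add_const_left _ _ Filter.tendsto_id
          simpa using (l.const_mul (C₀ * (1 + ‖x‖) ^ (-(1 / 2) : ℝ))).const_mul (2 * ‖x‖))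
    refine this.trans ?_
    gcongr
    rw [div_mul_eq_div_div]
    have : 0 ≤ C₀ / α := by positivity
    rw [show C₀ / 3 / α = C₀ / α / 3 by ring]
    linarith
  set k := C₀ / α * (1 + ‖x‖) ^ (-(3 * α)) with hk
  have hk0 : 0 ≤ k := by positivity
  have hs := sum_rot_sq Φ (p := (t, x)) hx0
  have hsum : ∑ i, ∑ j, rot i j Φ (t, x) ^ 2 ≤ ∑ _i : Fin 3, ∑ _j : Fin 3, k ^ 2 :=
    Finset.sum_le_sum fun i _ => Finset.sum_le_sum fun j _ => sq_le_sq' (abs_le.1 (hG i j)).1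
      (abs_le.1 (hG i j)).2
  simp only [Finset.sum_const, Finset.card_univ, Fintype.card_fin, nsmul_eq_mul] at hsum
  have h9 : ‖x‖ ^ 2 * angSq Φ (t, x) ≤ (3 * k) ^ 2 := by
    push_cast at hsum
    simp only at hs
    nlinarith [sq_nonneg k]
  have h10 : ‖x‖ * √(angSq Φ (t, x)) ≤ 3 * k := by
    rw [← Real.sqrt_sq hr.le, ← Real.sqrt_mul (sq_nonneg _)]
    exact (Real.sqrt_le_sqrt h9).trans (Real.sqrt_sq (by positivity)).le
  have h11 : (1 + ‖x‖) ^ (-(3 * α)) = (1 + ‖x‖) * (1 + ‖x‖) ^ (-1 - 3 * α) := by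
    rw [← Real.rpow_one_add' (by positivity) (by linarith)]
    congr 1; ring
  have h12 : 1 + ‖x‖ ≤ (1 + R₁) / R₁ * ‖x‖ := by
    rw [div_mul_eq_mul_div, le_div_iff₀ hR]
    nlinarith
  rw [← mul_le_mul_iff_right₀ hr]
  refine h10.trans ?_
  rw [hk, h11]
  calc 3 * (C₀ / α * ((1 + ‖x‖) * (1 + ‖x‖) ^ (-1 - 3 * α)))
      ≤ 3 * (C₀ / α * (((1 + R₁) / R₁ * ‖x‖) * (1 + ‖x‖) ^ (-1 - 3 * α))) := by gcongr
    _ = _ := by ring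

end outgoing

theorem sq_le_of_abs_le {z F A u w g h : ℝ} (hz : z + A = F) (hg : 0 ≤ g) (hh : 0 ≤ h)
    (hA : |A| ≤ u * √g + w * √h) : z ^ 2 ≤ 3 * (F ^ 2 + u ^ 2 * g + w ^ 2 * h) := by
  have h1 : A ^ 2 ≤ (u * √g + w * √h) ^ 2 := sq_le_sq' (abs_le.1 hA).1 (abs_le.1 hA).2
  have h2 : (u * √g) ^ 2 = u ^ 2 * g := by rw [mul_pow, Real.sq_sqrt hg]
  have h3 : (w * √h) ^ 2 = w ^ 2 * h := by rw [mul_pow, Real.sq_sqrt hh]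
  rw [← h2, ← h3]
  have : z = F - A := by linarith
  rw [this]
  nlinarith [sq_nonneg (u * √g - w * √h), sq_nonneg (F + A), sq_nonneg (F + (u * √g + w * √h)),
    sq_nonneg (2 * F + A), sq_nonneg (F - 2 * A)]

theorem one_add_rpow_le_one {r e : ℝ} (hr : 0 ≤ r) (he : e ≤ 0) : (1 + r) ^ e ≤ 1 :=
  Real.rpow_le_one_of_one_le_of_nonpos (by linarith) he

section coefficients
variable {B : Matrix (Fin 4) (Fin 4) ℝ} {δ δ₀ α t₀ R₁ C₀ R : ℝ} {Φ φ : Scalar} {L : Fin 4 → Scalar}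

theorem IsWeakWave.sqrt_gradSq_le (hΦ : IsWeakWave δ α t₀ R₁ C₀ Φ) (hδ : δ < δ₀)
    (p : Spacetime) : √(gradSq Φ p) ≤ C₀ + δ₀ := by
  obtain ⟨t, x⟩ := p
  have h1 := hΦ.δ_pos
  have h2 := hΦ.α_pos
  have h3 := hΦ.C₀_pos
  have h4 := hΦ.α_le
  rcases le_total t t₀ with h | h
  · linarith [hΦ.early t x h]
  rcases le_total R₁ ‖x‖ with h' | h'
  · refine (hΦ.exterior t x h h').trans ?_
    have e1 := one_add_rpow_le_one (norm_nonneg x) (show (-(1 / 2) : ℝ) ≤ 0 by norm_num)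
    have e2 := one_add_rpow_le_one (le_max_right (t - ‖x‖) 0)
      (show -(1 / 2) - 4 * α ≤ 0 by linarith)
    calc _ ≤ C₀ * 1 * 1 := by gcongr
      _ ≤ _ := by linarith
  · refine (hΦ.interior t x h h').trans ?_
    have e1 := one_add_rpow_le_one (norm_nonneg x) (show -1 - α ≤ 0 by linarith)
    have h5 : 0 < δ₀ := h1.trans hδ
    calc _ ≤ δ₀ * (1 / 4) * 1 := by gcongr
      _ ≤ _ := by linarith

theorem LDecay.abs_le (hL : LDecay δ α t₀ C₀ L) (hδ : δ < δ₀) (h0 : 0 < δ) (hα : 0 < α)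
    (hα' : α ≤ 1 / 4) (hC : 0 < C₀) {t : ℝ} {x : Space} (ht : t₀ ≤ t) (μ : Fin 4) :
    |L μ (t, x)| ≤ (C₀ + δ₀) * (1 + ‖x‖) ^ (-1 - 3 * α) := by
  rcases hL with h | h
  · refine (h μ t x ht).trans ?_
    have : δ * α ≤ C₀ + δ₀ := by nlinarith
    gcongr
  · refine (h μ t x ht).trans ?_
    have e2 := one_add_rpow_le_one (le_max_right (t - ‖x‖) 0) (show -α ≤ 0 by linarith)
    calc _ ≤ C₀ * (1 + ‖x‖) ^ (-1 - 3 * α) * 1 := by gcongr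
      _ ≤ _ := by rw [mul_one]; gcongr; linarith

/-- The first order terms, with no use of the null condition. -/
theorem abs_lower_le {k l : ℝ} {p : Spacetime} (hk : √(gradSq Φ p) ≤ k) (hl : ∀ μ, |L μ p| ≤ l) :
    |nullForm B Φ φ p + linTerm L φ p| ≤ (entrySum B * k + 4 * l) * √(gradSq φ p) := by
  have hb := entrySum_nonneg B
  calc _ ≤ |nullForm B Φ φ p| + |linTerm L φ p| := abs_add_le _ _
    _ ≤ entrySum B * (k * √(gradSq φ p)) + 4 * l * √(gradSq φ p) := by
        refine add_le_add ((abs_nullForm_le B).trans ?_) (abs_linTerm_le hl)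
        gcongr
    _ = _ := by ring

theorem abs_lower_le_const (hΦ : IsWeakWave δ α t₀ R₁ C₀ Φ) (hδ : δ < δ₀)
    (hL₀ : ∀ μ t x, t ≤ t₀ → |L μ (t, x)| ≤ C₀) (hL : LDecay δ α t₀ C₀ L) (p : Spacetime) :
    |nullForm B Φ φ p + linTerm L φ p| ≤ (entrySum B + 4) * (C₀ + δ₀) * √(gradSq φ p) := by
  have h1 := hΦ.δ_pos
  have h2 := hΦ.α_pos
  have h3 := hΦ.C₀_pos
  refine (abs_lower_le (hΦ.sqrt_gradSq_le hδ p) (l := C₀ + δ₀) fun μ => ?_).trans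
    (le_of_eq (by ring))
  rcases le_total p.1 t₀ with h | h
  · linarith [hL₀ μ p.1 p.2 h]
  · refine (hL.abs_le hδ h1 h2 hΦ.α_le h3 h μ).trans ?_
    exact mul_le_of_le_one_right (by linarith) (one_add_rpow_le_one (norm_nonneg _) (by linarith))

/-- The constant in the decay of the tangential derivatives of a weak wave. -/
def tangConst (α R₁ C₀ : ℝ) : ℝ := C₀ + 3 * (C₀ / α) * ((1 + R₁) / R₁)

theorem abs_nullForm_le_tang (hB : NullCondition B) (hΦ : IsWeakWave δ α t₀ R₁ C₀ Φ)
    (hrot : B.IsSymm ∨ ∀ i j, IsWeakWave δ α t₀ R₁ C₀ (rot i j Φ)) {t : ℝ} {x : Space}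
    (ht : t₀ ≤ t) (hx : R₁ ≤ ‖x‖) :
    ∃ η, η ≤ tangConst α R₁ C₀ * (1 + ‖x‖) ^ (-1 - 3 * α) ∧ η ≤ 2 * √(gradSq Φ (t, x)) ∧
      |nullForm B Φ φ (t, x)| ≤ entrySum B * (η * √(gradSq φ (t, x)) +
        2 * √(gradSq Φ (t, x)) * √good[φ, (t, x)]) := by
  have h2 := hΦ.α_pos
  have h3 := hΦ.C₀_pos
  have h4 := hΦ.R₁_pos
  have hb := entrySum_nonneg B
  have hx0 : x ≠ 0 := norm_pos_iff.1 (h4.trans_le hx)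
  have hgood : √good[Φ, (t, x)] ≤ 2 * √(gradSq Φ (t, x)) := by
    refine Real.sqrt_le_iff.2 ⟨by positivity, ?_⟩
    rw [mul_pow, Real.sq_sqrt (gradSq_nonneg _ _)]
    linarith [dv_sq_add_le (φ := Φ) (p := (t, x)) hx0, gradSq_nonneg Φ (t, x)]
  have hdv := hΦ.outgoing t x ht hx
  have hd : |dv Φ (t, x)| ≤ √good[Φ, (t, x)] :=
    Real.abs_le_sqrt (by linarith [angSq_nonneg Φ (t, x)])
  have hr : 0 ≤ (1 + ‖x‖) ^ (-1 - 3 * α) := by positivity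
  have hc : 0 ≤ 3 * (C₀ / α) * ((1 + R₁) / R₁) := by positivity
  rcases hrot with hs | hrot
  · refine ⟨|dv Φ (t, x)|, ?_, hd.trans hgood, ?_⟩
    · rw [tangConst]; nlinarith
    · refine (abs_nullForm_le_of_symm hB hs (p := (t, x)) hx0).trans (le_of_eq (by ring))
  · refine ⟨√good[Φ, (t, x)], ?_, hgood, ?_⟩
    · have := hΦ.angSq_le hrot ht hx
      rw [tangConst, add_mul]
      refine le_trans ?_ (add_le_add hdv this)
      refine Real.sqrt_le_iff.2 ⟨by positivity, ?_⟩
      nlinarith [Real.sq_sqrt (angSq_nonneg Φ (t, x)), sq_abs (dv Φ (t, x)),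
        mul_nonneg (abs_nonneg (dv Φ (t, x))) (Real.sqrt_nonneg (angSq Φ (t, x)))]
    · refine (abs_nullForm_le_good hB (p := (t, x)) hx0).trans ?_
      have e1 : 0 ≤ √(gradSq Φ (t, x)) * √good[φ, (t, x)] := by positivity
      refine mul_le_mul_of_nonneg_left ?_ hb
      linarith

theorem abs_lower_le_outer (hB : NullCondition B) (hΦ : IsWeakWave δ α t₀ R₁ C₀ Φ)
    (hrot : B.IsSymm ∨ ∀ i j, IsWeakWave δ α t₀ R₁ C₀ (rot i j Φ)) {t : ℝ} {x : Space}
    (ht : t₀ ≤ t) (hx : R₁ ≤ ‖x‖) {k l : ℝ}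
    (hk : ∀ η, η ≤ tangConst α R₁ C₀ * (1 + ‖x‖) ^ (-1 - 3 * α) → η ≤ 2 * √(gradSq Φ (t, x)) →
      η ≤ k) (hl : ∀ μ, |L μ (t, x)| ≤ l) :
    |nullForm B Φ φ (t, x) + linTerm L φ (t, x)| ≤
      (entrySum B * k + 4 * l) * √(gradSq φ (t, x)) + entrySum B * 2 * √(gradSq Φ (t, x)) *
        √good[φ, (t, x)] := by
  have hb := entrySum_nonneg B
  obtain ⟨η, h1, h2, h3⟩ := abs_nullForm_le_tang (φ := φ) hB hΦ hrot ht hx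
  have hη := hk η h1 h2
  calc _ ≤ |nullForm B Φ φ (t, x)| + |linTerm L φ (t, x)| := abs_add_le _ _
    _ ≤ entrySum B * (k * √(gradSq φ (t, x)) + 2 * √(gradSq Φ (t, x)) * √good[φ, (t, x)])
        + 4 * l * √(gradSq φ (t, x)) := by
        refine add_le_add (h3.trans ?_) (abs_linTerm_le hl)
        gcongr
    _ = _ := by ring

end coefficients

section sourceBounds
variable {B : Matrix (Fin 4) (Fin 4) ℝ} {δ δ₀ α t₀ R₁ C₀ R : ℝ} {Φ φ F : Scalar}
  {L : Fin 4 → Scalar} {p : Spacetime}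

theorem sq_outer_weight {W s r : ℝ} (hs : 0 < s) (hr : 0 ≤ r) :
    (W * (s ^ (-(1 / 2) - 4 * α) * (1 + r) ^ (-(1 / 2) : ℝ))) ^ 2 =
      W ^ 2 * (s ^ (-1 - 8 * α) * (1 + r) ^ (-1 : ℝ)) := by
  rw [mul_pow, mul_pow, ← Real.rpow_mul_natCast hs.le, ← Real.rpow_mul_natCast (by positivity)]
  congr 3
  · push_cast; ring
  · push_cast; norm_num

theorem lateSource_of_abs_le {A U W Λ s : ℝ} (hs : 0 < s) (hz : box φ p + A = F p)
    (hΛ : 3 * (1 + U ^ 2 + W ^ 2) ≤ Λ)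
    (hA : |A| ≤ U * jb[p] ^ (-1 - 3 * α) * √(gradSq φ p) +
      (if R < r[p] then W * (s ^ (-(1 / 2) - 4 * α) * jb[p] ^ (-(1 / 2) : ℝ)) else 0) *
        √good[φ, p]) :
    LateSource R α Λ s F φ p := by
  have hg := gradSq_nonneg φ p
  have hh : 0 ≤ dv φ p ^ 2 + angSq φ p := add_nonneg (sq_nonneg _) (angSq_nonneg _ _)
  have hr := norm_nonneg p.2
  refine (sq_le_of_abs_le hz hg hh hA).trans ?_
  have e1 : (U * jb[p] ^ (-1 - 3 * α)) ^ 2 = U ^ 2 * jb[p] ^ (-2 - 6 * α) := by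
    rw [mul_pow, ← Real.rpow_mul_natCast (by positivity)]
    congr 2; push_cast; ring
  have g1 : 0 ≤ jb[p] ^ (-2 - 6 * α) * gradSq φ p := by positivity
  have hU := sq_nonneg U
  have hW := sq_nonneg W
  have hF := sq_nonneg (F p)
  rw [e1]
  split_ifs with h
  · rw [sq_outer_weight hs hr]
    have g2 : 0 ≤ s ^ (-1 - 8 * α) * (jb[p] ^ (-1 : ℝ) * good[φ, p]) := by
      positivity
    refine le_trans ?_ (mul_le_mul_of_nonneg_right hΛ (by positivity))
    nlinarith [mul_nonneg hU g2, mul_nonneg hW g1, mul_nonneg hU hF, mul_nonneg hW hF]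
  · refine le_trans ?_ (mul_le_mul_of_nonneg_right hΛ (by positivity))
    nlinarith [mul_nonneg hW g1, mul_nonneg hU hF, mul_nonneg hW hF]

theorem smallSource_of_abs_le {A ε W Λ s : ℝ} (hs : 0 < s) (hz : box φ p + A = F p) (hΛ : W ^ 2 ≤ Λ)
    (hA : |A| ≤ ε * jb[p] ^ (-1 - α) * √(gradSq φ p) +
      (if R < r[p] then W * (s ^ (-(1 / 2) - 4 * α) * jb[p] ^ (-(1 / 2) : ℝ)) else 0) *
        √good[φ, p]) :
    SmallSource R α Λ ε s F φ p := by
  have hg := gradSq_nonneg φ p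
  have hh : 0 ≤ dv φ p ^ 2 + angSq φ p := add_nonneg (sq_nonneg _) (angSq_nonneg _ _)
  have hr := norm_nonneg p.2
  refine (sq_le_of_abs_le hz hg hh hA).trans ?_
  have e1 : (ε * jb[p] ^ (-1 - α)) ^ 2 = ε ^ 2 * jb[p] ^ (-2 - 2 * α) := by
    rw [mul_pow, ← Real.rpow_mul_natCast (by positivity)]
    congr 2; push_cast; ring
  rw [e1]
  split_ifs with h
  · rw [sq_outer_weight hs hr]
    have g2 : 0 ≤ s ^ (-1 - 8 * α) * (jb[p] ^ (-1 : ℝ) * good[φ, p]) := by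
      positivity
    nlinarith [mul_le_mul_of_nonneg_right hΛ g2]
  · simp

theorem le_rpow_of_le {k M r e : ℝ} (hk : 0 ≤ k) (hr : 0 ≤ r) (hM : r ≤ M) (he : 0 ≤ e) :
    k ≤ k * (1 + M) ^ e * (1 + r) ^ (-e) := by
  rw [mul_assoc, rpow_neg (by positivity), ← div_eq_mul_inv]
  refine le_mul_of_one_le_right hk ((one_le_div (by positivity)).2 ?_)
  gcongr

/-- The constant in front of the transversal derivatives. -/
def transConst (b α R₁ C₀ M δ₀ : ℝ) : ℝ :=
  (b + 4) * (C₀ + δ₀) * (1 + M) ^ (1 + 3 * α) + b * tangConst α R₁ C₀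

theorem tangConst_nonneg (hα : 0 < α) (hR : 0 < R₁) (hC : 0 < C₀) : 0 ≤ tangConst α R₁ C₀ := by
  rw [tangConst]; positivity

theorem abs_lower_le_near (hΦ : IsWeakWave δ α t₀ R₁ C₀ Φ) (hδ : δ < δ₀)
    (hL₀ : ∀ μ t x, t ≤ t₀ → |L μ (t, x)| ≤ C₀) (hL : LDecay δ α t₀ C₀ L) {M : ℝ}
    (hM : r[p] ≤ M) :
    |nullForm B Φ φ p + linTerm L φ p| ≤
      transConst (entrySum B) α R₁ C₀ M δ₀ * jb[p] ^ (-1 - 3 * α) * √(gradSq φ p) := by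
  have h1 := hΦ.δ_pos
  have h2 := hΦ.α_pos
  have h3 := hΦ.C₀_pos
  have hb := entrySum_nonneg B
  have ht := tangConst_nonneg h2 hΦ.R₁_pos h3
  have h5 : 0 < δ₀ := h1.trans hδ
  refine (abs_lower_le_const hΦ hδ hL₀ hL p).trans
    (mul_le_mul_of_nonneg_right ?_ (Real.sqrt_nonneg _))
  refine (le_rpow_of_le (by positivity) (norm_nonneg p.2) hM
    (show 0 ≤ 1 + 3 * α by positivity)).trans ?_
  rw [show -(1 + 3 * α) = -1 - 3 * α by ring, transConst]
  refine mul_le_mul_of_nonneg_right ?_ (by have := norm_nonneg p.2; positivity)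
  exact le_add_of_nonneg_right (by positivity)

theorem abs_lower_le_far (hB : NullCondition B) (hΦ : IsWeakWave δ α t₀ R₁ C₀ Φ) (hδ : δ < δ₀)
    (hrot : B.IsSymm ∨ ∀ i j, IsWeakWave δ α t₀ R₁ C₀ (rot i j Φ)) (hL : LDecay δ α t₀ C₀ L)
    {M : ℝ} (hM : 0 ≤ M) (ht : t₀ ≤ p.1) (hx : R₁ ≤ r[p]) :
    |nullForm B Φ φ p + linTerm L φ p| ≤
      transConst (entrySum B) α R₁ C₀ M δ₀ * jb[p] ^ (-1 - 3 * α) * √(gradSq φ p) +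
        entrySum B * 2 * √(gradSq Φ p) * √good[φ, p] := by
  have h1 := hΦ.δ_pos
  have h2 := hΦ.α_pos
  have h3 := hΦ.C₀_pos
  have hb := entrySum_nonneg B
  have h5 : 0 < δ₀ := h1.trans hδ
  have hM' : 1 ≤ (1 + M) ^ (1 + 3 * α) := one_le_rpow (by linarith) (by positivity)
  refine (abs_lower_le_outer (φ := φ) (t := p.1) (x := p.2) hB hΦ hrot ht hx
    (fun η h _ => h) (fun μ => hL.abs_le hδ h1 h2 hΦ.α_le h3 ht μ)).trans ?_
  refine add_le_add ?_ le_rfl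
  refine mul_le_mul_of_nonneg_right ?_ (Real.sqrt_nonneg _)
  rw [transConst, ← mul_assoc, ← mul_assoc, ← add_mul]
  refine mul_le_mul_of_nonneg_right ?_ (by positivity)
  have e1 : 4 * (C₀ + δ₀) ≤ (entrySum B + 4) * (C₀ + δ₀) := by nlinarith
  have e2 : (entrySum B + 4) * (C₀ + δ₀) ≤ (entrySum B + 4) * (C₀ + δ₀) * (1 + M) ^ (1 + 3 * α) :=
    le_mul_of_one_le_right (by positivity) hM'
  linarith

/-- The constant in front of the tangential derivatives. -/
def goodConst (b C₀ R : ℝ) : ℝ := b * 2 * (C₀ * (1 + R) ^ 2)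

theorem sqrt_gradSq_le_cone (hΦ : IsWeakWave δ α t₀ R₁ C₀ Φ) (hR : 0 ≤ R) {τ : ℝ} (hτ : 0 ≤ τ)
    {x : Space} (ht : t₀ ≤ τ - R + ‖x‖) (hx : R₁ ≤ ‖x‖) :
    √(gradSq Φ (τ - R + ‖x‖, x)) ≤
      C₀ * (1 + R) ^ 2 * ((1 + τ) ^ (-(1 / 2) - 4 * α) * (1 + ‖x‖) ^ (-(1 / 2) : ℝ)) := by
  have h2 := hΦ.α_pos
  have h3 := hΦ.C₀_pos
  have h4 := hΦ.α_le
  refine (hΦ.exterior _ x ht hx).trans ?_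
  rw [show τ - R + ‖x‖ - ‖x‖ = τ - R by ring]
  have e1 : 1 + τ ≤ (1 + R) * (1 + max (τ - R) 0) := by
    nlinarith [le_max_left (τ - R) 0, le_max_right (τ - R) 0]
  have e0 : 0 ≤ max (τ - R) 0 := le_max_right _ _
  have e2 : (1 + max (τ - R) 0) ^ (-(1 / 2) - 4 * α) ≤
      (1 + R) ^ 2 * (1 + τ) ^ (-(1 / 2) - 4 * α) := by
    have : (1 + R) ^ (1 / 2 + 4 * α) ≤ (1 + R) ^ 2 := by
      rw [← rpow_natCast]
      exact one_add_rpow_le hR (by push_cast; linarith)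
    have e3 := rpow_le_rpow_of_nonpos (z := -(1 / 2) - 4 * α) (by positivity) e1 (by linarith)
    rw [Real.mul_rpow (by positivity) (by positivity)] at e3
    have e4 : (1 + R) ^ (1 / 2 + 4 * α) * (1 + R) ^ (-(1 / 2) - 4 * α) = 1 := by
      rw [← rpow_add (by positivity)]
      convert rpow_zero _ using 2; ring
    calc (1 + max (τ - R) 0) ^ (-(1 / 2) - 4 * α) = (1 + R) ^ (1 / 2 + 4 * α) *
          ((1 + R) ^ (-(1 / 2) - 4 * α) * (1 + max (τ - R) 0) ^ (-(1 / 2) - 4 * α)) := by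
            rw [← mul_assoc, e4, one_mul]
      _ ≤ (1 + R) ^ 2 * (1 + τ) ^ (-(1 / 2) - 4 * α) := by gcongr
  calc _ ≤ C₀ * (1 + ‖x‖) ^ (-(1 / 2) : ℝ) * ((1 + R) ^ 2 * (1 + τ) ^ (-(1 / 2) - 4 * α)) := by
        gcongr
    _ = _ := by ring

end sourceBounds

section smallness
variable {B : Matrix (Fin 4) (Fin 4) ℝ} {δ δ₀ α t₀ R₁ C₀ R : ℝ} {Φ φ F : Scalar}
  {L : Fin 4 → Scalar} {p : Spacetime}

theorem lateSource_of_isWeakWave (hB : NullCondition B) (hΦ : IsWeakWave δ α t₀ R₁ C₀ Φ)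
    (hδ : δ < δ₀) (hrot : B.IsSymm ∨ ∀ i j, IsWeakWave δ α t₀ R₁ C₀ (rot i j Φ))
    (hL₀ : ∀ μ t x, t ≤ t₀ → |L μ (t, x)| ≤ C₀) (hL : LDecay δ α t₀ C₀ L) (hR : t₀ ≤ R)
    {τ : ℝ} (hτ : 0 ≤ τ) {x : Space}
    (hz : box φ (leaf R τ x) + (nullForm B Φ φ (leaf R τ x) + linTerm L φ (leaf R τ x)) =
      F (leaf R τ x)) :
    LateSource R α (3 * (1 + transConst (entrySum B) α R₁ C₀ (R + t₀) δ₀ ^ 2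
      + goodConst (entrySum B) C₀ R ^ 2)) (1 + τ) F φ (leaf R τ x) := by
  have ht₀ := hΦ.t₀_pos
  have h3 := hΦ.C₀_pos
  have hb := entrySum_nonneg B
  have hR₁ := hΦ.R₁_le
  have hx := norm_nonneg x
  have hτ' : (0 : ℝ) ≤ 1 + τ := by linarith
  refine lateSource_of_abs_le (by positivity) hz le_rfl ?_
  rcases le_or_gt ‖x‖ (R + t₀) with h | h
  · refine (abs_lower_le_near (p := leaf R τ x) hΦ hδ hL₀ hL h).trans
      (le_add_of_nonneg_right (mul_nonneg ?_ (Real.sqrt_nonneg _)))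
    have hx' := norm_nonneg (leaf R τ x).2
    split_ifs
    · rw [goodConst]; positivity
    · exact le_rfl
  · have hxR : R < ‖x‖ := by linarith
    have ht : t₀ ≤ τ - R + ‖x‖ := by linarith
    have e := leaf_outer (τ := τ) hxR.le
    have hp : (leaf R τ x).2 = x := rfl
    rw [hp, if_pos hxR, e]
    refine (abs_lower_le_far (p := (τ - R + ‖x‖, x)) hB hΦ hδ hrot hL
      (M := R + t₀) (by linarith) ht (by simp only; linarith)).trans (add_le_add le_rfl ?_)
    refine mul_le_mul_of_nonneg_right ?_ (Real.sqrt_nonneg _)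
    have := sqrt_gradSq_le_cone hΦ (by linarith) hτ ht (by linarith : R₁ ≤ ‖x‖)
    rw [goodConst, mul_assoc (entrySum B * 2)]
    gcongr

theorem smallSource_of_isWeakWave (hB : NullCondition B) (hΦ : IsWeakWave δ α t₀ R₁ C₀ Φ)
    (hδ : δ < δ₀) (hrot : B.IsSymm ∨ ∀ i j, IsWeakWave δ α t₀ R₁ C₀ (rot i j Φ))
    (hL : LDecay δ α t₀ C₀ L) (hR : t₀ ≤ R) {M τ : ℝ} (hM : R ≤ M)
    (hM' : ∀ r, M ≤ r → tangConst α R₁ C₀ * (1 + r) ^ (-(2 * α)) ≤ δ₀ * α)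
    (hτ : R + t₀ ≤ τ)
    (hq : C₀ * (1 + (τ - R)) ^ (-α) ≤ δ₀ * α / 2 * (1 + M) ^ (-1 - α)) {x : Space}
    (hz : box φ (leaf R τ x) + (nullForm B Φ φ (leaf R τ x) + linTerm L φ (leaf R τ x)) =
      F (leaf R τ x)) :
    SmallSource R α (3 * (1 + transConst (entrySum B) α R₁ C₀ (R + t₀) δ₀ ^ 2
      + goodConst (entrySum B) C₀ R ^ 2)) ((entrySum B + 4) * (δ₀ * α)) (1 + τ) F φ
      (leaf R τ x) := by
  have ht₀ := hΦ.t₀_pos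
  have h1 := hΦ.δ_pos
  have h2 := hΦ.α_pos
  have h3 := hΦ.C₀_pos
  have h4 := hΦ.α_le
  have h5 : 0 < δ₀ := h1.trans hδ
  have hb := entrySum_nonneg B
  have hR₁ := hΦ.R₁_le
  have hx := norm_nonneg x
  have hδα : δ * α ≤ δ₀ * α := by gcongr
  have hε : 0 < δ₀ * α := by positivity
  set ε := δ₀ * α with hεdef
  have hτR : 0 ≤ τ - R := by linarith
  -- the weights in `t - r`
  have hw : ∀ t, t₀ ≤ t → τ - R ≤ t - ‖x‖ → C₀ * (1 + max (t - ‖x‖) 0) ^ (-α) ≤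
      ε / 2 * (1 + M) ^ (-1 - α) := by
    intro t _ h
    refine le_trans ?_ hq
    have := rpow_le_rpow_of_nonpos (z := -α) (by linarith : 0 < 1 + (τ - R))
      (by linarith [le_max_left (t - ‖x‖) 0] : 1 + (τ - R) ≤ 1 + max (t - ‖x‖) 0) (by linarith)
    gcongr
  have hMe : ε / 2 * (1 + M) ^ (-1 - α) ≤ ε / 2 :=
    mul_le_of_le_one_right (by positivity) (one_add_rpow_le_one (by linarith) (by linarith))
  have hl : ∀ t, t₀ ≤ t → τ - R ≤ t - ‖x‖ → ∀ μ, |L μ (t, x)| ≤ ε * (1 + ‖x‖) ^ (-1 - α) := by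
    intro t ht h μ
    have e1 : (1 + ‖x‖) ^ (-1 - 3 * α) ≤ (1 + ‖x‖) ^ (-1 - α) := one_add_rpow_le hx (by linarith)
    rcases hL with h' | h'
    · refine (h' μ t x ht).trans ?_
      gcongr
    · refine (h' μ t x ht).trans ?_
      have := hw t ht h
      calc _ = (C₀ * (1 + max (t - ‖x‖) 0) ^ (-α)) * (1 + ‖x‖) ^ (-1 - 3 * α) := by ring
        _ ≤ ε * (1 + ‖x‖) ^ (-1 - α) := by
          gcongr
          linarith
  have hΦ' : ∀ t, t₀ ≤ t → τ - R ≤ t - ‖x‖ → R₁ ≤ ‖x‖ → ‖x‖ ≤ M →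
      √(gradSq Φ (t, x)) ≤ ε / 2 * (1 + ‖x‖) ^ (-1 - α) := by
    intro t ht h hxR hxM
    refine (hΦ.exterior t x ht hxR).trans ?_
    have e1 := one_add_rpow_le_one hx (show (-(1 / 2) : ℝ) ≤ 0 by norm_num)
    have e2 : (1 + max (t - ‖x‖) 0) ^ (-(1 / 2) - 4 * α) ≤ (1 + max (t - ‖x‖) 0) ^ (-α) :=
      one_add_rpow_le (le_max_right _ _) (by linarith)
    have e3 := rpow_le_rpow_of_nonpos (z := -1 - α) (by linarith : 0 < 1 + ‖x‖)
      (by linarith : 1 + ‖x‖ ≤ 1 + M) (by linarith)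
    calc _ ≤ C₀ * 1 * (1 + max (t - ‖x‖) 0) ^ (-α) := by gcongr
      _ ≤ ε / 2 * (1 + M) ^ (-1 - α) := by rw [mul_one]; exact hw t ht h
      _ ≤ _ := by gcongr
  have hτ' : (0 : ℝ) ≤ 1 + τ := by linarith
  have hΛ : goodConst (entrySum B) C₀ R ^ 2 ≤
      3 * (1 + transConst (entrySum B) α R₁ C₀ (R + t₀) δ₀ ^ 2
        + goodConst (entrySum B) C₀ R ^ 2) := by
    nlinarith [sq_nonneg (transConst (entrySum B) α R₁ C₀ (R + t₀) δ₀),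
      sq_nonneg (goodConst (entrySum B) C₀ R)]
  refine smallSource_of_abs_le (by linarith) hz hΛ ?_
  have hp : (leaf R τ x).2 = x := rfl
  rcases le_or_gt ‖x‖ R with h | h
  · rw [hp, if_neg h.not_gt, leaf_inner h, zero_mul, add_zero]
    have ht : t₀ ≤ τ := by linarith
    have hτx : τ - R ≤ τ - ‖x‖ := by linarith
    have hk : √(gradSq Φ (τ, x)) ≤ ε * (1 + ‖x‖) ^ (-1 - α) := by
      rcases le_total R₁ ‖x‖ with h' | h'
      · refine (hΦ' τ ht hτx h' (by linarith)).trans ?_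
        gcongr
        linarith
      · refine (hΦ.interior τ x ht h').trans ?_
        gcongr
    exact (abs_lower_le hk (hl τ ht hτx)).trans (le_of_eq (by ring))
  · rw [hp, if_pos h, leaf_outer h.le]
    have ht : t₀ ≤ τ - R + ‖x‖ := by linarith
    have hτx : τ - R ≤ τ - R + ‖x‖ - ‖x‖ := by linarith
    have hxR : R₁ ≤ ‖x‖ := by linarith
    refine (abs_lower_le_outer hB hΦ hrot ht hxR (k := ε * (1 + ‖x‖) ^ (-1 - α))
      (fun η e1 e2 => ?_) (hl _ ht hτx)).trans (add_le_add (le_of_eq (by ring)) ?_)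
    · rcases le_total ‖x‖ M with h' | h'
      · linarith [hΦ' _ ht hτx hxR h']
      · refine e1.trans ?_
        rw [show -1 - 3 * α = -(2 * α) + (-1 - α) by ring, rpow_add (by positivity), ← mul_assoc]
        have := hM' _ h'
        gcongr
    · refine mul_le_mul_of_nonneg_right ?_ (Real.sqrt_nonneg _)
      have := sqrt_gradSq_le_cone hΦ (by linarith) (by linarith : 0 ≤ τ) ht hxR
      rw [goodConst, mul_assoc (entrySum B * 2)]
      gcongr

/-- The estimates for the linear equation with coefficients given by weak waves. -/
theorem exists_estimates (hB : NullCondition B) (hδ₀ : 0 < δ₀)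
    (hsmall : 28800 * ((entrySum B + 4) * δ₀) ^ 2 ≤ 1) (hα : 0 < α) (hα' : α ≤ 1 / 4)
    (ht₀ : 0 < t₀) (hR₁ : 0 < R₁) (hC₀ : 0 < C₀) (hR : t₀ ≤ R) :
    ∃ C : ℝ≥0, ∀ (δ : ℝ) (Φ : Scalar) (L : Fin 4 → Scalar) (F φ : Scalar),
      δ < δ₀ → IsWeakWave δ α t₀ R₁ C₀ Φ →
      (B.IsSymm ∨ ∀ i j, IsWeakWave δ α t₀ R₁ C₀ (rot i j Φ)) →
      (∀ μ t x, t ≤ t₀ → |L μ (t, x)| ≤ C₀) → LDecay δ α t₀ C₀ L →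
      Smooth φ → Measurable F →
      (∀ p : Spacetime, box φ p + (nullForm B Φ φ p + linTerm L φ p) = F p) →
      ∀ a b, 0 ≤ a → a ≤ b → Estimates R α F φ C a b := by
  have hε : 0 < δ₀ * α := by positivity
  have hK := tangConst_nonneg hα hR₁ hC₀
  obtain ⟨M, hM0, hM⟩ := exists_rpow_neg_le (γ := 2 * α)
    (ε := δ₀ * α / (tangConst α R₁ C₀ + 1)) (by positivity) (by positivity)
  obtain ⟨T, hT0, hT⟩ := exists_rpow_neg_le (γ := α)
    (ε := δ₀ * α / 2 * (1 + max M R) ^ (-1 - α) / C₀) hα (by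
      have : 0 ≤ max M R := hM0.trans (le_max_left _ _)
      positivity)
  have hΛ : 0 ≤ 3 * (1 + transConst (entrySum B) α R₁ C₀ (R + t₀) δ₀ ^ 2
      + goodConst (entrySum B) C₀ R ^ 2) := by positivity
  obtain ⟨C, hC⟩ := estimates_of_source (R := R) (T₀ := T + R + t₀)
    (ε := (entrySum B + 4) * (δ₀ * α)) (ht₀.trans_le hR) hα hα' hΛ (by
      have : ((entrySum B + 4) * (δ₀ * α)) ^ 2 = ((entrySum B + 4) * δ₀) ^ 2 * α ^ 2 := by ring
      rw [this]
      nlinarith [sq_nonneg α])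
  refine ⟨C, fun δ Φ L F φ hδ hΦ hrot hL₀ hL hφ hF hz => hC φ F hφ hF ?_ ?_⟩
  · intro τ hτ x
    exact (lateSource_of_isWeakWave hB hΦ hδ hrot hL₀ hL hR hτ (hz _)).sourceBound hα hΛ
      (by linarith)
  · intro τ hτ x
    refine ⟨lateSource_of_isWeakWave hB hΦ hδ hrot hL₀ hL hR (by linarith) (hz _),
      smallSource_of_isWeakWave hB hΦ hδ hrot hL hR (le_max_right M R) (fun r hr => ?_)
        (by linarith) ?_ (hz _)⟩
    · have h1 := hM r ((le_max_left _ _).trans hr)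
      rw [le_div_iff₀ (by positivity)] at h1
      have : 0 ≤ (1 + r) ^ (-(2 * α)) := by
        have := hM0.trans ((le_max_left _ _).trans hr)
        positivity
      nlinarith
    · have h1 := hT (τ - R) (by linarith)
      rw [le_div_iff₀ hC₀] at h1
      linarith

end smallness

section source
variable {R α : ℝ} {F F' : Scalar}

theorem DNorm_congr (h : ∀ t x, 0 ≤ t → F (t, x) = F' (t, x)) {a : ℝ} (ha : 0 ≤ a) (β b : ℝ) :
    DNorm R β F a b = DNorm R β F' a b := by
  refine setLIntegral_congr_fun measurableSet_Icc fun τ hτ => lintegral_congr fun x => ?_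
  simp only
  rw [h _ _ (add_nonneg (ha.trans hτ.1) (le_max_right _ _))]

theorem DIter_congr (h : ∀ t x, 0 ≤ t → F (t, x) = F' (t, x)) {a : ℝ} (ha : 0 ≤ a) (b : ℝ) :
    DIter R α F a b = DIter R α F' a b := by
  refine setLIntegral_congr_fun measurableSet_Icc fun τ hτ => ?_
  rw [DNorm_congr h (ha.trans hτ.1)]

theorem energyRhs_congr (h : ∀ t x, 0 ≤ t → F (t, x) = F' (t, x)) {a : ℝ} (ha : 0 ≤ a) (b : ℝ)
    (φ : Scalar) : energyRhs R α F φ a b = energyRhs R α F' φ a b := by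
  simp only [energyRhs, DNorm_congr h ha, DIter_congr h ha]

theorem lowRhs_congr (h : ∀ t x, 0 ≤ t → F (t, x) = F' (t, x)) {a : ℝ} (ha : 0 ≤ a) (b : ℝ)
    (φ : Scalar) : lowRhs R α F φ a b = lowRhs R α F' φ a b := by
  have e : ∫⁻ τ in Icc a b, tw[τ, -α] * DNorm R (2 * α) F τ b =
      ∫⁻ τ in Icc a b, tw[τ, -α] * DNorm R (2 * α) F' τ b := by
    refine setLIntegral_congr_fun measurableSet_Icc fun τ hτ => ?_
    rw [DNorm_congr h (ha.trans hτ.1)]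
  simp only [lowRhs, DNorm_congr h ha, DIter_congr h ha, e]

theorem topRhs_congr (h : ∀ t x, 0 ≤ t → F (t, x) = F' (t, x)) {a : ℝ} (ha : 0 ≤ a) (b : ℝ)
    (φ : Scalar) : topRhs R α F φ a b = topRhs R α F' φ a b := by
  simp only [topRhs, DNorm_congr h ha, DIter_congr h ha]

/-- The estimates depend on the source in the future of the initial surface only. -/
theorem Estimates.congr {φ : Scalar} {C : ℝ≥0} {a b : ℝ} (hE : Estimates R α F φ C a b)
    (h : ∀ t x, 0 ≤ t → F (t, x) = F' (t, x)) (ha : 0 ≤ a) : Estimates R α F' φ C a b where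
  energy := by rw [← energyRhs_congr h ha]; exact hE.energy
  low := by rw [← lowRhs_congr h ha]; exact hE.low
  top := by rw [← topRhs_congr h ha]; exact hE.top

end source

@[fun_prop]
theorem measurable_nullForm (B : Matrix (Fin 4) (Fin 4) ℝ) {Φ φ : Scalar}
    (hΦ : Smooth Φ) (hφ : Smooth φ) : Measurable (nullForm B Φ φ) := by
  unfold nullForm
  exact Finset.measurable_fun_sum _ fun μ _ => Finset.measurable_fun_sum _ fun ν _ =>
    (((contDiff_pd hΦ μ).continuous.measurable).const_mul _).mul
      (contDiff_pd hφ ν).continuous.measurable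

@[fun_prop]
theorem measurable_linTerm {L : Fin 4 → Scalar} {φ : Scalar}
    (hL : ∀ μ, Measurable (L μ)) (hφ : Smooth φ) : Measurable (linTerm L φ) := by
  unfold linTerm
  exact Finset.measurable_fun_sum _ fun μ _ => (hL μ).mul (contDiff_pd hφ μ).continuous.measurable

theorem gBar_zero_eq {R q a b : ℝ} (hR : 0 < R) {φ : Scalar} (hφ : Smooth φ) :
    GBar R φ 0 q a b = bulkInt R a b (mDens R q φ) := by
  rw [bulkInt_eq, GBar]
  simp only [neg_zero, rpow_zero, ofReal_one, one_mul, gBarFlux_eq hR hφ]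

end

end MinkowskiWave

theorem proposition3p1 (B : Matrix (Fin 4) (Fin 4) ℝ) (hB : NullCondition B) :
    ∃ δ₀ : ℝ, 0 < δ₀ ∧
      ∀ α t₀ R₁ C₀ R₀ : ℝ, 0 < R₀ → ∃ C : ℝ≥0,
        ∀ (δ : ℝ) (Φ : Spacetime → ℝ) (L : Fin 4 → Spacetime → ℝ) (F φ : Spacetime → ℝ) (R : ℝ),
          δ < δ₀ →
          C₀ ≤ (1 + t₀) ^ α * δ * α →
          IsWeakWave δ α t₀ R₁ C₀ Φ →
          (B.IsSymm ∨ ∀ i j, IsWeakWave δ α t₀ R₁ C₀ (rot i j Φ)) →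
          (∀ μ, Measurable (L μ)) →
          (∀ μ t x, t ≤ t₀ → |L μ (t, x)| ≤ C₀) →
          LDecay δ α t₀ C₀ L →
          IsSolution B Φ L F R₀ φ →
          R = t₀ + R₀ →
          ∀ τ₁ τ₂ : ℝ, 0 ≤ τ₁ → τ₁ ≤ τ₂ →
            -- integrated local energy estimate
            localEnergy R α φ τ₁ τ₂ ≤
              C * (energy R φ τ₁ + DNorm R α F τ₁ τ₂
                + ENNReal.ofReal ((1 + τ₁) ^ (-α)) * DNorm R (2 * α) F τ₁ τ₂
                + ENNReal.ofReal ((1 + τ₁) ^ (-1 - 2 * α)) *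
                    (gFlux R φ (1 + 2 * α) τ₁ + DIter R α F τ₁ τ₂)) ∧
            -- energy bound
            energy R φ τ₂ ≤
              C * (energy R φ τ₁ + DNorm R α F τ₁ τ₂
                + ENNReal.ofReal ((1 + τ₁) ^ (-α)) * DNorm R (2 * α) F τ₁ τ₂
                + ENNReal.ofReal ((1 + τ₁) ^ (-1 - 2 * α)) *
                    (gFlux R φ (1 + 2 * α) τ₁ + DIter R α F τ₁ τ₂)) ∧
            -- weighted energy inequality for p = 1
            gFlux R φ 1 τ₂ + (∫⁻ τ in Set.Icc τ₁ τ₂, energy R φ τ) ≤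
              C * (gFlux R φ 1 τ₁
                + ENNReal.ofReal ((1 + τ₁) ^ (1 - α)) * DNorm R (2 * α) F τ₁ τ₂
                + ENNReal.ofReal ((1 + τ₁) ^ (1 - α)) * energy R φ τ₁
                + (∫⁻ τ in Set.Icc τ₁ τ₂,
                    ENNReal.ofReal ((1 + τ) ^ (-α)) * DNorm R (2 * α) F τ τ₂)
                + ENNReal.ofReal ((1 + τ₁) ^ (-(2 * α))) * DIter R α F τ₁ τ₂
                + ENNReal.ofReal ((1 + τ₁) ^ (-(2 * α))) * gFlux R φ (1 + 2 * α) τ₁) ∧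
            -- weighted energy inequality for p = 1 + 2α
            gFlux R φ (1 + 2 * α) τ₂ + GBar R φ 0 (2 * α) τ₁ τ₂ ≤
              C * (gFlux R φ (1 + 2 * α) τ₁
                + ENNReal.ofReal ((1 + τ₁) ^ (1 - α)) * energy R φ τ₁
                + DIter R α F τ₁ τ₂
                + ENNReal.ofReal ((1 + τ₁) ^ (1 + α / 2)) * DNorm R (2 * α) F τ₁ τ₂) := by
  have hb := entrySum_nonneg B
  refine ⟨1 / (200 * (entrySum B + 4)), by positivity, fun α t₀ R₁ C₀ R₀ hR₀ => ?_⟩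
  by_cases hpar : 0 < α ∧ α ≤ 1 / 4 ∧ 0 < t₀ ∧ 0 < R₁ ∧ 0 < C₀
  swap
  · refine ⟨0, fun δ Φ L F φ R _ _ hΦ => absurd ?_ hpar⟩
    exact ⟨hΦ.α_pos, hΦ.α_le, hΦ.t₀_pos, hΦ.R₁_pos, hΦ.C₀_pos⟩
  obtain ⟨hα, hα', ht₀, hR₁, hC₀⟩ := hpar
  obtain ⟨C, hC⟩ := exists_estimates (R := t₀ + R₀) hB
    (δ₀ := 1 / (200 * (entrySum B + 4))) (by positivity) (by
      have : (entrySum B + 4) * (1 / (200 * (entrySum B + 4))) = 1 / 200 := by field_simp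
      rw [this]; norm_num) hα hα' ht₀ hR₁ hC₀ (by linarith)
  refine ⟨C, fun δ Φ L F φ R hδ _ hΦ hrot hLm hL₀ hL hφ hR a b ha hab => ?_⟩
  subst hR
  have hR : 0 < t₀ + R₀ := by linarith
  have hs := hφ.smooth
  have hE := (hC δ Φ L (fun p => box φ p + (nullForm B Φ φ p + linTerm L φ p)) φ hδ hΦ hrot hL₀ hL
    hs ((contDiff_box hs).continuous.measurable.add
      ((measurable_nullForm B hΦ.smooth hs).add (measurable_linTerm hLm hs)))
    (fun _ => rfl) a b ha hab).congr (F' := F)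
      (fun t x ht => by rw [← hφ.eqn t x ht, add_assoc]) ha
  obtain ⟨h1, h2, h3⟩ := hE
  simp only [energy_eq hs, gFlux_eq hR hs, gBar_zero_eq hR hs]
  exact ⟨le_add_self.trans h1, le_self_add.trans h1, h2, h3⟩
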